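/- **Conventions.** Let $\mathscr V=(\mathscr V_0,\otimes,E,[-,-])$ be a bicomplete closed symmetric monoidal category with a left adjoint strong monoidal functor $L$ from simplicial sets (with cartesian product) to $\mathscr V_0$; write $\Delta^n=L(\Delta[n])$. A *homotopical category* is a category with a class of weak equivalences that contains the identities and is such that, whenever $hg$ and $gf$ are weak equivalences, so are $f,g,h,hgf$. A *left deformation retract* of a homotopical category is a full subcategory containing the image of some functor $Q$ with a natural weak equivalence $q\colon Q\to\mathrm{Id}$ (a *left deformation*); right deformation retracts are dual ($r\colon\mathrm{Id}\to R$). A functor is *homotopical* on a full subcategory if it sends weak equivalences in it to weak equivalences. A *deformation retract* for a two-variable adjunction $(\circledast,\hom_\ell,\hom_r)\colon\mathscr M\times\mathscr N\to\mathscr P$ consists of left deformation retracts $\mathscr M_Q,\mathscr N_Q$ and a right deformation retract $\mathscr P_R$ such that $\circledast$, $\hom_\ell$, $\hom_r$ are homotopical on $\mathscr M_Q\times\mathscr N_Q$, $\mathscr M_Q^{op}\times\mathscr P_R$, $\mathscr N_Q^{op}\times\mathscr P_R$. Suppose that $\mathscr V_0$ is a closed symmetric monoidal homotopical category: it is homotopical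 and $(\mathscr V_Q,\mathscr V_Q,\mathscr V_R)$ is a deformation retract for $(\otimes,[-,-],[-,-])$; $\otimes$ maps $\mathscr V_Q\times\mathscr V_Q$ into $\mathscr V_Q$, and $[-,-]$ maps $\mathscr V_Q^{op}\times\mathscr V_R$ into $\mathscr V_R$; the natural maps $QE\otimes X\to X$, $X\otimes QE\to X$ ($X\in\mathscr V_Q$) and $Y\to[QE,Y]$ ($Y\in\mathscr V_R$) are weak equivalences. A *$\mathscr V$-homotopical category* is a tensored and cotensored $\mathscr V$-category $\mathscr M$ with a homotopical structure on the underlying category $\mathscr M_0$ and full subcategories $\mathscr M_Q,\mathscr M_R$ such that $(\mathscr V_Q,\mathscr M_Q,\mathscr M_R)$ is a deformation retract for $(\odot,\{-,-\},\mathscr M(-,-))$; $\odot$ maps $\mathscr V_Q\times\mathscr M_Q$ into $\mathscr M_Q$ and $\{-,-\}$ maps $\mathscr V_Q^{op}\times\mathscr M_R$ into $\mathscr M_R$; and the natural maps $QE\odot X\to X$ ($X\in\mathscr M_Q$) and $Y\to\{QE,Y\}$ ($Y\in\mathscr M_R$) are weak equivalences. For a small $\mathscr V$-category $\mathscr D$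 and a tensored and cotensored, complete and cocomplete $\mathscr V$-category $\mathscr M$, let $\mathscr M^{\mathscr D}$ be the $\mathscr V$-category of $\mathscr V$-functors $\mathscr D\to\mathscr M$, with objectwise weak equivalences, and let $\mathscr M_Q^{\mathscr D},\mathscr M_R^{\mathscr D}$ be the full subcategories of diagrams with values in $\mathscr M_Q$, $\mathscr M_R$. For $F,G\in\mathscr M^{\mathscr D}$ the bar construction $B(\mathscr D,\mathscr D,F)\in\mathscr M^{\mathscr D}$ is the geometric realization $\int^n\Delta^n\odot B_n$ of the simplicial diagram $$B_n(\mathscr D,\mathscr D,F)=\coprod_{\alpha_0,\dots,\alpha_n\in\mathscr D}\mathscr D(\alpha_n,-)\odot\bigl(\mathscr D(\alpha_{n-1},\alpha_n)\odot\cdots\odot(\mathscr D(\alpha_0,\alpha_1)\odot F\alpha_0)\bigr),$$ the cobar construction $C(\mathscr D,\mathscr D,F)\in\mathscr M^{\mathscr D}$ is the totalization of the dual cosimplicial diagram $$C^n(\mathscr D,\mathscr D,F)=\prod_{\alpha_0,\dots,\alpha_n}\{\mathscr D(-,\alpha_0),\{\mathscr D(\alpha_0,\alpha_1),\cdots\{\mathscr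 D(\alpha_{n-1},\alpha_n),F\alpha_n\}\}\},$$ and $C(G,\mathscr D,F)\in\mathscr V$ is the totalization of $$C^n(G,\mathscr D,F)=\prod_{\alpha_0,\dots,\alpha_n}\mathscr M\bigl(\mathscr D(\alpha_{n-1},\alpha_n)\odot\cdots\odot(\mathscr D(\alpha_0,\alpha_1)\odot G\alpha_0),\,F\alpha_n\bigr).$$ Let $\mathscr M_{BQ}^{\mathscr D}$ be the full subcategory of the diagrams isomorphic to $B(\mathscr D,\mathscr D,F)$ for some $F\in\mathscr M_Q^{\mathscr D}$, and $\mathscr M_{CR}^{\mathscr D}$ that of the diagrams isomorphic to $C(\mathscr D,\mathscr D,F)$ for some $F\in\mathscr M_R^{\mathscr D}$. If $\mathscr M$ is $\mathscr V$-homotopical, $\mathscr D$ is *good for the hom-functor of $\mathscr M$* if $C(-,\mathscr D,-)$ is homotopical on $(\mathscr M_Q^{\mathscr D})^{op}\times\mathscr M_R^{\mathscr D}$ and, for all $G\in\mathscr M_Q^{\mathscr D}$ and $F\in\mathscr M_R^{\mathscr D}$, up to isomorphism $B(\mathscr D,\mathscr D,G)\in\mathscr M_Q^{\mathscr D}$,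 $C(\mathscr D,\mathscr D,F)\in\mathscr M_R^{\mathscr D}$ and $C(G,\mathscr D,F)\in\mathscr V_R$. Simplicial homotopies in $\mathscr M$ are morphisms $\Delta^1\to\mathscr M(X,Y)$ in $\mathscr V_0$; simplicial homotopy is the equivalence relation that they generate. **Theorem.** Let $\mathscr M$ be a complete and cocomplete $\mathscr V$-homotopical category in which simplicial homotopy equivalences are weak equivalences, let $\mathscr D$ be a small $\mathscr V$-category that is good for the hom-functor of $\mathscr M$, and assume that $\mathscr M_Q^{\mathscr D}$ and $\mathscr M_R^{\mathscr D}$ are a left and a right deformation retract of $\mathscr M^{\mathscr D}$, respectively. Then: 1. $\mathscr M^{\mathscr D}$, with objectwise weak equivalences, tensors and cotensors, is a $\mathscr V$-homotopical category when equipped with $(\mathscr M_{BQ}^{\mathscr D},\mathscr M_R^{\mathscr D})$ (the bar structure), and also when equipped with $(\mathscr M_Q^{\mathscr D},\mathscr M_{CR}^{\mathscr D})$ (the cobar structure). 2. With the derived closed symmetric monoidal structure on $\operatorname{Ho}\mathscr V_0$, the homotopy category $\operatorname{Ho}(\mathscr M^{\mathscr D})_0$ is the underlying category of a $\operatorname{Ho}\mathscr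 V$-enriched, tensored and cotensored category whose hom, tensor and cotensor are the derived functors of those of $\mathscr M^{\mathscr D}$, the localization functor being compatible with the enrichments. Here "derived structure" means: the localization functor $\mathscr V_0\to\operatorname{Ho}\mathscr V_0$ is lax symmetric monoidal and preserves the unit up to isomorphism, and its structure maps exhibit the tensor product and the internal hom of $\operatorname{Ho}\mathscr V_0$ as total left and right derived functors of those of $\mathscr V_0$. 3. If $\operatorname{Ho}\mathscr V_0$ has small hom-sets, then so does $\operatorname{Ho}(\mathscr M^{\mathscr D})_0$. -/

import Mathlib

open CategoryTheory MonoidalCategory Limits Opposite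

set_option linter.unusedSectionVars false

noncomputable section

namespace EnrichedHomotopy

universe v u₁ u₂

section Tensors

universe w

variable (V : Type u₁) [Category.{v} V] [MonoidalCategory V] [SymmetricCategory V]
  [MonoidalClosed V]
variable {M : Type u₂} [Category.{w} M] [EnrichedOrdinaryCategory V M]

/-- A tensor `K ⊙ X`: an object `obj` together with `K ⟶ M(X, obj)` inducing isomorphisms
`M(obj, Y) ≅ [K, M(X, Y)]`. -/
structure EnrichedTensor (K : V) (X : M) where
  obj : M
  coev : K ⟶ (X ⟶[V] obj)
  isIso_curry : ∀ Y : M, IsIso (MonoidalClosed.curry (coev ▷ (obj ⟶[V] Y) ≫ eComp V X obj Y))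

/-- A cotensor `{K, X}`: an object `obj` together with `K ⟶ M(obj, X)` inducing isomorphisms
`M(Y, obj) ≅ [K, M(Y, X)]`. -/
structure EnrichedCotensor (K : V) (X : M) where
  obj : M
  ev : K ⟶ (obj ⟶[V] X)
  isIso_curry : ∀ Y : M, IsIso (MonoidalClosed.curry
    ((β_ K (Y ⟶[V] obj)).hom ≫ (Y ⟶[V] obj) ◁ ev ≫ eComp V Y obj X))

variable (M) in
/-- A tensored `V`-category, with chosen tensors. -/
class Tensored where
  tensor (K : V) (X : M) : EnrichedTensor V K X

variable (M) in
/-- A cotensored `V`-category, with chosen cotensors. -/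
class Cotensored where
  cotensor (K : V) (X : M) : EnrichedCotensor V K X

/-- A morphism `m` out of `K ⊗ A` induces an isomorphism `A ≅ [K, Z]` as soon as it is
universal. -/
lemma isIso_curry_of_universal {V : Type u₁} [Category.{v} V] [MonoidalCategory V]
    [MonoidalClosed V] {K B Z : V} (m : K ⊗ B ⟶ Z)
    (inj : ∀ (A : V) (u u' : A ⟶ B), K ◁ u ≫ m = K ◁ u' ≫ m → u = u')
    (surj : ∀ (A : V) (f : K ⊗ A ⟶ Z), ∃ u : A ⟶ B, K ◁ u ≫ m = f) :
    IsIso (MonoidalClosed.curry m) := by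
  obtain ⟨u, hu⟩ := surj _ ((ihom.ev K).app Z)
  have h1 : u ≫ MonoidalClosed.curry m = 𝟙 _ := by
    rw [← MonoidalClosed.curry_natural_left, hu, ← MonoidalClosed.uncurry_id_eq_ev,
      MonoidalClosed.curry_uncurry]
  refine ⟨u, ?_, h1⟩
  apply inj
  rw [MonoidalCategory.whiskerLeft_comp, Category.assoc, hu, ← MonoidalClosed.uncurry_eq,
    MonoidalClosed.uncurry_curry, MonoidalCategory.whiskerLeft_id, Category.id_comp]

section T

variable [Tensored V M]

/-- The chosen tensor `K ⊙ X`. -/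
def tobj (K : V) (X : M) : M := (Tensored.tensor K X).obj

/-- The unit `K ⟶ M(X, K ⊙ X)`. -/
def tcoev (K : V) (X : M) : K ⟶ (X ⟶[V] tobj V K X) := (Tensored.tensor K X).coev

instance (K : V) (X Y : M) :
    IsIso (MonoidalClosed.curry (tcoev V K X ▷ (tobj V K X ⟶[V] Y) ≫ eComp V X _ Y)) :=
  (Tensored.tensor K X).isIso_curry Y

variable {V}

/-- The morphism `A ⟶ M(K ⊙ X, Y)` corresponding to `K ⊗ A ⟶ M(X, Y)`. -/
def tlift {K A : V} {X Y : M} (f : K ⊗ A ⟶ (X ⟶[V] Y)) : A ⟶ (tobj V K X ⟶[V] Y) :=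
  MonoidalClosed.curry f ≫
    inv (MonoidalClosed.curry (tcoev V K X ▷ (tobj V K X ⟶[V] Y) ≫ eComp V X _ Y))

lemma tlift_fac {K A : V} {X Y : M} (f : K ⊗ A ⟶ (X ⟶[V] Y)) :
    K ◁ tlift f ≫ tcoev V K X ▷ _ ≫ eComp V X (tobj V K X) Y = f := by
  apply MonoidalClosed.curry_injective
  rw [MonoidalClosed.curry_natural_left]
  simp [tlift]

lemma tlift_fac' {K A : V} {X Y : M} (f : K ⊗ A ⟶ (X ⟶[V] Y)) :
    (tcoev V K X ⊗ₘ tlift f) ≫ eComp V X (tobj V K X) Y = f := by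
  rw [tensorHom_def', Category.assoc, tlift_fac]

lemma tensor_hom_ext {K A : V} {X Y : M} {u u' : A ⟶ (tobj V K X ⟶[V] Y)}
    (h : (tcoev V K X ⊗ₘ u) ≫ eComp V X (tobj V K X) Y =
      (tcoev V K X ⊗ₘ u') ≫ eComp V X (tobj V K X) Y) : u = u' := by
  rw [← cancel_mono (MonoidalClosed.curry (tcoev V K X ▷ (tobj V K X ⟶[V] Y) ≫ eComp V X _ Y)),
    ← MonoidalClosed.curry_natural_left, ← MonoidalClosed.curry_natural_left]
  rw [tensorHom_def', tensorHom_def', Category.assoc, Category.assoc] at h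
  rw [h]

/-- The morphism `K ⊙ X ⟶ Y` corresponding to `K ⟶ M(X, Y)`. -/
def tdesc {K : V} {X Y : M} (f : K ⟶ (X ⟶[V] Y)) : tobj V K X ⟶ Y :=
  (eHomEquiv V).symm (tlift ((ρ_ K).hom ≫ f))

lemma tdesc_fac {K : V} {X Y : M} (f : K ⟶ (X ⟶[V] Y)) :
    tcoev V K X ≫ eHomWhiskerLeft V X (tdesc f) = f := by
  have := tlift_fac ((ρ_ K).hom ≫ f)
  rw [eHomWhiskerLeft, tdesc, Equiv.apply_symm_apply, rightUnitor_inv_naturality_assoc,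
    ← whisker_exchange_assoc, this, Iso.inv_hom_id_assoc]

lemma tobj_hom_ext {K : V} {X Y : M} {g g' : tobj V K X ⟶ Y}
    (h : tcoev V K X ≫ eHomWhiskerLeft V X g = tcoev V K X ≫ eHomWhiskerLeft V X g') :
    g = g' := by
  apply (eHomEquiv V).injective
  apply tensor_hom_ext
  simp only [eHomWhiskerLeft, rightUnitor_inv_naturality_assoc, Iso.cancel_iso_inv_left] at h
  simpa only [MonoidalCategory.tensorHom_def, Category.assoc] using h

/-- Ordinary morphisms `K ⊙ X ⟶ Y` are morphisms `K ⟶ M(X, Y)`. -/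
def tensorHomEquiv (K : V) (X Y : M) : (tobj V K X ⟶ Y) ≃ (K ⟶ (X ⟶[V] Y)) where
  toFun g := tcoev V K X ≫ eHomWhiskerLeft V X g
  invFun := tdesc
  left_inv _ := tobj_hom_ext (tdesc_fac _)
  right_inv := tdesc_fac

variable (V M)

/-- The tensor as a bifunctor. -/
@[simps]
def tensorFunctor : V ⥤ M ⥤ M where
  obj K :=
    { obj := fun X => tobj V K X
      map := fun {X X'} f => tdesc (tcoev V K X' ≫ eHomWhiskerRight V f _)
      map_id := fun X => tobj_hom_ext (by simp [tdesc_fac])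
      map_comp := fun f g => tobj_hom_ext (by
        rw [tdesc_fac, eHomWhiskerLeft_comp, reassoc_of% tdesc_fac, Category.assoc,
          ← eHom_whisker_exchange, reassoc_of% tdesc_fac, eHomWhiskerRight_comp, Category.assoc]) }
  map {K K'} k :=
    { app := fun X => tdesc (k ≫ tcoev V K' X)
      naturality := fun X X' f => tobj_hom_ext (by
        dsimp only
        rw [eHomWhiskerLeft_comp, eHomWhiskerLeft_comp, reassoc_of% tdesc_fac, Category.assoc,
          ← eHom_whisker_exchange, reassoc_of% tdesc_fac, reassoc_of% tdesc_fac, Category.assoc,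
          Category.assoc, tdesc_fac]) }
  map_id K := by
    ext X
    exact tobj_hom_ext (by simp [tdesc_fac])
  map_comp k l := by
    ext X
    refine tobj_hom_ext ?_
    simp only [NatTrans.comp_app]
    rw [eHomWhiskerLeft_comp, tdesc_fac, reassoc_of% tdesc_fac, Category.assoc, Category.assoc, tdesc_fac]

end T

section C

variable [Cotensored V M]

/-- The chosen cotensor `{K, X}`. -/
def cobj (K : V) (X : M) : M := (Cotensored.cotensor K X).obj

/-- The counit `K ⟶ M({K, X}, X)`. -/
def cev (K : V) (X : M) : K ⟶ (cobj V K X ⟶[V] X) := (Cotensored.cotensor K X).ev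

instance (K : V) (X Y : M) : IsIso (MonoidalClosed.curry
    ((β_ K (Y ⟶[V] cobj V K X)).hom ≫ (Y ⟶[V] cobj V K X) ◁ cev V K X ≫ eComp V Y _ X)) :=
  (Cotensored.cotensor K X).isIso_curry Y

variable {V}

/-- The morphism `A ⟶ M(Y, {K, X})` corresponding to `A ⊗ K ⟶ M(Y, X)`. -/
def clift {K A : V} {X Y : M} (f : A ⊗ K ⟶ (Y ⟶[V] X)) : A ⟶ (Y ⟶[V] cobj V K X) :=
  MonoidalClosed.curry ((β_ K A).hom ≫ f) ≫ inv (MonoidalClosed.curry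
    ((β_ K (Y ⟶[V] cobj V K X)).hom ≫ (Y ⟶[V] cobj V K X) ◁ cev V K X ≫ eComp V Y _ X))

lemma clift_fac {K A : V} {X Y : M} (f : A ⊗ K ⟶ (Y ⟶[V] X)) :
    (clift f ⊗ₘ cev V K X) ≫ eComp V Y (cobj V K X) X = f := by
  rw [← cancel_epi (β_ K A).hom]
  apply MonoidalClosed.curry_injective
  have := MonoidalClosed.curry_natural_left (clift f)
    ((β_ K (Y ⟶[V] cobj V K X)).hom ≫ (Y ⟶[V] cobj V K X) ◁ cev V K X ≫ eComp V Y _ X)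
  rw [MonoidalCategory.tensorHom_def, Category.assoc, ← BraidedCategory.braiding_naturality_right_assoc, this]
  simp [clift]

lemma cotensor_hom_ext {K A : V} {X Y : M} {u u' : A ⟶ (Y ⟶[V] cobj V K X)}
    (h : (u ⊗ₘ cev V K X) ≫ eComp V Y (cobj V K X) X =
      (u' ⊗ₘ cev V K X) ≫ eComp V Y (cobj V K X) X) : u = u' := by
  rw [← cancel_mono (MonoidalClosed.curry
    ((β_ K (Y ⟶[V] cobj V K X)).hom ≫ (Y ⟶[V] cobj V K X) ◁ cev V K X ≫ eComp V Y _ X)),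
    ← MonoidalClosed.curry_natural_left, ← MonoidalClosed.curry_natural_left]
  rw [MonoidalCategory.tensorHom_def, MonoidalCategory.tensorHom_def, Category.assoc, Category.assoc] at h
  rw [BraidedCategory.braiding_naturality_right_assoc,
    BraidedCategory.braiding_naturality_right_assoc, h]

/-- The morphism `Y ⟶ {K, X}` corresponding to `K ⟶ M(Y, X)`. -/
def cdesc {K : V} {X Y : M} (f : K ⟶ (Y ⟶[V] X)) : Y ⟶ cobj V K X :=
  (eHomEquiv V).symm (clift ((λ_ K).hom ≫ f))

lemma cdesc_fac {K : V} {X Y : M} (f : K ⟶ (Y ⟶[V] X)) :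
    cev V K X ≫ eHomWhiskerRight V (cdesc f) X = f := by
  have := clift_fac ((λ_ K).hom ≫ f)
  rw [tensorHom_def', Category.assoc] at this
  rw [eHomWhiskerRight, cdesc, Equiv.apply_symm_apply, leftUnitor_inv_naturality_assoc,
    this, Iso.inv_hom_id_assoc]

lemma cobj_hom_ext {K : V} {X Y : M} {g g' : Y ⟶ cobj V K X}
    (h : cev V K X ≫ eHomWhiskerRight V g X = cev V K X ≫ eHomWhiskerRight V g' X) :
    g = g' := by
  apply (eHomEquiv V).injective
  apply cotensor_hom_ext
  simp only [eHomWhiskerRight, leftUnitor_inv_naturality_assoc, Iso.cancel_iso_inv_left] at h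
  simpa only [tensorHom_def', Category.assoc] using h

/-- Ordinary morphisms `Y ⟶ {K, X}` are morphisms `K ⟶ M(Y, X)`. -/
def cotensorHomEquiv (K : V) (X Y : M) : (Y ⟶ cobj V K X) ≃ (K ⟶ (Y ⟶[V] X)) where
  toFun g := cev V K X ≫ eHomWhiskerRight V g X
  invFun := cdesc
  left_inv _ := cobj_hom_ext (cdesc_fac _)
  right_inv := cdesc_fac

variable (V M)

/-- The cotensor as a bifunctor. -/
@[simps]
def cotensorFunctor : Vᵒᵖ ⥤ M ⥤ M where
  obj K :=
    { obj := fun X => cobj V K.unop X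
      map := fun {X X'} f => cdesc (cev V K.unop X ≫ eHomWhiskerLeft V _ f)
      map_id := fun X => cobj_hom_ext (by simp [cdesc_fac])
      map_comp := fun f g => cobj_hom_ext (by
        rw [cdesc_fac, eHomWhiskerRight_comp, reassoc_of% cdesc_fac, Category.assoc,
          eHom_whisker_exchange, reassoc_of% cdesc_fac, eHomWhiskerLeft_comp, Category.assoc]) }
  map {K K'} k :=
    { app := fun X => cdesc (k.unop ≫ cev V K.unop X)
      naturality := fun X X' f => cobj_hom_ext (by
        dsimp only
        rw [eHomWhiskerRight_comp, eHomWhiskerRight_comp, reassoc_of% cdesc_fac,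
          reassoc_of% cdesc_fac, Category.assoc, Category.assoc, cdesc_fac,
          eHom_whisker_exchange, reassoc_of% cdesc_fac, Category.assoc]) }
  map_id K := by
    ext X
    exact cobj_hom_ext (by simp [cdesc_fac])
  map_comp k l := by
    ext X
    refine cobj_hom_ext ?_
    simp only [NatTrans.comp_app]
    rw [eHomWhiskerRight_comp, cdesc_fac, reassoc_of% cdesc_fac, unop_comp, Category.assoc,
      Category.assoc, cdesc_fac]

end C

end Tensors

section GeneralizedElements

universe w

variable {V : Type u₁} [Category.{v} V] [MonoidalCategory V] {M : Type u₂} [EnrichedCategory V M]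

/-- Composition of generalized elements of the hom-objects of a `V`-category. -/
def gcomp {A B : V} {X Y Z : M} (x : A ⟶ (X ⟶[V] Y)) (y : B ⟶ (Y ⟶[V] Z)) :
    A ⊗ B ⟶ (X ⟶[V] Z) :=
  (x ⊗ₘ y) ≫ eComp V X Y Z

local infixr:70 " ⋆ " => gcomp

lemma gcomp_comp {A B A' B' : V} {X Y Z : M} (f : A' ⟶ A) (g : B' ⟶ B)
    (x : A ⟶ (X ⟶[V] Y)) (y : B ⟶ (Y ⟶[V] Z)) :
    (f ≫ x) ⋆ (g ≫ y) = (f ⊗ₘ g) ≫ (x ⋆ y) := by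
  simp [gcomp]

lemma gcomp_comp_left {A B A' : V} {X Y Z : M} (f : A' ⟶ A)
    (x : A ⟶ (X ⟶[V] Y)) (y : B ⟶ (Y ⟶[V] Z)) :
    (f ≫ x) ⋆ y = f ▷ B ≫ (x ⋆ y) := by
  simp [gcomp, MonoidalCategory.tensorHom_def]

lemma gcomp_comp_right {A B B' : V} {X Y Z : M} (g : B' ⟶ B)
    (x : A ⟶ (X ⟶[V] Y)) (y : B ⟶ (Y ⟶[V] Z)) :
    x ⋆ (g ≫ y) = A ◁ g ≫ (x ⋆ y) := by
  simp [gcomp, MonoidalCategory.tensorHom_def']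

lemma gcomp_assoc {A B C : V} {W X Y Z : M} (x : A ⟶ (W ⟶[V] X)) (y : B ⟶ (X ⟶[V] Y))
    (z : C ⟶ (Y ⟶[V] Z)) : (x ⋆ y) ⋆ z = (α_ A B C).hom ≫ (x ⋆ (y ⋆ z)) := by
  have h := e_assoc V W X Y Z
  rw [Iso.inv_comp_eq] at h
  have e1 : (x ⋆ y) ⋆ z = ((x ⊗ₘ y) ⊗ₘ z) ≫ eComp V W X Y ▷ _ ≫ eComp V W Y Z := by
    simp only [gcomp, ← tensorHom_id, tensorHom_comp_tensorHom_assoc, Category.comp_id]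
  rw [e1, h]
  simp only [gcomp, ← id_tensorHom, tensorHom_comp_tensorHom_assoc, Category.comp_id,
    associator_naturality_assoc]

lemma gcomp_assoc' {A B C : V} {W X Y Z : M} (x : A ⟶ (W ⟶[V] X)) (y : B ⟶ (X ⟶[V] Y))
    (z : C ⟶ (Y ⟶[V] Z)) : x ⋆ (y ⋆ z) = (α_ A B C).inv ≫ ((x ⋆ y) ⋆ z) := by
  rw [gcomp_assoc, Iso.inv_hom_id_assoc]

lemma gcomp_id {A : V} {X Y : M} (x : A ⟶ (X ⟶[V] Y)) :
    x ⋆ eId V Y = (ρ_ A).hom ≫ x := by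
  have := e_comp_id V X Y
  rw [Iso.inv_comp_eq, Category.comp_id] at this
  rw [gcomp, MonoidalCategory.tensorHom_def, Category.assoc, this, rightUnitor_naturality]

lemma id_gcomp {A : V} {X Y : M} (x : A ⟶ (X ⟶[V] Y)) :
    eId V X ⋆ x = (λ_ A).hom ≫ x := by
  have := e_id_comp V X Y
  rw [Iso.inv_comp_eq, Category.comp_id] at this
  rw [gcomp, MonoidalCategory.tensorHom_def', Category.assoc, this, leftUnitor_naturality]

lemma gcomp_eHomEquiv {M : Type u₂} [Category.{w} M] [EnrichedOrdinaryCategory V M]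
    {A : V} {X Y Z : M} (x : A ⟶ (X ⟶[V] Y)) (g : Y ⟶ Z) :
    x ⋆ eHomEquiv V g = (ρ_ A).hom ≫ x ≫ eHomWhiskerLeft V X g := by
  rw [eHomWhiskerLeft, rightUnitor_inv_naturality_assoc, Iso.hom_inv_id_assoc, gcomp,
    MonoidalCategory.tensorHom_def, Category.assoc]

lemma eHomEquiv_gcomp {M : Type u₂} [Category.{w} M] [EnrichedOrdinaryCategory V M]
    {A : V} {X Y Z : M} (f : X ⟶ Y) (x : A ⟶ (Y ⟶[V] Z)) :
    eHomEquiv V f ⋆ x = (λ_ A).hom ≫ x ≫ eHomWhiskerRight V f Z := by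
  rw [eHomWhiskerRight, leftUnitor_inv_naturality_assoc, Iso.hom_inv_id_assoc, gcomp,
    MonoidalCategory.tensorHom_def', Category.assoc]

end GeneralizedElements

local infixr:70 " ⋆ " => gcomp

section Diagrams

variable (V : Type u₁) [Category.{v} V] [MonoidalCategory V] [SymmetricCategory V]
  [MonoidalClosed V] (D : Type v) [EnrichedCategory V D]
  (M : Type u₂) [Category.{v} M] [EnrichedOrdinaryCategory V M]

/-- The objects of `M^D`: the `V`-functors `D ⟶ M`. -/
structure Diagram where
  toFun : EnrichedFunctor V D M

variable {V D M}

namespace Diagram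

/-- The value of a diagram. -/
def val (F : Diagram V D M) (d : D) : M := F.toFun.obj d

/-- The action of a diagram on hom-objects. -/
def act (F : Diagram V D M) (d d' : D) : (d ⟶[V] d') ⟶ (F.val d ⟶[V] F.val d') :=
  F.toFun.map d d'

lemma act_id (F : Diagram V D M) (d : D) : eId V d ≫ F.act d d = eId V (F.val d) :=
  F.toFun.map_id d

lemma act_comp (F : Diagram V D M) (d d' d'' : D) :
    eComp V d d' d'' ≫ F.act d d'' = F.act d d' ⋆ F.act d' d'' :=
  F.toFun.map_comp d d' d''

/-- `V`-natural transformations. -/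
@[ext]
structure Hom (F G : Diagram V D M) where
  app (d : D) : F.val d ⟶ G.val d
  naturality (d d' : D) : F.act d d' ≫ eHomWhiskerLeft V _ (app d') =
    G.act d d' ≫ eHomWhiskerRight V (app d) _

instance : Category.{v} (Diagram V D M) where
  Hom := Hom
  id F := { app := fun d => 𝟙 _, naturality := fun d d' => by simp }
  comp {F G H} f g :=
    { app := fun d => f.app d ≫ g.app d
      naturality := fun d d' => by
        have e1 := f.naturality d d'
        have e2 := g.naturality d d'
        rw [eHomWhiskerLeft_comp, reassoc_of% e1, ← eHom_whisker_exchange, reassoc_of% e2,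
          eHomWhiskerRight_comp] }
  id_comp f := Hom.ext (by funext d; exact Category.id_comp _)
  comp_id f := Hom.ext (by funext d; exact Category.comp_id _)
  assoc f g h := Hom.ext (by funext d; exact Category.assoc _ _ _)

@[ext]
lemma hom_ext {F G : Diagram V D M} {f g : F ⟶ G} (h : ∀ d, Hom.app f d = Hom.app g d) : f = g :=
  Hom.ext (funext h)

lemma naturality {F G : Diagram V D M} (f : F ⟶ G) (d d' : D) :
    F.act d d' ≫ eHomWhiskerLeft V _ (Hom.app f d') =
      G.act d d' ≫ eHomWhiskerRight V (Hom.app f d) _ :=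
  Hom.naturality f d d'

@[simp] lemma id_app (F : Diagram V D M) (d : D) : Hom.app (𝟙 F) d = 𝟙 (F.val d) := rfl

@[simp] lemma comp_app {F G H : Diagram V D M} (f : F ⟶ G) (g : G ⟶ H) (d : D) :
    Hom.app (f ≫ g) d = Hom.app f d ≫ Hom.app g d := rfl

variable (V M) in
/-- Evaluation at an object of `D`. -/
@[simps]
def ev (d : D) : Diagram V D M ⥤ M where
  obj F := F.val d
  map f := Hom.app f d

/-- A family of generalized elements `A ⟶ M(F d, G d)` is `V`-natural. -/
def IsNat {F G : Diagram V D M} {A : V} (φ : ∀ d, A ⟶ (F.val d ⟶[V] G.val d)) : Prop :=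
  ∀ d d', F.act d d' ⋆ φ d' = (β_ (d ⟶[V] d') A).hom ≫ (φ d ⋆ G.act d d')

variable [HasLimits V]

/-- The hom-object of `M^D`: the end `∫_d M(F d, G d)`, presented as an equalizer. -/
def homObj (F G : Diagram V D M) : V :=
  equalizer
    (Pi.lift fun p : D × D => MonoidalClosed.curry
      (F.act p.1 p.2 ⋆ Pi.π (fun d => F.val d ⟶[V] G.val d) p.2))
    (Pi.lift fun p : D × D => MonoidalClosed.curry
      ((β_ _ _).hom ≫ (Pi.π (fun d => F.val d ⟶[V] G.val d) p.1 ⋆ G.act p.1 p.2)))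

/-- The inclusion of the equalizer. -/
def homι (F G : Diagram V D M) : homObj F G ⟶ ∏ᶜ fun d => (F.val d ⟶[V] G.val d) :=
  equalizer.ι _ _

/-- The projection `∫_d M(F d, G d) ⟶ M(F d, G d)`. -/
def homπ (F G : Diagram V D M) (d : D) : homObj F G ⟶ (F.val d ⟶[V] G.val d) :=
  homι F G ≫ Pi.π (fun d => F.val d ⟶[V] G.val d) d

lemma isNat_homπ (F G : Diagram V D M) : IsNat (homπ F G) := by
  intro d d'
  have := equalizer.condition
    (Pi.lift fun p : D × D => MonoidalClosed.curry
      (F.act p.1 p.2 ⋆ Pi.π (fun d => F.val d ⟶[V] G.val d) p.2))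
    (Pi.lift fun p : D × D => MonoidalClosed.curry
      ((β_ _ _).hom ≫ (Pi.π (fun d => F.val d ⟶[V] G.val d) p.1 ⋆ G.act p.1 p.2)))
  change homι F G ≫ _ = homι F G ≫ _ at this
  have h := congrArg (fun k => k ≫ Pi.π _ (d, d')) this
  simp only [Category.assoc, limit.lift_π, Fan.mk_pt, Fan.mk_π_app] at h
  rw [← MonoidalClosed.curry_natural_left, ← MonoidalClosed.curry_natural_left] at h
  have h := MonoidalClosed.curry_injective h
  rw [homπ, gcomp_comp_right, h, homπ, gcomp_comp_left,
    BraidedCategory.braiding_naturality_right_assoc]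

lemma IsNat.comp {F G : Diagram V D M} {A B : V} {φ : ∀ d, B ⟶ (F.val d ⟶[V] G.val d)}
    (h : IsNat φ) (f : A ⟶ B) : IsNat (fun d => f ≫ φ d) := by
  intro d d'
  rw [gcomp_comp_right, h d d', gcomp_comp_left, BraidedCategory.braiding_naturality_right_assoc]

/-- The universal property of `∫_d M(F d, G d)`. -/
def homLift {F G : Diagram V D M} {A : V} (φ : ∀ d, A ⟶ (F.val d ⟶[V] G.val d))
    (h : IsNat φ) : A ⟶ homObj F G :=
  equalizer.lift (Pi.lift φ) (by
    apply Pi.hom_ext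
    rintro ⟨d, d'⟩
    simp only [Category.assoc, limit.lift_π, Fan.mk_pt, Fan.mk_π_app]
    rw [← MonoidalClosed.curry_natural_left, ← MonoidalClosed.curry_natural_left,
      BraidedCategory.braiding_naturality_right_assoc, ← gcomp_comp_left, ← gcomp_comp_right]
    simpa using congrArg MonoidalClosed.curry (h d d'))

@[simp]
lemma homLift_π {F G : Diagram V D M} {A : V} (φ : ∀ d, A ⟶ (F.val d ⟶[V] G.val d))
    (h : IsNat φ) (d : D) : homLift φ h ≫ homπ F G d = φ d := by
  rw [homLift, homπ, homι]
  erw [equalizer.lift_ι_assoc]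
  simp

lemma homObj_ext {F G : Diagram V D M} {A : V} {f g : A ⟶ homObj F G}
    (h : ∀ d, f ≫ homπ F G d = g ≫ homπ F G d) : f = g := by
  apply equalizer.hom_ext
  apply Pi.hom_ext
  intro d
  exact (Category.assoc _ _ _).trans ((h d).trans (Category.assoc _ _ _).symm)

lemma IsNat.gcomp {F G H : Diagram V D M} {A B : V} {φ : ∀ d, A ⟶ (F.val d ⟶[V] G.val d)}
    {ψ : ∀ d, B ⟶ (G.val d ⟶[V] H.val d)} (hφ : IsNat φ) (hψ : IsNat ψ) :
    IsNat (fun d => φ d ⋆ ψ d) := by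
  intro d d'
  rw [gcomp_assoc', hφ d d', gcomp_comp_left, gcomp_assoc, hψ d d', gcomp_comp_right,
    gcomp_assoc', BraidedCategory.braiding_tensor_right_hom]
  simp

lemma isNat_eHomEquiv {F G : Diagram V D M} (f : F ⟶ G) :
    IsNat (fun d => eHomEquiv V (Hom.app f d)) := by
  intro d d'
  rw [gcomp_eHomEquiv, eHomEquiv_gcomp, naturality, ← braiding_leftUnitor_assoc]

lemma isNat_id (F : Diagram V D M) : IsNat (fun d => eId V (F.val d)) := by
  intro d d'
  rw [gcomp_id, id_gcomp, ← braiding_leftUnitor_assoc]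

instance : EnrichedCategory V (Diagram V D M) where
  Hom F G := homObj F G
  id F := homLift (fun d => eId V (F.val d)) (isNat_id F)
  comp F G H := homLift _ ((isNat_homπ F G).gcomp (isNat_homπ G H))
  id_comp F G := homObj_ext fun d => by
    rw [Category.assoc, Category.assoc, homLift_π _ ((isNat_homπ F F).gcomp (isNat_homπ F G)),
      ← gcomp_comp_left, homLift_π _ (isNat_id F), id_gcomp, Iso.inv_hom_id_assoc, Category.id_comp]
  comp_id F G := homObj_ext fun d => by
    rw [Category.assoc, Category.assoc, homLift_π _ ((isNat_homπ F G).gcomp (isNat_homπ G G)),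
      ← gcomp_comp_right, homLift_π _ (isNat_id G), gcomp_id, Iso.inv_hom_id_assoc, Category.id_comp]
  assoc F G H K := homObj_ext fun d => by
    rw [Category.assoc, Category.assoc, Category.assoc,
      homLift_π _ ((isNat_homπ F H).gcomp (isNat_homπ H K)),
      homLift_π _ ((isNat_homπ F G).gcomp (isNat_homπ G K)),
      ← gcomp_comp_right, homLift_π _ ((isNat_homπ G H).gcomp (isNat_homπ H K)),
      ← gcomp_comp_left, homLift_π _ ((isNat_homπ F G).gcomp (isNat_homπ G H)), gcomp_assoc,
      Iso.inv_hom_id_assoc]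

lemma eId_π (F : Diagram V D M) (d : D) : eId V F ≫ homπ F F d = eId V (F.val d) :=
  homLift_π _ (isNat_id F) d

lemma eComp_π (F G H : Diagram V D M) (d : D) :
    eComp V F G H ≫ homπ F H d = homπ F G d ⋆ homπ G H d :=
  homLift_π _ ((isNat_homπ F G).gcomp (isNat_homπ G H)) d

/-- Points of `∫_d M(F d, G d)` are `V`-natural transformations. -/
def homObjEquiv (F G : Diagram V D M) : (F ⟶ G) ≃ (𝟙_ V ⟶ (F ⟶[V] G)) where
  toFun f := homLift _ (isNat_eHomEquiv f)
  invFun u :=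
    { app := fun d => (eHomEquiv V).symm (u ≫ homπ F G d)
      naturality := fun d d' => by
        have := ((isNat_homπ F G).comp u) d d'
        dsimp only at this
        rw [← (eHomEquiv V).apply_symm_apply (u ≫ homπ F G d),
          ← (eHomEquiv V).apply_symm_apply (u ≫ homπ F G d'), gcomp_eHomEquiv,
          eHomEquiv_gcomp, braiding_leftUnitor_assoc] at this
        exact (cancel_epi _).1 this }
  left_inv f := hom_ext fun d => by
    change (eHomEquiv V).symm _ = _
    rw [homLift_π, Equiv.symm_apply_apply]
  right_inv u := homObj_ext fun d => by
    rw [homLift_π]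
    exact Equiv.apply_symm_apply _ _

lemma homObjEquiv_π {F G : Diagram V D M} (f : F ⟶ G) (d : D) :
    homObjEquiv F G f ≫ homπ F G d = eHomEquiv V (Hom.app f d) :=
  homLift_π _ (isNat_eHomEquiv f) d

instance : EnrichedOrdinaryCategory V (Diagram V D M) where
  homEquiv {F G} := homObjEquiv F G
  homEquiv_id F := homObj_ext fun d => by
    rw [eId_π, homObjEquiv_π, id_app, eHomEquiv_id]
  homEquiv_comp {F G H} f g := homObj_ext fun d => by
    rw [homObjEquiv_π, Category.assoc, Category.assoc, eComp_π, ← gcomp_comp, homObjEquiv_π,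
      homObjEquiv_π, comp_app, eHomEquiv_comp, gcomp]

lemma eHomEquiv_π {F G : Diagram V D M} (f : F ⟶ G) (d : D) :
    eHomEquiv V f ≫ homπ F G d = eHomEquiv V (Hom.app f d) :=
  homObjEquiv_π f d

end Diagram

end Diagrams

section Whiskering

universe w

variable {V : Type u₁} [Category.{v} V] [MonoidalCategory V]
  {M : Type u₂} [Category.{w} M] [EnrichedOrdinaryCategory V M]

lemma gcomp_whiskerLeft {A B : V} {X Y Z Z' : M} (x : A ⟶ (X ⟶[V] Y)) (y : B ⟶ (Y ⟶[V] Z))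
    (g : Z ⟶ Z') : (x ⋆ y) ≫ eHomWhiskerLeft V X g = x ⋆ (y ≫ eHomWhiskerLeft V Y g) := by
  rw [gcomp_comp_right, gcomp, gcomp, Category.assoc, eComp_eHomWhiskerLeft,
    ← id_tensorHom, ← id_tensorHom]
  simp only [tensorHom_comp_tensorHom_assoc, Category.comp_id, Category.id_comp]

lemma gcomp_whiskerRight {A B : V} {X' X Y Z : M} (x : A ⟶ (X ⟶[V] Y)) (y : B ⟶ (Y ⟶[V] Z))
    (f : X' ⟶ X) : (x ⋆ y) ≫ eHomWhiskerRight V f Z = (x ≫ eHomWhiskerRight V f Y) ⋆ y := by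
  rw [gcomp_comp_left, gcomp, gcomp, Category.assoc, eComp_eHomWhiskerRight,
    ← tensorHom_id, ← tensorHom_id]
  simp only [tensorHom_comp_tensorHom_assoc, Category.comp_id, Category.id_comp]

lemma whiskerLeft_gcomp {A B : V} {X Y Y' Z : M} (x : A ⟶ (X ⟶[V] Y)) (y : B ⟶ (Y' ⟶[V] Z))
    (g : Y ⟶ Y') : (x ≫ eHomWhiskerLeft V X g) ⋆ y = x ⋆ (y ≫ eHomWhiskerRight V g Z) := by
  have e1 : x ≫ eHomWhiskerLeft V X g = (ρ_ A).inv ≫ (x ⋆ eHomEquiv V g) := by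
    rw [gcomp_eHomEquiv, Iso.inv_hom_id_assoc]
  have e2 : y ≫ eHomWhiskerRight V g Z = (λ_ B).inv ≫ (eHomEquiv V g ⋆ y) := by
    rw [eHomEquiv_gcomp, Iso.inv_hom_id_assoc]
  rw [e1, e2, gcomp_comp_left, gcomp_comp_right, gcomp_assoc]
  simp

end Whiskering

section Tensors

universe w

variable {V : Type u₁} [Category.{v} V] [MonoidalCategory V] [SymmetricCategory V]
  [MonoidalClosed V] {M : Type u₂} [Category.{w} M] [EnrichedOrdinaryCategory V M]

lemma tcoev_gcomp_tlift [Tensored V M] {K A : V} {X Y : M} (f : K ⊗ A ⟶ (X ⟶[V] Y)) :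
    tcoev V K X ⋆ tlift f = f := tlift_fac' f

lemma clift_gcomp_cev [Cotensored V M] {K A : V} {X Y : M} (f : A ⊗ K ⟶ (Y ⟶[V] X)) :
    clift f ⋆ cev V K X = f := clift_fac f

/-- The universal property of a colimit for generalized elements of hom-objects. -/
def colimLift [Cotensored V M] {J : Type*} [Category* J] {K : J ⥤ M} {c : Cocone K}
    (hc : IsColimit c) {A : V} {Y : M} (φ : ∀ j, A ⟶ (K.obj j ⟶[V] Y))
    (h : ∀ {j j'} (f : j ⟶ j'), φ j' ≫ eHomWhiskerRight V (K.map f) Y = φ j) :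
    A ⟶ (c.pt ⟶[V] Y) :=
  cev V A Y ≫ eHomWhiskerRight V (hc.desc (Cocone.mk (cobj V A Y)
    { app := fun j => cdesc (φ j)
      naturality := fun j j' f => cobj_hom_ext (by
        dsimp only [Functor.const_obj_obj, Functor.const_obj_map]
        rw [eHomWhiskerRight_comp, reassoc_of% cdesc_fac, h f, Category.comp_id,
          cdesc_fac]) })) Y

lemma colimLift_fac [Cotensored V M] {J : Type*} [Category* J] {K : J ⥤ M} {c : Cocone K}
    (hc : IsColimit c) {A : V} {Y : M} (φ : ∀ j, A ⟶ (K.obj j ⟶[V] Y))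
    (h : ∀ {j j'} (f : j ⟶ j'), φ j' ≫ eHomWhiskerRight V (K.map f) Y = φ j) (j : J) :
    colimLift hc φ h ≫ eHomWhiskerRight V (c.ι.app j) Y = φ j := by
  rw [colimLift, Category.assoc, ← eHomWhiskerRight_comp, hc.fac, cdesc_fac]

lemma colim_hom_ext [Cotensored V M] {J : Type*} [Category* J] {K : J ⥤ M} {c : Cocone K}
    (hc : IsColimit c) {A : V} {Y : M} {u u' : A ⟶ (c.pt ⟶[V] Y)}
    (h : ∀ j, u ≫ eHomWhiskerRight V (c.ι.app j) Y = u' ≫ eHomWhiskerRight V (c.ι.app j) Y) :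
    u = u' := by
  rw [← cdesc_fac u, ← cdesc_fac u']
  congr 2
  apply hc.hom_ext
  intro j
  apply cobj_hom_ext
  rw [eHomWhiskerRight_comp, eHomWhiskerRight_comp, reassoc_of% cdesc_fac,
    reassoc_of% cdesc_fac, h j]

/-- The universal property of a limit for generalized elements of hom-objects. -/
def limLift [Tensored V M] {J : Type*} [Category* J] {K : J ⥤ M} {c : Cone K}
    (hc : IsLimit c) {A : V} {X : M} (φ : ∀ j, A ⟶ (X ⟶[V] K.obj j))
    (h : ∀ {j j'} (f : j ⟶ j'), φ j ≫ eHomWhiskerLeft V X (K.map f) = φ j') :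
    A ⟶ (X ⟶[V] c.pt) :=
  tcoev V A X ≫ eHomWhiskerLeft V X (hc.lift (Cone.mk (tobj V A X)
    { app := fun j => tdesc (φ j)
      naturality := fun j j' f => tobj_hom_ext (by
        dsimp only [Functor.const_obj_obj, Functor.const_obj_map]
        rw [eHomWhiskerLeft_comp V X (tdesc (φ j)), reassoc_of% tdesc_fac, h f, Category.id_comp,
          tdesc_fac]) }))

lemma limLift_fac [Tensored V M] {J : Type*} [Category* J] {K : J ⥤ M} {c : Cone K}
    (hc : IsLimit c) {A : V} {X : M} (φ : ∀ j, A ⟶ (X ⟶[V] K.obj j))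
    (h : ∀ {j j'} (f : j ⟶ j'), φ j ≫ eHomWhiskerLeft V X (K.map f) = φ j') (j : J) :
    limLift hc φ h ≫ eHomWhiskerLeft V X (c.π.app j) = φ j := by
  rw [limLift, Category.assoc, ← eHomWhiskerLeft_comp, hc.fac, tdesc_fac]

lemma lim_hom_ext [Tensored V M] {J : Type*} [Category* J] {K : J ⥤ M} {c : Cone K}
    (hc : IsLimit c) {A : V} {X : M} {u u' : A ⟶ (X ⟶[V] c.pt)}
    (h : ∀ j, u ≫ eHomWhiskerLeft V X (c.π.app j) = u' ≫ eHomWhiskerLeft V X (c.π.app j)) :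
    u = u' := by
  rw [← tdesc_fac u, ← tdesc_fac u']
  congr 2
  apply hc.hom_ext
  intro j
  apply tobj_hom_ext
  rw [eHomWhiskerLeft_comp, eHomWhiskerLeft_comp, reassoc_of% tdesc_fac,
    reassoc_of% tdesc_fac, h j]

end Tensors

section Diagrams

variable {V : Type u₁} [Category.{v} V] [MonoidalCategory V] [SymmetricCategory V]
  [MonoidalClosed V] {D : Type v} [EnrichedCategory V D]
  {M : Type u₂} [Category.{v} M] [EnrichedOrdinaryCategory V M]

namespace Diagram

section Tensored

variable [Tensored V M]

/-- The action on hom-objects of `K ⊙ F`. -/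
def tensorAct (K : V) (F : Diagram V D M) (d d' : D) :
    (d ⟶[V] d') ⟶ (tobj V K (F.val d) ⟶[V] tobj V K (F.val d')) :=
  tlift ((β_ K (d ⟶[V] d')).hom ≫ (F.act d d' ⋆ tcoev V K (F.val d')))

lemma tcoev_tensorAct (K : V) (F : Diagram V D M) (d d' : D) :
    tcoev V K (F.val d) ⋆ tensorAct K F d d' =
      (β_ K (d ⟶[V] d')).hom ≫ (F.act d d' ⋆ tcoev V K (F.val d')) :=
  tcoev_gcomp_tlift _

/-- The objectwise tensor. -/
def tensor (K : V) (F : Diagram V D M) : Diagram V D M where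
  toFun :=
    { obj := fun d => tobj V K (F.val d)
      map := fun d d' => tensorAct K F d d'
      map_id := fun d => tensor_hom_ext (by
        change tcoev V K (F.val d) ⋆ _ = tcoev V K (F.val d) ⋆ _
        rw [gcomp_comp_right, tcoev_tensorAct, gcomp_id,
          BraidedCategory.braiding_naturality_right_assoc, ← gcomp_comp_left, F.act_id, id_gcomp,
          braiding_leftUnitor_assoc])
      map_comp := fun d d' d'' => tensor_hom_ext (by
        change tcoev V K (F.val d) ⋆ _ = tcoev V K (F.val d) ⋆ (tensorAct K F d d' ⋆ _)
        rw [gcomp_comp_right, tcoev_tensorAct, gcomp_assoc', tcoev_tensorAct, gcomp_comp_left,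
          gcomp_assoc, tcoev_tensorAct, gcomp_comp_right, gcomp_assoc',
          BraidedCategory.braiding_naturality_right_assoc, ← gcomp_comp_left, F.act_comp,
          BraidedCategory.braiding_tensor_right_hom]
        simp) }

variable [HasLimits V]

/-- The unit `K ⟶ M(F d, (K ⊙ F) d)`. -/
def tensorUnit (K : V) (F : Diagram V D M) (d : D) : K ⟶ (F.val d ⟶[V] (tensor K F).val d) :=
  tcoev V K (F.val d)

/-- The morphism `A ⟶ M((K ⊙ F) d, Y)` corresponding to `K ⊗ A ⟶ M(F d, Y)`. -/
def tensorLift {K A : V} {F : Diagram V D M} {d : D} {Y : M} (f : K ⊗ A ⟶ (F.val d ⟶[V] Y)) :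
    A ⟶ ((tensor K F).val d ⟶[V] Y) :=
  tlift f

lemma tensorUnit_lift {K A : V} {F : Diagram V D M} {d : D} {Y : M}
    (f : K ⊗ A ⟶ (F.val d ⟶[V] Y)) : tensorUnit K F d ⋆ tensorLift f = f :=
  tcoev_gcomp_tlift f

lemma tensorUnit_ext {K A : V} {F : Diagram V D M} {d : D} {Y : M}
    {u u' : A ⟶ ((tensor K F).val d ⟶[V] Y)}
    (h : tensorUnit K F d ⋆ u = tensorUnit K F d ⋆ u') : u = u' :=
  tensor_hom_ext h

lemma tensorUnit_act (K : V) (F : Diagram V D M) (d d' : D) :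
    tensorUnit K F d ⋆ (tensor K F).act d d' =
      (β_ K (d ⟶[V] d')).hom ≫ (F.act d d' ⋆ tensorUnit K F d') :=
  tcoev_tensorAct K F d d'

lemma isNat_tensorUnit (K : V) (F : Diagram V D M) : IsNat (tensorUnit K F) := by
  intro d d'
  rw [tensorUnit_act, SymmetricCategory.symmetry_assoc]

lemma tensor_universal (K : V) (F G : Diagram V D M) {A : V} (u : A ⟶ (tensor K F ⟶[V] G))
    (d : D) :
    (K ◁ u ≫ homLift _ (isNat_tensorUnit K F) ▷ _ ≫ eComp V F (tensor K F) G) ≫ homπ F G d =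
      tensorUnit K F d ⋆ (u ≫ homπ (tensor K F) G d) := by
  rw [Category.assoc, Category.assoc, eComp_π, ← gcomp_comp_left,
    homLift_π _ (isNat_tensorUnit K F), ← gcomp_comp_right]

instance : Tensored V (Diagram V D M) where
  tensor K F :=
    { obj := tensor K F
      coev := homLift _ (isNat_tensorUnit K F)
      isIso_curry := fun G => by
        apply isIso_curry_of_universal
        · intro A u u' h
          apply homObj_ext
          intro d
          apply tensorUnit_ext
          rw [← tensor_universal, ← tensor_universal, h]
        · intro A f
          have hn : IsNat (F := tensor K F) (G := G) (fun d => tensorLift (f ≫ homπ F G d)) := by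
            intro d d'
            apply tensorUnit_ext
            have e := (isNat_homπ F G).comp f d d'
            dsimp only at e ⊢
            rw [gcomp_assoc', tensorUnit_act, gcomp_comp_left, gcomp_assoc, tensorUnit_lift,
              gcomp_comp_right _ (tensorUnit K F d), gcomp_assoc', tensorUnit_lift,
              e, BraidedCategory.braiding_tensor_right_hom]
            simp only [Category.assoc]
            rw [Iso.hom_inv_id_assoc, ← comp_whiskerRight_assoc, SymmetricCategory.symmetry]
            simp
          refine ⟨homLift _ hn, homObj_ext fun d => ?_⟩
          rw [tensor_universal, homLift_π _ hn, tensorUnit_lift] }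

end Tensored

section Cotensored

variable [Cotensored V M]

/-- The action on hom-objects of `{K, F}`. -/
def cotensorAct (K : V) (F : Diagram V D M) (d d' : D) :
    (d ⟶[V] d') ⟶ (cobj V K (F.val d) ⟶[V] cobj V K (F.val d')) :=
  clift ((β_ (d ⟶[V] d') K).hom ≫ (cev V K (F.val d) ⋆ F.act d d'))

lemma cotensorAct_cev (K : V) (F : Diagram V D M) (d d' : D) :
    cotensorAct K F d d' ⋆ cev V K (F.val d') =
      (β_ (d ⟶[V] d') K).hom ≫ (cev V K (F.val d) ⋆ F.act d d') :=
  clift_gcomp_cev _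

/-- The objectwise cotensor. -/
def cotensor (K : V) (F : Diagram V D M) : Diagram V D M where
  toFun :=
    { obj := fun d => cobj V K (F.val d)
      map := fun d d' => cotensorAct K F d d'
      map_id := fun d => cotensor_hom_ext (by
        change _ ⋆ cev V K (F.val d) = _ ⋆ cev V K (F.val d)
        rw [gcomp_comp_left, cotensorAct_cev, id_gcomp,
          BraidedCategory.braiding_naturality_left_assoc, ← gcomp_comp_right, F.act_id, gcomp_id,
          braiding_rightUnitor_assoc])
      map_comp := fun d d' d'' => cotensor_hom_ext (by
        change _ ⋆ cev V K (F.val d'') =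
          (cotensorAct K F d d' ⋆ cotensorAct K F d' d'') ⋆ cev V K (F.val d'')
        rw [gcomp_comp_left, cotensorAct_cev, gcomp_assoc, cotensorAct_cev, gcomp_comp_right,
          gcomp_assoc', cotensorAct_cev, gcomp_comp_left, gcomp_assoc,
          BraidedCategory.braiding_naturality_left_assoc, ← gcomp_comp_right, F.act_comp,
          BraidedCategory.braiding_tensor_left_hom]
        simp) }

variable [HasLimits V]

/-- The counit `K ⟶ M({K, F} d, F d)`. -/
def cotensorCounit (K : V) (F : Diagram V D M) (d : D) :
    K ⟶ ((cotensor K F).val d ⟶[V] F.val d) :=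
  cev V K (F.val d)

/-- The morphism `A ⟶ M(Y, {K, F} d)` corresponding to `A ⊗ K ⟶ M(Y, F d)`. -/
def cotensorLift {K A : V} {F : Diagram V D M} {d : D} {Y : M} (f : A ⊗ K ⟶ (Y ⟶[V] F.val d)) :
    A ⟶ (Y ⟶[V] (cotensor K F).val d) :=
  clift f

lemma cotensorLift_counit {K A : V} {F : Diagram V D M} {d : D} {Y : M}
    (f : A ⊗ K ⟶ (Y ⟶[V] F.val d)) : cotensorLift f ⋆ cotensorCounit K F d = f :=
  clift_gcomp_cev f

lemma cotensorCounit_ext {K A : V} {F : Diagram V D M} {d : D} {Y : M}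
    {u u' : A ⟶ (Y ⟶[V] (cotensor K F).val d)}
    (h : u ⋆ cotensorCounit K F d = u' ⋆ cotensorCounit K F d) : u = u' :=
  cotensor_hom_ext h

lemma act_cotensorCounit (K : V) (F : Diagram V D M) (d d' : D) :
    (cotensor K F).act d d' ⋆ cotensorCounit K F d' =
      (β_ (d ⟶[V] d') K).hom ≫ (cotensorCounit K F d ⋆ F.act d d') :=
  cotensorAct_cev K F d d'

lemma isNat_cotensorCounit (K : V) (F : Diagram V D M) : IsNat (cotensorCounit K F) :=
  act_cotensorCounit K F

lemma cotensor_universal (K : V) (F G : Diagram V D M) {A : V} (u : A ⟶ (G ⟶[V] cotensor K F))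
    (d : D) :
    (K ◁ u ≫ (β_ K _).hom ≫ (G ⟶[V] cotensor K F) ◁ homLift _ (isNat_cotensorCounit K F) ≫
        eComp V G (cotensor K F) F) ≫ homπ G F d =
      (β_ K A).hom ≫ ((u ≫ homπ G (cotensor K F) d) ⋆ cotensorCounit K F d) := by
  rw [Category.assoc, Category.assoc, Category.assoc, eComp_π, ← gcomp_comp_right,
    homLift_π _ (isNat_cotensorCounit K F), gcomp_comp_left,
    BraidedCategory.braiding_naturality_right_assoc]

instance : Cotensored V (Diagram V D M) where
  cotensor K F :=
    { obj := cotensor K F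
      ev := homLift _ (isNat_cotensorCounit K F)
      isIso_curry := fun G => by
        apply isIso_curry_of_universal
        · intro A u u' h
          apply homObj_ext
          intro d
          apply cotensorCounit_ext
          rw [← cancel_epi (β_ K A).hom, ← cotensor_universal, ← cotensor_universal, h]
        · intro A f
          have hn : IsNat (F := G) (G := cotensor K F)
              (fun d => cotensorLift (((β_ K A).inv ≫ f) ≫ homπ G F d)) := by
            intro d d'
            apply cotensorCounit_ext
            have e := (isNat_homπ G F).comp ((β_ K A).inv ≫ f) d d'
            dsimp only at e ⊢
            rw [gcomp_assoc, cotensorLift_counit, e,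
              gcomp_comp_left _ (_ ⋆ (cotensor K F).act d d'), gcomp_assoc, act_cotensorCounit,
              gcomp_comp_right, gcomp_assoc', cotensorLift_counit,
              BraidedCategory.braiding_tensor_right_hom]
            simp
          refine ⟨homLift _ hn, homObj_ext fun d => ?_⟩
          rw [cotensor_universal, homLift_π _ hn, cotensorLift_counit, Category.assoc,
            Iso.hom_inv_id_assoc] }

end Cotensored

end Diagram

end Diagrams

lemma eId_whisker {V : Type u₁} [Category.{v} V] [MonoidalCategory V]
    {M : Type u₂} [Category.{v} M] [EnrichedOrdinaryCategory V M] {X Y : M} (g : X ⟶ Y) :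
    eId V X ≫ eHomWhiskerLeft V X g = eId V Y ≫ eHomWhiskerRight V g Y := by
  have h1 := gcomp_eHomEquiv (eId V X) g
  have h2 := eHomEquiv_gcomp g (eId V Y)
  rw [id_gcomp] at h1
  rw [gcomp_id, ← unitors_equal, h1] at h2
  rw [unitors_equal] at h2
  exact (cancel_epi _).1 h2

section Diagrams

variable {V : Type u₁} [Category.{v} V] [MonoidalCategory V] [SymmetricCategory V]
  [MonoidalClosed V] {D : Type v} [EnrichedCategory V D]
  {M : Type u₂} [Category.{v} M] [EnrichedOrdinaryCategory V M]

namespace Diagram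

section Colimits

variable {J : Type*} [Category* J] [HasColimitsOfShape J M] (K : J ⥤ Diagram V D M)

/-- The objectwise colimit. -/
def colimObj (d : D) : M := colimit (K ⋙ ev V M d)

/-- The coprojections of the objectwise colimit. -/
def colimι (j : J) (d : D) : (K.obj j).val d ⟶ colimObj K d := colimit.ι (K ⋙ ev V M d) j

lemma colimι_w {j j' : J} (f : j ⟶ j') (d : D) :
    Hom.app (K.map f) d ≫ colimι K j' d = colimι K j d :=
  colimit.w (K ⋙ ev V M d) f

/-- Morphisms out of the objectwise colimit. -/
def colimDesc {d : D} {Y : M} (φ : ∀ j, (K.obj j).val d ⟶ Y)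
    (h : ∀ {j j'} (f : j ⟶ j'), Hom.app (K.map f) d ≫ φ j' = φ j) : colimObj K d ⟶ Y :=
  colimit.desc (K ⋙ ev V M d) (Cocone.mk Y
    { app := φ
      naturality := fun _ _ f => (h f).trans (Category.comp_id _).symm })

lemma colimDesc_fac {d : D} {Y : M} (φ : ∀ j, (K.obj j).val d ⟶ Y)
    (h : ∀ {j j'} (f : j ⟶ j'), Hom.app (K.map f) d ≫ φ j' = φ j) (j : J) :
    colimι K j d ≫ colimDesc K φ h = φ j :=
  colimit.ι_desc _ _

lemma colimObj_ext {d : D} {Y : M} {f g : colimObj K d ⟶ Y}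
    (h : ∀ j, colimι K j d ≫ f = colimι K j d ≫ g) : f = g :=
  colimit.hom_ext h

variable [Cotensored V M]

lemma colimObj_ehom_ext {d : D} {A : V} {Y : M} {u u' : A ⟶ (colimObj K d ⟶[V] Y)}
    (h : ∀ j, u ≫ eHomWhiskerRight V (colimι K j d) Y =
      u' ≫ eHomWhiskerRight V (colimι K j d) Y) : u = u' :=
  colim_hom_ext (colimit.isColimit (K ⋙ ev V M d)) h

lemma colimι_whisker {j j' : J} (f : j ⟶ j') (d d' : D) :
    ((K.obj j').act d d' ≫ eHomWhiskerLeft V ((K.obj j').val d) (colimι K j' d')) ≫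
        eHomWhiskerRight V (Hom.app (K.map f) d) _ =
      (K.obj j).act d d' ≫ eHomWhiskerLeft V ((K.obj j).val d) (colimι K j d') := by
  rw [Category.assoc, eHom_whisker_exchange, ← reassoc_of% (naturality (K.map f) d d'),
    ← eHomWhiskerLeft_comp, colimι_w]

/-- The action on hom-objects of an objectwise colimit. -/
def colimAct (d d' : D) : (d ⟶[V] d') ⟶ (colimObj K d ⟶[V] colimObj K d') :=
  colimLift (colimit.isColimit (K ⋙ ev V M d))
    (fun j => (K.obj j).act d d' ≫ eHomWhiskerLeft V ((K.obj j).val d) (colimι K j d'))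
    (fun f => colimι_whisker K f d d')

lemma colimAct_fac (j : J) (d d' : D) :
    colimAct K d d' ≫ eHomWhiskerRight V (colimι K j d) _ =
      (K.obj j).act d d' ≫ eHomWhiskerLeft V ((K.obj j).val d) (colimι K j d') :=
  colimLift_fac (colimit.isColimit (K ⋙ ev V M d)) _ _ j

/-- The objectwise colimit of diagrams. -/
def colim : Diagram V D M where
  toFun :=
    { obj := fun d => colimObj K d
      map := fun d d' => colimAct K d d'
      map_id := fun d => colimObj_ehom_ext K fun j => by
        rw [Category.assoc, colimAct_fac, ← Category.assoc, act_id, eId_whisker]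
      map_comp := fun d d' d'' => colimObj_ehom_ext K fun j => by
        change _ = (colimAct K d d' ⋆ colimAct K d' d'') ≫ _
        rw [gcomp_whiskerRight, Category.assoc, colimAct_fac, colimAct_fac, whiskerLeft_gcomp,
          colimAct_fac, ← gcomp_whiskerLeft, ← act_comp, Category.assoc] }

/-- The objectwise colimit cocone. -/
def colimCocone : Cocone K where
  pt := colim K
  ι :=
    { app := fun j => { app := fun d => colimι K j d
                        naturality := fun d d' => (colimAct_fac K j d d').symm }
      naturality := fun j j' f => hom_ext fun d => by
        refine (colimι_w K f d).trans ?_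
        exact (Category.comp_id _).symm }

lemma colimDesc_naturality {G : Diagram V D M} (φ : ∀ j, K.obj j ⟶ G)
    (h : ∀ {j j'} (f : j ⟶ j') (d : D), Hom.app (K.map f) d ≫ Hom.app (φ j') d = Hom.app (φ j) d)
    (d d' : D) :
    colimAct K d d' ≫ eHomWhiskerLeft V _ (colimDesc K (fun j => Hom.app (φ j) d')
      (fun f => h f d')) =
    G.act d d' ≫ eHomWhiskerRight V (colimDesc K (fun j => Hom.app (φ j) d) (fun f => h f d)) _ :=
  colimObj_ehom_ext K fun j => by
    have e := colimAct_fac K j d d'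
    rw [Category.assoc, eHom_whisker_exchange, Category.assoc, ← eHomWhiskerRight_comp,
      colimDesc_fac, reassoc_of% e, ← eHomWhiskerLeft_comp, colimDesc_fac, naturality]

/-- The objectwise colimit cocone is a colimit cocone. -/
def colimIsColimit : IsColimit (colimCocone K) where
  desc s :=
    { app := fun d => colimDesc K (fun j => Hom.app (s.ι.app j) d)
        (fun f => congrArg (fun k => Hom.app k d) (s.w f))
      naturality := fun d d' => colimDesc_naturality K (fun j => s.ι.app j)
        (fun f d => congrArg (fun k => Hom.app k d) (s.w f)) d d' }
  fac s j := hom_ext fun d => colimDesc_fac K _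
    (fun f => congrArg (fun k => Hom.app k d) (s.w f)) j
  uniq s m h := hom_ext fun d => colimObj_ext K fun j => by
    change colimι K j d ≫ Hom.app m d = colimι K j d ≫ colimDesc K
      (fun j => Hom.app (s.ι.app j) d) (fun f => congrArg (fun k => Hom.app k d) (s.w f))
    rw [colimDesc_fac]
    exact congrArg (fun k => Hom.app k d) (h j)

instance : HasColimitsOfShape J (Diagram V D M) where
  has_colimit K := ⟨⟨⟨colimCocone K, colimIsColimit K⟩⟩⟩

end Colimits

universe w₁ w₂

instance [Cotensored V M] [HasColimitsOfSize.{w₁, w₂} M] :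
    HasColimitsOfSize.{w₁, w₂} (Diagram V D M) where

section Limits

variable {J : Type*} [Category* J] [HasLimitsOfShape J M] (K : J ⥤ Diagram V D M)

/-- The objectwise limit. -/
def limObj (d : D) : M := limit (K ⋙ ev V M d)

/-- The projections of the objectwise limit. -/
def limπ (j : J) (d : D) : limObj K d ⟶ (K.obj j).val d := limit.π (K ⋙ ev V M d) j

lemma limπ_w {j j' : J} (f : j ⟶ j') (d : D) :
    limπ K j d ≫ Hom.app (K.map f) d = limπ K j' d :=
  limit.w (K ⋙ ev V M d) f

/-- Morphisms into the objectwise limit. -/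
def limLift' {d : D} {Y : M} (φ : ∀ j, Y ⟶ (K.obj j).val d)
    (h : ∀ {j j'} (f : j ⟶ j'), φ j ≫ Hom.app (K.map f) d = φ j') : Y ⟶ limObj K d :=
  limit.lift (K ⋙ ev V M d) (Cone.mk Y
    { app := φ
      naturality := fun _ _ f => (Category.id_comp _).trans (h f).symm })

lemma limLift'_fac {d : D} {Y : M} (φ : ∀ j, Y ⟶ (K.obj j).val d)
    (h : ∀ {j j'} (f : j ⟶ j'), φ j ≫ Hom.app (K.map f) d = φ j') (j : J) :
    limLift' K φ h ≫ limπ K j d = φ j :=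
  limit.lift_π _ _

lemma limObj_ext {d : D} {Y : M} {f g : Y ⟶ limObj K d}
    (h : ∀ j, f ≫ limπ K j d = g ≫ limπ K j d) : f = g :=
  limit.hom_ext h

variable [Tensored V M]

lemma limObj_ehom_ext {d : D} {A : V} {Y : M} {u u' : A ⟶ (Y ⟶[V] limObj K d)}
    (h : ∀ j, u ≫ eHomWhiskerLeft V Y (limπ K j d) = u' ≫ eHomWhiskerLeft V Y (limπ K j d)) :
    u = u' :=
  lim_hom_ext (limit.isLimit (K ⋙ ev V M d)) h

lemma limπ_whisker {j j' : J} (f : j ⟶ j') (d d' : D) :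
    ((K.obj j).act d d' ≫ eHomWhiskerRight V (limπ K j d) ((K.obj j).val d')) ≫
        eHomWhiskerLeft V _ (Hom.app (K.map f) d') =
      (K.obj j').act d d' ≫ eHomWhiskerRight V (limπ K j' d) ((K.obj j').val d') := by
  rw [Category.assoc, ← eHom_whisker_exchange, reassoc_of% (naturality (K.map f) d d'),
    ← eHomWhiskerRight_comp, limπ_w]

/-- The action on hom-objects of an objectwise limit. -/
def limAct (d d' : D) : (d ⟶[V] d') ⟶ (limObj K d ⟶[V] limObj K d') :=
  limLift (limit.isLimit (K ⋙ ev V M d'))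
    (fun j => (K.obj j).act d d' ≫ eHomWhiskerRight V (limπ K j d) ((K.obj j).val d'))
    (fun f => limπ_whisker K f d d')

lemma limAct_fac (j : J) (d d' : D) :
    limAct K d d' ≫ eHomWhiskerLeft V _ (limπ K j d') =
      (K.obj j).act d d' ≫ eHomWhiskerRight V (limπ K j d) ((K.obj j).val d') :=
  limLift_fac (limit.isLimit (K ⋙ ev V M d')) _ _ j

/-- The objectwise limit of diagrams. -/
def lim : Diagram V D M where
  toFun :=
    { obj := fun d => limObj K d
      map := fun d d' => limAct K d d'
      map_id := fun d => limObj_ehom_ext K fun j => by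
        rw [Category.assoc, limAct_fac, ← Category.assoc, act_id, eId_whisker]
      map_comp := fun d d' d'' => limObj_ehom_ext K fun j => by
        change _ = (limAct K d d' ⋆ limAct K d' d'') ≫ _
        rw [gcomp_whiskerLeft, Category.assoc, limAct_fac, limAct_fac, ← whiskerLeft_gcomp,
          limAct_fac, ← gcomp_whiskerRight, ← act_comp, Category.assoc] }

/-- The objectwise limit cone. -/
def limCone : Cone K where
  pt := lim K
  π :=
    { app := fun j => { app := fun d => limπ K j d
                        naturality := fun d d' => limAct_fac K j d d' }
      naturality := fun j j' f => hom_ext fun d => by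
        refine Eq.trans ?_ (limπ_w K f d).symm
        exact Category.id_comp _ }

lemma limLift'_naturality {G : Diagram V D M} (φ : ∀ j, G ⟶ K.obj j)
    (h : ∀ {j j'} (f : j ⟶ j') (d : D), Hom.app (φ j) d ≫ Hom.app (K.map f) d = Hom.app (φ j') d)
    (d d' : D) :
    G.act d d' ≫ eHomWhiskerLeft V _ (limLift' K (fun j => Hom.app (φ j) d')
      (fun f => h f d')) =
    limAct K d d' ≫ eHomWhiskerRight V (limLift' K (fun j => Hom.app (φ j) d)
      (fun f => h f d)) _ :=
  limObj_ehom_ext K fun j => by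
    have e := limAct_fac K j d d'
    rw [Category.assoc, ← eHomWhiskerLeft_comp, limLift'_fac, Category.assoc,
      ← eHom_whisker_exchange, reassoc_of% e, ← eHomWhiskerRight_comp, limLift'_fac, naturality]

/-- The objectwise limit cone is a limit cone. -/
def limIsLimit : IsLimit (limCone K) where
  lift s :=
    { app := fun d => limLift' K (fun j => Hom.app (s.π.app j) d)
        (fun f => congrArg (fun k => Hom.app k d) (s.w f))
      naturality := fun d d' => limLift'_naturality K (fun j => s.π.app j)
        (fun f d => congrArg (fun k => Hom.app k d) (s.w f)) d d' }
  fac s j := hom_ext fun d => limLift'_fac K _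
    (fun f => congrArg (fun k => Hom.app k d) (s.w f)) j
  uniq s m h := hom_ext fun d => limObj_ext K fun j => by
    change Hom.app m d ≫ limπ K j d = limLift' K (fun j => Hom.app (s.π.app j) d)
      (fun f => congrArg (fun k => Hom.app k d) (s.w f)) ≫ limπ K j d
    rw [limLift'_fac]
    exact congrArg (fun k => Hom.app k d) (h j)

instance : HasLimitsOfShape J (Diagram V D M) where
  has_limit K := ⟨⟨⟨limCone K, limIsLimit K⟩⟩⟩

end Limits

instance [Tensored V M] [HasLimitsOfSize.{w₁, w₂} M] :
    HasLimitsOfSize.{w₁, w₂} (Diagram V D M) where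

end Diagram

end Diagrams

section Diagrams

variable {V : Type u₁} [Category.{v} V] [MonoidalCategory V] [SymmetricCategory V]
  [MonoidalClosed V] {D : Type v} [EnrichedCategory V D]
  {M : Type u₂} [Category.{v} M] [EnrichedOrdinaryCategory V M]

lemma eHomEquiv_comp_right {X Y Z : M} (f : X ⟶ Y) (g : Y ⟶ Z) :
    eHomEquiv V (f ≫ g) = eHomEquiv V g ≫ eHomWhiskerRight V f Z := by
  have := eHomEquiv_gcomp f (eHomEquiv V g)
  rw [gcomp] at this
  rw [eHomEquiv_comp, this, Iso.inv_hom_id_assoc]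

lemma eHomEquiv_comp_left {X Y Z : M} (f : X ⟶ Y) (g : Y ⟶ Z) :
    eHomEquiv V (f ≫ g) = eHomEquiv V f ≫ eHomWhiskerLeft V X g := by
  have := gcomp_eHomEquiv (eHomEquiv V f) g
  rw [gcomp, ← unitors_equal] at this
  rw [eHomEquiv_comp, this, Iso.inv_hom_id_assoc]

namespace Diagram

section Free

variable [Tensored V M]

variable (V) in
/-- The action on hom-objects of the diagram `d ↦ D(b, d) ⊙ X`. -/
def freeAct (b : D) (X : M) (d d' : D) :
    (d ⟶[V] d') ⟶ (tobj V (b ⟶[V] d) X ⟶[V] tobj V (b ⟶[V] d') X) :=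
  tlift (eComp V b d d' ≫ tcoev V (b ⟶[V] d') X)

lemma tcoev_freeAct (b : D) (X : M) (d d' : D) :
    tcoev V (b ⟶[V] d) X ⋆ freeAct V b X d d' = eComp V b d d' ≫ tcoev V (b ⟶[V] d') X :=
  tcoev_gcomp_tlift _

variable (V) in
/-- The diagram `d ↦ D(b, d) ⊙ X`. -/
def free (b : D) (X : M) : Diagram V D M where
  toFun :=
    { obj := fun d => tobj V (b ⟶[V] d) X
      map := fun d d' => freeAct V b X d d'
      map_id := fun d => tensor_hom_ext (by
        change tcoev V (b ⟶[V] d) X ⋆ _ = tcoev V (b ⟶[V] d) X ⋆ _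
        have e := e_comp_id V b d
        rw [Iso.inv_comp_eq, Category.comp_id] at e
        rw [gcomp_comp_right, tcoev_freeAct, reassoc_of% e, gcomp_id])
      map_comp := fun d d' d'' => tensor_hom_ext (by
        change tcoev V (b ⟶[V] d) X ⋆ _ =
          tcoev V (b ⟶[V] d) X ⋆ (freeAct V b X d d' ⋆ freeAct V b X d' d'')
        have e := e_assoc V b d d' d''
        rw [gcomp_comp_right, tcoev_freeAct, gcomp_assoc', tcoev_freeAct, gcomp_comp_left,
          tcoev_freeAct, reassoc_of% e]) }

variable (V) in
/-- The unit `D(b, d) ⟶ M(X, D(b, d) ⊙ X)`. -/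
def freeUnit (b : D) (X : M) (d : D) : (b ⟶[V] d) ⟶ (X ⟶[V] (free V b X).val d) :=
  tcoev V (b ⟶[V] d) X

/-- The morphism `A ⟶ M(D(b, d) ⊙ X, Y)` corresponding to `D(b, d) ⊗ A ⟶ M(X, Y)`. -/
def freeLift {b : D} {X : M} {d : D} {A : V} {Y : M} (f : (b ⟶[V] d) ⊗ A ⟶ (X ⟶[V] Y)) :
    A ⟶ ((free V b X).val d ⟶[V] Y) :=
  tlift f

lemma freeUnit_lift {b : D} {X : M} {d : D} {A : V} {Y : M}
    (f : (b ⟶[V] d) ⊗ A ⟶ (X ⟶[V] Y)) : freeUnit V b X d ⋆ freeLift f = f :=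
  tcoev_gcomp_tlift f

lemma freeUnit_ext {b : D} {X : M} {d : D} {A : V} {Y : M}
    {u u' : A ⟶ ((free V b X).val d ⟶[V] Y)}
    (h : freeUnit V b X d ⋆ u = freeUnit V b X d ⋆ u') : u = u' :=
  tensor_hom_ext h

lemma freeUnit_act (b : D) (X : M) (d d' : D) :
    freeUnit V b X d ⋆ (free V b X).act d d' = eComp V b d d' ≫ freeUnit V b X d' :=
  tcoev_freeAct b X d d'

variable (V) in
/-- The element of `(D(b, -) ⊙ X)(b)` given by the identity of `b`. -/
def freeη (b : D) (X : M) : X ⟶ (free V b X).val b :=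
  (eHomEquiv V).symm (eId V b ≫ freeUnit V b X b)

lemma eHomEquiv_freeη (b : D) (X : M) :
    eHomEquiv V (freeη V b X) = eId V b ≫ freeUnit V b X b :=
  Equiv.apply_symm_apply _ _

lemma freeη_act (b : D) (X : M) (d : D) :
    eHomEquiv V (freeη V b X) ⋆ (free V b X).act b d = (λ_ _).hom ≫ freeUnit V b X d := by
  have e := e_id_comp V b d
  rw [Iso.inv_comp_eq, Category.comp_id] at e
  rw [eHomEquiv_freeη, gcomp_comp_left, freeUnit_act, reassoc_of% e]

variable [HasLimits V]

/-- The Yoneda morphism `M^D(D(b, -) ⊙ X, F) ⟶ M(X, F b)`. -/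
def freeYoneda (b : D) (X : M) (F : Diagram V D M) : (free V b X ⟶[V] F) ⟶ (X ⟶[V] F.val b) :=
  homπ (free V b X) F b ≫ eHomWhiskerRight V (freeη V b X) (F.val b)

lemma comp_freeYoneda {b : D} {X : M} {F : Diagram V D M} {A : V} (u : A ⟶ (free V b X ⟶[V] F)) :
    u ≫ freeYoneda b X F =
      (λ_ A).inv ≫ (eHomEquiv V (freeη V b X) ⋆ (u ≫ homπ (free V b X) F b)) := by
  rw [eHomEquiv_gcomp, Iso.inv_hom_id_assoc, freeYoneda, Category.assoc]

lemma freeUnit_gcomp {b : D} {X : M} {F : Diagram V D M} {A : V} (u : A ⟶ (free V b X ⟶[V] F))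
    (d : D) : freeUnit V b X d ⋆ (u ≫ homπ (free V b X) F d) =
      (β_ (b ⟶[V] d) A).hom ≫ ((u ≫ freeYoneda b X F) ⋆ F.act b d) := by
  have e := (isNat_homπ (free V b X) F).comp u b d
  dsimp only at e
  have e' := congrArg (fun k => (β_ A (b ⟶[V] d)).hom ≫ k) e
  simp only [SymmetricCategory.symmetry_assoc] at e'
  rw [comp_freeYoneda, gcomp_comp_left, gcomp_assoc, ← e',
    gcomp_comp_right (β_ A (b ⟶[V] d)).hom, gcomp_assoc',
    freeη_act, gcomp_comp_left]
  simp

/-- The inverse of the Yoneda morphism on generalized elements. -/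
def freeYonedaInv {b : D} {X : M} {F : Diagram V D M} {A : V} (x : A ⟶ (X ⟶[V] F.val b)) :
    A ⟶ (free V b X ⟶[V] F) :=
  homLift (F := free V b X) (G := F)
    (fun d => freeLift ((β_ (b ⟶[V] d) A).hom ≫ (x ⋆ F.act b d)))
    (by
      intro d d'
      apply freeUnit_ext
      rw [gcomp_assoc', freeUnit_act, gcomp_comp_left, freeUnit_lift,
        gcomp_comp_right _ (freeUnit V b X d), gcomp_assoc', freeUnit_lift, gcomp_comp_left,
        gcomp_assoc, ← F.act_comp, gcomp_comp_right,
        BraidedCategory.braiding_naturality_left_assoc, BraidedCategory.braiding_tensor_left_hom]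
      simp)

lemma freeYonedaInv_π {b : D} {X : M} {F : Diagram V D M} {A : V} (x : A ⟶ (X ⟶[V] F.val b))
    (d : D) : freeYonedaInv x ≫ homπ (free V b X) F d =
      freeLift ((β_ (b ⟶[V] d) A).hom ≫ (x ⋆ F.act b d)) :=
  homLift_π (F := free V b X) (G := F) _ _ d

lemma freeYonedaInv_yoneda {b : D} {X : M} {F : Diagram V D M} {A : V}
    (x : A ⟶ (X ⟶[V] F.val b)) : freeYonedaInv x ≫ freeYoneda b X F = x := by
  rw [comp_freeYoneda, freeYonedaInv_π, eHomEquiv_freeη, gcomp_comp_left, freeUnit_lift,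
    BraidedCategory.braiding_naturality_left_assoc, ← gcomp_comp_right, F.act_id, gcomp_id,
    braiding_rightUnitor_assoc, Iso.inv_hom_id_assoc]

lemma freeYoneda_ext {b : D} {X : M} {F : Diagram V D M} {A : V}
    {u u' : A ⟶ (free V b X ⟶[V] F)} (h : u ≫ freeYoneda b X F = u' ≫ freeYoneda b X F) :
    u = u' := by
  apply homObj_ext
  intro d
  apply freeUnit_ext
  rw [freeUnit_gcomp, freeUnit_gcomp, h]

/-- The enriched Yoneda isomorphism `M^D(D(b, -) ⊙ X, F) ≅ M(X, F b)`. -/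
def freeYonedaIso (b : D) (X : M) (F : Diagram V D M) : (free V b X ⟶[V] F) ≅ (X ⟶[V] F.val b) where
  hom := freeYoneda b X F
  inv := freeYonedaInv (𝟙 _)
  hom_inv_id := freeYoneda_ext (by
    rw [Category.assoc, freeYonedaInv_yoneda, Category.comp_id, Category.id_comp])
  inv_hom_id := freeYonedaInv_yoneda _

/-- Morphisms `D(b, -) ⊙ X ⟶ F` are morphisms `X ⟶ F b`. -/
def freeHomEquiv (b : D) (X : M) (F : Diagram V D M) : (free V b X ⟶ F) ≃ (X ⟶ F.val b) where
  toFun h := freeη V b X ≫ Hom.app h b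
  invFun x := (eHomEquiv V).symm (freeYonedaInv (eHomEquiv V x))
  left_inv h := (eHomEquiv V).injective (freeYoneda_ext (by
    rw [Equiv.apply_symm_apply, freeYonedaInv_yoneda, eHomEquiv_comp_right, freeYoneda,
      ← eHomEquiv_π, Category.assoc]))
  right_inv x := (eHomEquiv V).injective (by
    rw [eHomEquiv_comp_right, ← eHomEquiv_π, Category.assoc]
    change _ ≫ freeYoneda b X F = _
    rw [Equiv.apply_symm_apply, freeYonedaInv_yoneda])

lemma freeHomEquiv_naturality (b : D) {X : M} {F F' : Diagram V D M} (k : F ⟶ F')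
    (h : free V b X ⟶ F) : freeHomEquiv b X F' (h ≫ k) = freeHomEquiv b X F h ≫ Hom.app k b :=
  (Category.assoc _ _ _).symm

variable (V M) in
/-- The functor `X ↦ D(b, -) ⊙ X`. -/
def freeFunctor (b : D) : M ⥤ Diagram V D M :=
  Adjunction.leftAdjointOfEquiv (G := ev V M b) (F_obj := fun X => free V b X)
    (fun X F => freeHomEquiv b X F) (fun _ _ _ k h => freeHomEquiv_naturality b k h)

variable (V M) in
/-- The functor `X ↦ D(b, -) ⊙ X` is left adjoint to evaluation at `b`. -/
def freeAdj (b : D) : freeFunctor V M b ⊣ ev V M b :=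
  Adjunction.adjunctionOfEquivLeft (G := ev V M b) (F_obj := fun X => free V b X)
    (fun X F => freeHomEquiv b X F) (fun _ _ _ k h => freeHomEquiv_naturality b k h)

end Free

section Cofree

variable [Cotensored V M]

variable (V) in
/-- The action on hom-objects of the diagram `d ↦ {D(d, b), X}`. -/
def cofreeAct (b : D) (X : M) (d d' : D) :
    (d ⟶[V] d') ⟶ (cobj V (d ⟶[V] b) X ⟶[V] cobj V (d' ⟶[V] b) X) :=
  clift (eComp V d d' b ≫ cev V (d ⟶[V] b) X)

lemma cofreeAct_cev (b : D) (X : M) (d d' : D) :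
    cofreeAct V b X d d' ⋆ cev V (d' ⟶[V] b) X = eComp V d d' b ≫ cev V (d ⟶[V] b) X :=
  clift_gcomp_cev _

variable (V) in
/-- The diagram `d ↦ {D(d, b), X}`. -/
def cofree (b : D) (X : M) : Diagram V D M where
  toFun :=
    { obj := fun d => cobj V (d ⟶[V] b) X
      map := fun d d' => cofreeAct V b X d d'
      map_id := fun d => cotensor_hom_ext (by
        change _ ⋆ cev V (d ⟶[V] b) X = _ ⋆ cev V (d ⟶[V] b) X
        have e := e_id_comp V d b
        rw [Iso.inv_comp_eq, Category.comp_id] at e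
        rw [gcomp_comp_left, cofreeAct_cev, reassoc_of% e, id_gcomp])
      map_comp := fun d d' d'' => cotensor_hom_ext (by
        change _ ⋆ cev V (d'' ⟶[V] b) X =
          (cofreeAct V b X d d' ⋆ cofreeAct V b X d' d'') ⋆ cev V (d'' ⟶[V] b) X
        have e := e_assoc V d d' d'' b
        rw [Iso.inv_comp_eq] at e
        rw [gcomp_comp_left, cofreeAct_cev, gcomp_assoc, cofreeAct_cev, gcomp_comp_right,
          cofreeAct_cev, reassoc_of% e]) }

variable (V) in
/-- The counit `D(d, b) ⟶ M({D(d, b), X}, X)`. -/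
def cofreeCounit (b : D) (X : M) (d : D) : (d ⟶[V] b) ⟶ ((cofree V b X).val d ⟶[V] X) :=
  cev V (d ⟶[V] b) X

/-- The morphism `A ⟶ M(Y, {D(d, b), X})` corresponding to `A ⊗ D(d, b) ⟶ M(Y, X)`. -/
def cofreeLift {b : D} {X : M} {d : D} {A : V} {Y : M} (f : A ⊗ (d ⟶[V] b) ⟶ (Y ⟶[V] X)) :
    A ⟶ (Y ⟶[V] (cofree V b X).val d) :=
  clift f

lemma cofreeLift_counit {b : D} {X : M} {d : D} {A : V} {Y : M}
    (f : A ⊗ (d ⟶[V] b) ⟶ (Y ⟶[V] X)) : cofreeLift f ⋆ cofreeCounit V b X d = f :=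
  clift_gcomp_cev f

lemma cofreeCounit_ext {b : D} {X : M} {d : D} {A : V} {Y : M}
    {u u' : A ⟶ (Y ⟶[V] (cofree V b X).val d)}
    (h : u ⋆ cofreeCounit V b X d = u' ⋆ cofreeCounit V b X d) : u = u' :=
  cotensor_hom_ext h

lemma act_cofreeCounit (b : D) (X : M) (d d' : D) :
    (cofree V b X).act d d' ⋆ cofreeCounit V b X d' = eComp V d d' b ≫ cofreeCounit V b X d :=
  cofreeAct_cev b X d d'

variable (V) in
/-- The projection `{D(b, b), X} ⟶ X` given by the identity of `b`. -/
def cofreeε (b : D) (X : M) : (cofree V b X).val b ⟶ X :=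
  (eHomEquiv V).symm (eId V b ≫ cofreeCounit V b X b)

lemma eHomEquiv_cofreeε (b : D) (X : M) :
    eHomEquiv V (cofreeε V b X) = eId V b ≫ cofreeCounit V b X b :=
  Equiv.apply_symm_apply _ _

lemma act_cofreeε (b : D) (X : M) (d : D) :
    (cofree V b X).act d b ⋆ eHomEquiv V (cofreeε V b X) =
      (ρ_ _).hom ≫ cofreeCounit V b X d := by
  have e := e_comp_id V d b
  rw [Iso.inv_comp_eq, Category.comp_id] at e
  rw [eHomEquiv_cofreeε, gcomp_comp_right, act_cofreeCounit, reassoc_of% e]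

variable [HasLimits V]

/-- The Yoneda morphism `M^D(F, {D(-, b), X}) ⟶ M(F b, X)`. -/
def cofreeYoneda (b : D) (X : M) (F : Diagram V D M) : (F ⟶[V] cofree V b X) ⟶ (F.val b ⟶[V] X) :=
  homπ F (cofree V b X) b ≫ eHomWhiskerLeft V (F.val b) (cofreeε V b X)

lemma comp_cofreeYoneda {b : D} {X : M} {F : Diagram V D M} {A : V}
    (u : A ⟶ (F ⟶[V] cofree V b X)) : u ≫ cofreeYoneda b X F =
      (ρ_ A).inv ≫ ((u ≫ homπ F (cofree V b X) b) ⋆ eHomEquiv V (cofreeε V b X)) := by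
  rw [gcomp_eHomEquiv, Iso.inv_hom_id_assoc, cofreeYoneda, Category.assoc]

lemma gcomp_cofreeCounit {b : D} {X : M} {F : Diagram V D M} {A : V}
    (u : A ⟶ (F ⟶[V] cofree V b X)) (d : D) : (u ≫ homπ F (cofree V b X) d) ⋆ cofreeCounit V b X d =
      (β_ A (d ⟶[V] b)).hom ≫ (F.act d b ⋆ (u ≫ cofreeYoneda b X F)) := by
  have e := (isNat_homπ F (cofree V b X)).comp u d b
  dsimp only at e
  rw [comp_cofreeYoneda, gcomp_comp_right, gcomp_assoc', e,
    gcomp_comp_left (β_ (d ⟶[V] b) A).hom, gcomp_assoc,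
    act_cofreeε, gcomp_comp_right]
  simp

/-- The inverse of the Yoneda morphism on generalized elements. -/
def cofreeYonedaInv {b : D} {X : M} {F : Diagram V D M} {A : V} (x : A ⟶ (F.val b ⟶[V] X)) :
    A ⟶ (F ⟶[V] cofree V b X) :=
  homLift (F := F) (G := cofree V b X)
    (fun d => cofreeLift ((β_ A (d ⟶[V] b)).hom ≫ (F.act d b ⋆ x)))
    (by
      intro d d'
      apply cofreeCounit_ext
      rw [gcomp_assoc, cofreeLift_counit, gcomp_comp_right, gcomp_assoc', ← F.act_comp,
        gcomp_comp_left _ (_ ⋆ (cofree V b X).act d d'), gcomp_assoc, act_cofreeCounit,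
        gcomp_comp_right, cofreeLift_counit, gcomp_comp_left,
        BraidedCategory.braiding_naturality_right_assoc,
        BraidedCategory.braiding_tensor_right_hom]
      simp only [Category.assoc]
      rw [Iso.hom_inv_id_assoc,
        ← comp_whiskerRight_assoc (β_ (d ⟶[V] d') A).hom (β_ A (d ⟶[V] d')).hom,
        SymmetricCategory.symmetry]
      simp)

lemma cofreeYonedaInv_π {b : D} {X : M} {F : Diagram V D M} {A : V} (x : A ⟶ (F.val b ⟶[V] X))
    (d : D) : cofreeYonedaInv x ≫ homπ F (cofree V b X) d =
      cofreeLift ((β_ A (d ⟶[V] b)).hom ≫ (F.act d b ⋆ x)) :=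
  homLift_π (F := F) (G := cofree V b X) _ _ d

lemma cofreeYonedaInv_yoneda {b : D} {X : M} {F : Diagram V D M} {A : V}
    (x : A ⟶ (F.val b ⟶[V] X)) : cofreeYonedaInv x ≫ cofreeYoneda b X F = x := by
  rw [comp_cofreeYoneda, cofreeYonedaInv_π, eHomEquiv_cofreeε, gcomp_comp_right,
    cofreeLift_counit, BraidedCategory.braiding_naturality_right_assoc, ← gcomp_comp_left,
    F.act_id, id_gcomp, braiding_leftUnitor_assoc, Iso.inv_hom_id_assoc]

lemma cofreeYoneda_ext {b : D} {X : M} {F : Diagram V D M} {A : V}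
    {u u' : A ⟶ (F ⟶[V] cofree V b X)}
    (h : u ≫ cofreeYoneda b X F = u' ≫ cofreeYoneda b X F) : u = u' := by
  apply homObj_ext
  intro d
  apply cofreeCounit_ext
  rw [gcomp_cofreeCounit, gcomp_cofreeCounit, h]

/-- Morphisms `F b ⟶ X` are morphisms `F ⟶ {D(-, b), X}`. -/
def cofreeHomEquiv (b : D) (F : Diagram V D M) (X : M) : (F.val b ⟶ X) ≃ (F ⟶ cofree V b X) where
  toFun x := (eHomEquiv V).symm (cofreeYonedaInv (eHomEquiv V x))
  invFun h := Hom.app h b ≫ cofreeε V b X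
  right_inv h := (eHomEquiv V).injective (cofreeYoneda_ext (by
    rw [Equiv.apply_symm_apply, cofreeYonedaInv_yoneda, eHomEquiv_comp_left, cofreeYoneda,
      ← eHomEquiv_π, Category.assoc]))
  left_inv x := (eHomEquiv V).injective (by
    rw [eHomEquiv_comp_left, ← eHomEquiv_π, Category.assoc]
    change _ ≫ cofreeYoneda b X F = _
    rw [Equiv.apply_symm_apply, cofreeYonedaInv_yoneda])

lemma cofreeHomEquiv_naturality (b : D) {F F' : Diagram V D M} {X : M} (h : F' ⟶ F)
    (x : F.val b ⟶ X) :
    cofreeHomEquiv b F' X (Hom.app h b ≫ x) = h ≫ cofreeHomEquiv b F X x := by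
  apply (cofreeHomEquiv b F' X).symm.injective
  rw [Equiv.symm_apply_apply]
  change _ = (Hom.app h b ≫ Hom.app _ b) ≫ cofreeε V b X
  rw [Category.assoc]
  exact congrArg (fun k => Hom.app h b ≫ k) ((cofreeHomEquiv b F X).symm_apply_apply x).symm

variable (V M) in
/-- The functor `X ↦ {D(-, b), X}`. -/
def cofreeFunctor (b : D) : M ⥤ Diagram V D M :=
  Adjunction.rightAdjointOfEquiv (F := ev V M b) (G_obj := fun X => cofree V b X)
    (fun F X => cofreeHomEquiv b F X) (fun _ _ _ h x => cofreeHomEquiv_naturality b h x)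

variable (V M) in
/-- The functor `X ↦ {D(-, b), X}` is right adjoint to evaluation at `b`. -/
def cofreeAdj (b : D) : ev V M b ⊣ cofreeFunctor V M b :=
  Adjunction.adjunctionOfEquivRight (F := ev V M b) (G_obj := fun X => cofree V b X)
    (fun F X => cofreeHomEquiv b F X) (fun _ _ _ h x => cofreeHomEquiv_naturality b h x)

end Cofree

end Diagram

end Diagrams

section Bar

variable {I : Type*} {C : Type*} [Category* C] (G : I → Comonad C)

lemma succ_mono (f : ℕ →o ℕ) {j k : ℕ} (h : j ≤ k) : f j + 1 ≤ f k + 1 :=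
  Nat.succ_le_succ (f.monotone h)

/-- The composites `G_{a (n - 1)} ∘ ⋯ ∘ G_{a 0}`. -/
def word (a : ℕ → I) : ℕ → C ⥤ C
  | 0 => 𝟭 C
  | n + 1 => word a n ⋙ (G (a n)).toFunctor

/-- The counit forgets the last comonad. -/
def wordε (a : ℕ → I) (n : ℕ) : word G a (n + 1) ⟶ word G a n where
  app X := (G (a n)).ε.app ((word G a n).obj X)
  naturality _ _ f := (G (a n)).ε.naturality ((word G a n).map f)

/-- The counits forget the last `j - i` comonads. -/
def skip (a : ℕ → I) {i j : ℕ} (h : i ≤ j) : word G a j ⟶ word G a i :=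
  (Functor.ofOpSequence (wordε G a)).map (homOfLE h).op

lemma skip_self (a : ℕ → I) {i : ℕ} (h : i ≤ i) : skip G a h = 𝟙 _ :=
  (Functor.ofOpSequence (wordε G a)).map_id _

lemma skip_comp (a : ℕ → I) {i j k : ℕ} (h : i ≤ j) (h' : j ≤ k) :
    skip G a h' ≫ skip G a h = skip G a (h.trans h') :=
  ((Functor.ofOpSequence (wordε G a)).map_comp _ _).symm

lemma skip_succ (a : ℕ → I) (n : ℕ) (h : n ≤ n + 1) : skip G a h = wordε G a n :=
  Functor.ofOpSequence_map_homOfLE_succ (wordε G a) n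

/-- The coextension `T X ⟶ T T X ⟶ T Y` of `T X ⟶ Y`. -/
def kext (T : Comonad C) {X Y : C} (u : T.obj X ⟶ Y) : T.obj X ⟶ T.obj Y :=
  T.δ.app X ≫ T.map u

lemma kext_ε (T : Comonad C) {X Y : C} (u : T.obj X ⟶ Y) : kext T u ≫ T.ε.app Y = u := by
  have h := Comonad.counit_naturality C T u
  have h' := T.left_counit X
  rw [kext, Category.assoc, h, reassoc_of% h']

lemma kext_comp (T : Comonad C) {X Y Z : C} (u : T.obj X ⟶ Y) (w : T.obj Y ⟶ Z) :
    kext T u ≫ kext T w = kext T (kext T u ≫ w) := by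
  have h := Comonad.delta_naturality C T u
  have h' := T.coassoc X
  rw [kext, kext, kext, Category.assoc, reassoc_of% h, Functor.map_comp, Functor.map_comp,
    Category.assoc, reassoc_of% h']

lemma kext_naturality (T : Comonad C) {X X' Y Y' : C} (u : T.obj X ⟶ Y) (u' : T.obj X' ⟶ Y')
    (f : X ⟶ X') (g : Y ⟶ Y') (h : T.map f ≫ u' = u ≫ g) :
    T.map f ≫ kext T u' = kext T u ≫ T.map g := by
  have h' := Comonad.delta_naturality C T f
  rw [kext, kext, reassoc_of% h', Category.assoc, ← Functor.map_comp, ← Functor.map_comp, h]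

/-- The coextension `F T ⟶ F T T ⟶ H T` of `F T ⟶ H`. -/
def coext (T : Comonad C) {F H : C ⥤ C} (u : F ⋙ T.toFunctor ⟶ H) :
    F ⋙ T.toFunctor ⟶ H ⋙ T.toFunctor where
  app X := kext T (X := F.obj X) (u.app X)
  naturality _ _ f := kext_naturality T _ _ (F.map f) (H.map f) (u.naturality f)

lemma coext_ε (T : Comonad C) {F H : C ⥤ C} (u : F ⋙ T.toFunctor ⟶ H) :
    coext T u ≫ Functor.whiskerLeft H T.ε = u := by
  ext X
  exact kext_ε T (X := F.obj X) (u.app X)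

lemma coext_comp (T : Comonad C) {F H K : C ⥤ C} (u : F ⋙ T.toFunctor ⟶ H)
    (w : H ⋙ T.toFunctor ⟶ K) : coext T u ≫ coext T w = coext T (coext T u ≫ w) := by
  ext X
  exact kext_comp T (X := F.obj X) (Y := H.obj X) (u.app X) (w.app X)

lemma coext_counit (T : Comonad C) (F : C ⥤ C) :
    coext T (Functor.whiskerLeft F T.ε) = 𝟙 (F ⋙ T.toFunctor) := by
  ext X
  exact T.right_counit _

/-- The effect on words of reindexing along a monotone map `f`: the comonads with indices not in
the image of `f` are removed by counits, and comonads are repeated by comultiplications. -/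
def reindex (a : ℕ → I) (f : ℕ →o ℕ) : ∀ k : ℕ, word G a (f k + 1) ⟶ word G (a ∘ f) (k + 1)
  | 0 => coext (G (a (f 0))) (F := word G a (f 0)) (skip G a (Nat.zero_le (f 0 + 1)))
  | k + 1 => coext (G (a (f (k + 1)))) (F := word G a (f (k + 1)))
      (skip G a (succ_mono f (Nat.le_succ k)) ≫ reindex a f k)

lemma reindex_coext (a : ℕ → I) (f : ℕ →o ℕ) (k : ℕ) {K : C ⥤ C}
    (w : word G (a ∘ f) (k + 1) ⟶ K) :
    reindex G a f k ≫ coext (G (a (f k))) (F := word G (a ∘ f) k) w =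
      coext (G (a (f k))) (F := word G a (f k)) (reindex G a f k ≫ w) := by
  cases k with
  | zero => exact coext_comp (G (a (f 0))) _ w
  | succ k => exact coext_comp (G (a (f (k + 1)))) _ w

lemma reindex_ε_zero (a : ℕ → I) (f : ℕ →o ℕ) :
    reindex G a f 0 ≫ wordε G (a ∘ f) 0 = skip G a (Nat.zero_le (f 0 + 1)) :=
  coext_ε (G (a (f 0))) _

lemma reindex_ε_succ (a : ℕ → I) (f : ℕ →o ℕ) (k : ℕ) :
    reindex G a f (k + 1) ≫ wordε G (a ∘ f) (k + 1) =
      skip G a (succ_mono f (Nat.le_succ k)) ≫ reindex G a f k :=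
  coext_ε (G (a (f (k + 1)))) _

lemma reindex_skip (a : ℕ → I) (f : ℕ →o ℕ) {j k : ℕ} (h : j ≤ k) :
    reindex G a f k ≫ skip G (a ∘ f) (Nat.succ_le_succ h) =
      skip G a (succ_mono f h) ≫ reindex G a f j := by
  induction k, h using Nat.le_induction with
  | base => rw [skip_self, skip_self, Category.comp_id, Category.id_comp]
  | succ k h ih =>
    rw [← skip_comp G (a ∘ f) (Nat.succ_le_succ h) (Nat.le_succ (k + 1)), skip_succ,
      ← Category.assoc, reindex_ε_succ, Category.assoc, ih, ← Category.assoc, skip_comp]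

lemma reindex_skip_zero (a : ℕ → I) (f : ℕ →o ℕ) (k : ℕ) :
    reindex G a f k ≫ skip G (a ∘ f) (Nat.zero_le (k + 1)) =
      skip G a (Nat.zero_le (f k + 1)) := by
  rw [← skip_comp G (a ∘ f) (Nat.zero_le 1) (Nat.succ_le_succ (Nat.zero_le k)),
    ← Category.assoc, reindex_skip G a f (Nat.zero_le k), Category.assoc, skip_succ,
    reindex_ε_zero]
  exact skip_comp G a _ _

lemma reindex_comp (a : ℕ → I) (f g : ℕ →o ℕ) (k : ℕ) :
    reindex G a (f.comp g) k = reindex G a f (g k) ≫ reindex G (a ∘ f) g k := by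
  induction k with
  | zero =>
    exact ((reindex_coext G a f (g 0) (skip G (a ∘ f) (Nat.zero_le (g 0 + 1)))).trans
      (congrArg (coext (G (a (f (g 0)))) (F := word G a (f (g 0))))
        (reindex_skip_zero G a f (g 0)))).symm
  | succ k ih =>
    have h2 : reindex G a f (g (k + 1)) ≫
        skip G (a ∘ f) (succ_mono g (Nat.le_succ k)) ≫ reindex G (a ∘ f) g k =
      skip G a (succ_mono (f.comp g) (Nat.le_succ k)) ≫
        reindex G a (f.comp g) k := by
      rw [ih]
      exact (Category.assoc _ _ _).symm.trans ((congrArg (fun t => t ≫ reindex G (a ∘ f) g k)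
        (reindex_skip G a f (g.monotone (Nat.le_succ k)))).trans (Category.assoc _ _ _))
    exact ((reindex_coext G a f (g (k + 1)) _).trans
      (congrArg (coext (G (a (f (g (k + 1))))) (F := word G a (f (g (k + 1))))) h2)).symm

/-- `reindex`, with target a sequence `b` equal to `a ∘ f`. -/
def reindexEq (a b : ℕ → I) (f : ℕ →o ℕ) (h : b = a ∘ f) (k : ℕ) :
    word G a (f k + 1) ⟶ word G b (k + 1) :=
  h ▸ reindex G a f k

/-- The coextension, with a target comonad `G j` with `j = i`. -/
def coextEq {i j : I} (h : j = i) {F H : C ⥤ C} (u : F ⋙ (G i).toFunctor ⟶ H) :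
    F ⋙ (G i).toFunctor ⟶ H ⋙ (G j).toFunctor :=
  h ▸ coext (G i) u

lemma reindexEq_zero (a b : ℕ → I) (f : ℕ →o ℕ) (h : b = a ∘ f) :
    reindexEq G a b f h 0 = coextEq G (congrFun h 0) (F := word G a (f 0)) (H := 𝟭 C)
      (skip G a (Nat.zero_le (f 0 + 1))) := by
  subst h
  rfl

lemma reindexEq_succ (a b : ℕ → I) (f : ℕ →o ℕ) (h : b = a ∘ f) (k : ℕ) :
    reindexEq G a b f h (k + 1) = coextEq G (congrFun h (k + 1)) (F := word G a (f (k + 1)))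
      (skip G a (succ_mono f (Nat.le_succ k)) ≫ reindexEq G a b f h k) := by
  subst h
  rfl

lemma reindexEq_comp (a b c : ℕ → I) (f g : ℕ →o ℕ) (h : b = a ∘ f) (h' : c = b ∘ g)
    (h'' : c = a ∘ f.comp g) (k : ℕ) :
    reindexEq G a c (f.comp g) h'' k = reindexEq G a b f h (g k) ≫ reindexEq G b c g h' k := by
  subst h
  subst h'
  exact reindex_comp G a f g k

lemma reindexEq_skip (a b : ℕ → I) (f : ℕ →o ℕ) (h : b = a ∘ f) {j k : ℕ} (hjk : j ≤ k) :
    reindexEq G a b f h k ≫ skip G b (Nat.succ_le_succ hjk) =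
      skip G a (succ_mono f hjk) ≫ reindexEq G a b f h j := by
  subst h
  exact reindex_skip G a f hjk

lemma coextEq_skip (a : ℕ → I) {k p : ℕ} (hp : p = k) (h : a k = a p) (h' : k ≤ p + 1)
    (h'' : k + 1 ≤ p + 1) :
    coextEq G h (F := word G a p) (H := word G a k) (skip G a h') = skip G a h'' := by
  subst hp
  rw [skip_self]
  change coext (G (a p)) (F := word G a p) (skip G a h') = _
  rw [skip_succ]
  exact coext_counit (G (a p)) (word G a p)

lemma reindexEq_self (a : ℕ → I) (f : ℕ →o ℕ) (h : a = a ∘ f) (k : ℕ) (hf : ∀ i ≤ k, f i = i)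
    (hk : k + 1 ≤ f k + 1) : reindexEq G a a f h k = skip G a hk := by
  induction k with
  | zero =>
    rw [reindexEq_zero]
    exact coextEq_skip G a (hf 0 le_rfl) (congrFun h 0) _ hk
  | succ k ih =>
    have h0 := hf k (Nat.le_succ k)
    have h1 : k + 1 ≤ f k + 1 := by omega
    rw [reindexEq_succ, ih (fun i hi => hf i (hi.trans (Nat.le_succ k))) h1]
    refine (congrArg (fun t => coextEq G (congrFun h (k + 1)) (F := word G a (f (k + 1)))
      (H := word G a (k + 1)) t) (skip_comp G a h1 (succ_mono f (Nat.le_succ k)))).trans ?_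
    exact coextEq_skip G a (hf (k + 1) le_rfl) (congrFun h (k + 1)) _ hk

/-- Extension by a constant of a finite sequence. -/
def extend {n : ℕ} (α : Fin (n + 1) → I) (i : ℕ) : I := α ⟨min i n, by omega⟩

/-- Extension by a constant of a monotone map. -/
def extendHom {m n : ℕ} (f : Fin (m + 1) →o Fin (n + 1)) : ℕ →o ℕ where
  toFun i := f ⟨min i m, by omega⟩
  monotone' i j h := f.monotone (by simp only [Fin.mk_le_mk]; omega)

lemma extendHom_le {m n : ℕ} (f : Fin (m + 1) →o Fin (n + 1)) (i : ℕ) : extendHom f i ≤ n :=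
  Nat.le_of_lt_succ (f ⟨min i m, by omega⟩).2

lemma extend_comp {m n : ℕ} (α : Fin (n + 1) → I) (f : Fin (m + 1) →o Fin (n + 1)) :
    extend (α ∘ f) = extend α ∘ extendHom f := by
  funext i
  change α _ = α _
  congr 1
  ext
  change _ = min (extendHom f i) n
  rw [min_eq_left (extendHom_le f i)]
  rfl

lemma extendHom_comp {l m n : ℕ} (f : Fin (m + 1) →o Fin (n + 1))
    (g : Fin (l + 1) →o Fin (m + 1)) :
    extendHom (f.comp g) = (extendHom f).comp (extendHom g) := by
  ext i
  change ((f (g _) : Fin (n + 1)) : ℕ) = (f _ : Fin (n + 1))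
  congr 2
  ext
  change _ = min (extendHom g i) m
  rw [min_eq_left (extendHom_le g i)]
  rfl

/-- For `α = (α₀, …, αₙ)`, the composite `G_{αₙ} ∘ ⋯ ∘ G_{α₀}`. -/
def barWord {n : ℕ} (α : Fin (n + 1) → I) : C ⥤ C := word G (extend α) (n + 1)

/-- The effect of a monotone map on the composites `G_{αₙ} ∘ ⋯ ∘ G_{α₀}`. -/
def barWordMap {m n : ℕ} (f : Fin (m + 1) →o Fin (n + 1)) (α : Fin (n + 1) → I) :
    barWord G α ⟶ barWord G (α ∘ f) :=
  skip G (extend α) (Nat.succ_le_succ (extendHom_le f m)) ≫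
    reindexEq G (extend α) (extend (α ∘ f)) (extendHom f) (extend_comp α f) m

lemma barWordMap_id {n : ℕ} (α : Fin (n + 1) → I) : barWordMap G OrderHom.id α = 𝟙 (barWord G α) := by
  have hf : ∀ i ≤ n, extendHom (OrderHom.id : Fin (n + 1) →o Fin (n + 1)) i = i :=
    fun i hi => min_eq_left hi
  have h := reindexEq_self G (extend α) (extendHom OrderHom.id) (extend_comp α OrderHom.id) n hf
    (by rw [hf n le_rfl])
  refine (congrArg (fun t => skip G (extend α) _ ≫ t) h).trans ?_
  rw [skip_comp, skip_self]
  rfl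

lemma barWordMap_comp {l m n : ℕ} (f : Fin (m + 1) →o Fin (n + 1))
    (g : Fin (l + 1) →o Fin (m + 1)) (α : Fin (n + 1) → I) :
    barWordMap G (f.comp g) α = barWordMap G f α ≫ barWordMap G g (α ∘ f) := by
  have key : ∀ (p : ℕ →o ℕ) (hp : p = (extendHom f).comp (extendHom g))
      (h1 : p l ≤ n) (h2 : extend (α ∘ f ∘ g) = extend α ∘ p),
      skip G (extend α) (Nat.succ_le_succ h1) ≫ reindexEq G (extend α) (extend (α ∘ f ∘ g)) p h2 l =
        barWordMap G f α ≫ barWordMap G g (α ∘ f) := by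
    rintro p rfl h1 h2
    rw [reindexEq_comp G (extend α) (extend (α ∘ f)) (extend (α ∘ f ∘ g)) (extendHom f)
      (extendHom g) (extend_comp α f) (extend_comp (α ∘ f) g) h2 l]
    have e := reindexEq_skip G (extend α) (extend (α ∘ f)) (extendHom f) (extend_comp α f)
      (extendHom_le g l)
    have e' : skip G (extend α) (Nat.succ_le_succ (extendHom_le f m)) ≫
        skip G (extend α) (succ_mono (extendHom f) (extendHom_le g l)) =
        skip G (extend α) (Nat.succ_le_succ h1) := skip_comp G _ _ _
    refine (congrArg (fun t => t ≫ reindexEq G _ _ (extendHom f) (extend_comp α f) (extendHom g l) ≫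
      reindexEq G _ _ (extendHom g) (extend_comp (α ∘ f) g) l) e'.symm).trans ?_
    refine Eq.trans ?_ (congrArg (fun t => skip G (extend α) (Nat.succ_le_succ (extendHom_le f m)) ≫
      t ≫ reindexEq G _ _ (extendHom g) (extend_comp (α ∘ f) g) l) e.symm) |>.trans ?_
    · simp only [Category.assoc]
    · simp only [barWordMap, Category.assoc]
      exact (Category.assoc _ _ _).symm
  exact key _ (extendHom_comp f g) (extendHom_le _ l) (extend_comp α (f.comp g))

end Bar

section BarSimplicial

variable {I : Type*} {C : Type*} [Category* C] (G : I → Comonad C)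

/-- The simplicial functor `n ↦ ∐_α G_{αₙ} ∘ ⋯ ∘ G_{α₀}`, the coproduct being over all
`α = (α₀, …, αₙ)`. -/
def simplicialBar [∀ n : ℕ, HasColimitsOfShape (Discrete (Fin (n + 1) → I)) C] :
    SimplexCategoryᵒᵖ ⥤ C ⥤ C where
  obj n :=
    { obj := fun X => ∐ fun α : Fin (n.unop.len + 1) → I => (barWord G α).obj X
      map := fun f => Limits.Sigma.map fun α => (barWord G α).map f }
  map {n m} f :=
    { app := fun X => Sigma.desc fun α => (barWordMap G f.unop.toOrderHom α).app X ≫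
        Sigma.ι (fun β : Fin (m.unop.len + 1) → I => (barWord G β).obj X) (α ∘ f.unop.toOrderHom)
      naturality := fun X Y g => by
        ext α
        simp }
  map_id n := by
    ext X α
    have h : (barWordMap G OrderHom.id α).app X = 𝟙 _ :=
      congrArg (fun t => t.app X) (barWordMap_id G α)
    simp only [colimit.ι_desc, Cofan.mk_ι_app]
    refine (congrArg (fun t => t ≫ Sigma.ι (fun β => (barWord G β).obj X) α) h).trans ?_
    simp
  map_comp {n m l} f g := by
    ext X α
    have h := congrArg (fun t => t.app X)
      (barWordMap_comp G f.unop.toOrderHom g.unop.toOrderHom α)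
    simp only [colimit.ι_desc, Cofan.mk_ι_app, NatTrans.comp_app, colimit.ι_desc_assoc,
      Category.assoc] at h ⊢
    refine (congrArg (fun t => t ≫ Sigma.ι (fun β => (barWord G β).obj X)
      ((α ∘ f.unop.toOrderHom) ∘ g.unop.toOrderHom)) h).trans ?_
    simp only [Category.assoc]

end BarSimplicial

section BarCosimplicial

variable {I : Type*} {C : Type*} [Category* C] (G : I → Comonad Cᵒᵖ)

/-- The dual of `simplicialBar`, with the order of the sequences `α` reversed. -/
def cosimplicialCobar [∀ n : ℕ, HasLimitsOfShape (Discrete (Fin (n + 1) → I)) C] :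
    SimplexCategory ⥤ C ⥤ C :=
  SimplexCategory.rev ⋙
  { obj := fun n =>
      { obj := fun X => ∏ᶜ fun α : Fin (n.len + 1) → I => ((barWord G α).obj (op X)).unop
        map := fun f => Limits.Pi.map fun α => ((barWord G α).map f.op).unop
        map_comp := fun f g => by
          apply Pi.hom_ext
          intro α
          simp }
    map := fun {n m} f =>
      { app := fun X => Pi.lift fun α : Fin (m.len + 1) → I =>
          Pi.π (fun β : Fin (n.len + 1) → I => ((barWord G β).obj (op X)).unop)
            (α ∘ f.toOrderHom) ≫ ((barWordMap G f.toOrderHom α).app (op X)).unop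
        naturality := fun X Y g => by
          apply Pi.hom_ext
          intro α
          have h := congrArg Quiver.Hom.unop ((barWordMap G f.toOrderHom α).naturality g.op)
          simp only [unop_comp] at h
          simp [h] }
    map_id := fun n => by
      ext X α
      have h : ((barWordMap G OrderHom.id α).app (op X)).unop = 𝟙 _ :=
        congrArg (fun t => (t.app (op X)).unop) (barWordMap_id G α)
      simp only [limit.lift_π, Fan.mk_π_app]
      refine (congrArg (fun t => Pi.π (fun β => ((barWord G β).obj (op X)).unop) α ≫ t) h).trans ?_
      exact (Category.comp_id _).trans (Category.id_comp _).symm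
    map_comp := fun {n m l} f g => by
      ext X α
      have h := congrArg (fun t => (t.app (op X)).unop)
        (barWordMap_comp G g.toOrderHom f.toOrderHom α)
      simp only [limit.lift_π, Fan.mk_π_app, NatTrans.comp_app, limit.lift_π_assoc,
        Category.assoc] at h ⊢
      refine (congrArg (fun t => Pi.π (fun β => ((barWord G β).obj (op X)).unop)
        ((α ∘ g.toOrderHom) ∘ f.toOrderHom) ≫ t) h).trans ?_
      rfl }

end BarCosimplicial

section Realization

variable {V : Type u₁} [Category.{v} V] [MonoidalCategory V] [SymmetricCategory V]
  [MonoidalClosed V] (L : SSet.{v} ⥤ V)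

/-- The geometric realization `∫^n L(Δ[n]) ⊙ Xₙ`. -/
def realization {N : Type u₂} [Category.{v} N] [EnrichedOrdinaryCategory V N] [Tensored V N]
    [HasColimitsOfSize.{0, 0} N] (X : SimplexCategoryᵒᵖ ⥤ N) : N :=
  coend (X ⋙ (SSet.stdSimplex ⋙ L ⋙ tensorFunctor V N).flip)

/-- The totalization `∫_n P(L(Δ[n]), Xⁿ)`, where `P` is the cotensor (or the internal hom). -/
def totalization {N : Type u₂} [Category.{v} N] [HasLimitsOfSize.{0, 0} N] (P : Vᵒᵖ ⥤ N ⥤ N) :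
    (SimplexCategory ⥤ N) ⥤ N :=
  Functor.whiskeringLeft SimplexCategory N N ⋙
    (Functor.whiskeringLeft SimplexCategoryᵒᵖ (N ⥤ N) (SimplexCategory ⥤ N)).obj
      ((SSet.stdSimplex ⋙ L).op ⋙ P) ⋙ endFunctor SimplexCategory N

end Realization

section Diagrams

variable {V : Type u₁} [Category.{v} V] [MonoidalCategory V] [SymmetricCategory V]
  [MonoidalClosed V] {D : Type v} [EnrichedCategory V D]
  {M : Type u₂} [Category.{v} M] [EnrichedOrdinaryCategory V M]

section Sigma

variable {N : Type u₂} [Category.{v} N] [EnrichedOrdinaryCategory V N] [Cotensored V N]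
  {J : Type v} (X : J → N) [HasCoproduct X] [HasProductsOfShape J V] (Y : N)

lemma sigmaHom_compatible {j j' : Discrete J} (f : j ⟶ j') :
    Pi.π (fun j => (X j ⟶[V] Y)) j'.as ≫ eHomWhiskerRight V ((Discrete.functor X).map f) Y =
      Pi.π (fun j => (X j ⟶[V] Y)) j.as := by
  obtain ⟨j⟩ := j
  obtain ⟨j'⟩ := j'
  obtain ⟨⟨h⟩⟩ := f
  dsimp at h
  subst h
  simp

/-- Enriched homs out of a coproduct. -/
def sigmaHomIso : ((∐ X) ⟶[V] Y) ≅ ∏ᶜ fun j => (X j ⟶[V] Y) where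
  hom := Pi.lift fun j => eHomWhiskerRight V (Sigma.ι X j) Y
  inv := colimLift (colimit.isColimit (Discrete.functor X))
    (fun j => Pi.π (fun j => (X j ⟶[V] Y)) j.as) (sigmaHom_compatible X Y)
  hom_inv_id := colim_hom_ext (colimit.isColimit (Discrete.functor X)) fun j => by
    rw [Category.assoc, colimLift_fac _ _ (sigmaHom_compatible X Y), Category.id_comp]
    exact limit.lift_π _ _
  inv_hom_id := by
    apply Pi.hom_ext
    intro j
    rw [Category.assoc, Category.id_comp, limit.lift_π]
    exact colimLift_fac (colimit.isColimit (Discrete.functor X)) _ (sigmaHom_compatible X Y) ⟨j⟩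

end Sigma

variable [HasLimits V] [HasLimits M] [HasColimits M] [Tensored V M] [Cotensored V M]

variable (V D M) in
/-- The comonads `F ↦ D(b, -) ⊙ F b`. -/
def freeComonad (b : D) : Comonad (Diagram V D M) := (Diagram.freeAdj V M b).toComonad

variable (V D M) in
/-- The monads `F ↦ {D(-, b), F b}`, as comonads on the opposite category. -/
def cofreeComonad (b : D) : Comonad (Diagram V D M)ᵒᵖ := (Diagram.cofreeAdj V M b).op.toComonad

variable (V D M) in
/-- The simplicial bar construction, with `Bₙ(D, D, F)` the coproduct over `α₀, …, αₙ` of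
`D(αₙ, -) ⊙ (D(αₙ₋₁, αₙ) ⊙ ⋯ ⊙ (D(α₀, α₁) ⊙ F α₀))`. -/
def simplicialBarDiagram : SimplexCategoryᵒᵖ ⥤ Diagram V D M ⥤ Diagram V D M :=
  simplicialBar (freeComonad V D M)

variable (V D M) in
/-- The cosimplicial cobar construction, with `Cⁿ(D, D, F)` the product over `α₀, …, αₙ` of
`{D(-, α₀), {D(α₀, α₁), ⋯ {D(αₙ₋₁, αₙ), F αₙ}}}`. -/
def cosimplicialCobarDiagram : SimplexCategory ⥤ Diagram V D M ⥤ Diagram V D M :=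
  cosimplicialCobar (cofreeComonad V D M)

/-- The bar construction `B(D, D, F)`. -/
def bar (L : SSet.{v} ⥤ V) (F : Diagram V D M) : Diagram V D M :=
  realization L ((simplicialBarDiagram V D M).flip.obj F)

/-- The cobar construction `C(D, D, F)`. -/
def cobar (L : SSet.{v} ⥤ V) (F : Diagram V D M) : Diagram V D M :=
  (totalization L (cotensorFunctor V (Diagram V D M))).obj
    ((cosimplicialCobarDiagram V D M).flip.obj F)

/-- The object `Cⁿ(G, D, F)`: the product over `α₀, …, αₙ` of
`M(D(αₙ₋₁, αₙ) ⊙ (⋯ ⊙ (D(α₀, α₁) ⊙ G α₀)), F αₙ)`. -/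
def cobarHomObj (n : ℕ) (G F : Diagram V D M) : V :=
  ∏ᶜ fun α : Fin (n + 1) → D =>
    (((word (freeComonad V D M) (extend α) n).obj G).val (extend α n) ⟶[V] F.val (extend α n))

/-- The Yoneda isomorphism `M^D(Bₙ(D, D, G), F) ≅ Cⁿ(G, D, F)`. -/
def cobarHomIso (n : ℕ) (G F : Diagram V D M) :
    (((simplicialBarDiagram V D M).obj (op (SimplexCategory.mk n))).obj G ⟶[V] F) ≅
      cobarHomObj n G F :=
  sigmaHomIso (fun α : Fin (n + 1) → D => (barWord (freeComonad V D M) α).obj G) F ≪≫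
    Pi.mapIso fun α => Diagram.freeYonedaIso (extend α n)
      (((word (freeComonad V D M) (extend α) n).obj G).val (extend α n)) F

variable (V D M) in
/-- The functors `(n, G, F) ↦ Cⁿ(G, D, F)`, with the cosimplicial structure coming from the
simplicial structure of `Bₙ(D, D, G)`. -/
def cosimplicialCobarHom : SimplexCategory ⥤ (Diagram V D M)ᵒᵖ × Diagram V D M ⥤ V :=
  Functor.curry.obj ((Functor.uncurry.obj
    ((simplicialBarDiagram V D M).rightOp ⋙ Functor.opHom _ _ ⋙
      (Functor.whiskeringRight _ _ _).obj (eHomFunctor V (Diagram V D M)) ⋙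
        Functor.uncurry)).copyObj
    (fun x => cobarHomObj x.1.len x.2.1.unop x.2.2)
    (fun x => cobarHomIso x.1.len x.2.1.unop x.2.2))

variable (D M) in
/-- The cobar construction `C(-, D, -)`. -/
def cobarHom (L : SSet.{v} ⥤ V) : (Diagram V D M)ᵒᵖ × Diagram V D M ⥤ V :=
  (cosimplicialCobarHom V D M).flip ⋙ totalization L MonoidalClosed.internalHom

end Diagrams

section Homotopical

/-- Homotopical categories: the weak equivalences contain the identities and satisfy the
2-out-of-6 property. -/
class IsHomotopical {C : Type*} [Category* C] (W : MorphismProperty C) : Prop where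
  id_mem (X : C) : W (𝟙 X)
  two_out_of_six {X Y Z T : C} (f : X ⟶ Y) (g : Y ⟶ Z) (h : Z ⟶ T) (hfg : W (f ≫ g))
    (hgh : W (g ≫ h)) : W f ∧ W g ∧ W h ∧ W (f ≫ g ≫ h)

instance {C : Type*} [Category* C] (W : MorphismProperty C) [IsHomotopical W] :
    W.ContainsIdentities where
  id_mem := IsHomotopical.id_mem

variable {A B C : Type*} [Category* A] [Category* B] [Category* C]

/-- A left deformation into the full subcategory `P`. -/
structure LeftDeformation (W : MorphismProperty C) (P : ObjectProperty C) where
  Q : C ⥤ C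
  q : Q ⟶ 𝟭 C
  weq (X : C) : W (q.app X)
  mem (X : C) : P (Q.obj X)

/-- A right deformation into the full subcategory `P`. -/
structure RightDeformation (W : MorphismProperty C) (P : ObjectProperty C) where
  R : C ⥤ C
  r : 𝟭 C ⟶ R
  weq (X : C) : W (r.app X)
  mem (X : C) : P (R.obj X)

/-- A left deformation retract: a full subcategory containing the image of some left
deformation. -/
def IsLeftDeformationRetract (W : MorphismProperty C) (P : ObjectProperty C) : Prop :=
  Nonempty (LeftDeformation W P)

/-- A right deformation retract. -/
def IsRightDeformationRetract (W : MorphismProperty C) (P : ObjectProperty C) : Prop :=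
  Nonempty (RightDeformation W P)

/-- The functor `F` is homotopical on the full subcategory `P`. -/
def IsHomotopicalOn (F : A ⥤ C) (W : MorphismProperty A) (P : ObjectProperty A)
    (W' : MorphismProperty C) : Prop :=
  ∀ ⦃X Y : A⦄ (f : X ⟶ Y), P X → P Y → W f → W' (F.map f)

/-- The full subcategory `P × P'` of a product category. -/
def prodProperty (P : ObjectProperty A) (P' : ObjectProperty B) : ObjectProperty (A × B) :=
  fun X => P X.1 ∧ P' X.2

/-- A bifunctor is homotopical on `P × P'`. -/
def IsHomotopicalOn₂ (F : A ⥤ B ⥤ C) (W : MorphismProperty A) (P : ObjectProperty A)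
    (W' : MorphismProperty B) (P' : ObjectProperty B) (W'' : MorphismProperty C) : Prop :=
  IsHomotopicalOn (Functor.uncurry.obj F) (W.prod W') (prodProperty P P') W''

/-- `(P, P', P'')` is a deformation retract for the functors `(tens, homl, homr)` of a two-variable
adjunction. -/
structure IsDeformationRetract₂ (tens : A ⥤ B ⥤ C) (homl : Aᵒᵖ ⥤ C ⥤ B) (homr : Bᵒᵖ ⥤ C ⥤ A)
    (W : MorphismProperty A) (W' : MorphismProperty B) (W'' : MorphismProperty C)
    (P : ObjectProperty A) (P' : ObjectProperty B) (P'' : ObjectProperty C) : Prop where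
  left₁ : IsLeftDeformationRetract W P
  left₂ : IsLeftDeformationRetract W' P'
  right : IsRightDeformationRetract W'' P''
  tens : IsHomotopicalOn₂ tens W P W' P' W''
  homl : IsHomotopicalOn₂ homl W.op P.op W'' P'' W'
  homr : IsHomotopicalOn₂ homr W'.op P'.op W'' P'' W

end Homotopical

section VHomotopical

variable {V : Type u₁} [Category.{v} V] [MonoidalCategory V] [SymmetricCategory V]
  [MonoidalClosed V]

/-- `(VQ, VR)` is a closed monoidal deformation retract; with it, `V` is a closed symmetric
monoidal homotopical category. -/
structure IsClosedMonoidalDeformationRetract (W : MorphismProperty V) (VQ VR : ObjectProperty V) :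
    Prop where
  deform : IsDeformationRetract₂ (curriedTensor V) MonoidalClosed.internalHom
    MonoidalClosed.internalHom W W W VQ VQ VR
  tensor_mem (X Y : V) (hX : VQ X) (hY : VQ Y) : VQ (X ⊗ Y)
  ihom_mem (X Y : V) (hX : VQ X) (hY : VR Y) : VR ((ihom X).obj Y)
  unit_tensor (q : LeftDeformation W VQ) (X : V) (hX : VQ X) :
    W (q.q.app (𝟙_ V) ▷ X ≫ (λ_ X).hom)
  tensor_unit (q : LeftDeformation W VQ) (X : V) (hX : VQ X) :
    W (X ◁ q.q.app (𝟙_ V) ≫ (ρ_ X).hom)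
  ihom_unit (q : LeftDeformation W VQ) (Y : V) (hY : VR Y) :
    W (MonoidalClosed.curry (q.q.app (𝟙_ V) ▷ Y ≫ (λ_ Y).hom))

/-- `(MQ, MR)` is a deformation retract for the enrichment of `M`; with it, `M` is a
`V`-homotopical category. The maps `Q E ⊙ X ⟶ X` and `Y ⟶ {Q E, Y}` of the unit axioms are those
corresponding to `Q E ⟶ E ⟶ M(X, X)` and `Q E ⟶ E ⟶ M(Y, Y)`. -/
structure IsVHomotopical (WV : MorphismProperty V) (VQ : ObjectProperty V)
    {M : Type u₂} [Category.{v} M] [EnrichedOrdinaryCategory V M] [Tensored V M] [Cotensored V M]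
    (W : MorphismProperty M) (MQ MR : ObjectProperty M) : Prop where
  homotopical : IsHomotopical W
  deform : IsDeformationRetract₂ (tensorFunctor V M) (cotensorFunctor V M) (eHomFunctor V M)
    WV W W VQ MQ MR
  tensor_mem (K : V) (X : M) (hK : VQ K) (hX : MQ X) : MQ (tobj V K X)
  cotensor_mem (K : V) (Y : M) (hK : VQ K) (hY : MR Y) : MR (cobj V K Y)
  tensor_unit (q : LeftDeformation WV VQ) (X : M) (hX : MQ X) :
    W (tdesc (q.q.app (𝟙_ V) ≫ eId V X) : tobj V _ X ⟶ X)
  cotensor_unit (q : LeftDeformation WV VQ) (Y : M) (hY : MR Y) :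
    W (cdesc (q.q.app (𝟙_ V) ≫ eId V Y) : Y ⟶ cobj V _ Y)

end VHomotopical

section SimplicialHomotopy

variable {V : Type u₁} [Category.{v} V] [MonoidalCategory V] (L : SSet.{v} ⥤ V) [L.Monoidal]
  {M : Type u₂} [Category.{v} M] [EnrichedOrdinaryCategory V M]

/-- The `i`-th vertex `E ≅ L(*) ⟶ L(Δ[1])`. -/
def vertex (i : Fin 2) : 𝟙_ V ⟶ L.obj (SSet.stdSimplex.obj (SimplexCategory.mk 1)) :=
  Functor.LaxMonoidal.ε L ≫ L.map (SSet.const (SSet.stdSimplex.obj₀Equiv.symm i))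

/-- There is a simplicial homotopy from `f` to `g`, that is, a `1`-simplex from `f` to `g` of the
simplicial mapping space, whose `n`-simplices are the morphisms `L(Δ[n]) ⟶ M(X, Y)`. -/
def StrictlyHomotopic {X Y : M} (f g : X ⟶ Y) : Prop :=
  ∃ h : L.obj (SSet.stdSimplex.obj (SimplexCategory.mk 1)) ⟶ (X ⟶[V] Y),
    vertex L 0 ≫ h = eHomEquiv V f ∧ vertex L 1 ≫ h = eHomEquiv V g

/-- Simplicial homotopy, the equivalence relation generated by simplicial homotopies. -/
def SimpliciallyHomotopic {X Y : M} (f g : X ⟶ Y) : Prop :=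
  Relation.EqvGen (StrictlyHomotopic L) f g

variable (M) in
/-- Simplicial homotopy equivalences. -/
def simplicialHomotopyEquivalences : MorphismProperty M := fun X Y f =>
  ∃ g : Y ⟶ X, SimpliciallyHomotopic L (f ≫ g) (𝟙 X) ∧ SimpliciallyHomotopic L (g ≫ f) (𝟙 Y)

end SimplicialHomotopy

section HomotopicalDiagrams

variable {V : Type u₁} [Category.{v} V] [MonoidalCategory V] [SymmetricCategory V]
  [MonoidalClosed V] {M : Type u₂} [Category.{v} M] [EnrichedOrdinaryCategory V M]

variable (V) in
/-- The objectwise weak equivalences of diagrams. -/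
def objectwiseWeq (D : Type v) [EnrichedCategory V D] (W : MorphismProperty M) :
    MorphismProperty (Diagram V D M) :=
  fun _ _ f => ∀ d, W (Diagram.Hom.app f d)

instance (D : Type v) [EnrichedCategory V D] (W : MorphismProperty M) [IsHomotopical W] :
    IsHomotopical (objectwiseWeq V D W) where
  id_mem F d := IsHomotopical.id_mem (F.val d)
  two_out_of_six f g h hfg hgh := by
    have H := fun d => IsHomotopical.two_out_of_six (W := W) (Diagram.Hom.app f d)
      (Diagram.Hom.app g d) (Diagram.Hom.app h d) (hfg d) (hgh d)
    exact ⟨fun d => (H d).1, fun d => (H d).2.1, fun d => (H d).2.2.1, fun d => (H d).2.2.2⟩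

variable (V) in
/-- The diagrams with values in the full subcategory `P`. -/
def objectwise (D : Type v) [EnrichedCategory V D] (P : ObjectProperty M) :
    ObjectProperty (Diagram V D M) :=
  fun F => ∀ d, P (F.val d)

variable [HasLimits V] [HasLimits M] [HasColimits M] [Tensored V M] [Cotensored V M]

/-- `D` is good for the hom-functor of `M`. As bar and cobar constructions are only defined up to
isomorphism, the full subcategories in which they have to lie are closed under isomorphism. -/
structure IsGoodForHom (L : SSet.{v} ⥤ V) (D : Type v) [EnrichedCategory V D]
    (WV : MorphismProperty V) (VR : ObjectProperty V) (W : MorphismProperty M)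
    (MQ MR : ObjectProperty M) : Prop where
  homotopical : IsHomotopicalOn (cobarHom D M L) ((objectwiseWeq V D W).op.prod (objectwiseWeq V D W))
    (prodProperty (objectwise V D MQ).op (objectwise V D MR)) WV
  bar_mem (G : Diagram V D M) (hG : objectwise V D MQ G) :
    (objectwise V D MQ).isoClosure (bar L G)
  cobar_mem (F : Diagram V D M) (hF : objectwise V D MR F) :
    (objectwise V D MR).isoClosure (cobar L F)
  cobarHom_mem (G F : Diagram V D M) (hG : objectwise V D MQ G) (hF : objectwise V D MR F) :
    VR.isoClosure ((cobarHom D M L).obj (op G, F))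

/-- The full image of `B(D, D, -)` on the diagrams with values in `MQ`. -/
def barObjects (L : SSet.{v} ⥤ V) (D : Type v) [EnrichedCategory V D] (MQ : ObjectProperty M) :
    ObjectProperty (Diagram V D M) :=
  fun F => ∃ G, objectwise V D MQ G ∧ Nonempty (F ≅ bar L G)

/-- The full image of `C(D, D, -)` on the diagrams with values in `MR`. -/
def cobarObjects (L : SSet.{v} ⥤ V) (D : Type v) [EnrichedCategory V D] (MR : ObjectProperty M) :
    ObjectProperty (Diagram V D M) :=
  fun F => ∃ G, objectwise V D MR G ∧ Nonempty (F ≅ cobar L G)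

end HomotopicalDiagrams

section HomotopyCategory

/-- The homotopy category, the localization at the weak equivalences. -/
abbrev Ho {C : Type*} [Category* C] (W : MorphismProperty C) := W.Localization

open Functor.LaxMonoidal

variable {V : Type u₁} [Category.{v} V] [MonoidalCategory V] [SymmetricCategory V]
  [MonoidalClosed V] (WV : MorphismProperty V) [IsHomotopical WV]

/-- The structure of a closed symmetric monoidal category on `Ho(V)`, with the given lax symmetric
monoidal structure on `V ⥤ Ho(V)`, is the derived one: the unit object is that of `V`, the tensor
product is the left derived functor of that of `V`, and the internal hom is the right derived
functor of that of `V`. -/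
structure IsDerivedMonoidal [MonoidalCategory (Ho WV)] [SymmetricCategory (Ho WV)]
    [MonoidalClosed (Ho WV)] [WV.Q.LaxBraided] : Prop where
  isIso_ε : IsIso (ε WV.Q)
  tensor : ∃ m : WV.Q.prod WV.Q ⋙ Functor.uncurry.obj (curriedTensor (Ho WV)) ⟶
      Functor.uncurry.obj (curriedTensor V) ⋙ WV.Q,
    (∀ X Y : V, m.app (X, Y) = μ WV.Q X Y) ∧
    (Functor.uncurry.obj (curriedTensor (Ho WV))).IsLeftDerivedFunctor m (WV.prod WV)
  ihom : ∃ c : Functor.uncurry.obj MonoidalClosed.internalHom ⋙ WV.Q ⟶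
      WV.Q.op.prod WV.Q ⋙ Functor.uncurry.obj MonoidalClosed.internalHom,
    (∀ X Y : V, c.app (op X, Y) =
      MonoidalClosed.curry (μ WV.Q X ((ihom X).obj Y) ≫ WV.Q.map ((ihom.ev X).app Y))) ∧
    (Functor.uncurry.obj MonoidalClosed.internalHom).IsRightDerivedFunctor c (WV.op.prod WV)

variable [MonoidalCategory (Ho WV)] [SymmetricCategory (Ho WV)]
    [MonoidalClosed (Ho WV)] [WV.Q.LaxBraided]
  {N : Type u₂} [Category.{v} N] [EnrichedOrdinaryCategory V N] [Tensored V N] [Cotensored V N]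
  (W : MorphismProperty N) [IsHomotopical W]
  [EnrichedOrdinaryCategory (Ho WV) (Ho W)] [Tensored (Ho WV) (Ho W)] [Cotensored (Ho WV) (Ho W)]

/-- The structure of a tensored and cotensored `Ho(V)`-category on `Ho(N)` is the derived one:
`N ⥤ Ho(N)` is, through `r`, a functor of enriched categories over `V ⥤ Ho(V)`, and the enriched
hom, the tensor and the cotensor of `Ho(N)` are, through `r`, the derived functors of those of
`N`. -/
structure IsDerivedEnrichment (r : ∀ X Y : N, WV.Q.obj (X ⟶[V] Y) ⟶
    (W.Q.obj X ⟶[Ho WV] W.Q.obj Y)) : Prop where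
  map_hom {X Y : N} (f : X ⟶ Y) :
    ε WV.Q ≫ WV.Q.map (eHomEquiv V f) ≫ r X Y = eHomEquiv (Ho WV) (W.Q.map f)
  map_comp (X Y Z : N) :
    μ WV.Q (X ⟶[V] Y) (Y ⟶[V] Z) ≫ WV.Q.map (eComp V X Y Z) ≫ r X Z =
      (r X Y ⊗ₘ r Y Z) ≫ eComp (Ho WV) (W.Q.obj X) (W.Q.obj Y) (W.Q.obj Z)
  hom : ∃ a : Functor.uncurry.obj (eHomFunctor V N) ⋙ WV.Q ⟶
      W.Q.op.prod W.Q ⋙ Functor.uncurry.obj (eHomFunctor (Ho WV) (Ho W)),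
    (∀ X Y : N, a.app (op X, Y) = r X Y) ∧
    (Functor.uncurry.obj (eHomFunctor (Ho WV) (Ho W))).IsRightDerivedFunctor a (W.op.prod W)
  tensor : ∃ t : WV.Q.prod W.Q ⋙ Functor.uncurry.obj (tensorFunctor (Ho WV) (Ho W)) ⟶
      Functor.uncurry.obj (tensorFunctor V N) ⋙ W.Q,
    (∀ (K : V) (X : N), t.app (K, X) = tdesc (WV.Q.map (tcoev V K X) ≫ r X (tobj V K X))) ∧
    (Functor.uncurry.obj (tensorFunctor (Ho WV) (Ho W))).IsLeftDerivedFunctor t (WV.prod W)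
  cotensor : ∃ c : Functor.uncurry.obj (cotensorFunctor V N) ⋙ W.Q ⟶
      WV.Q.op.prod W.Q ⋙ Functor.uncurry.obj (cotensorFunctor (Ho WV) (Ho W)),
    (∀ (K : V) (X : N), c.app (op K, X) = cdesc (WV.Q.map (cev V K X) ≫ r (cobj V K X) X)) ∧
    (Functor.uncurry.obj (cotensorFunctor (Ho WV) (Ho W))).IsRightDerivedFunctor c (WV.op.prod W)

end HomotopyCategory

end EnrichedHomotopy

end

universe v u₁ u₂

open EnrichedHomotopy

set_option linter.unusedSectionVars false

namespace EnrichedHomotopy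

noncomputable section

section

section Words

variable {I : Type*} {C : Type*} [Category* C] (G : I → Comonad C)

/-- `f` restricts to a monotone map from `{0, …, m - 1}` to `{0, …, n - 1}` that pulls back the
sequence `a` to the sequence `b`. -/
structure IsReindexing (f : ℕ → ℕ) (a b : ℕ → I) (m n : ℕ) : Prop where
  lt : ∀ i < m, f i < n
  mono : ∀ i j, i ≤ j → j < m → f i ≤ f j
  eq : ∀ i < m, b i = a (f i)

variable {G} in
lemma coextEq_ε {i j : I} (h : j = i) {F H : C ⥤ C} (u : F ⋙ (G i).toFunctor ⟶ H) :
    coextEq G h u ≫ Functor.whiskerLeft H (G j).ε = u := by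
  subst h
  exact coext_ε _ u

variable {G} in
lemma coextEq_comp {i j k : I} (h : j = i) (h' : k = j) {F H K : C ⥤ C}
    (u : F ⋙ (G i).toFunctor ⟶ H) (w : H ⋙ (G j).toFunctor ⟶ K) :
    coextEq G h u ≫ coextEq G h' w = coextEq G (h'.trans h) (coextEq G h u ≫ w) := by
  subst h'
  subst h
  exact coext_comp _ u w

variable {G} in
lemma coextEq_whiskerRight {i j : I} (h : j = i) {F F' H : C ⥤ C} (x : F ⟶ F')
    (u : F' ⋙ (G i).toFunctor ⟶ H) :
    coextEq G h (Functor.whiskerRight x (G i).toFunctor ≫ u) =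
      Functor.whiskerRight x (G i).toFunctor ≫ coextEq G h u := by
  subst h
  ext X
  have := Comonad.delta_naturality C (G j) (x.app X)
  simp [coextEq, coext, kext, reassoc_of% this]

variable {G} in
lemma coextEq_comp_whiskerRight {i j : I} (h : j = i) {F H H' : C ⥤ C}
    (u : F ⋙ (G i).toFunctor ⟶ H) (x : H ⟶ H') :
    coextEq G h u ≫ Functor.whiskerRight x (G j).toFunctor = coextEq G h (u ≫ x) := by
  subst h
  ext X
  simp [coextEq, coext, kext]

variable {G} in
lemma coextEq_whiskerLeft {i j : I} (h : j = i) (E : C ⥤ C) {F H : C ⥤ C}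
    (u : F ⋙ (G i).toFunctor ⟶ H) :
    coextEq G h (F := E ⋙ F) (H := E ⋙ H) (Functor.whiskerLeft E u) =
      Functor.whiskerLeft E (coextEq G h u) := by
  subst h
  rfl

namespace IsReindexing

variable {f g : ℕ → ℕ} {a b c : ℕ → I} {m n l : ℕ}

lemma pred (h : IsReindexing f a b (m + 1) n) : IsReindexing f a b m (f m + 1) where
  lt i hi := Nat.lt_succ_of_le (h.mono i m hi.le (Nat.lt_succ_self m))
  mono i j hij hj := h.mono i j hij (hj.trans (Nat.lt_succ_self m))
  eq i hi := h.eq i (hi.trans (Nat.lt_succ_self m))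

lemma up (h : IsReindexing f a b m n) {n' : ℕ} (hn : n ≤ n') : IsReindexing f a b m n' where
  lt i hi := (h.lt i hi).trans_le hn
  mono := h.mono
  eq := h.eq

lemma down (h : IsReindexing f a b m n) (hl : l ≤ m) : IsReindexing f a b l n where
  lt i hi := h.lt i (hi.trans_le hl)
  mono i j hij hj := h.mono i j hij (hj.trans_le hl)
  eq i hi := h.eq i (hi.trans_le hl)

lemma comp (h : IsReindexing f a b m n) (h' : IsReindexing g b c l m) :
    IsReindexing (f ∘ g) a c l n where
  lt i hi := h.lt _ (h'.lt i hi)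
  mono i j hij hj := h.mono _ _ (h'.mono i j hij hj) (h'.lt j hj)
  eq i hi := (h'.eq i hi).trans (h.eq _ (h'.lt i hi))

end IsReindexing

/-- `coextEq` for words. -/
def wordCoext {a b : ℕ → I} {p m : ℕ} (h : b m = a p) (u : word G a (p + 1) ⟶ word G b m) :
    word G a (p + 1) ⟶ word G b (m + 1) :=
  coextEq G h (F := word G a p) (H := word G b m) u

/-- The effect on words of a reindexing. -/
def wordMap (f : ℕ → ℕ) (a b : ℕ → I) :
    ∀ m n : ℕ, IsReindexing f a b m n → (word G a n ⟶ word G b m)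
  | 0, n, _ => skip G a (Nat.zero_le n)
  | m + 1, _, h => skip G a (h.lt m (Nat.lt_succ_self m)) ≫
      wordCoext G (h.eq m (Nat.lt_succ_self m)) (wordMap f a b m (f m + 1) h.pred)

variable {f g : ℕ → ℕ} {a b c : ℕ → I} {m n l : ℕ}

lemma wordCoext_ε {p : ℕ} (h : b m = a p) (u : word G a (p + 1) ⟶ word G b m) :
    wordCoext G h u ≫ wordε G b m = u :=
  coextEq_ε _ _

lemma wordCoext_comp {p q : ℕ} (h : b m = a p) (h' : c q = b m) (u : word G a (p + 1) ⟶ word G b m)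
    (w : word G b (m + 1) ⟶ word G c q) :
    wordCoext G h u ≫ wordCoext G h' w = wordCoext G (h'.trans h) (wordCoext G h u ≫ w) :=
  coextEq_comp (G := G) h h' (F := word G a p) (H := word G b m) (K := word G c q) u w

lemma skip_wordMap (h : IsReindexing f a b m n) {n' : ℕ} (hn : n ≤ n') :
    skip G a hn ≫ wordMap G f a b m n h = wordMap G f a b m n' (h.up hn) := by
  cases m with
  | zero => exact skip_comp G a _ _
  | succ m =>
    rw [wordMap, wordMap, ← Category.assoc, skip_comp]

lemma wordMap_succ_skip (h : IsReindexing f a b (m + 1) n) :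
    wordMap G f a b (m + 1) n h ≫ wordε G b m =
      wordMap G f a b m n (h.down (Nat.le_succ m)) := by
  rw [wordMap, Category.assoc, wordCoext_ε, skip_wordMap]

lemma wordMap_skip (h : IsReindexing f a b m n) (hl : l ≤ m) :
    wordMap G f a b m n h ≫ skip G b hl = wordMap G f a b l n (h.down hl) := by
  induction m, hl using Nat.le_induction with
  | base => rw [skip_self, Category.comp_id]
  | succ m hm ih =>
    rw [← skip_comp G b hm (Nat.le_succ m), skip_succ, ← Category.assoc, wordMap_succ_skip, ih]

lemma wordMap_congr (h : IsReindexing f a b m n) (h' : IsReindexing g a b m n)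
    (hfg : ∀ i < m, f i = g i) : wordMap G f a b m n h = wordMap G g a b m n h' := by
  induction m generalizing n with
  | zero => rfl
  | succ m ih =>
    have key : ∀ p p' (_ : p = p') (h1 : p + 1 ≤ n) (h1' : p' + 1 ≤ n) (h2 : b m = a p)
        (h2' : b m = a p') (h3 : IsReindexing f a b m (p + 1)) (h3' : IsReindexing g a b m (p' + 1)),
        skip G a h1 ≫ wordCoext G h2 (wordMap G f a b m (p + 1) h3) =
          skip G a h1' ≫ wordCoext G h2' (wordMap G g a b m (p' + 1) h3') := by
      rintro p _ rfl h1 h1' h2 h2' h3 h3'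
      rw [ih h3 h3' fun i hi => hfg i (hi.trans (Nat.lt_succ_self m))]
    exact key _ _ (hfg m (Nat.lt_succ_self m)) _ _ _ _ _ _

lemma wordMap_last (h : IsReindexing f a b (m + 1) (f m + 1)) :
    wordMap G f a b (m + 1) (f m + 1) h =
      wordCoext G (h.eq m (Nat.lt_succ_self m)) (wordMap G f a b m (f m + 1) h.pred) := by
  rw [wordMap, skip_self, Category.id_comp]

lemma wordMap_comp (h : IsReindexing f a b m n) (h' : IsReindexing g b c l m) :
    wordMap G f a b m n h ≫ wordMap G g b c l m h' = wordMap G (f ∘ g) a c l n (h.comp h') := by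
  induction l generalizing m n with
  | zero => exact wordMap_skip G h _
  | succ l ih =>
    have h1 := h.down (h'.lt l (Nat.lt_succ_self l))
    have h3 : IsReindexing f a b (g l + 1) (f (g l) + 1) :=
      ⟨fun i hi => Nat.lt_succ_of_le (h.mono i (g l) (Nat.le_of_lt_succ hi)
        (h'.lt l (Nat.lt_succ_self l))), h1.mono, h1.eq⟩
    rw [wordMap, wordMap, ← Category.assoc, wordMap_skip, wordMap, Category.assoc, wordCoext_comp]
    congr 2
    rw [← wordMap_last G h3, ih h3 h'.pred]
    rfl

lemma isReindexing_id (a : ℕ → I) (n : ℕ) : IsReindexing id a a n n :=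
  ⟨fun _ hi => hi, fun _ _ h _ => h, fun _ _ => rfl⟩

lemma wordMap_id (a : ℕ → I) (n : ℕ) (h : IsReindexing id a a n n) :
    wordMap G id a a n n h = 𝟙 _ := by
  induction n with
  | zero => exact skip_self G a _
  | succ n ih =>
    have h' := isReindexing_id a n
    have : wordMap G id a a n (n + 1) h.pred = wordε G a n := by
      rw [← skip_wordMap G h' (Nat.le_succ n), ih, skip_succ, Category.comp_id]
    have h2 := wordMap_last G h
    refine h2.trans ((congrArg (wordCoext G rfl) this).trans ?_)
    exact coext_counit (G (a n)) (word G a n)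

/-- Isomorphic words on sequences that agree on the relevant range. -/
def wordCongr (h : IsReindexing id a b n n) (h' : IsReindexing id b a n n) :
    word G a n ≅ word G b n where
  hom := wordMap G id a b n n h
  inv := wordMap G id b a n n h'
  hom_inv_id := (wordMap_comp G h h').trans (wordMap_id G a n _)
  inv_hom_id := (wordMap_comp G h' h).trans (wordMap_id G b n _)

lemma reindexEq_eq_wordMap (f : ℕ →o ℕ) (h : b = a ∘ f) (k : ℕ)
    (h' : IsReindexing f a b (k + 1) (f k + 1)) :
    reindexEq G a b f h k = wordMap G f a b (k + 1) (f k + 1) h' := by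
  induction k with
  | zero =>
    rw [reindexEq_zero, wordMap_last]
    rfl
  | succ k ih =>
    have h2 : IsReindexing f a b (k + 1) (f k + 1) :=
      ⟨fun i hi => Nat.lt_succ_of_le (f.monotone (Nat.le_of_lt_succ hi)),
        fun i j hij _ => f.monotone hij, fun i _ => congrFun h i⟩
    rw [reindexEq_succ, wordMap_last, ih h2]
    exact congrArg (wordCoext G _) (skip_wordMap G h2 (succ_mono f (Nat.le_succ k)))

lemma isReindexing_extend {m n : ℕ} (f : Fin (m + 1) →o Fin (n + 1)) (α : Fin (n + 1) → I) :
    IsReindexing (extendHom f) (extend α) (extend (α ∘ f)) (m + 1) (n + 1) where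
  lt i _ := Nat.lt_succ_of_le (extendHom_le f i)
  mono _ _ hij _ := (extendHom f).monotone hij
  eq i _ := congrFun (extend_comp α f) i

lemma barWordMap_eq_wordMap {m n : ℕ} (f : Fin (m + 1) →o Fin (n + 1)) (α : Fin (n + 1) → I) :
    barWordMap G f α = wordMap G (extendHom f) (extend α) (extend (α ∘ f)) (m + 1) (n + 1)
      (isReindexing_extend f α) := by
  have h : IsReindexing (extendHom f) (extend α) (extend (α ∘ f)) (m + 1) (extendHom f m + 1) :=
    ⟨fun i hi => Nat.lt_succ_of_le ((extendHom f).monotone (Nat.le_of_lt_succ hi)),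
      (isReindexing_extend f α).mono, (isReindexing_extend f α).eq⟩
  rw [barWordMap, reindexEq_eq_wordMap G _ _ _ h]
  exact skip_wordMap G h _

/-- Prepend a term to a sequence. -/
def consSeq (i : I) (a : ℕ → I) : ℕ → I
  | 0 => i
  | n + 1 => a n

/-- Peel off the innermost letter of a word. -/
def consIso (i : I) (a : ℕ → I) : ∀ n, word G (consSeq i a) (n + 1) ≅ (G i).toFunctor ⋙ word G a n
  | 0 => Iso.refl _
  | n + 1 => Functor.isoWhiskerRight (consIso i a n) (G (a n)).toFunctor

lemma wordε_consIso (i : I) (a : ℕ → I) (n : ℕ) :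
    wordε G (consSeq i a) (n + 1) ≫ (consIso G i a n).hom =
      (consIso G i a (n + 1)).hom ≫ Functor.whiskerLeft (G i).toFunctor (wordε G a n) := by
  ext X
  exact ((G (a n)).ε.naturality ((consIso G i a n).hom.app X)).symm

lemma skip_consIso (i : I) (a : ℕ → I) {p n : ℕ} (h : p ≤ n) :
    skip G (consSeq i a) (Nat.succ_le_succ h) ≫ (consIso G i a p).hom =
      (consIso G i a n).hom ≫ Functor.whiskerLeft (G i).toFunctor (skip G a h) := by
  induction n, h using Nat.le_induction with
  | base =>
    rw [skip_self, skip_self]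
    exact (Category.id_comp _).trans (Category.comp_id _).symm
  | succ n h ih =>
    rw [← skip_comp G _ (Nat.succ_le_succ h) (Nat.le_succ (n + 1)), Category.assoc, ih,
      skip_succ, ← skip_comp G a h (Nat.le_succ n), skip_succ, ← Category.assoc, wordε_consIso,
      Category.assoc, Functor.whiskerLeft_comp]

/-- The counit of the innermost letter. -/
def wordInnerε (i : I) (a : ℕ → I) (n : ℕ) : word G (consSeq i a) (n + 1) ⟶ word G a n :=
  (consIso G i a n).hom ≫ Functor.whiskerRight (G i).ε (word G a n)

lemma wordInnerε_succ (i : I) (a : ℕ → I) (n : ℕ) :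
    wordInnerε G i a (n + 1) = Functor.whiskerRight (wordInnerε G i a n) (G (a n)).toFunctor := by
  ext X
  exact ((G (a n)).map_comp _ _).symm

lemma skip_wordInnerε (i : I) (a : ℕ → I) {p n : ℕ} (h : p ≤ n) :
    skip G (consSeq i a) (Nat.succ_le_succ h) ≫ wordInnerε G i a p =
      wordInnerε G i a n ≫ skip G a h := by
  have h1 := skip_consIso G i a h
  have h2 : Functor.whiskerRight (G i).ε (word G a n) ≫ skip G a h =
      Functor.whiskerLeft (G i).toFunctor (skip G a h) ≫
        Functor.whiskerRight (G i).ε (word G a p) := by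
    ext X
    exact (skip G a h).naturality ((G i).ε.app X)
  rw [wordInnerε, wordInnerε, ← Category.assoc, h1, Category.assoc, Category.assoc, ← h2]

lemma skip_zero_wordInnerε (i : I) (a : ℕ → I) (n : ℕ) :
    skip G (consSeq i a) (Nat.zero_le (n + 1)) =
      wordInnerε G i a n ≫ skip G a (Nat.zero_le n) := by
  rw [← skip_comp G _ (Nat.zero_le 1) (Nat.succ_le_succ (Nat.zero_le n)), skip_succ,
    ← skip_wordInnerε]
  congr 1
  ext X
  exact (Category.id_comp ((G i).ε.app X)).symm

lemma wordInnerε_wordCoext {i : I} {p : ℕ} (h : b m = a p) (u : word G a (p + 1) ⟶ word G b m) :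
    wordCoext G (a := consSeq i a) (p := p + 1) h (wordInnerε G i a (p + 1) ≫ u) =
      wordInnerε G i a (p + 1) ≫ wordCoext G h u := by
  rw [wordInnerε_succ]
  exact coextEq_whiskerRight (G := G) h (wordInnerε G i a p) u

lemma isReindexing_drop (h : IsReindexing g a b m n) (i : I) :
    IsReindexing (fun j => g j + 1) (consSeq i a) b m (n + 1) where
  lt j hj := Nat.succ_lt_succ (h.lt j hj)
  mono j k hjk hk := Nat.succ_le_succ (h.mono j k hjk hk)
  eq j hj := h.eq j hj

/-- A reindexing that avoids the innermost letter. -/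
lemma wordMap_drop (h : IsReindexing g a b m n) (i : I) :
    wordMap G (fun j => g j + 1) (consSeq i a) b m (n + 1) (isReindexing_drop h i) =
      wordInnerε G i a n ≫ wordMap G g a b m n h := by
  induction m generalizing n with
  | zero => exact skip_zero_wordInnerε G i a n
  | succ m ih =>
    have e := wordInnerε_wordCoext G (i := i) (h.eq m (Nat.lt_succ_self m))
      (wordMap G g a b m (g m + 1) h.pred)
    rw [wordMap, wordMap, ih h.pred]
    refine (congrArg (fun t => skip G (consSeq i a) _ ≫ t) e).trans ?_
    rw [← Category.assoc, ← Category.assoc, skip_wordInnerε]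

lemma isReindexing_tail {i : I} (h : IsReindexing g (consSeq i a) (consSeq i b) (m + 1) n) :
    IsReindexing (fun j => g (j + 1)) (consSeq i a) b m n where
  lt _ hj := h.lt _ (Nat.succ_lt_succ hj)
  mono _ _ hjk hk := h.mono _ _ (Nat.succ_le_succ hjk) (Nat.succ_lt_succ hk)
  eq j hj := h.eq (j + 1) (Nat.succ_lt_succ hj)

/-- The comultiplication of the innermost letter. -/
def wordInnerδ (i : I) (a : ℕ → I) (n : ℕ) :
    word G (consSeq i a) (n + 1) ⟶ (G i).toFunctor ⋙ word G (consSeq i a) (n + 1) :=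
  (consIso G i a n).hom ≫ Functor.whiskerRight (G i).δ (word G a n) ≫
    Functor.whiskerLeft (G i).toFunctor (consIso G i a n).inv

lemma wordInnerδ_succ (i : I) (a : ℕ → I) (n : ℕ) :
    wordInnerδ G i a (n + 1) = Functor.whiskerRight (wordInnerδ G i a n) (G (a n)).toFunctor := by
  ext X
  exact ((G (a n)).map_comp_assoc _ _ _).symm.trans ((G (a n)).map_comp _ _).symm |>.trans
    (congrArg (G (a n)).map (Category.assoc _ _ _))

lemma skip_wordInnerδ (i : I) (a : ℕ → I) {p n : ℕ} (h : p ≤ n) :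
    skip G (consSeq i a) (Nat.succ_le_succ h) ≫ wordInnerδ G i a p =
      wordInnerδ G i a n ≫
        Functor.whiskerLeft (G i).toFunctor (skip G (consSeq i a) (Nat.succ_le_succ h)) := by
  have h1 := skip_consIso G i a h
  have h2 : Functor.whiskerRight (G i).δ (word G a n) ≫
        Functor.whiskerLeft (G i).toFunctor (Functor.whiskerLeft (G i).toFunctor (skip G a h)) =
      Functor.whiskerLeft (G i).toFunctor (skip G a h) ≫
        Functor.whiskerRight (G i).δ (word G a p) := by
    ext X
    exact (skip G a h).naturality ((G i).δ.app X)
  have h3 : (consIso G i a n).inv ≫ skip G (consSeq i a) (Nat.succ_le_succ h) =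
      Functor.whiskerLeft (G i).toFunctor (skip G a h) ≫ (consIso G i a p).inv := by
    rw [Iso.inv_comp_eq, ← Category.assoc, Iso.eq_comp_inv, h1]
  rw [wordInnerδ, wordInnerδ, ← Category.assoc, h1, Category.assoc, Category.assoc, Category.assoc,
    ← Functor.whiskerLeft_comp, h3, Functor.whiskerLeft_comp, ← Category.assoc (Functor.whiskerLeft _ _),
    ← h2, Category.assoc]

lemma wordInnerδ_zero (i : I) (a : ℕ → I) :
    wordInnerδ G i a 0 ≫ Functor.whiskerLeft (G i).toFunctor (wordε G (consSeq i a) 0) =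
      (consIso G i a 0).hom := by
  ext X
  change (𝟙 ((G i).obj X) ≫ (G i).δ.app X ≫ 𝟙 _) ≫ (G i).ε.app ((G i).obj X) = 𝟙 ((G i).obj X)
  simp

lemma wordInnerδ_wordCoext {i : I} {p : ℕ} (h : b m = consSeq i a p)
    (u : word G (consSeq i a) (p + 1) ⟶ word G b m)
    (v : word G (consSeq i a) (p + 1) ⟶ word G (consSeq i b) (m + 1))
    (huv : v ≫ (consIso G i b m).hom =
      wordInnerδ G i a p ≫ Functor.whiskerLeft (G i).toFunctor u) :
    wordCoext G (b := consSeq i b) (m := m + 1) h v ≫ (consIso G i b (m + 1)).hom =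
      wordInnerδ G i a p ≫ Functor.whiskerLeft (G i).toFunctor (wordCoext G h u) := by
  have e1 : wordCoext G (b := consSeq i b) (m := m + 1) h v ≫ (consIso G i b (m + 1)).hom =
      coextEq G h (F := word G (consSeq i a) p) (v ≫ (consIso G i b m).hom) :=
    coextEq_comp_whiskerRight (G := G) h (F := word G (consSeq i a) p)
      (H := word G (consSeq i b) (m + 1)) v (consIso G i b m).hom
  refine e1.trans ((congrArg (coextEq G h (F := word G (consSeq i a) p)) huv).trans ?_)
  clear e1 huv v
  cases p with
  | succ p =>
    rw [wordInnerδ_succ]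
    exact (coextEq_whiskerRight (G := G) h (wordInnerδ G i a p)
      (Functor.whiskerLeft (G i).toFunctor u)).trans
      (congrArg (fun t => Functor.whiskerRight (wordInnerδ G i a p) (G (a p)).toFunctor ≫ t)
        (coextEq_whiskerLeft (G := G) h (G i).toFunctor (F := word G (consSeq i a) (p + 1)) u))
  | zero =>
    have e2 : wordInnerδ G i a 0 = (G i).δ := by
      ext X
      change 𝟙 ((G i).obj X) ≫ (G i).δ.app X ≫ 𝟙 _ = (G i).δ.app X
      rw [Category.id_comp, Category.comp_id]
    have e3 : ∀ {j : I} (h : j = i) {H : C ⥤ C} (u : 𝟭 C ⋙ (G i).toFunctor ⟶ H),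
        coextEq G h (F := 𝟭 C) (H := (G i).toFunctor ⋙ H)
          ((G i).δ ≫ Functor.whiskerLeft (G i).toFunctor u) =
        (G i).δ ≫ Functor.whiskerLeft (G i).toFunctor (coextEq G h (F := 𝟭 C) u) := by
      intro j h H u
      subst h
      ext X
      simp [coextEq, coext, kext]
    rw [e2]
    exact e3 h u

/-- A reindexing that preserves the innermost letter. -/
lemma wordMap_keep {i : I} (h : IsReindexing g (consSeq i a) (consSeq i b) (m + 1) (n + 1))
    (h0 : g 0 = 0) :
    wordMap G g (consSeq i a) (consSeq i b) (m + 1) (n + 1) h ≫ (consIso G i b m).hom =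
      wordInnerδ G i a n ≫ Functor.whiskerLeft (G i).toFunctor
        (wordMap G (fun j => g (j + 1)) (consSeq i a) b m (n + 1) (isReindexing_tail h)) := by
  induction m generalizing n with
  | zero =>
    have e1 : IsReindexing id (consSeq i a) (consSeq i b) 1 1 :=
      ⟨fun _ hj => hj, fun _ _ hjk _ => hjk, fun j hj => by
        obtain rfl : j = 0 := by omega
        rfl⟩
    have e2 : wordMap G id (consSeq i a) (consSeq i b) 1 1 e1 = 𝟙 (word G (consSeq i a) 1) :=
      wordMap_id G (consSeq i a) 1 (isReindexing_id _ _)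
    have e3 : wordMap G g (consSeq i a) (consSeq i b) (0 + 1) (n + 1) h =
        skip G (consSeq i a) (Nat.succ_le_succ (Nat.zero_le n)) := by
      rw [wordMap_congr G h (e1.up (Nat.succ_le_succ (Nat.zero_le n))) (fun j hj => by
        obtain rfl : j = 0 := by omega
        exact h0), ← skip_wordMap G e1 (Nat.succ_le_succ (Nat.zero_le n)), e2]
      exact Category.comp_id _
    have e4 : wordMap G (fun j => g (j + 1)) (consSeq i a) b 0 (n + 1) (isReindexing_tail h) =
        skip G (consSeq i a) (Nat.succ_le_succ (Nat.zero_le n)) ≫ wordε G (consSeq i a) 0 := by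
      rw [← skip_succ G (consSeq i a) 0 (Nat.zero_le 1), skip_comp]
      rfl
    have e5 := skip_wordInnerδ G i a (Nat.zero_le n)
    rw [e4]
    refine (congrArg (fun t => t ≫ (consIso G i b 0).hom) e3).trans ?_
    refine (congrArg (fun t => skip G (consSeq i a) _ ≫ t) (wordInnerδ_zero G i a).symm).trans ?_
    exact (Category.assoc _ _ _).symm.trans ((congrArg (fun t => t ≫ Functor.whiskerLeft _
      (wordε G (consSeq i a) 0)) e5).trans (Category.assoc _ _ _))
  | succ m ih =>
    have e := wordInnerδ_wordCoext G (b := b) (m := m) (h.eq (m + 1) (Nat.lt_succ_self _)) _ _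
      (ih h.pred)
    have e5 := skip_wordInnerδ G i a (Nat.le_of_lt_succ (h.lt (m + 1) (Nat.lt_succ_self _)))
    rw [wordMap]
    refine (Category.assoc _ _ _).trans ?_
    refine (congrArg (fun t => skip G (consSeq i a) _ ≫ t) e).trans ?_
    exact (Category.assoc _ _ _).symm.trans ((congrArg (fun t => t ≫ Functor.whiskerLeft _
      _) e5).trans (Category.assoc _ _ _))

end Words

end

section

section SimplicialJoin

open SimplexCategory

/-- A functorial way of adding a vertex to the simplices `[n]`, with a natural homotopy between
the inclusions `[n] ⟶ [n + 1]` and the maps that are constant at the new vertex. -/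
structure VertexExtension where
  map {m n : SimplexCategory} (f : m ⟶ n) : mk (m.len + 1) ⟶ mk (n.len + 1)
  cone {n : SimplexCategory} (a : n ⟶ mk 1) : n ⟶ mk (n.len + 1)
  incl (n : SimplexCategory) : n ⟶ mk (n.len + 1)
  pt (n : SimplexCategory) : mk 0 ⟶ mk (n.len + 1)
  start : Fin 2
  target : Fin 2
  comp_cone {m n : SimplexCategory} (f : m ⟶ n) (a : n ⟶ mk 1) :
    f ≫ cone a = cone (f ≫ a) ≫ map f
  cone_start (n : SimplexCategory) : cone (SimplexCategory.const n (mk 1) start) = incl n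
  cone_target (n : SimplexCategory) :
    cone (SimplexCategory.const n (mk 1) target) = SimplexCategory.const n (mk 0) 0 ≫ pt n

/-- The map `[m + 1] ⟶ [n + 1]` that extends `[m] ⟶ [n]` and preserves the last vertex. -/
def snocHom {m n : SimplexCategory} (f : m ⟶ n) : mk (m.len + 1) ⟶ mk (n.len + 1) :=
  SimplexCategory.Hom.mk
    ⟨fun i => if h : (i : ℕ) < m.len + 1 then (f.toOrderHom ⟨i, h⟩).castSucc else Fin.last _, by
      intro i j hij
      dsimp only
      split_ifs with h1 h2 h2
      · exact Fin.castSucc_le_castSucc_iff.2 (f.toOrderHom.monotone hij)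
      · exact Fin.le_last _
      · exact absurd (lt_of_le_of_lt (Fin.le_def.1 hij) h2) h1
      · exact le_rfl⟩

/-- The map `[n] ⟶ [n + 1]` that sends `i` to `i` if `a i = 0` and to `n + 1` otherwise. -/
def lastConeHom {n : SimplexCategory} (a : n ⟶ mk 1) : n ⟶ mk (n.len + 1) :=
  SimplexCategory.Hom.mk
    ⟨fun i => if a.toOrderHom i = 0 then i.castSucc else Fin.last _, by
      intro i j hij
      dsimp only
      have := a.toOrderHom.monotone hij
      split_ifs with h1 h2 h2
      · exact Fin.castSucc_le_castSucc_iff.2 hij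
      · exact Fin.le_last _
      · rw [h2] at this
        exact absurd (Fin.le_zero_iff.1 this) h1
      · exact le_rfl⟩

/-- Adding a last vertex. -/
def lastVertex : VertexExtension where
  map f := snocHom f
  cone a := lastConeHom a
  incl n := SimplexCategory.Hom.mk (Fin.castSuccOrderEmb).toOrderHom
  pt n := SimplexCategory.const _ _ (Fin.last _)
  start := 0
  target := 1
  comp_cone {m n} f a := by
    ext i : 3
    change (if a.toOrderHom (f.toOrderHom i) = 0 then (f.toOrderHom i).castSucc else Fin.last _) =
      (snocHom f).toOrderHom (if a.toOrderHom (f.toOrderHom i) = 0 then i.castSucc else Fin.last _)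
    split_ifs
    · change _ = dite _ _ _
      rw [dif_pos (show (i.castSucc : ℕ) < m.len + 1 from i.2)]
      rfl
    · change _ = dite _ _ _
      rw [dif_neg (by simp)]
  cone_start n := by
    ext i : 3
    rfl
  cone_target n := by
    ext i : 3
    rfl

/-- Adding a first vertex. -/
def firstVertex : VertexExtension where
  map f := rev.map (snocHom (rev.map f))
  cone {n} a := rev.map (lastConeHom (n := n) (rev.map a))
  incl n := rev.map (lastVertex.incl n)
  pt n := rev.map (lastVertex.pt n)
  start := 1
  target := 0
  comp_cone {m n} f a := by
    have h := lastVertex.comp_cone (rev.map f) (rev.map a)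
    have h' := congrArg (fun t => rev.map t) h
    simp only [Functor.map_comp] at h'
    refine Eq.trans ?_ (h'.trans ?_)
    · rw [rev_map_rev_map]
      rfl
    · rw [Functor.map_comp rev f a]
      rfl
  cone_start n := congrArg (fun t => rev.map t) (lastVertex.cone_start n)
  cone_target n := by
    refine (congrArg (fun t => rev.map t) (lastVertex.cone_target n)).trans ?_
    rw [Functor.map_comp]
    rfl

variable (E : VertexExtension) (Γ : SimplexCategory ⥤ SSet.{v})
  (u : ∀ n : SimplexCategory, (Γ.obj n).obj (op n))
  (hu : ∀ {m n : SimplexCategory} (f : m ⟶ n),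
    (Γ.map f).app (op m) (u m) = (Γ.obj n).map f.op (u n))
  (s : ∀ n : SimplexCategory, Γ.obj (mk (n.len + 1)) ⟶ Γ.obj n)
  (hs : ∀ {m n : SimplexCategory} (f : m ⟶ n), s m ≫ Γ.map f = Γ.map (E.map f) ≫ s n)

/-- The diagonal simplices of the homotopy defined by an extra codegeneracy. -/
def extraSimplex {n : SimplexCategory} (a : n ⟶ SimplexCategory.mk 1) : (Γ.obj n).obj (op n) :=
  (Γ.map (E.cone a) ≫ s n).app (op n) (u n)

include hu hs in
lemma extraSimplex_naturality {m n : SimplexCategory} (f : m ⟶ n) (a : n ⟶ SimplexCategory.mk 1) :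
    (Γ.map f).app (op m) (extraSimplex E Γ u s (f ≫ a)) =
      (Γ.obj n).map f.op (extraSimplex E Γ u s a) := by
  have h : (Γ.map (E.cone (f ≫ a)) ≫ s m) ≫ Γ.map f = Γ.map f ≫ Γ.map (E.cone a) ≫ s n := by
    rw [Category.assoc, hs, ← Functor.map_comp_assoc, ← E.comp_cone, Functor.map_comp_assoc]
  have h1 := congrArg (fun t => (t.app (op m)) (u m)) h
  have h2 := (Γ.map (E.cone a) ≫ s n).naturality_apply f.op (u n)
  refine h1.trans (Eq.trans ?_ h2)
  exact congrArg (fun t => (Γ.map (E.cone a) ≫ s n).app (op m) t) (hu f)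

/-- The homotopy defined by an extra codegeneracy. -/
def extraHomotopy (n : SimplexCategory) :
    SSet.stdSimplex.obj n ⊗ SSet.stdSimplex.obj (SimplexCategory.mk 1) ⟶ Γ.obj n where
  app k := ↾fun x => (Γ.map (SSet.stdSimplex.objEquiv x.1)).app k
    (extraSimplex E Γ u s (SSet.stdSimplex.objEquiv x.2))
  naturality k l f := by
    ext ⟨x, a⟩
    have h1 := extraSimplex_naturality E Γ u hu s hs f.unop (SSet.stdSimplex.objEquiv a)
    have h2 := (Γ.map (SSet.stdSimplex.objEquiv x)).naturality_apply f
      (extraSimplex E Γ u s (SSet.stdSimplex.objEquiv a))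
    refine Eq.trans ?_ h2
    refine Eq.trans ?_ (congrArg (fun t => (Γ.map (SSet.stdSimplex.objEquiv x)).app l t) h1)
    exact congrArg (fun t => (t.app l) (extraSimplex E Γ u s (SSet.stdSimplex.objEquiv 
      (m := l) ((SSet.stdSimplex.obj _).map f a)))) (Γ.map_comp f.unop (SSet.stdSimplex.objEquiv x))

include hu hs in
lemma extraHomotopy_compatible {m n : SimplexCategory} (f : m ⟶ n) :
    extraHomotopy E Γ u hu s hs m ≫ Γ.map f =
      SSet.stdSimplex.map f ▷ _ ≫ extraHomotopy E Γ u hu s hs n := by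
  ext k ⟨x, a⟩
  exact (congrArg (fun t => (t.app k) (extraSimplex E Γ u s (SSet.stdSimplex.objEquiv a)))
    (Γ.map_comp (SSet.stdSimplex.objEquiv x) f)).symm

lemma extraHomotopy_vertex (i : Fin 2) (n : SimplexCategory)
    (w : ∀ k, (Γ.obj k).obj (op k))
    (hw : ∀ {m n : SimplexCategory} (f : m ⟶ n), (Γ.map f).app (op m) (w m) =
      (Γ.obj n).map f.op (w n))
    (hi : ∀ k, extraSimplex E Γ u s (SimplexCategory.const k (SimplexCategory.mk 1) i) = w k) :
    (ρ_ _).inv ≫ SSet.stdSimplex.obj n ◁ (SSet.const (SSet.stdSimplex.obj₀Equiv.symm i)) ≫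
      extraHomotopy E Γ u hu s hs n = SSet.yonedaEquiv.symm (w n) := by
  ext k x
  refine Eq.trans ?_ (hw (SSet.stdSimplex.objEquiv x))
  exact congrArg (fun t => (Γ.map (SSet.stdSimplex.objEquiv x)).app k t) (hi k.unop)

lemma extraSimplex_start {n : SimplexCategory} (h₀ : Γ.map (E.incl n) ≫ s n = 𝟙 _) :
    extraSimplex E Γ u s (SimplexCategory.const n (SimplexCategory.mk 1) E.start) = u n := by
  rw [extraSimplex, E.cone_start, h₀]
  rfl

include hu in
lemma extraSimplex_target (n : SimplexCategory) :
    extraSimplex E Γ u s (SimplexCategory.const n (SimplexCategory.mk 1) E.target) =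
      (Γ.map (E.pt n) ≫ s n).app (op n) ((Γ.obj _).map (SimplexCategory.const n (SimplexCategory.mk 0) 0).op (u _)) := by
  rw [extraSimplex, E.cone_target, ← hu, Functor.map_comp, Category.assoc]
  rfl

end SimplicialJoin
section WeightedEnds

variable {V : Type u₁} [Category.{v} V] [MonoidalCategory V] [SymmetricCategory V]
  [MonoidalClosed V] [HasLimits V] (S : SimplexCategory ⥤ V)

/-- The end `∫_n P(Sₙ, Xⁿ)`. -/
def weightedEnd {N : Type u₂} [Category.{v} N] [HasLimitsOfSize.{0, 0} N] (P : Vᵒᵖ ⥤ N ⥤ N) :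
    (SimplexCategory ⥤ N) ⥤ N :=
  Functor.whiskeringLeft SimplexCategory N N ⋙
    (Functor.whiskeringLeft SimplexCategoryᵒᵖ (N ⥤ N) (SimplexCategory ⥤ N)).obj
      (S.op ⋙ P) ⋙ endFunctor SimplexCategory N

section

variable {N : Type u₂} [Category.{v} N] [HasLimitsOfSize.{0, 0} N] (P : Vᵒᵖ ⥤ N ⥤ N)
  (X : SimplexCategory ⥤ N)

/-- The projections of the end `∫_n P(Sₙ, Xⁿ)`. -/
def weightedEndπ (n : SimplexCategory) :
    (weightedEnd S P).obj X ⟶ (P.obj (op (S.obj n))).obj (X.obj n) :=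
  end_.π (((Functor.whiskeringLeft SimplexCategory N N ⋙
    (Functor.whiskeringLeft SimplexCategoryᵒᵖ (N ⥤ N) (SimplexCategory ⥤ N)).obj
      (S.op ⋙ P)).obj X)) n

lemma weightedEndπ_condition {m n : SimplexCategory} (f : m ⟶ n) :
    weightedEndπ S P X m ≫ (P.obj (op (S.obj m))).map (X.map f) =
      weightedEndπ S P X n ≫ (P.map (S.map f).op).app (X.obj n) :=
  end_.condition (((Functor.whiskeringLeft SimplexCategory N N ⋙
    (Functor.whiskeringLeft SimplexCategoryᵒᵖ (N ⥤ N) (SimplexCategory ⥤ N)).obj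
      (S.op ⋙ P)).obj X)) f

variable {S P X}

lemma weightedEnd_hom_ext {A : N} {f g : A ⟶ (weightedEnd S P).obj X}
    (h : ∀ n, f ≫ weightedEndπ S P X n = g ≫ weightedEndπ S P X n) : f = g :=
  end_.hom_ext h

/-- The universal property of the end `∫_n P(Sₙ, Xⁿ)`. -/
def weightedEndLift {A : N} (φ : ∀ n, A ⟶ (P.obj (op (S.obj n))).obj (X.obj n))
    (h : ∀ {m n : SimplexCategory} (f : m ⟶ n),
      φ m ≫ (P.obj (op (S.obj m))).map (X.map f) = φ n ≫ (P.map (S.map f).op).app (X.obj n)) :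
    A ⟶ (weightedEnd S P).obj X :=
  end_.lift (F := ((Functor.whiskeringLeft SimplexCategory N N ⋙
    (Functor.whiskeringLeft SimplexCategoryᵒᵖ (N ⥤ N) (SimplexCategory ⥤ N)).obj
      (S.op ⋙ P)).obj X)) φ (fun _ _ f => h f)

lemma weightedEndLift_π {A : N} (φ : ∀ n, A ⟶ (P.obj (op (S.obj n))).obj (X.obj n))
    (h : ∀ {m n : SimplexCategory} (f : m ⟶ n),
      φ m ≫ (P.obj (op (S.obj m))).map (X.map f) = φ n ≫ (P.map (S.map f).op).app (X.obj n))
    (n : SimplexCategory) : weightedEndLift φ h ≫ weightedEndπ S P X n = φ n :=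
  end_.lift_π (F := ((Functor.whiskeringLeft SimplexCategory N N ⋙
    (Functor.whiskeringLeft SimplexCategoryᵒᵖ (N ⥤ N) (SimplexCategory ⥤ N)).obj
      (S.op ⋙ P)).obj X)) φ (fun _ _ f => h f) n

lemma weightedEnd_map_π {X Y : SimplexCategory ⥤ N} (f : X ⟶ Y) (n : SimplexCategory) :
    (weightedEnd S P).map f ≫ weightedEndπ S P Y n =
      weightedEndπ S P X n ≫ (P.obj (op (S.obj n))).map (f.app n) :=
  end_.map_π _ n

end

/-- The object `∫_n [Sₙ, Γₙ]`. -/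
abbrev tot (Γ : SimplexCategory ⥤ V) : V := (weightedEnd S MonoidalClosed.internalHom).obj Γ

variable (Γ : SimplexCategory ⥤ V)

/-- The projections `∫_n [Sₙ, Γₙ] ⟶ [Sₙ, Γₙ]`. -/
def totπ (n : SimplexCategory) : tot S Γ ⟶ (ihom (S.obj n)).obj (Γ.obj n) :=
  weightedEndπ S MonoidalClosed.internalHom Γ n

lemma totπ_condition {m n : SimplexCategory} (f : m ⟶ n) :
    totπ S Γ m ≫ (ihom (S.obj m)).map (Γ.map f) =
      totπ S Γ n ≫ (MonoidalClosed.pre (S.map f)).app (Γ.obj n) :=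
  weightedEndπ_condition S MonoidalClosed.internalHom Γ f

/-- The projections `Sₙ ⊗ ∫_n [Sₙ, Γₙ] ⟶ Γₙ`. -/
def totEv (n : SimplexCategory) : S.obj n ⊗ tot S Γ ⟶ Γ.obj n :=
  MonoidalClosed.uncurry (totπ S Γ n)

/-- A family `Sₙ ⊗ A ⟶ Γₙ` is dinatural. -/
def IsTotFamily {A : V} (φ : ∀ n, S.obj n ⊗ A ⟶ Γ.obj n) : Prop :=
  ∀ {m n : SimplexCategory} (f : m ⟶ n), φ m ≫ Γ.map f = S.map f ▷ A ≫ φ n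

lemma isTotFamily_totEv : IsTotFamily S Γ (totEv S Γ) := by
  intro m n f
  have h := congrArg MonoidalClosed.uncurry (totπ_condition S Γ f)
  rwa [MonoidalClosed.uncurry_natural_right, MonoidalClosed.uncurry_pre_app] at h

variable {S Γ}

lemma IsTotFamily.curry {A : V} {φ : ∀ n, S.obj n ⊗ A ⟶ Γ.obj n}
    (h : IsTotFamily S Γ φ) {m n : SimplexCategory} (f : m ⟶ n) :
    MonoidalClosed.curry (φ m) ≫ (ihom (S.obj m)).map (Γ.map f) =
      MonoidalClosed.curry (φ n) ≫ (MonoidalClosed.pre (S.map f)).app (Γ.obj n) := by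
  rw [MonoidalClosed.curry_pre_app, ← MonoidalClosed.curry_natural_right, h f]

/-- The universal property of `∫_n [Sₙ, Γₙ]`. -/
def totLift {A : V} (φ : ∀ n, S.obj n ⊗ A ⟶ Γ.obj n) (h : IsTotFamily S Γ φ) : A ⟶ tot S Γ :=
  weightedEndLift (P := MonoidalClosed.internalHom) (fun n => MonoidalClosed.curry (φ n)) h.curry

lemma totLift_totπ {A : V} (φ : ∀ n, S.obj n ⊗ A ⟶ Γ.obj n)
    (h : IsTotFamily S Γ φ) (n : SimplexCategory) :
    totLift φ h ≫ totπ S Γ n = MonoidalClosed.curry (φ n) :=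
  weightedEndLift_π (P := MonoidalClosed.internalHom) (fun n => MonoidalClosed.curry (φ n)) h.curry n

lemma totLift_totEv {A : V} (φ : ∀ n, S.obj n ⊗ A ⟶ Γ.obj n)
    (h : IsTotFamily S Γ φ) (n : SimplexCategory) : _ ◁ totLift φ h ≫ totEv S Γ n = φ n := by
  rw [totEv, ← MonoidalClosed.uncurry_natural_left, totLift_totπ, MonoidalClosed.uncurry_curry]

lemma tot_hom_ext {A : V} {f g : A ⟶ tot S Γ}
    (h : ∀ n, _ ◁ f ≫ totEv S Γ n = _ ◁ g ≫ totEv S Γ n) : f = g := by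
  apply weightedEnd_hom_ext
  intro n
  apply MonoidalClosed.uncurry_injective
  exact (MonoidalClosed.uncurry_natural_left _ _).trans ((h n).trans
    (MonoidalClosed.uncurry_natural_left _ _).symm)

lemma tot_map_totEv {Γ Γ' : SimplexCategory ⥤ V} (f : Γ ⟶ Γ') (n : SimplexCategory) :
    S.obj n ◁ (weightedEnd S MonoidalClosed.internalHom).map f ≫ totEv S Γ' n =
      totEv S Γ n ≫ f.app n := by
  have h : (weightedEnd S MonoidalClosed.internalHom).map f ≫ totπ S Γ' n =
      totπ S Γ n ≫ (ihom (S.obj n)).map (f.app n) := weightedEnd_map_π f n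
  rw [totEv, totEv, ← MonoidalClosed.uncurry_natural_left, h, MonoidalClosed.uncurry_natural_right]

end WeightedEnds

end

section

local infixr:70 " ⋆ " => gcomp

section WeightedColimits

variable {V : Type u₁} [Category.{v} V] [MonoidalCategory V] [SymmetricCategory V]
  [MonoidalClosed V] [HasLimits V] (S : SimplexCategory ⥤ V)
  {N : Type u₂} [Category.{v} N] [EnrichedOrdinaryCategory V N]

section TensorMaps

variable [Tensored V N]

/-- The functoriality of `K ⊙ Y` in `Y`. -/
def tmapRight (K : V) {Y Y' : N} (f : Y ⟶ Y') : tobj V K Y ⟶ tobj V K Y' :=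
  tdesc (tcoev V K Y' ≫ eHomWhiskerRight V f _)

/-- The functoriality of `K ⊙ Y` in `K`. -/
def tmapLeft {K K' : V} (k : K ⟶ K') (Y : N) : tobj V K Y ⟶ tobj V K' Y :=
  tdesc (k ≫ tcoev V K' Y)

lemma tcoev_tmapRight (K : V) {Y Y' Z : N} (f : Y ⟶ Y') (g : tobj V K Y' ⟶ Z) :
    tcoev V K Y ≫ eHomWhiskerLeft V Y (tmapRight K f ≫ g) =
      (tcoev V K Y' ≫ eHomWhiskerLeft V Y' g) ≫ eHomWhiskerRight V f Z := by
  rw [tmapRight, eHomWhiskerLeft_comp, reassoc_of% tdesc_fac, Category.assoc, Category.assoc,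
    ← eHom_whisker_exchange]

lemma tcoev_tmapLeft {K K' : V} (k : K ⟶ K') {Y Z : N} (g : tobj V K' Y ⟶ Z) :
    tcoev V K Y ≫ eHomWhiskerLeft V Y (tmapLeft k Y ≫ g) =
      k ≫ tcoev V K' Y ≫ eHomWhiskerLeft V Y g := by
  rw [tmapLeft, eHomWhiskerLeft_comp, reassoc_of% tdesc_fac, Category.assoc]

end TensorMaps

section CotensorMaps

variable [Cotensored V N]

/-- The functoriality of `{K, Y}` in `Y`. -/
def cmapRight (K : V) {Y Y' : N} (f : Y ⟶ Y') : cobj V K Y ⟶ cobj V K Y' :=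
  cdesc (cev V K Y ≫ eHomWhiskerLeft V _ f)

/-- The functoriality of `{K, Y}` in `K`. -/
def cmapLeft {K K' : V} (k : K ⟶ K') (Y : N) : cobj V K' Y ⟶ cobj V K Y :=
  cdesc (k ≫ cev V K' Y)

lemma cev_cmapRight (K : V) {Y Y' Z : N} (f : Y ⟶ Y') (g : Z ⟶ cobj V K Y) :
    cev V K Y' ≫ eHomWhiskerRight V (g ≫ cmapRight K f) Y' =
      (cev V K Y ≫ eHomWhiskerRight V g Y) ≫ eHomWhiskerLeft V Z f := by
  rw [cmapRight, eHomWhiskerRight_comp, reassoc_of% cdesc_fac, Category.assoc, Category.assoc,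
    eHom_whisker_exchange]

lemma cev_cmapLeft {K K' : V} (k : K ⟶ K') {Y Z : N} (g : Z ⟶ cobj V K' Y) :
    cev V K Y ≫ eHomWhiskerRight V (g ≫ cmapLeft k Y) Y =
      k ≫ cev V K' Y ≫ eHomWhiskerRight V g Y := by
  rw [cmapLeft, eHomWhiskerRight_comp, reassoc_of% cdesc_fac, Category.assoc]

end CotensorMaps

section Realization

variable [Tensored V N] [HasColimitsOfSize.{0, 0} N] (X : SimplexCategoryᵒᵖ ⥤ N)

/-- The coend `∫^n Sₙ ⊙ Xₙ`. -/
def weightedCoend (X : SimplexCategoryᵒᵖ ⥤ N) : N :=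
  coend (X ⋙ (S ⋙ tensorFunctor V N).flip)

/-- The coprojections of the coend. -/
def weightedCoendIn (n : SimplexCategory) : tobj V (S.obj n) (X.obj (op n)) ⟶ weightedCoend S X :=
  coend.ι (X ⋙ (S ⋙ tensorFunctor V N).flip) n

lemma weightedCoendIn_condition {m n : SimplexCategory} (f : m ⟶ n) :
    tmapRight (S.obj m) (X.map f.op) ≫ weightedCoendIn S X m =
      tmapLeft (S.map f) (X.obj (op n)) ≫ weightedCoendIn S X n :=
  coend.condition (X ⋙ (S ⋙ tensorFunctor V N).flip) f

/-- The morphisms `Sₙ ⟶ N(Xₙ, ∫^n Sₙ ⊙ Xₙ)`. -/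
def weightedCoendι (n : SimplexCategory) : S.obj n ⟶ (X.obj (op n) ⟶[V] weightedCoend S X) :=
  tcoev V (S.obj n) (X.obj (op n)) ≫ eHomWhiskerLeft V _ (weightedCoendIn S X n)

lemma weightedCoendι_condition {m n : SimplexCategory} (f : m ⟶ n) :
    weightedCoendι S X m ≫ eHomWhiskerRight V (X.map f.op) _ =
      S.map f ≫ weightedCoendι S X n := by
  rw [weightedCoendι, weightedCoendι, ← tcoev_tmapRight, weightedCoendIn_condition,
    tcoev_tmapLeft]

variable {S X}

lemma weightedCoendDesc_compatible {Y : N} {φ : ∀ n, S.obj n ⟶ (X.obj (op n) ⟶[V] Y)}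
    (h : ∀ {m n : SimplexCategory} (f : m ⟶ n),
      φ m ≫ eHomWhiskerRight V (X.map f.op) _ = S.map f ≫ φ n) {m n : SimplexCategory}
    (f : m ⟶ n) : tmapRight (S.obj m) (X.map f.op) ≫ tdesc (φ m) =
      tmapLeft (S.map f) (X.obj (op n)) ≫ tdesc (φ n) := by
  apply tobj_hom_ext
  rw [tcoev_tmapRight, tcoev_tmapLeft, tdesc_fac, tdesc_fac, h]

/-- Morphisms out of `∫^n Sₙ ⊙ Xₙ`. -/
def weightedCoendDesc {Y : N} (φ : ∀ n, S.obj n ⟶ (X.obj (op n) ⟶[V] Y))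
    (h : ∀ {m n : SimplexCategory} (f : m ⟶ n),
      φ m ≫ eHomWhiskerRight V (X.map f.op) _ = S.map f ≫ φ n) : weightedCoend S X ⟶ Y :=
  coend.desc (F := X ⋙ (S ⋙ tensorFunctor V N).flip) (fun n => tdesc (φ n))
    (fun _ _ f => weightedCoendDesc_compatible h f)

lemma weightedCoendι_desc {Y : N} (φ : ∀ n, S.obj n ⟶ (X.obj (op n) ⟶[V] Y))
    (h : ∀ {m n : SimplexCategory} (f : m ⟶ n),
      φ m ≫ eHomWhiskerRight V (X.map f.op) _ = S.map f ≫ φ n) (n : SimplexCategory) :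
    weightedCoendι S X n ≫ eHomWhiskerLeft V _ (weightedCoendDesc φ h) = φ n := by
  have h1 : weightedCoendIn S X n ≫ weightedCoendDesc φ h = tdesc (φ n) :=
    coend.ι_desc (F := X ⋙ (S ⋙ tensorFunctor V N).flip) (fun n => tdesc (φ n))
      (fun _ _ f => weightedCoendDesc_compatible h f) n
  rw [weightedCoendι, Category.assoc, ← eHomWhiskerLeft_comp, h1, tdesc_fac]

lemma weightedCoend_hom_ext {Y : N} {f g : weightedCoend S X ⟶ Y}
    (h : ∀ n, weightedCoendι S X n ≫ eHomWhiskerLeft V _ f =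
      weightedCoendι S X n ≫ eHomWhiskerLeft V _ g) : f = g := by
  have e : ∀ n, weightedCoendIn S X n ≫ f = weightedCoendIn S X n ≫ g := by
    intro n
    apply tobj_hom_ext
    rw [eHomWhiskerLeft_comp, eHomWhiskerLeft_comp]
    simpa only [weightedCoendι, Category.assoc] using h n
  exact coend.hom_ext e

lemma weightedCoendMap_compatible {X X' : SimplexCategoryᵒᵖ ⥤ N} (f : X ⟶ X')
    {m n : SimplexCategory} (g : m ⟶ n) :
    (weightedCoendι S X' m ≫ eHomWhiskerRight V (f.app (op m)) _) ≫
        eHomWhiskerRight V (X.map g.op) _ =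
      S.map g ≫ weightedCoendι S X' n ≫ eHomWhiskerRight V (f.app (op n)) _ := by
  rw [Category.assoc, ← eHomWhiskerRight_comp, f.naturality, eHomWhiskerRight_comp,
    reassoc_of% weightedCoendι_condition]

variable (S) in
/-- The functoriality of `∫^n Sₙ ⊙ Xₙ`. -/
def weightedCoendMap {X X' : SimplexCategoryᵒᵖ ⥤ N} (f : X ⟶ X') :
    weightedCoend S X ⟶ weightedCoend S X' :=
  weightedCoendDesc (fun n => weightedCoendι S X' n ≫ eHomWhiskerRight V (f.app (op n)) _)
    (weightedCoendMap_compatible f)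

lemma weightedCoendι_map {X X' : SimplexCategoryᵒᵖ ⥤ N} (f : X ⟶ X') (n : SimplexCategory) :
    weightedCoendι S X n ≫ eHomWhiskerLeft V _ (weightedCoendMap S f) =
      weightedCoendι S X' n ≫ eHomWhiskerRight V (f.app (op n)) _ :=
  weightedCoendι_desc _ (weightedCoendMap_compatible f) n

variable [Cotensored V N]

variable (X) in
/-- The cosimplicial object `n ↦ N(Xₙ, Y)`. -/
@[reducible]
def homCosimplicial (Y : N) : SimplexCategory ⥤ V where
  obj n := X.obj (op n) ⟶[V] Y
  map f := eHomWhiskerRight V (X.map f.op) Y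
  map_id n := by rw [op_id, X.map_id, eHomWhiskerRight_id]
  map_comp f g := by rw [op_comp, X.map_comp, eHomWhiskerRight_comp]

lemma clift_compatible {A : V} {Y : N} {φ : ∀ n, S.obj n ⊗ A ⟶ (X.obj (op n) ⟶[V] Y)}
    (h : IsTotFamily S (homCosimplicial X Y) φ) {m n : SimplexCategory} (f : m ⟶ n) :
    clift (φ m) ≫ eHomWhiskerRight V (X.map f.op) (cobj V A Y) = S.map f ≫ clift (φ n) := by
  apply cotensor_hom_ext
  change (clift (φ m) ≫ _) ⋆ cev V A Y = (S.map f ≫ _) ⋆ cev V A Y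
  rw [gcomp_comp_left (S.map f), clift_gcomp_cev, ← gcomp_whiskerRight, clift_gcomp_cev]
  exact h f

/-- The enriched universal property of `∫^n Sₙ ⊙ Xₙ`. -/
def weightedCoendLift {A : V} {Y : N} (φ : ∀ n, S.obj n ⊗ A ⟶ (X.obj (op n) ⟶[V] Y))
    (h : IsTotFamily S (homCosimplicial X Y) φ) : A ⟶ (weightedCoend S X ⟶[V] Y) :=
  cev V A Y ≫ eHomWhiskerRight V (weightedCoendDesc (fun n => clift (φ n))
    (clift_compatible h)) Y

lemma weightedCoendι_lift {A : V} {Y : N} (φ : ∀ n, S.obj n ⊗ A ⟶ (X.obj (op n) ⟶[V] Y))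
    (h : IsTotFamily S (homCosimplicial X Y) φ) (n : SimplexCategory) :
    weightedCoendι S X n ⋆ weightedCoendLift φ h = φ n := by
  unfold weightedCoendLift
  rw [← whiskerLeft_gcomp, weightedCoendι_desc, clift_gcomp_cev]
  exact clift_compatible h

lemma weightedCoend_ehom_ext {A : V} {Y : N} {u u' : A ⟶ (weightedCoend S X ⟶[V] Y)}
    (h : ∀ n, weightedCoendι S X n ⋆ u = weightedCoendι S X n ⋆ u') : u = u' := by
  rw [← cdesc_fac u, ← cdesc_fac u']
  congr 2
  apply weightedCoend_hom_ext
  intro n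
  apply cotensor_hom_ext
  change (_ ≫ _) ⋆ cev V A Y = (_ ≫ _) ⋆ cev V A Y
  rw [whiskerLeft_gcomp, whiskerLeft_gcomp, cdesc_fac, cdesc_fac, h]

lemma isTotFamily_gcomp {A : V} {Y : N} (u : A ⟶ (weightedCoend S X ⟶[V] Y)) :
    IsTotFamily S (homCosimplicial X Y) (fun n => weightedCoendι S X n ⋆ u) := by
  intro m n f
  refine (gcomp_whiskerRight _ _ _).trans ?_
  rw [weightedCoendι_condition, gcomp_comp_left]

variable (S X) in
/-- The isomorphism `N(∫^n Sₙ ⊙ Xₙ, Y) ≅ ∫_n [Sₙ, N(Xₙ, Y)]`. -/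
def weightedCoendHomIso (Y : N) : (weightedCoend S X ⟶[V] Y) ≅ tot S (homCosimplicial X Y) where
  hom := totLift (fun n => weightedCoendι S X n ⋆ 𝟙 _) (isTotFamily_gcomp _)
  inv := weightedCoendLift (totEv S _) (isTotFamily_totEv S _)
  hom_inv_id := weightedCoend_ehom_ext fun n => by
    rw [gcomp_comp_right, weightedCoendι_lift, totLift_totEv]
  inv_hom_id := tot_hom_ext fun n => by
    rw [MonoidalCategory.whiskerLeft_comp, Category.assoc, totLift_totEv, ← gcomp_comp_right,
      Category.comp_id, weightedCoendι_lift, MonoidalCategory.whiskerLeft_id, Category.id_comp]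

lemma weightedCoendHomIso_totEv {A : V} {Y : N} (u : A ⟶ (weightedCoend S X ⟶[V] Y))
    (n : SimplexCategory) :
    _ ◁ (u ≫ (weightedCoendHomIso S X Y).hom) ≫ totEv S _ n = weightedCoendι S X n ⋆ u := by
  rw [weightedCoendHomIso, MonoidalCategory.whiskerLeft_comp, Category.assoc, totLift_totEv,
    ← gcomp_comp_right, Category.comp_id]
  exact isTotFamily_gcomp _

end Realization

section Totalization

variable [Cotensored V N] [HasLimitsOfSize.{0, 0} N] (X : SimplexCategory ⥤ N)

/-- The end `∫_n {Sₙ, Xⁿ}`. -/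
def cotot (X : SimplexCategory ⥤ N) : N := (weightedEnd S (cotensorFunctor V N)).obj X

/-- The projections of the end. -/
def cototOut (n : SimplexCategory) : cotot S X ⟶ cobj V (S.obj n) (X.obj n) :=
  weightedEndπ S (cotensorFunctor V N) X n

lemma cototOut_condition {m n : SimplexCategory} (f : m ⟶ n) :
    cototOut S X m ≫ cmapRight (S.obj m) (X.map f) =
      cototOut S X n ≫ cmapLeft (S.map f) (X.obj n) :=
  weightedEndπ_condition S (cotensorFunctor V N) X f

/-- The morphisms `Sₙ ⟶ N(∫_n {Sₙ, Xⁿ}, Xⁿ)`. -/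
def cototπ (n : SimplexCategory) : S.obj n ⟶ (cotot S X ⟶[V] X.obj n) :=
  cev V (S.obj n) (X.obj n) ≫ eHomWhiskerRight V (cototOut S X n) _

lemma cototπ_condition {m n : SimplexCategory} (f : m ⟶ n) :
    cototπ S X m ≫ eHomWhiskerLeft V _ (X.map f) = S.map f ≫ cototπ S X n := by
  rw [cototπ, cototπ, ← cev_cmapRight, cototOut_condition, cev_cmapLeft]

variable {S X}

lemma cdesc_compatible {Y : N} {φ : ∀ n, S.obj n ⟶ (Y ⟶[V] X.obj n)}
    (h : ∀ {m n : SimplexCategory} (f : m ⟶ n),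
      φ m ≫ eHomWhiskerLeft V _ (X.map f) = S.map f ≫ φ n) {m n : SimplexCategory} (f : m ⟶ n) :
    cdesc (φ m) ≫ cmapRight (S.obj m) (X.map f) =
      cdesc (φ n) ≫ cmapLeft (S.map f) (X.obj n) := by
  apply cobj_hom_ext
  rw [cev_cmapRight, cev_cmapLeft, cdesc_fac, cdesc_fac, h]

/-- Morphisms into `∫_n {Sₙ, Xⁿ}`. -/
def cototDesc {Y : N} (φ : ∀ n, S.obj n ⟶ (Y ⟶[V] X.obj n))
    (h : ∀ {m n : SimplexCategory} (f : m ⟶ n),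
      φ m ≫ eHomWhiskerLeft V _ (X.map f) = S.map f ≫ φ n) : Y ⟶ cotot S X :=
  weightedEndLift (P := cotensorFunctor V N) (fun n => cdesc (φ n)) (cdesc_compatible h)

lemma cototDesc_π {Y : N} (φ : ∀ n, S.obj n ⟶ (Y ⟶[V] X.obj n))
    (h : ∀ {m n : SimplexCategory} (f : m ⟶ n),
      φ m ≫ eHomWhiskerLeft V _ (X.map f) = S.map f ≫ φ n) (n : SimplexCategory) :
    cototπ S X n ≫ eHomWhiskerRight V (cototDesc φ h) _ = φ n := by
  have h1 : cototDesc φ h ≫ cototOut S X n = cdesc (φ n) :=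
    weightedEndLift_π (P := cotensorFunctor V N) (fun n => cdesc (φ n)) (cdesc_compatible h) n
  rw [cototπ, Category.assoc, ← eHomWhiskerRight_comp, h1, cdesc_fac]

lemma cotot_hom_ext {Y : N} {f g : Y ⟶ cotot S X}
    (h : ∀ n, cototπ S X n ≫ eHomWhiskerRight V f _ =
      cototπ S X n ≫ eHomWhiskerRight V g _) : f = g := by
  have e : ∀ n, f ≫ cototOut S X n = g ≫ cototOut S X n := by
    intro n
    apply cobj_hom_ext
    rw [eHomWhiskerRight_comp, eHomWhiskerRight_comp]
    simpa only [cototπ, Category.assoc] using h n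
  exact weightedEnd_hom_ext e

variable (S) in
/-- The functoriality of `∫_n {Sₙ, Xⁿ}`. -/
def cototMap {X X' : SimplexCategory ⥤ N} (f : X ⟶ X') : cotot S X ⟶ cotot S X' :=
  (weightedEnd S (cotensorFunctor V N)).map f

lemma cototπ_map {X X' : SimplexCategory ⥤ N} (f : X ⟶ X') (n : SimplexCategory) :
    cototπ S X' n ≫ eHomWhiskerRight V (cototMap S f) _ =
      cototπ S X n ≫ eHomWhiskerLeft V _ (f.app n) := by
  have h : cototMap S f ≫ cototOut S X' n = cototOut S X n ≫ cmapRight (S.obj n) (f.app n) :=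
    weightedEnd_map_π f n
  rw [cototπ, cototπ, Category.assoc, ← eHomWhiskerRight_comp, h, cev_cmapRight]

variable [Tensored V N]

variable (X) in
/-- The cosimplicial object `n ↦ N(Y, Xⁿ)`. -/
@[reducible]
def cohomCosimplicial (Y : N) : SimplexCategory ⥤ V where
  obj n := Y ⟶[V] X.obj n
  map f := eHomWhiskerLeft V Y (X.map f)
  map_id n := by rw [X.map_id, eHomWhiskerLeft_id]
  map_comp f g := by rw [X.map_comp, eHomWhiskerLeft_comp]

lemma tlift_compatible {A : V} {Y : N} {φ : ∀ n, S.obj n ⊗ A ⟶ (Y ⟶[V] X.obj n)}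
    (h : IsTotFamily S (cohomCosimplicial X Y) φ) {m n : SimplexCategory} (f : m ⟶ n) :
    tlift ((β_ A (S.obj m)).hom ≫ φ m) ≫ eHomWhiskerLeft V (tobj V A Y) (X.map f) =
      S.map f ≫ tlift ((β_ A (S.obj n)).hom ≫ φ n) := by
  apply tensor_hom_ext
  change tcoev V A Y ⋆ (_ ≫ eHomWhiskerLeft V _ _) = tcoev V A Y ⋆ (S.map f ≫ _)
  rw [gcomp_comp_right (S.map f) (tcoev V A Y), tcoev_gcomp_tlift, ← gcomp_whiskerLeft,
    tcoev_gcomp_tlift, BraidedCategory.braiding_naturality_right_assoc, Category.assoc]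
  exact congrArg (fun t => (β_ _ _).hom ≫ t) (h f)

/-- The enriched universal property of `∫_n {Sₙ, Xⁿ}`. -/
def cototLift {A : V} {Y : N} (φ : ∀ n, S.obj n ⊗ A ⟶ (Y ⟶[V] X.obj n))
    (h : IsTotFamily S (cohomCosimplicial X Y) φ) : A ⟶ (Y ⟶[V] cotot S X) :=
  tcoev V A Y ≫ eHomWhiskerLeft V Y (cototDesc (fun n => tlift ((β_ _ _).hom ≫ φ n))
    (tlift_compatible h))

lemma cototLift_π {A : V} {Y : N} (φ : ∀ n, S.obj n ⊗ A ⟶ (Y ⟶[V] X.obj n))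
    (h : IsTotFamily S (cohomCosimplicial X Y) φ) (n : SimplexCategory) :
    cototLift φ h ⋆ cototπ S X n = (β_ _ _).hom ≫ φ n := by
  unfold cototLift
  rw [whiskerLeft_gcomp, cototDesc_π, tcoev_gcomp_tlift]
  exact tlift_compatible h

lemma cotot_ehom_ext {A : V} {Y : N} {u u' : A ⟶ (Y ⟶[V] cotot S X)}
    (h : ∀ n, u ⋆ cototπ S X n = u' ⋆ cototπ S X n) : u = u' := by
  rw [← tdesc_fac u, ← tdesc_fac u']
  congr 2
  apply cotot_hom_ext
  intro n
  apply tensor_hom_ext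
  change tcoev V A Y ⋆ (_ ≫ _) = tcoev V A Y ⋆ (_ ≫ _)
  rw [← whiskerLeft_gcomp, ← whiskerLeft_gcomp, tdesc_fac, tdesc_fac, h]

lemma isTotFamily_gcomp' {A : V} {Y : N} (u : A ⟶ (Y ⟶[V] cotot S X)) :
    IsTotFamily S (cohomCosimplicial X Y) (fun n => (β_ _ _).hom ≫ (u ⋆ cototπ S X n)) := by
  intro m n f
  refine (Category.assoc _ _ _).trans ((congrArg (fun t => (β_ _ _).hom ≫ t)
    (gcomp_whiskerLeft _ _ _)).trans ?_)
  dsimp only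
  rw [cototπ_condition, gcomp_comp_right, BraidedCategory.braiding_naturality_left_assoc]

variable (S X) in
/-- The isomorphism `N(Y, ∫_n {Sₙ, Xⁿ}) ≅ ∫_n [Sₙ, N(Y, Xⁿ)]`. -/
def cototHomIso (Y : N) : (Y ⟶[V] cotot S X) ≅ tot S (cohomCosimplicial X Y) where
  hom := totLift (fun n => (β_ _ _).hom ≫ (𝟙 _ ⋆ cototπ S X n)) (isTotFamily_gcomp' _)
  inv := cototLift (totEv S _) (isTotFamily_totEv S _)
  hom_inv_id := cotot_ehom_ext fun n => by
    rw [gcomp_comp_left, cototLift_π, BraidedCategory.braiding_naturality_left_assoc,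
      totLift_totEv, SymmetricCategory.symmetry_assoc]
  inv_hom_id := tot_hom_ext fun n => by
    rw [MonoidalCategory.whiskerLeft_comp, Category.assoc, totLift_totEv,
      BraidedCategory.braiding_naturality_right_assoc, ← gcomp_comp_left,
      Category.comp_id, cototLift_π, SymmetricCategory.symmetry_assoc,
      MonoidalCategory.whiskerLeft_id, Category.id_comp]

lemma cototHomIso_totEv {A : V} {Y : N} (u : A ⟶ (Y ⟶[V] cotot S X))
    (n : SimplexCategory) : _ ◁ (u ≫ (cototHomIso S X Y).hom) ≫ totEv S _ n =
      (β_ _ _).hom ≫ (u ⋆ cototπ S X n) := by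
  rw [cototHomIso, MonoidalCategory.whiskerLeft_comp, Category.assoc, totLift_totEv,
    BraidedCategory.braiding_naturality_right_assoc, ← gcomp_comp_left, Category.comp_id]
  exact isTotFamily_gcomp' _

end Totalization

end WeightedColimits

end

section

local infixr:70 " ⋆ " => gcomp

section ExtraCodegeneracy

variable {V : Type u₁} [Category.{v} V] [MonoidalCategory V] [SymmetricCategory V]
  [MonoidalClosed V] [HasLimits V] (L : SSet.{v} ⥤ V)

/-- The cosimplicial object `n ↦ L(Δ[n])`. -/
def simplexWeight : SimplexCategory ⥤ V := SSet.stdSimplex ⋙ L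

/-- The constant map `[n] ⟶ [0]`. -/
def toZero (n : SimplexCategory) : n ⟶ SimplexCategory.mk 0 := SimplexCategory.const n _ 0

section

variable [L.IsLeftAdjoint] {L}

/-- The simplices of the simplicial set underlying an object of `V`. -/
def simplexEquiv {n : SimplexCategory} {X : V} :
    ((simplexWeight L).obj n ⟶ X) ≃ (L.rightAdjoint.obj X).obj (op n) :=
  ((Adjunction.ofIsLeftAdjoint L).homEquiv _ _).trans SSet.yonedaEquiv

lemma simplexEquiv_comp {n : SimplexCategory} {X Y : V} (x : (simplexWeight L).obj n ⟶ X)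
    (f : X ⟶ Y) :
    simplexEquiv (x ≫ f) = (L.rightAdjoint.map f).app (op n) (simplexEquiv x) :=
  (congrArg SSet.yonedaEquiv ((Adjunction.ofIsLeftAdjoint L).homEquiv_naturality_right x f)).trans
    (SSet.yonedaEquiv_comp _ _)

lemma simplexEquiv_map {m n : SimplexCategory} {X : V} (f : m ⟶ n)
    (x : (simplexWeight L).obj n ⟶ X) :
    simplexEquiv ((simplexWeight L).map f ≫ x) =
      (L.rightAdjoint.obj X).map f.op (simplexEquiv x) :=
  (congrArg SSet.yonedaEquiv ((Adjunction.ofIsLeftAdjoint L).homEquiv_naturality_left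
    (SSet.stdSimplex.map f) x)).trans (SSet.yonedaEquiv_naturality _ _).symm

end

section

variable [L.Monoidal] [L.IsLeftAdjoint]

/-- Morphisms out of `L(K) ⊗ L(K')`. -/
def tensorDesc {K K' : SSet.{v}} {X : V} (f : K ⊗ K' ⟶ L.rightAdjoint.obj X) :
    L.obj K ⊗ L.obj K' ⟶ X :=
  Functor.LaxMonoidal.μ L K K' ≫ ((Adjunction.ofIsLeftAdjoint L).homEquiv _ _).symm f

variable {L}

lemma tensorDesc_comp {K K' : SSet.{v}} {X Y : V} (f : K ⊗ K' ⟶ L.rightAdjoint.obj X) (g : X ⟶ Y) :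
    tensorDesc L f ≫ g = tensorDesc L (f ≫ L.rightAdjoint.map g) := by
  rw [tensorDesc, tensorDesc, Adjunction.homEquiv_naturality_right_symm, Category.assoc]

lemma whiskerRight_tensorDesc {K₁ K K' : SSet.{v}} {X : V} (k : K₁ ⟶ K)
    (f : K ⊗ K' ⟶ L.rightAdjoint.obj X) :
    L.map k ▷ L.obj K' ≫ tensorDesc L f = tensorDesc L (k ▷ K' ≫ f) := by
  rw [tensorDesc, tensorDesc, Adjunction.homEquiv_naturality_left_symm,
    Functor.LaxMonoidal.μ_natural_left_assoc]

lemma vertex_tensorDesc {K K' : SSet.{v}} {X : V} (k : 𝟙_ SSet.{v} ⟶ K')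
    (f : K ⊗ K' ⟶ L.rightAdjoint.obj X) :
    (ρ_ (L.obj K)).inv ≫ L.obj K ◁ (Functor.LaxMonoidal.ε L ≫ L.map k) ≫ tensorDesc L f =
      ((Adjunction.ofIsLeftAdjoint L).homEquiv _ _).symm ((ρ_ K).inv ≫ K ◁ k ≫ f) := by
  rw [tensorDesc, MonoidalCategory.whiskerLeft_comp, Category.assoc,
    Functor.LaxMonoidal.μ_natural_right_assoc, Adjunction.homEquiv_naturality_left_symm,
    Adjunction.homEquiv_naturality_left_symm]
  have h := Functor.LaxMonoidal.right_unitality_inv L K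
  rw [← reassoc_of% h]

variable (L) in
/-- An extra codegeneracy of a cosimplicial object defines a simplicial homotopy. -/
lemma exists_extraHomotopy (E : VertexExtension) (Γ : SimplexCategory ⥤ V)
    (u : ∀ n, (simplexWeight L).obj n ⟶ Γ.obj n)
    (hu : ∀ {m n : SimplexCategory} (f : m ⟶ n),
      u m ≫ Γ.map f = (simplexWeight L).map f ≫ u n)
    (s : ∀ n, Γ.obj (SimplexCategory.mk (n.len + 1)) ⟶ Γ.obj n)
    (hs : ∀ {m n : SimplexCategory} (f : m ⟶ n), s m ≫ Γ.map f = Γ.map (E.map f) ≫ s n)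
    (hs₀ : ∀ n, Γ.map (E.incl n) ≫ s n = 𝟙 _) :
    ∃ h : ∀ n, (simplexWeight L).obj n ⊗ L.obj (SSet.stdSimplex.obj (SimplexCategory.mk 1)) ⟶
        Γ.obj n,
      IsTotFamily (simplexWeight L) Γ h ∧
      (∀ n, (ρ_ _).inv ≫ _ ◁ vertex L E.start ≫ h n = u n) ∧
      (∀ n, (ρ_ _).inv ≫ _ ◁ vertex L E.target ≫ h n =
        (simplexWeight L).map (toZero n) ≫ u _ ≫ Γ.map (E.pt n) ≫ s n) := by
  let Γ' : SimplexCategory ⥤ SSet.{v} := Γ ⋙ L.rightAdjoint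
  let u' : ∀ n, (Γ'.obj n).obj (op n) := fun n => simplexEquiv (u n)
  have hu' : ∀ {m n : SimplexCategory} (f : m ⟶ n),
      (Γ'.map f).app (op m) (u' m) = (Γ'.obj n).map f.op (u' n) := fun f =>
    (simplexEquiv_comp _ _).symm.trans ((congrArg simplexEquiv (hu f)).trans (simplexEquiv_map _ _))
  let s' : ∀ n, Γ'.obj (SimplexCategory.mk (n.len + 1)) ⟶ Γ'.obj n := fun n =>
    L.rightAdjoint.map (s n)
  have hs' : ∀ {m n : SimplexCategory} (f : m ⟶ n), s' m ≫ Γ'.map f = Γ'.map (E.map f) ≫ s' n :=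
    fun f => (L.rightAdjoint.map_comp _ _).symm.trans ((congrArg L.rightAdjoint.map (hs f)).trans
      (L.rightAdjoint.map_comp _ _))
  have hs₀' : ∀ n, Γ'.map (E.incl n) ≫ s' n = 𝟙 _ := fun n =>
    (L.rightAdjoint.map_comp _ _).symm.trans ((congrArg L.rightAdjoint.map (hs₀ n)).trans
      (L.rightAdjoint.map_id _))
  have key : ∀ (w : ∀ n, (simplexWeight L).obj n ⟶ Γ.obj n)
      (hw : ∀ {m n : SimplexCategory} (f : m ⟶ n),
        w m ≫ Γ.map f = (simplexWeight L).map f ≫ w n) (i : Fin 2)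
      (hi : ∀ k, extraSimplex E Γ' u' s' (SimplexCategory.const k (SimplexCategory.mk 1) i) =
        simplexEquiv (w k)) (n : SimplexCategory),
      (ρ_ _).inv ≫ _ ◁ vertex L i ≫ tensorDesc L (extraHomotopy E Γ' u' hu' s' hs' n) = w n := by
    intro w hw i hi n
    refine (vertex_tensorDesc _ _).trans ?_
    refine (Equiv.symm_apply_eq _).2 ?_
    refine (extraHomotopy_vertex E Γ' u' hu' s' hs' i n (fun k => simplexEquiv (w k)) ?_ hi).trans ?_
    · intro m n f
      exact (simplexEquiv_comp _ _).symm.trans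
        ((congrArg simplexEquiv (hw f)).trans (simplexEquiv_map _ _))
    · exact SSet.yonedaEquiv.symm_apply_apply
        ((Adjunction.ofIsLeftAdjoint L).homEquiv _ _ (w n))
  refine ⟨fun n => tensorDesc L (extraHomotopy E Γ' u' hu' s' hs' n), ?_, ?_, ?_⟩
  · intro m n f
    refine (tensorDesc_comp _ _).trans (Eq.trans ?_ (whiskerRight_tensorDesc _ _).symm)
    exact congrArg (tensorDesc L) (extraHomotopy_compatible E Γ' u' hu' s' hs' f)
  · exact key u hu E.start (fun k => extraSimplex_start E Γ' u' s' (hs₀' k))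
  · have e : ∀ {m n : SimplexCategory} (f : m ⟶ n), E.pt m ≫ E.map f = E.pt n := by
      intro m n f
      have h1 : ∀ k, SimplexCategory.const (SimplexCategory.mk 0) k 0 ≫ toZero k = 𝟙 _ := fun k => by
        ext i : 3
        exact Subsingleton.elim (α := Fin 1) _ _
      have h2 := E.comp_cone f (SimplexCategory.const n (SimplexCategory.mk 1) E.target)
      have h3 : f ≫ SimplexCategory.const n (SimplexCategory.mk 1) E.target =
        SimplexCategory.const m (SimplexCategory.mk 1) E.target := rfl
      have h4 : f ≫ toZero n = toZero m := rfl
      rw [h3, E.cone_target, E.cone_target] at h2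
      have h5 : toZero m ≫ E.pt n = toZero m ≫ E.pt m ≫ E.map f := by
        rw [← h4, Category.assoc, h4]
        exact h2.trans (Category.assoc _ _ _)
      have h6 := congrArg (fun t => SimplexCategory.const (SimplexCategory.mk 0) m 0 ≫ t) h5
      rw [reassoc_of% h1 m, reassoc_of% h1 m] at h6
      exact h6.symm
    refine key (fun n => (simplexWeight L).map (toZero n) ≫ u _ ≫ Γ.map (E.pt n) ≫ s n) ?_ E.target
      (fun k => ?_)
    · intro m n f
      have h0 : f ≫ toZero n = toZero m := rfl
      simp only [Category.assoc]
      rw [hs f, ← Functor.map_comp_assoc, e, ← h0, Functor.map_comp, Category.assoc]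
    · refine (extraSimplex_target E Γ' u' hu' s' k).trans ?_
      rw [simplexEquiv_map]
      refine ((Γ'.map (E.pt k) ≫ s' k).naturality_apply (toZero k).op (u' _)).trans ?_
      refine congrArg ((L.rightAdjoint.obj (Γ.obj k)).map (toZero k).op) ?_
      refine Eq.trans ?_ (simplexEquiv_comp _ _).symm
      rw [L.rightAdjoint.map_comp]
      rfl

end

end ExtraCodegeneracy

end

section

section AdjunctionWords

variable {I : Type*} {C : Type*} [Category* C] {E : Type*} [Category* E]
  {Lf : I → E ⥤ C} {R : I → C ⥤ E} (adj : ∀ i, Lf i ⊣ R i)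

/-- The comonads of a family of adjunctions. -/
@[reducible]
def adjComonad (i : I) : Comonad C := (adj i).toComonad

/-- The unit, with a target comonad `G c` with `c = b`. -/
def unitEq {b c : I} (h : c = b) (X : C) : (R b).obj X ⟶ (R b).obj ((adjComonad adj c).obj X) :=
  h ▸ (adj b).unit.app ((R b).obj X)

lemma unitEq_ε {b c : I} (h : c = b) (X : C) :
    unitEq adj h X ≫ (R b).map ((adjComonad adj c).ε.app X) = 𝟙 _ := by
  subst h
  exact (adj c).right_triangle_components X

lemma unitEq_coextEq {b c d : I} (h : c = b) (h' : d = c) {F H : C ⥤ C}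
    (u : F ⋙ (adjComonad adj c).toFunctor ⟶ H) (X : C) :
    unitEq adj h (F.obj X) ≫ (R b).map ((coextEq (G := adjComonad adj) h' u).app X) =
      unitEq adj h (F.obj X) ≫ (R b).map (u.app X) ≫ unitEq adj (h'.trans h) (H.obj X) := by
  subst h
  subst h'
  have h1 := (adj d).unit.naturality ((adj d).unit.app ((R d).obj (F.obj X)))
  have h2 := (adj d).unit.naturality ((R d).map (u.app X))
  change (adj d).unit.app ((R d).obj (F.obj X)) ≫ (R d).map
    ((Lf d).map ((adj d).unit.app ((R d).obj (F.obj X))) ≫ (Lf d).map ((R d).map (u.app X))) =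
    (adj d).unit.app ((R d).obj (F.obj X)) ≫ (R d).map (u.app X) ≫
      (adj d).unit.app ((R d).obj (H.obj X))
  dsimp only [Functor.id_map, Functor.comp_map, Functor.id_obj, Functor.comp_obj] at h1 h2
  rw [(R d).map_comp, ← reassoc_of% h1]
  exact congrArg (fun t => (adj d).unit.app ((R d).obj (F.obj X)) ≫ t) h2.symm

variable {b : I} {f g : ℕ → ℕ} {a a' c c' : ℕ → I} {m n : ℕ}

/-- The unit, for words. -/
def wordUnit (hb : a n = b) (X : C) : (R b).obj ((word (adjComonad adj) a n).obj X) ⟶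
    (R b).obj ((word (adjComonad adj) a (n + 1)).obj X) :=
  unitEq adj hb ((word (adjComonad adj) a n).obj X)

lemma wordUnit_ε (hb : a n = b) (X : C) :
    wordUnit adj hb X ≫ (R b).map ((wordε (adjComonad adj) a n).app X) = 𝟙 _ :=
  unitEq_ε adj hb _

lemma wordUnit_wordCoext (hb : a n = b) (h : c m = a n)
    (u : word (adjComonad adj) a (n + 1) ⟶ word (adjComonad adj) c m) (X : C) :
    wordUnit adj hb X ≫ (R b).map ((wordCoext (adjComonad adj) h u).app X) =
      wordUnit adj hb X ≫ (R b).map (u.app X) ≫ wordUnit adj (h.trans hb) X :=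
  unitEq_coextEq adj hb h (F := word (adjComonad adj) a n) (H := word (adjComonad adj) c m) u X

/-- The section of the counit of the last letter of a word. -/
def wordσ (h : IsReindexing id a a' n n) (hb : a' n = b) (X : C) :
    (R b).obj ((word (adjComonad adj) a n).obj X) ⟶
      (R b).obj ((word (adjComonad adj) a' (n + 1)).obj X) :=
  (R b).map ((wordMap (adjComonad adj) id a a' n n h).app X) ≫ wordUnit adj hb X

lemma wordσ_wordMap (h : IsReindexing id a a' n n) (hb : a' n = b)
    (hf : IsReindexing f a' c m n) (X : C) :
    wordσ adj h hb X ≫ (R b).map ((wordMap (adjComonad adj) f a' c m (n + 1)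
        (hf.up (Nat.le_succ n))).app X) =
      (R b).map ((wordMap (adjComonad adj) f a c m n (h.comp hf)).app X) := by
  have h1 := congrArg (fun t => t.app X) (skip_wordMap (adjComonad adj) hf (Nat.le_succ n))
  have h2 := congrArg (fun t => t.app X) (wordMap_comp (adjComonad adj) h hf)
  dsimp only [NatTrans.comp_app] at h1 h2
  rw [skip_succ] at h1
  have h3 := wordUnit_ε adj hb X
  rw [wordσ, Category.assoc, ← h1, (R b).map_comp, reassoc_of% h3, ← (R b).map_comp, h2]
  rfl

lemma wordσ_naturality (h : IsReindexing id a a' n n) (hb : a' n = b)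
    (h' : IsReindexing id c c' m m) (hb' : c' m = b)
    (hf : IsReindexing f a c m n) (hg : IsReindexing g a' c' (m + 1) (n + 1)) (hn : g m = n)
    (hfg : ∀ i < m, f i = g i) (X : C) :
    wordσ adj h hb X ≫ (R b).map ((wordMap (adjComonad adj) g a' c' (m + 1) (n + 1) hg).app X) =
      (R b).map ((wordMap (adjComonad adj) f a c m n hf).app X) ≫ wordσ adj h' hb' X := by
  subst hn
  have hg' : IsReindexing g a' c' m (g m) :=
    ⟨fun i hi => by rw [← hfg i hi]; exact hf.lt i hi, hg.pred.mono, hg.pred.eq⟩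
  have h1 := wordσ_wordMap adj h hb hg' X
  have h2 := congrArg (fun t => t.app X) (wordMap_comp (adjComonad adj) hf h')
  have h3 := congrArg (fun t => t.app X) (wordMap_congr (adjComonad adj) (h.comp hg')
    (hf.comp h') (fun i hi => (hfg i hi).symm))
  dsimp only [NatTrans.comp_app] at h2 h3
  rw [wordMap_last (adjComonad adj) hg]
  unfold wordσ at h1 ⊢
  rw [Category.assoc, wordUnit_wordCoext]
  simp only [Category.assoc] at h1
  rw [reassoc_of% h1, ← Category.assoc, ← (R b).map_comp, h2, ← h3]
  rfl

end AdjunctionWords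

section BarWords

variable {I : Type*} {C : Type*} [Category* C] (G : I → Comonad C) {f : ℕ → ℕ} {m n : ℕ}

/-- `wordMap` for the words of the bar construction. -/
def barReindex (f : ℕ → ℕ) (α : Fin (n + 1) → I) (γ : Fin (m + 1) → I)
    (h : IsReindexing f (extend α) (extend γ) (m + 1) (n + 1)) : barWord G α ⟶ barWord G γ :=
  wordMap G f (extend α) (extend γ) (m + 1) (n + 1) h

lemma barWordMap_comp_app (p : Fin (m + 1) →o Fin (n + 1)) (α : Fin (n + 1) → I)
    (γ : Fin (m + 1) → I) (hγ : γ = α ∘ p)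
    (h : IsReindexing f (extend α) (extend γ) (m + 1) (n + 1))
    (hf : ∀ i < m + 1, extendHom p i = f i) {X Z : C} (ι : ∀ γ, (barWord G γ).obj X ⟶ Z) :
    (barWordMap G p α).app X ≫ ι (α ∘ p) =
      (barReindex G f α γ h).app X ≫ ι γ := by
  subst hγ
  rw [barWordMap_eq_wordMap]
  exact congrArg (fun t => t.app X ≫ ι (α ∘ p)) (wordMap_congr G _ h hf)

lemma wordMap_id_comp_app (α γ : Fin (n + 1) → I) (hγ : γ = α)
    (h : IsReindexing f (extend α) (extend γ) (n + 1) (n + 1))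
    (hf : ∀ i < n + 1, f i = i) {X Z : C} (ι : ∀ γ, (barWord G γ).obj X ⟶ Z) :
    (barReindex G f α γ h).app X ≫ ι γ = ι α := by
  subst hγ
  have h1 : barReindex G f γ γ h = 𝟙 _ := (wordMap_congr G h (isReindexing_id _ _) hf).trans (wordMap_id G _ _ _)
  rw [h1]
  exact Category.id_comp _

/-- The augmentation of the bar construction. -/
def barAug (α : Fin (n + 1) → I) (X : C) : (barWord G α).obj X ⟶ X :=
  (skip G (extend α) (Nat.zero_le (n + 1))).app X

lemma barWordMap_barAug (p : Fin (m + 1) →o Fin (n + 1)) (α : Fin (n + 1) → I) (X : C) :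
    (barWordMap G p α).app X ≫ barAug G (α ∘ p) X = barAug G α X := by
  rw [barWordMap_eq_wordMap]
  exact congrArg (fun t => t.app X) (wordMap_skip G (isReindexing_extend p α) (Nat.zero_le _))

lemma barAug_naturality (α : Fin (n + 1) → I) {X Y : C} (g : X ⟶ Y) :
    (barWord G α).map g ≫ barAug G α Y = barAug G α X ≫ g :=
  (skip G (extend α) (Nat.zero_le (n + 1))).naturality g

/-- The sequence `(α₀, …, αₙ, b)`. -/
def snocSeq (α : Fin (n + 1) → I) (b : I) (i : Fin (n + 2)) : I :=
  if h : (i : ℕ) < n + 1 then α ⟨i, h⟩ else b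

lemma extend_of_lt (α : Fin (n + 1) → I) {i : ℕ} (hi : i < n + 1) : extend α i = α ⟨i, hi⟩ := by
  have : min i n = i := by omega
  simp [extend, this]

lemma extend_snocSeq (α : Fin (n + 1) → I) (b : I) {i : ℕ} (hi : i < n + 1) :
    extend (snocSeq α b) i = extend α i := by
  rw [extend_of_lt _ (hi.trans (Nat.lt_succ_self _)), extend_of_lt _ hi, snocSeq, dif_pos hi]

lemma extend_snocSeq_last (α : Fin (n + 1) → I) (b : I) : extend (snocSeq α b) (n + 1) = b := by
  rw [extend_of_lt _ (Nat.lt_succ_self _), snocSeq, dif_neg (by simp)]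

lemma isReindexing_snocSeq (α : Fin (n + 1) → I) (b : I) :
    IsReindexing id (extend α) (extend (snocSeq α b)) (n + 1) (n + 1) :=
  ⟨fun _ hi => hi, fun _ _ h _ => h, fun _ hi => extend_snocSeq α b hi⟩

end BarWords

section BarSection

variable {I : Type*} {C : Type*} [Category* C] {E : Type*} [Category* E]
  {Lf : I → E ⥤ C} {R : I → C ⥤ E} (adj : ∀ i, Lf i ⊣ R i) {b : I} {X : C}

/-- The extra degeneracy of the bar construction. -/
def barσ {n : ℕ} (α : Fin (n + 1) → I) (b : I) (X : C) :
    (R b).obj ((barWord (adjComonad adj) α).obj X) ⟶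
      (R b).obj ((barWord (adjComonad adj) (snocSeq α b)).obj X) :=
  wordσ adj (isReindexing_snocSeq α b) (extend_snocSeq_last α b) X

/-- The extra degeneracy of the augmentation of the bar construction. -/
def barσ₀ (b : I) (X : C) :
    (R b).obj X ⟶ (R b).obj ((barWord (adjComonad adj) (fun _ : Fin 1 => b)).obj X) :=
  wordUnit adj (a := extend (fun _ : Fin 1 => b)) (n := 0) rfl X

lemma barσ₀_barAug : barσ₀ adj b X ≫ (R b).map (barAug (adjComonad adj) (fun _ : Fin 1 => b) X) =
    𝟙 _ := by
  rw [barAug, skip_succ]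
  exact wordUnit_ε adj (a := extend (fun _ : Fin 1 => b)) (n := 0) rfl X

lemma snocHom_apply {m n : SimplexCategory} (f : m ⟶ n) {i : ℕ} (hi : i < m.len + 2) :
    (((snocHom f).toOrderHom ⟨i, hi⟩ : Fin (n.len + 2)) : ℕ) =
      if h : i < m.len + 1 then (f.toOrderHom ⟨i, h⟩ : ℕ) else n.len + 1 := by
  change ((dite _ _ _ : Fin (n.len + 2)) : ℕ) = _
  split_ifs <;> rfl

lemma snocSeq_snocHom {m n : SimplexCategory} (f : m ⟶ n) (α : Fin (n.len + 1) → I) (b : I) :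
    snocSeq (α ∘ f.toOrderHom) b = snocSeq α b ∘ (snocHom f).toOrderHom := by
  funext ⟨i, hi⟩
  change _ = snocSeq α b ((snocHom f).toOrderHom ⟨i, hi⟩)
  unfold snocSeq
  have h0 := snocHom_apply f hi
  by_cases h : i < m.len + 1
  · rw [dif_pos h] at h0 ⊢
    rw [dif_pos (by rw [h0]; exact (f.toOrderHom ⟨i, h⟩).2)]
    change α _ = α _
    congr 1
    ext
    exact h0.symm
  · rw [dif_neg h] at h0 ⊢
    rw [dif_neg (by rw [h0]; simp)]

lemma extendHom_of_lt {m n : ℕ} (p : Fin (m + 1) →o Fin (n + 1)) {i : ℕ} (hi : i < m + 1) :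
    extendHom p i = p ⟨i, hi⟩ := by
  change ((p _ : Fin (n + 1)) : ℕ) = _
  congr 3
  omega

lemma barσ_naturality {m n : SimplexCategory} (f : m ⟶ n) (α : Fin (n.len + 1) → I) {Z : C}
    (ι : ∀ γ : Fin (m.len + 2) → I, (barWord (adjComonad adj) γ).obj X ⟶ Z) :
    barσ adj α b X ≫ (R b).map ((barWordMap (adjComonad adj) (snocHom f).toOrderHom
        (snocSeq α b)).app X ≫ ι (snocSeq α b ∘ (snocHom f).toOrderHom)) =
      (R b).map ((barWordMap (adjComonad adj) f.toOrderHom α).app X) ≫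
        barσ adj (α ∘ f.toOrderHom) b X ≫ (R b).map (ι (snocSeq (α ∘ f.toOrderHom) b)) := by
  have hg : IsReindexing (extendHom (snocHom f).toOrderHom) (extend (snocSeq α b))
      (extend (snocSeq (α ∘ f.toOrderHom) b)) (m.len + 2) (n.len + 2) := by
    rw [snocSeq_snocHom]
    exact isReindexing_extend _ _
  rw [barWordMap_comp_app (adjComonad adj) (snocHom f).toOrderHom (snocSeq α b) _
    (snocSeq_snocHom f α b) hg (fun _ _ => rfl), (R b).map_comp]
  have h : _ ≫ (R b).map ((barReindex (adjComonad adj) _ (snocSeq α b) _ hg).app X) = _ ≫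
      barσ adj (α ∘ f.toOrderHom) b X := wordσ_naturality adj (isReindexing_snocSeq α b) (extend_snocSeq_last α b)
    (isReindexing_snocSeq (α ∘ f.toOrderHom) b) (extend_snocSeq_last (α ∘ f.toOrderHom) b)
    (isReindexing_extend f.toOrderHom α) hg
    (by rw [extendHom_of_lt _ (Nat.lt_succ_self _), snocHom_apply, dif_neg (by simp)])
    (fun i hi => by
      rw [extendHom_of_lt _ hi, extendHom_of_lt _ (hi.trans (Nat.lt_succ_self _)), snocHom_apply,
        dif_pos hi]) X
  have h' := congrArg (fun t => t ≫ (R b).map (ι (snocSeq (α ∘ f.toOrderHom) b))) h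
  rw [← barWordMap_eq_wordMap] at h'
  exact (Category.assoc _ _ _).symm.trans (h'.trans (Category.assoc _ _ _))

lemma snocSeq_castSucc {n : ℕ} (α : Fin (n + 1) → I) (b : I) :
    α = snocSeq α b ∘ (Fin.castSuccOrderEmb).toOrderHom := by
  funext i
  change _ = snocSeq α b i.castSucc
  rw [snocSeq, dif_pos (show (i.castSucc : ℕ) < n + 1 from i.2)]
  rfl

lemma barσ_incl {n : ℕ} (α : Fin (n + 1) → I) {Z : C}
    (ι : ∀ γ : Fin (n + 1) → I, (barWord (adjComonad adj) γ).obj X ⟶ Z) :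
    barσ adj α b X ≫ (R b).map ((barWordMap (adjComonad adj) (Fin.castSuccOrderEmb).toOrderHom
        (snocSeq α b)).app X ≫ ι (snocSeq α b ∘ (Fin.castSuccOrderEmb).toOrderHom)) =
      (R b).map (ι α) := by
  have h0 : IsReindexing id (extend (snocSeq α b)) (extend α) (n + 1) (n + 1) :=
    ⟨fun _ hi => hi, fun _ _ h _ => h, fun _ hi => (extend_snocSeq α b hi).symm⟩
  rw [barWordMap_comp_app (adjComonad adj) _ (snocSeq α b) α (snocSeq_castSucc α b)
    (h0.up (Nat.le_succ _)) (fun i hi => by rw [extendHom_of_lt _ hi]; rfl), (R b).map_comp]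
  have h : barσ adj α b X ≫ (R b).map ((barReindex (adjComonad adj) id (snocSeq α b) α
      (h0.up (Nat.le_succ _))).app X) = (R b).map ((barReindex (adjComonad adj) _ α α _).app X) :=
    wordσ_wordMap adj (isReindexing_snocSeq α b) (extend_snocSeq_last α b) h0 X
  refine (Category.assoc _ _ _).symm.trans ((congrArg (fun t => t ≫ (R b).map (ι α)) h).trans ?_)
  rw [← (R b).map_comp]
  exact congrArg (fun t => (R b).map t) (wordMap_id_comp_app (adjComonad adj) α α rfl _
    (fun _ _ => rfl) ι)

lemma barσ_pt {n : ℕ} (α : Fin (n + 1) → I) {Z : C}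
    (ι : ∀ γ : Fin 1 → I, (barWord (adjComonad adj) γ).obj X ⟶ Z) (p : Fin 1 →o Fin (n + 2))
    (hp : p 0 = Fin.last _) :
    barσ adj α b X ≫ (R b).map ((barWordMap (adjComonad adj) p
        (snocSeq α b)).app X ≫ ι (snocSeq α b ∘ p)) =
      (R b).map (barAug (adjComonad adj) α X) ≫ barσ₀ adj b X ≫ (R b).map (ι (fun _ => b)) := by
  have hp' : ∀ i, extendHom p i = n + 1 := fun i => by
    change ((p _ : Fin (n + 2)) : ℕ) = _
    rw [Subsingleton.elim (⟨min i 0, _⟩ : Fin 1) 0, hp]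
    rfl
  have e : (fun _ : Fin 1 => b) = snocSeq α b ∘ p := by
    funext i
    change _ = snocSeq α b (p i)
    rw [Subsingleton.elim i 0, hp, snocSeq, dif_neg (by simp)]
  have hg : IsReindexing (extendHom p) (extend (snocSeq α b)) (extend (fun _ : Fin 1 => b))
      1 (n + 2) := by
    rw [e]
    exact isReindexing_extend _ _
  rw [barWordMap_comp_app (adjComonad adj) p (snocSeq α b) _ e hg (fun _ _ => rfl),
    (R b).map_comp]
  have hf : IsReindexing (extendHom p) (extend α) (extend (fun _ : Fin 1 => b)) 0 (n + 1) :=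
    ⟨fun _ hi => absurd hi (Nat.not_lt_zero _), fun _ _ _ hi => absurd hi (Nat.not_lt_zero _),
      fun _ hi => absurd hi (Nat.not_lt_zero _)⟩
  have h0 : IsReindexing id (extend (fun _ : Fin 1 => b)) (extend (fun _ : Fin 1 => b)) 0 0 :=
    isReindexing_id _ _
  have h : _ ≫ (R b).map ((barReindex (adjComonad adj) _ (snocSeq α b) _ hg).app X) = _ :=
    wordσ_naturality adj (isReindexing_snocSeq α b) (extend_snocSeq_last α b)
    h0 (b := b) rfl hf hg (hp' 0) (fun _ hi => absurd hi (Nat.not_lt_zero _)) X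
  have h1 : wordσ adj h0 (b := b) rfl X = barσ₀ adj b X := by
    unfold wordσ
    rw [wordMap_id]
    refine (congrArg (fun t => t ≫ _) ((R b).map_id _)).trans ?_
    exact Category.id_comp _
  refine (Category.assoc _ _ _).symm.trans ((congrArg (fun t => t ≫ (R b).map
    (ι (fun _ => b))) h).trans ?_)
  rw [h1]
  exact Category.assoc _ _ _

end BarSection

end

section

local infixr:70 " ⋆ " => gcomp

section Evaluation

variable {V : Type u₁} [Category.{v} V] [MonoidalCategory V] [SymmetricCategory V]
  [MonoidalClosed V] {D : Type v} [EnrichedCategory V D]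
  {M : Type u₂} [Category.{v} M] [EnrichedOrdinaryCategory V M]
  [HasLimits V]

namespace Diagram

lemma gcomp_π {F G H : Diagram V D M} {A B : V} (x : A ⟶ (F ⟶[V] G)) (y : B ⟶ (G ⟶[V] H)) (d : D) :
    (x ⋆ y) ≫ homπ F H d = (x ≫ homπ F G d) ⋆ (y ≫ homπ G H d) := by
  rw [gcomp_comp, gcomp, Category.assoc, eComp_π]

lemma eHomWhiskerLeft_π (F : Diagram V D M) {G H : Diagram V D M} (g : G ⟶ H) (d : D) :
    eHomWhiskerLeft V F g ≫ homπ F H d = homπ F G d ≫ eHomWhiskerLeft V (F.val d) (Hom.app g d) := by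
  have h := gcomp_π (𝟙 (F ⟶[V] G)) (eHomEquiv V g) d
  rw [gcomp_eHomEquiv, eHomEquiv_π, gcomp_eHomEquiv, Category.assoc] at h
  simpa using h

lemma eHomWhiskerRight_π {F G : Diagram V D M} (f : F ⟶ G) (H : Diagram V D M) (d : D) :
    eHomWhiskerRight V f H ≫ homπ F H d =
      homπ G H d ≫ eHomWhiskerRight V (Hom.app f d) (H.val d) := by
  have h := gcomp_π (eHomEquiv V f) (𝟙 (G ⟶[V] H)) d
  rw [eHomEquiv_gcomp, eHomEquiv_π, eHomEquiv_gcomp, Category.assoc] at h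
  simpa using h

variable [Cotensored V M]

lemma eHomWhiskerRight_cofreeYoneda {F G : Diagram V D M} (f : F ⟶ G) (b : D) (Y : M) :
    eHomWhiskerRight V f (cofree V b Y) ≫ cofreeYoneda b Y F =
      cofreeYoneda b Y G ≫ eHomWhiskerRight V (Hom.app f b) Y := by
  rw [cofreeYoneda, cofreeYoneda, reassoc_of% eHomWhiskerRight_π, Category.assoc,
    eHom_whisker_exchange]

lemma cofreeYonedaInv_whisker {F G : Diagram V D M} (f : F ⟶ G) (b : D) (Y : M) {A : V}
    (x : A ⟶ (G.val b ⟶[V] Y)) :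
    cofreeYonedaInv x ≫ eHomWhiskerRight V f (cofree V b Y) =
      cofreeYonedaInv (x ≫ eHomWhiskerRight V (Hom.app f b) Y) := by
  apply cofreeYoneda_ext
  rw [Category.assoc, eHomWhiskerRight_cofreeYoneda, reassoc_of% cofreeYonedaInv_yoneda,
    cofreeYonedaInv_yoneda]

end Diagram

namespace Diagram

variable [Tensored V M]

lemma eHomWhiskerLeft_freeYoneda {F G : Diagram V D M} (f : F ⟶ G) (b : D) (X : M) :
    eHomWhiskerLeft V (free V b X) f ≫ freeYoneda b X G =
      freeYoneda b X F ≫ eHomWhiskerLeft V X (Hom.app f b) := by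
  rw [freeYoneda, freeYoneda, reassoc_of% eHomWhiskerLeft_π, Category.assoc,
    eHom_whisker_exchange]

lemma freeYonedaInv_whisker {F G : Diagram V D M} (f : F ⟶ G) (b : D) (X : M) {A : V}
    (x : A ⟶ (X ⟶[V] F.val b)) :
    freeYonedaInv x ≫ eHomWhiskerLeft V (free V b X) f =
      freeYonedaInv (x ≫ eHomWhiskerLeft V X (Hom.app f b)) := by
  apply freeYoneda_ext
  rw [Category.assoc, eHomWhiskerLeft_freeYoneda, reassoc_of% freeYonedaInv_yoneda,
    freeYonedaInv_yoneda]

end Diagram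

section CoendAt

variable (S : SimplexCategory ⥤ V) [HasColimits M] [Tensored V M] [Cotensored V M]
  (X : SimplexCategoryᵒᵖ ⥤ Diagram V D M) (b : D)

/-- The components at `b` of the coprojections of `∫^n Sₙ ⊙ Xₙ`. -/
def coendAtι (n : SimplexCategory) :
    S.obj n ⟶ ((X.obj (op n)).val b ⟶[V] (weightedCoend S X).val b) :=
  weightedCoendι S X n ≫ Diagram.homπ _ _ b

lemma coendAtι_condition {m n : SimplexCategory} (f : m ⟶ n) :
    coendAtι S X b m ≫ eHomWhiskerRight V (Diagram.Hom.app (X.map f.op) b) _ =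
      S.map f ≫ coendAtι S X b n := by
  have h := congrArg (fun t => t ≫ Diagram.homπ _ _ b) (weightedCoendι_condition S X f)
  simp only [Category.assoc, Diagram.eHomWhiskerRight_π] at h
  rw [coendAtι, coendAtι, Category.assoc, h]

/-- The cosimplicial object `n ↦ M(Xₙ b, Y)`. -/
@[reducible]
def homCosimplicialAt (Y : M) : SimplexCategory ⥤ V where
  obj n := (X.obj (op n)).val b ⟶[V] Y
  map f := eHomWhiskerRight V (Diagram.Hom.app (X.map f.op) b) Y
  map_id n := by rw [op_id, X.map_id, Diagram.id_app, eHomWhiskerRight_id]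
  map_comp f g := by rw [op_comp, X.map_comp, Diagram.comp_app, eHomWhiskerRight_comp]

variable {S X b}

lemma exists_coendAt_lift {A : V} {Y : M} (φ : ∀ n, S.obj n ⊗ A ⟶ ((X.obj (op n)).val b ⟶[V] Y))
    (h : IsTotFamily S (homCosimplicialAt X b Y) φ) :
    ∃ u : A ⟶ ((weightedCoend S X).val b ⟶[V] Y), ∀ n, coendAtι S X b n ⋆ u = φ n := by
  have h' : IsTotFamily S (homCosimplicial X (Diagram.cofree V b Y))
      (fun n => Diagram.cofreeYonedaInv (φ n)) := by
    intro m n f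
    refine (Diagram.cofreeYonedaInv_whisker (X.map f.op) b Y (φ m)).trans ?_
    refine (congrArg (fun t => Diagram.cofreeYonedaInv t) (h f)).trans ?_
    apply Diagram.cofreeYoneda_ext
    rw [Category.assoc, Diagram.cofreeYonedaInv_yoneda, Diagram.cofreeYonedaInv_yoneda]
  refine ⟨weightedCoendLift _ h' ≫ Diagram.cofreeYoneda b Y _, fun n => ?_⟩
  have e := weightedCoendι_lift _ h' n
  rw [Diagram.cofreeYoneda, coendAtι, ← Category.assoc (weightedCoendLift _ h'),
    ← gcomp_whiskerLeft, ← Diagram.gcomp_π, e, Category.assoc]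
  exact Diagram.cofreeYonedaInv_yoneda (φ n)

lemma coendAt_ehom_ext {A : V} {Y : M} {u u' : A ⟶ ((weightedCoend S X).val b ⟶[V] Y)}
    (h : ∀ n, coendAtι S X b n ⋆ u = coendAtι S X b n ⋆ u') : u = u' := by
  have e : Diagram.cofreeYonedaInv u = Diagram.cofreeYonedaInv u' := by
    apply weightedCoend_ehom_ext
    intro n
    apply Diagram.cofreeYoneda_ext
    have key : ∀ w : A ⟶ ((weightedCoend S X).val b ⟶[V] Y),
        (weightedCoendι S X n ⋆ Diagram.cofreeYonedaInv w) ≫ Diagram.cofreeYoneda b Y _ =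
          coendAtι S X b n ⋆ w := by
      intro w
      rw [Diagram.cofreeYoneda, ← Category.assoc, Diagram.gcomp_π, gcomp_whiskerLeft,
        Category.assoc]
      exact congrArg (fun t => coendAtι S X b n ⋆ t) (Diagram.cofreeYonedaInv_yoneda w)
    rw [key, key, h]
  rw [← Diagram.cofreeYonedaInv_yoneda u, e, Diagram.cofreeYonedaInv_yoneda]

end CoendAt

section CototAt

variable (S : SimplexCategory ⥤ V) [HasLimits M] [Tensored V M] [Cotensored V M]
  (X : SimplexCategory ⥤ Diagram V D M) (b : D)

/-- The components at `b` of the projections of `∫_n {Sₙ, Xⁿ}`. -/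
def cototAtπ (n : SimplexCategory) :
    S.obj n ⟶ ((cotot S X).val b ⟶[V] (X.obj n).val b) :=
  cototπ S X n ≫ Diagram.homπ _ _ b

lemma cototAtπ_condition {m n : SimplexCategory} (f : m ⟶ n) :
    cototAtπ S X b m ≫ eHomWhiskerLeft V _ (Diagram.Hom.app (X.map f) b) =
      S.map f ≫ cototAtπ S X b n := by
  have h := congrArg (fun t => t ≫ Diagram.homπ _ _ b) (cototπ_condition S X f)
  simp only [Category.assoc, Diagram.eHomWhiskerLeft_π] at h
  rw [cototAtπ, cototAtπ, Category.assoc, h]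

/-- The cosimplicial object `n ↦ M(Y, Xⁿ b)`. -/
@[reducible]
def cohomCosimplicialAt (Y : M) : SimplexCategory ⥤ V where
  obj n := Y ⟶[V] (X.obj n).val b
  map f := eHomWhiskerLeft V Y (Diagram.Hom.app (X.map f) b)
  map_id n := by rw [X.map_id, Diagram.id_app, eHomWhiskerLeft_id]
  map_comp f g := by rw [X.map_comp, Diagram.comp_app, eHomWhiskerLeft_comp]

variable {S X b}

lemma exists_cototAt_lift {A : V} {Y : M} (φ : ∀ n, S.obj n ⊗ A ⟶ (Y ⟶[V] (X.obj n).val b))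
    (h : IsTotFamily S (cohomCosimplicialAt X b Y) φ) :
    ∃ u : A ⟶ (Y ⟶[V] (cotot S X).val b), ∀ n, (β_ _ _).hom ≫ (u ⋆ cototAtπ S X b n) = φ n := by
  have h' : IsTotFamily S (cohomCosimplicial X (Diagram.free V b Y))
      (fun n => Diagram.freeYonedaInv (φ n)) := by
    intro m n f
    refine (Diagram.freeYonedaInv_whisker (X.map f) b Y (φ m)).trans ?_
    refine (congrArg (fun t => Diagram.freeYonedaInv t) (h f)).trans ?_
    apply Diagram.freeYoneda_ext
    rw [Category.assoc, Diagram.freeYonedaInv_yoneda, Diagram.freeYonedaInv_yoneda]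
  refine ⟨cototLift _ h' ≫ Diagram.freeYoneda b Y _, fun n => ?_⟩
  have e := cototLift_π _ h' n
  rw [Diagram.freeYoneda, cototAtπ, ← Category.assoc (cototLift _ h'),
    ← gcomp_whiskerRight, ← Diagram.gcomp_π, e]
  simp only [Category.assoc, SymmetricCategory.symmetry_assoc]
  exact Diagram.freeYonedaInv_yoneda (φ n)

lemma cototAt_ehom_ext {A : V} {Y : M} {u u' : A ⟶ (Y ⟶[V] (cotot S X).val b)}
    (h : ∀ n, u ⋆ cototAtπ S X b n = u' ⋆ cototAtπ S X b n) : u = u' := by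
  have e : Diagram.freeYonedaInv u = Diagram.freeYonedaInv u' := by
    apply cotot_ehom_ext
    intro n
    apply Diagram.freeYoneda_ext
    have key : ∀ w : A ⟶ (Y ⟶[V] (cotot S X).val b),
        (Diagram.freeYonedaInv w ⋆ cototπ S X n) ≫ Diagram.freeYoneda b Y _ =
          w ⋆ cototAtπ S X b n := by
      intro w
      rw [Diagram.freeYoneda, ← Category.assoc, Diagram.gcomp_π, gcomp_whiskerRight,
        Category.assoc]
      exact congrArg (fun t => t ⋆ cototAtπ S X b n) (Diagram.freeYonedaInv_yoneda w)
    rw [key, key, h]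
  rw [← Diagram.freeYonedaInv_yoneda u, e, Diagram.freeYonedaInv_yoneda]

end CototAt

end Evaluation

end

section

local infixr:70 " ⋆ " => gcomp

section WeightUnit

variable {V : Type u₁} [Category.{v} V] [MonoidalCategory V] (L : SSet.{v} ⥤ V) [L.Monoidal]

/-- The map `L(Δ[n]) ⟶ E`. -/
def weightUnit (n : SimplexCategory) : (simplexWeight L).obj n ⟶ 𝟙_ V :=
  L.map (SemiCartesianMonoidalCategory.toUnit (SSet.stdSimplex.obj n)) ≫ Functor.OplaxMonoidal.η L

/-- The point `E ⟶ L(Δ[0])`. -/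
def weightPt : 𝟙_ V ⟶ (simplexWeight L).obj (SimplexCategory.mk 0) :=
  Functor.LaxMonoidal.ε L ≫ L.map (SSet.const (SSet.stdSimplex.obj₀Equiv.symm 0))

lemma map_weightUnit {m n : SimplexCategory} (f : m ⟶ n) :
    (simplexWeight L).map f ≫ weightUnit L n = weightUnit L m := by
  change L.map _ ≫ L.map _ ≫ _ = L.map _ ≫ _
  rw [← L.map_comp_assoc]
  rfl

lemma unit_counit {K : SSet.{v}} (k : 𝟙_ SSet.{v} ⟶ K) (k' : K ⟶ 𝟙_ SSet.{v}) :
    (Functor.LaxMonoidal.ε L ≫ L.map k) ≫ L.map k' ≫ Functor.OplaxMonoidal.η L = 𝟙 _ := by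
  rw [Category.assoc, ← L.map_comp_assoc,
    SemiCartesianMonoidalCategory.toUnit_unique (k ≫ k') (𝟙 _), L.map_id, Category.id_comp,
    Functor.Monoidal.ε_η]

lemma counit_unit {K K' : SSet.{v}} (k : K ⟶ 𝟙_ SSet.{v}) (k' : 𝟙_ SSet.{v} ⟶ K') :
    (L.map k ≫ Functor.OplaxMonoidal.η L) ≫ Functor.LaxMonoidal.ε L ≫ L.map k' =
      L.map (k ≫ k') := by
  rw [Category.assoc, Functor.Monoidal.η_ε_assoc, ← L.map_comp]

lemma weightPt_weightUnit : weightPt L ≫ weightUnit L _ = 𝟙 _ :=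
  unit_counit L _ _

lemma weightUnit_weightPt (n : SimplexCategory) :
    weightUnit L n ≫ weightPt L = (simplexWeight L).map (toZero n) :=
  (counit_unit L _ _).trans (congrArg (fun t => L.map t)
    (SSet.stdSimplex.isTerminalObj₀.hom_ext _ _))

end WeightUnit

section ExtraDegeneracy

variable {V : Type u₁} [Category.{v} V] [MonoidalCategory V] [SymmetricCategory V]
  [MonoidalClosed V] {D : Type v} [EnrichedCategory V D]
  {M : Type u₂} [Category.{v} M] [EnrichedOrdinaryCategory V M]
  [HasLimits V] [HasLimits M] [HasColimits M] [Tensored V M] [Cotensored V M]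
  (L : SSet.{v} ⥤ V) [L.Monoidal]

section Coend

variable {X : SimplexCategoryᵒᵖ ⥤ Diagram V D M} {F : Diagram V D M}
  (aug : ∀ n : SimplexCategory, X.obj (op n) ⟶ F)
  (haug : ∀ {m n : SimplexCategory} (f : m ⟶ n), X.map f.op ≫ aug m = aug n)

include haug in
lemma coendAug_compatible {m n : SimplexCategory} (f : m ⟶ n) :
    (weightUnit L m ≫ eHomEquiv V (aug m)) ≫ eHomWhiskerRight V (X.map f.op) F =
      (simplexWeight L).map f ≫ weightUnit L n ≫ eHomEquiv V (aug n) := by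
  rw [Category.assoc, ← eHomEquiv_comp_right, haug, ← map_weightUnit L f, Category.assoc]

/-- The augmentation of a realization. -/
def coendAug : weightedCoend (simplexWeight L) X ⟶ F :=
  weightedCoendDesc (fun n => weightUnit L n ≫ eHomEquiv V (aug n)) (coendAug_compatible L aug haug)

lemma coendAtι_coendAug (b : D) (n : SimplexCategory) :
    coendAtι (simplexWeight L) X b n ≫
        eHomWhiskerLeft V _ (Diagram.Hom.app (coendAug L aug haug) b) =
      weightUnit L n ≫ eHomEquiv V (Diagram.Hom.app (aug n) b) := by
  have h := congrArg (fun t => t ≫ Diagram.homπ _ _ b)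
    (weightedCoendι_desc _ (coendAug_compatible L aug haug) n)
  simp only [Category.assoc, Diagram.eHomWhiskerLeft_π, Diagram.eHomEquiv_π] at h
  rw [coendAtι, Category.assoc]
  exact h

variable [L.IsLeftAdjoint]

/-- An augmented simplicial diagram with an extra degeneracy at `b`. -/
theorem coendAug_homotopyEquivalence (E : VertexExtension) (b : D)
    (σ : ∀ n : SimplexCategory, (X.obj (op n)).val b ⟶
      (X.obj (op (SimplexCategory.mk (n.len + 1)))).val b)
    (σ₀ : F.val b ⟶ (X.obj (op (SimplexCategory.mk 0))).val b)
    (hσ : ∀ {m n : SimplexCategory} (f : m ⟶ n), σ n ≫ Diagram.Hom.app (X.map (E.map f).op) b =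
      Diagram.Hom.app (X.map f.op) b ≫ σ m)
    (hincl : ∀ n, σ n ≫ Diagram.Hom.app (X.map (E.incl n).op) b = 𝟙 _)
    (hpt : ∀ n, σ n ≫ Diagram.Hom.app (X.map (E.pt n).op) b = Diagram.Hom.app (aug n) b ≫ σ₀)
    (hσ₀ : σ₀ ≫ Diagram.Hom.app (aug _) b = 𝟙 _) :
    simplicialHomotopyEquivalences L M (Diagram.Hom.app (coendAug L aug haug) b) := by
  let s : F.val b ⟶ (weightedCoend (simplexWeight L) X).val b := (eHomEquiv V).symm
    (weightPt L ≫ coendAtι (simplexWeight L) X b _ ≫ eHomWhiskerRight V σ₀ _)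
  have hs : eHomEquiv V s =
    weightPt L ≫ coendAtι (simplexWeight L) X b _ ≫ eHomWhiskerRight V σ₀ _ :=
    Equiv.apply_symm_apply _ _
  have h1 : s ≫ Diagram.Hom.app (coendAug L aug haug) b = 𝟙 _ := by
    apply (eHomEquiv V).injective
    rw [eHomEquiv_comp_left, hs, Category.assoc, Category.assoc, ← eHom_whisker_exchange,
      reassoc_of% coendAtι_coendAug, reassoc_of% weightPt_weightUnit, ← eHomEquiv_comp_right, hσ₀]
  refine ⟨s, ?_, ?_⟩
  swap
  · rw [h1]
    exact Relation.EqvGen.refl _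
  obtain ⟨h, hfam, hstart, htarget⟩ := exists_extraHomotopy L E
    (homCosimplicialAt X b ((weightedCoend (simplexWeight L) X).val b))
    (coendAtι (simplexWeight L) X b) (fun f => coendAtι_condition _ X b f)
    (fun n => eHomWhiskerRight V (σ n) _)
    (fun f => by
      refine (eHomWhiskerRight_comp _ _ _ _).symm.trans ((congrArg
        (fun t => eHomWhiskerRight V t _) (hσ f).symm).trans (eHomWhiskerRight_comp _ _ _ _)))
    (fun n => by
      refine (eHomWhiskerRight_comp _ _ _ _).symm.trans ((congrArg
        (fun t => eHomWhiskerRight V t _) (hincl n)).trans (eHomWhiskerRight_id V _ _)))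
  obtain ⟨H, hH⟩ := exists_coendAt_lift h hfam
  have key : ∀ (i : Fin 2) (g : (weightedCoend (simplexWeight L) X).val b ⟶
      (weightedCoend (simplexWeight L) X).val b),
      (∀ n, (ρ_ _).inv ≫ _ ◁ vertex L i ≫ h n =
        coendAtι (simplexWeight L) X b n ≫ eHomWhiskerLeft V _ g) →
      vertex L i ≫ H = eHomEquiv V g := by
    intro i g hg
    apply coendAt_ehom_ext
    intro n
    rw [gcomp_comp_right, hH, gcomp_eHomEquiv, ← hg, Iso.hom_inv_id_assoc]
  have e1 : vertex L E.start ≫ H = eHomEquiv V (𝟙 _) := key _ _ (fun n => by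
    rw [hstart, eHomWhiskerLeft_id, Category.comp_id])
  have e2 : vertex L E.target ≫ H =
      eHomEquiv V (Diagram.Hom.app (coendAug L aug haug) b ≫ s) := key _ _ (fun n => by
    rw [htarget, eHomWhiskerLeft_comp, reassoc_of% coendAtι_coendAug, ← eHomEquiv_comp_left,
      eHomEquiv_comp_right, hs]
    have e3 := weightUnit_weightPt L n
    simp only [Category.assoc]
    rw [reassoc_of% e3]
    refine congrArg (fun t => (simplexWeight L).map (toZero n) ≫
      coendAtι (simplexWeight L) X b _ ≫ t) ?_
    refine (eHomWhiskerRight_comp _ _ _ _).symm.trans ((congrArg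
        (fun t => eHomWhiskerRight V t _) (hpt n)).trans (eHomWhiskerRight_comp _ _ _ _)))
  have hE : (E.start = 0 ∧ E.target = 1) ∨ (E.start = 1 ∧ E.target = 0) ∨ E.start = E.target := by
    omega
  rcases hE with ⟨h0, h0'⟩ | ⟨h0, h0'⟩ | h0
  · rw [h0] at e1
    rw [h0'] at e2
    exact Relation.EqvGen.symm _ _ (Relation.EqvGen.rel _ _ ⟨H, e1, e2⟩)
  · rw [h0] at e1
    rw [h0'] at e2
    exact Relation.EqvGen.rel _ _ ⟨H, e2, e1⟩
  · rw [h0] at e1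
    rw [(eHomEquiv V).injective (e2.symm.trans e1)]
    exact Relation.EqvGen.refl _

end Coend

section Cotot

variable {X : SimplexCategory ⥤ Diagram V D M} {F : Diagram V D M}
  (aug : ∀ n : SimplexCategory, F ⟶ X.obj n)
  (haug : ∀ {m n : SimplexCategory} (f : m ⟶ n), aug m ≫ X.map f = aug n)

include haug in
lemma cototAug_compatible {m n : SimplexCategory} (f : m ⟶ n) :
    (weightUnit L m ≫ eHomEquiv V (aug m)) ≫ eHomWhiskerLeft V F (X.map f) =
      (simplexWeight L).map f ≫ weightUnit L n ≫ eHomEquiv V (aug n) := by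
  rw [Category.assoc, ← eHomEquiv_comp_left, haug, ← map_weightUnit L f, Category.assoc]

/-- The coaugmentation of a totalization. -/
def cototAug : F ⟶ cotot (simplexWeight L) X :=
  cototDesc (fun n => weightUnit L n ≫ eHomEquiv V (aug n)) (cototAug_compatible L aug haug)

lemma cototAtπ_cototAug (b : D) (n : SimplexCategory) :
    cototAtπ (simplexWeight L) X b n ≫
        eHomWhiskerRight V (Diagram.Hom.app (cototAug L aug haug) b) _ =
      weightUnit L n ≫ eHomEquiv V (Diagram.Hom.app (aug n) b) := by
  have h := congrArg (fun t => t ≫ Diagram.homπ _ _ b)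
    (cototDesc_π _ (cototAug_compatible L aug haug) n)
  simp only [Category.assoc, Diagram.eHomWhiskerRight_π, Diagram.eHomEquiv_π] at h
  rw [cototAtπ, Category.assoc]
  exact h

variable [L.IsLeftAdjoint]

/-- A coaugmented cosimplicial diagram with an extra codegeneracy at `b`. -/
theorem cototAug_homotopyEquivalence (E : VertexExtension) (b : D)
    (σ : ∀ n : SimplexCategory, (X.obj (SimplexCategory.mk (n.len + 1))).val b ⟶
      (X.obj n).val b)
    (σ₀ : (X.obj (SimplexCategory.mk 0)).val b ⟶ F.val b)
    (hσ : ∀ {m n : SimplexCategory} (f : m ⟶ n), Diagram.Hom.app (X.map (E.map f)) b ≫ σ n =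
      σ m ≫ Diagram.Hom.app (X.map f) b)
    (hincl : ∀ n, Diagram.Hom.app (X.map (E.incl n)) b ≫ σ n = 𝟙 _)
    (hpt : ∀ n, Diagram.Hom.app (X.map (E.pt n)) b ≫ σ n = σ₀ ≫ Diagram.Hom.app (aug n) b)
    (hσ₀ : Diagram.Hom.app (aug _) b ≫ σ₀ = 𝟙 _) :
    simplicialHomotopyEquivalences L M (Diagram.Hom.app (cototAug L aug haug) b) := by
  let s : (cotot (simplexWeight L) X).val b ⟶ F.val b := (eHomEquiv V).symm
    (weightPt L ≫ cototAtπ (simplexWeight L) X b _ ≫ eHomWhiskerLeft V _ σ₀)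
  have hs : eHomEquiv V s =
    weightPt L ≫ cototAtπ (simplexWeight L) X b _ ≫ eHomWhiskerLeft V _ σ₀ :=
    Equiv.apply_symm_apply _ _
  have h1 : Diagram.Hom.app (cototAug L aug haug) b ≫ s = 𝟙 _ := by
    apply (eHomEquiv V).injective
    rw [eHomEquiv_comp_right, hs, Category.assoc, Category.assoc, eHom_whisker_exchange,
      reassoc_of% cototAtπ_cototAug, reassoc_of% weightPt_weightUnit, ← eHomEquiv_comp_left, hσ₀]
  refine ⟨s, ?_, ?_⟩
  · rw [h1]
    exact Relation.EqvGen.refl _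
  obtain ⟨h, hfam, hstart, htarget⟩ := exists_extraHomotopy L E
    (cohomCosimplicialAt X b ((cotot (simplexWeight L) X).val b))
    (cototAtπ (simplexWeight L) X b) (fun f => cototAtπ_condition _ X b f)
    (fun n => eHomWhiskerLeft V _ (σ n))
    (fun f => by
      refine (eHomWhiskerLeft_comp _ _ _ _).symm.trans ((congrArg
        (fun t => eHomWhiskerLeft V _ t) (hσ f).symm).trans (eHomWhiskerLeft_comp _ _ _ _)))
    (fun n => by
      refine (eHomWhiskerLeft_comp _ _ _ _).symm.trans ((congrArg
        (fun t => eHomWhiskerLeft V _ t) (hincl n)).trans (eHomWhiskerLeft_id V _ _)))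
  obtain ⟨H, hH⟩ := exists_cototAt_lift h hfam
  have key : ∀ (i : Fin 2) (g : (cotot (simplexWeight L) X).val b ⟶
      (cotot (simplexWeight L) X).val b),
      (∀ n, (ρ_ _).inv ≫ _ ◁ vertex L i ≫ h n =
        cototAtπ (simplexWeight L) X b n ≫ eHomWhiskerRight V g _) →
      vertex L i ≫ H = eHomEquiv V g := by
    intro i g hg
    apply cototAt_ehom_ext
    intro n
    have e := hg n
    rw [← hH, BraidedCategory.braiding_naturality_right_assoc, ← gcomp_comp_left,
      Iso.inv_comp_eq, braiding_tensorUnit_right, Category.assoc] at e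
    have e' := (cancel_epi _).1 e
    rw [Iso.inv_comp_eq] at e'
    rw [e', eHomEquiv_gcomp]
  have e1 : vertex L E.start ≫ H = eHomEquiv V (𝟙 _) := key _ _ (fun n => by
    rw [hstart, eHomWhiskerRight_id, Category.comp_id])
  have e2 : vertex L E.target ≫ H =
      eHomEquiv V (s ≫ Diagram.Hom.app (cototAug L aug haug) b) := key _ _ (fun n => by
    rw [htarget, eHomWhiskerRight_comp, reassoc_of% cototAtπ_cototAug, ← eHomEquiv_comp_right,
      eHomEquiv_comp_left, hs]
    have e3 := weightUnit_weightPt L n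
    simp only [Category.assoc]
    rw [reassoc_of% e3]
    refine congrArg (fun t => (simplexWeight L).map (toZero n) ≫
      cototAtπ (simplexWeight L) X b _ ≫ t) ?_
    refine (eHomWhiskerLeft_comp _ _ _ _).symm.trans ((congrArg
        (fun t => eHomWhiskerLeft V _ t) (hpt n)).trans (eHomWhiskerLeft_comp _ _ _ _)))
  have hE : (E.start = 0 ∧ E.target = 1) ∨ (E.start = 1 ∧ E.target = 0) ∨ E.start = E.target := by
    omega
  rcases hE with ⟨h0, h0'⟩ | ⟨h0, h0'⟩ | h0
  · rw [h0] at e1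
    rw [h0'] at e2
    exact Relation.EqvGen.symm _ _ (Relation.EqvGen.rel _ _ ⟨H, e1, e2⟩)
  · rw [h0] at e1
    rw [h0'] at e2
    exact Relation.EqvGen.rel _ _ ⟨H, e2, e1⟩
  · rw [h0] at e1
    rw [(eHomEquiv V).injective (e2.symm.trans e1)]
    exact Relation.EqvGen.refl _

end Cotot

end ExtraDegeneracy

end

section

local infixr:70 " ⋆ " => gcomp

section BarResolution

variable {V : Type u₁} [Category.{v} V] [MonoidalCategory V] [SymmetricCategory V]
  [MonoidalClosed V] {D : Type v} [EnrichedCategory V D]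
  {M : Type u₂} [Category.{v} M] [EnrichedOrdinaryCategory V M]
  [HasLimits V] [HasLimits M] [HasColimits M] [Tensored V M] [Cotensored V M]

section Bar

variable (F : Diagram V D M)

/-- The simplicial diagram `B(D, D, F)`. -/
abbrev barDiag : SimplexCategoryᵒᵖ ⥤ Diagram V D M := (simplicialBarDiagram V D M).flip.obj F

/-- The summands of `Bₙ(D, D, F)`. -/
abbrev barTerm {n : ℕ} (α : Fin (n + 1) → D) : Diagram V D M :=
  (barWord (freeComonad V D M) α).obj F

/-- The coprojections of `Bₙ(D, D, F)`. -/
def barIn (n : SimplexCategory) (α : Fin (n.len + 1) → D) :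
    barTerm F α ⟶ (barDiag F).obj (op n) :=
  Sigma.ι (fun α : Fin (n.len + 1) → D => barTerm F α) α

variable {F}

/-- Morphisms out of `Bₙ(D, D, F)`. -/
def barOut {n : SimplexCategory} {Y : Diagram V D M}
    (φ : ∀ α : Fin (n.len + 1) → D, barTerm F α ⟶ Y) : (barDiag F).obj (op n) ⟶ Y :=
  Sigma.desc φ

lemma barIn_barOut {n : SimplexCategory} {Y : Diagram V D M}
    (φ : ∀ α : Fin (n.len + 1) → D, barTerm F α ⟶ Y) (α : Fin (n.len + 1) → D) :
    barIn F n α ≫ barOut φ = φ α :=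
  Sigma.ι_desc _ _

lemma bar_hom_ext {n : SimplexCategory} {Y : Diagram V D M} {f g : (barDiag F).obj (op n) ⟶ Y}
    (h : ∀ α, barIn F n α ≫ f = barIn F n α ≫ g) : f = g :=
  Sigma.hom_ext _ _ h

lemma barIn_map {m n : SimplexCategory} (f : m ⟶ n) (α : Fin (n.len + 1) → D) :
    barIn F n α ≫ (barDiag F).map f.op =
      (barWordMap (freeComonad V D M) f.toOrderHom α).app F ≫ barIn F m (α ∘ f.toOrderHom) :=
  Sigma.ι_desc _ _

variable (F) in
/-- The augmentation of `B(D, D, F)`. -/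
def barDiagAug (n : SimplexCategory) : (barDiag F).obj (op n) ⟶ F :=
  barOut fun α => barAug (freeComonad V D M) α F

lemma map_barDiagAug {m n : SimplexCategory} (f : m ⟶ n) :
    (barDiag F).map f.op ≫ barDiagAug F m = barDiagAug F n := by
  apply bar_hom_ext
  intro α
  unfold barDiagAug
  rw [← Category.assoc, barIn_map, Category.assoc, barIn_barOut, barIn_barOut]
  exact barWordMap_barAug (freeComonad V D M) f.toOrderHom α F

variable {b : D} {Y : M} {n : SimplexCategory}

/-- Morphisms out of `Bₙ(D, D, F)(b)`. -/
def barAtOut (φ : ∀ α : Fin (n.len + 1) → D, (barTerm F α).val b ⟶ Y) :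
    ((barDiag F).obj (op n)).val b ⟶ Y :=
  (Diagram.cofreeHomEquiv b _ Y).symm
    (barOut fun α => Diagram.cofreeHomEquiv b _ Y (φ α))

lemma cofreeHomEquiv_symm_naturality {G G' : Diagram V D M} (f : G' ⟶ G)
    (h : G ⟶ Diagram.cofree V b Y) :
    (Diagram.cofreeHomEquiv b G' Y).symm (f ≫ h) =
      Diagram.Hom.app f b ≫ (Diagram.cofreeHomEquiv b G Y).symm h := by
  rw [Equiv.symm_apply_eq, Diagram.cofreeHomEquiv_naturality, Equiv.apply_symm_apply]

lemma barIn_barAtOut (φ : ∀ α : Fin (n.len + 1) → D, (barTerm F α).val b ⟶ Y)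
    (α : Fin (n.len + 1) → D) : Diagram.Hom.app (barIn F n α) b ≫ barAtOut φ = φ α := by
  unfold barAtOut
  rw [← cofreeHomEquiv_symm_naturality, barIn_barOut, Equiv.symm_apply_apply]

lemma barAt_hom_ext {f g : ((barDiag F).obj (op n)).val b ⟶ Y}
    (h : ∀ α, Diagram.Hom.app (barIn F n α) b ≫ f = Diagram.Hom.app (barIn F n α) b ≫ g) :
    f = g := by
  apply (Diagram.cofreeHomEquiv b _ Y).injective
  apply bar_hom_ext
  intro α
  rw [← Diagram.cofreeHomEquiv_naturality, h, Diagram.cofreeHomEquiv_naturality]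

/-- The extra degeneracy on the summands of `B(D, D, F)(b)`. -/
def barTermσ (F : Diagram V D M) {n : ℕ} (α : Fin (n + 1) → D) (b : D) :
    (barTerm F α).val b ⟶ (barTerm F (snocSeq α b)).val b :=
  barσ (Diagram.freeAdj V M) α b F

/-- The extra degeneracy on the augmentation. -/
def barTermσ₀ (F : Diagram V D M) (b : D) :
    F.val b ⟶ (barTerm F (fun _ : Fin 1 => b)).val b :=
  barσ₀ (Diagram.freeAdj V M) b F

/-- The extra degeneracy of `B(D, D, F)(b)`. -/
def barDiagσ (F : Diagram V D M) (b : D) (n : SimplexCategory) : ((barDiag F).obj (op n)).val b ⟶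
    ((barDiag F).obj (op (SimplexCategory.mk (n.len + 1)))).val b :=
  barAtOut fun α => barTermσ F α b ≫
    Diagram.Hom.app (barIn F (SimplexCategory.mk (n.len + 1)) (snocSeq α b)) b

/-- The extra degeneracy of the augmentation. -/
def barDiagσ₀ (F : Diagram V D M) (b : D) :
    F.val b ⟶ ((barDiag F).obj (op (SimplexCategory.mk 0))).val b :=
  barTermσ₀ F b ≫
    Diagram.Hom.app (barIn F (SimplexCategory.mk 0) (fun _ => b)) b

variable (L : SSet.{v} ⥤ V) [L.Monoidal]

/-- The augmentation `B(D, D, F) ⟶ F`. -/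
def barε (F : Diagram V D M) : bar L F ⟶ F :=
  coendAug L (X := barDiag F) (barDiagAug F) map_barDiagAug

variable [L.IsLeftAdjoint]

theorem barε_homotopyEquivalence (F : Diagram V D M) (b : D) :
    simplicialHomotopyEquivalences L M (Diagram.Hom.app (barε L F) b) := by
  refine coendAug_homotopyEquivalence L (X := barDiag F) (barDiagAug F) map_barDiagAug lastVertex b
    (barDiagσ F b) (barDiagσ₀ F b) ?_ ?_ ?_ ?_
  · intro m n f
    apply barAt_hom_ext
    intro α
    have h1 := barσ_naturality (Diagram.freeAdj V M) f α (b := b) (X := F)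
      (barIn F (SimplexCategory.mk (m.len + 1)))
    have h2 := congrArg (fun t => Diagram.Hom.app t b) (barIn_map (F := F) (snocHom f) (snocSeq α b))
    have h3 := congrArg (fun t => Diagram.Hom.app t b) (barIn_map (F := F) f α)
    simp only [Diagram.comp_app] at h2 h3
    unfold barDiagσ
    rw [← Category.assoc, barIn_barAtOut, Category.assoc, reassoc_of% h3,
      barIn_barAtOut]
    exact (congrArg (fun t => barTermσ F α b ≫ t) h2).trans h1
  · intro n
    apply barAt_hom_ext
    intro α
    have h1 := barσ_incl (Diagram.freeAdj V M) α (b := b) (X := F) (barIn F n)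
    have h2 := congrArg (fun t => Diagram.Hom.app t b)
      (barIn_map (F := F) (lastVertex.incl n) (snocSeq α b))
    simp only [Diagram.comp_app] at h2
    unfold barDiagσ
    rw [← Category.assoc, barIn_barAtOut, Category.assoc, Category.comp_id]
    exact (congrArg (fun t => barTermσ F α b ≫ t) h2).trans h1
  · intro n
    apply barAt_hom_ext
    intro α
    have h1 := barσ_pt (Diagram.freeAdj V M) α (b := b) (X := F) (barIn F (SimplexCategory.mk 0))
      (lastVertex.pt n).toOrderHom rfl
    have h2 := congrArg (fun t => Diagram.Hom.app t b)
      (barIn_map (F := F) (lastVertex.pt n) (snocSeq α b))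
    have h3 := congrArg (fun t => Diagram.Hom.app t b)
      (barIn_barOut (F := F) (n := n) (fun α => barAug (freeComonad V D M) α F) α)
    simp only [Diagram.comp_app] at h2 h3
    unfold barDiagσ barDiagAug
    rw [← Category.assoc, barIn_barAtOut, Category.assoc, reassoc_of% h3]
    exact (congrArg (fun t => barTermσ F α b ≫ t) h2).trans h1
  · have h3 := congrArg (fun t => Diagram.Hom.app t b)
      (barIn_barOut (F := F) (n := SimplexCategory.mk 0)
        (fun α => barAug (freeComonad V D M) α F) (fun _ => b))
    simp only [Diagram.comp_app] at h3
    unfold barDiagσ₀ barDiagAug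
    rw [Category.assoc, h3]
    exact barσ₀_barAug (Diagram.freeAdj V M)

end Bar

section Cobar

variable (F : Diagram V D M)

/-- The cosimplicial diagram `C(D, D, F)`. -/
abbrev cobarDiag : SimplexCategory ⥤ Diagram V D M := (cosimplicialCobarDiagram V D M).flip.obj F

/-- The factors of `Cⁿ(D, D, F)`. -/
abbrev cobarTerm {n : ℕ} (α : Fin (n + 1) → D) : Diagram V D M :=
  ((barWord (cofreeComonad V D M) α).obj (op F)).unop

/-- The projections of `Cⁿ(D, D, F)`. -/
def cobarOut (n : SimplexCategory) (α : Fin (n.len + 1) → D) :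
    (cobarDiag F).obj n ⟶ cobarTerm F α :=
  Pi.π (fun α : Fin (n.len + 1) → D => cobarTerm F α) α

variable {F}

/-- Morphisms into `Cⁿ(D, D, F)`. -/
def cobarIn {n : SimplexCategory} {Y : Diagram V D M}
    (φ : ∀ α : Fin (n.len + 1) → D, Y ⟶ cobarTerm F α) : Y ⟶ (cobarDiag F).obj n :=
  Pi.lift φ

lemma cobarIn_cobarOut {n : SimplexCategory} {Y : Diagram V D M}
    (φ : ∀ α : Fin (n.len + 1) → D, Y ⟶ cobarTerm F α) (α : Fin (n.len + 1) → D) :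
    cobarIn φ ≫ cobarOut F n α = φ α :=
  Pi.lift_π _ _

lemma cobar_hom_ext {n : SimplexCategory} {Y : Diagram V D M} {f g : Y ⟶ (cobarDiag F).obj n}
    (h : ∀ α, f ≫ cobarOut F n α = g ≫ cobarOut F n α) : f = g :=
  Pi.hom_ext _ _ h

lemma cobarDiag_map {m n : SimplexCategory} (f : m ⟶ n) (α : Fin (n.len + 1) → D) :
    (cobarDiag F).map f ≫ cobarOut F n α = cobarOut F m (α ∘ (SimplexCategory.rev.map f).toOrderHom) ≫
      ((barWordMap (cofreeComonad V D M) (SimplexCategory.rev.map f).toOrderHom α).app (op F)).unop :=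
  Pi.lift_π _ _

lemma cobarDiag_map_rev {m n : SimplexCategory} (g : m ⟶ n) (α : Fin (n.len + 1) → D) :
    (cobarDiag F).map (SimplexCategory.rev.map g) ≫ cobarOut F n α =
      cobarOut F m (α ∘ g.toOrderHom) ≫
        ((barWordMap (cofreeComonad V D M) g.toOrderHom α).app (op F)).unop := by
  have h : ∀ g' : m ⟶ n, g' = g → cobarOut F m (α ∘ g'.toOrderHom) ≫
        ((barWordMap (cofreeComonad V D M) g'.toOrderHom α).app (op F)).unop =
      cobarOut F m (α ∘ g.toOrderHom) ≫
        ((barWordMap (cofreeComonad V D M) g.toOrderHom α).app (op F)).unop := by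
    rintro _ rfl
    rfl
  exact (cobarDiag_map (SimplexCategory.rev.map g) α).trans
    (h _ (SimplexCategory.rev_map_rev_map g))

variable (F) in
/-- The coaugmentation of `C(D, D, F)`. -/
def cobarDiagAug (n : SimplexCategory) : F ⟶ (cobarDiag F).obj n :=
  cobarIn fun α => (barAug (cofreeComonad V D M) α (op F)).unop

lemma cobarDiagAug_map {m n : SimplexCategory} (f : m ⟶ n) :
    cobarDiagAug F m ≫ (cobarDiag F).map f = cobarDiagAug F n := by
  apply cobar_hom_ext
  intro α
  unfold cobarDiagAug
  rw [Category.assoc, cobarDiag_map, ← Category.assoc, cobarIn_cobarOut, cobarIn_cobarOut]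
  exact congrArg Quiver.Hom.unop (barWordMap_barAug (cofreeComonad V D M)
    (SimplexCategory.rev.map f).toOrderHom α (op F))

variable {b : D} {Y : M} {n : SimplexCategory}

/-- Morphisms into `Cⁿ(D, D, F)(b)`. -/
def cobarAtIn (φ : ∀ α : Fin (n.len + 1) → D, Y ⟶ (cobarTerm F α).val b) :
    Y ⟶ ((cobarDiag F).obj n).val b :=
  Diagram.freeHomEquiv b Y _ (cobarIn fun α => (Diagram.freeHomEquiv b Y _).symm (φ α))

lemma cobarAtIn_cobarOut (φ : ∀ α : Fin (n.len + 1) → D, Y ⟶ (cobarTerm F α).val b)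
    (α : Fin (n.len + 1) → D) : cobarAtIn φ ≫ Diagram.Hom.app (cobarOut F n α) b = φ α := by
  unfold cobarAtIn
  rw [← Diagram.freeHomEquiv_naturality, cobarIn_cobarOut, Equiv.apply_symm_apply]

lemma cobarAt_hom_ext {f g : Y ⟶ ((cobarDiag F).obj n).val b}
    (h : ∀ α, f ≫ Diagram.Hom.app (cobarOut F n α) b = g ≫ Diagram.Hom.app (cobarOut F n α) b) :
    f = g := by
  apply (Diagram.freeHomEquiv b Y _).symm.injective
  apply cobar_hom_ext
  intro α
  apply (Diagram.freeHomEquiv b Y _).injective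
  rw [Diagram.freeHomEquiv_naturality, Diagram.freeHomEquiv_naturality, Equiv.apply_symm_apply,
    Equiv.apply_symm_apply, h]

variable (V M) in
/-- The adjunctions between cofree diagrams and evaluations, on opposite categories. -/
@[reducible]
def cofreeAdjOp (b : D) : (Diagram.cofreeFunctor V M b).op ⊣ (Diagram.ev V M b).op :=
  (Diagram.cofreeAdj V M b).op

/-- The extra codegeneracy on the factors of `C(D, D, F)(b)`. -/
def cobarTermσ (F : Diagram V D M) {n : ℕ} (α : Fin (n + 1) → D) (b : D) :
    (cobarTerm F (snocSeq α b)).val b ⟶ (cobarTerm F α).val b :=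
  (barσ (cofreeAdjOp V M) α b (op F)).unop

/-- The extra codegeneracy on the coaugmentation. -/
def cobarTermσ₀ (F : Diagram V D M) (b : D) :
    (cobarTerm F (fun _ : Fin 1 => b)).val b ⟶ F.val b :=
  (barσ₀ (cofreeAdjOp V M) b (op F)).unop

/-- The extra codegeneracy of `C(D, D, F)(b)`. -/
def cobarDiagσ (F : Diagram V D M) (b : D) (n : SimplexCategory) :
    ((cobarDiag F).obj (SimplexCategory.mk (n.len + 1))).val b ⟶ ((cobarDiag F).obj n).val b :=
  cobarAtIn fun α =>
    Diagram.Hom.app (cobarOut F (SimplexCategory.mk (n.len + 1)) (snocSeq α b)) b ≫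
      cobarTermσ F α b

/-- The extra codegeneracy of the coaugmentation. -/
def cobarDiagσ₀ (F : Diagram V D M) (b : D) :
    ((cobarDiag F).obj (SimplexCategory.mk 0)).val b ⟶ F.val b :=
  Diagram.Hom.app (cobarOut F (SimplexCategory.mk 0) (fun _ => b)) b ≫
    cobarTermσ₀ F b

variable (L : SSet.{v} ⥤ V) [L.Monoidal]

/-- The coaugmentation `F ⟶ C(D, D, F)`. -/
def cobarη (F : Diagram V D M) : F ⟶ cobar L F :=
  cototAug L (X := cobarDiag F) (cobarDiagAug F) cobarDiagAug_map

variable [L.IsLeftAdjoint]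

theorem cobarη_homotopyEquivalence (F : Diagram V D M) (b : D) :
    simplicialHomotopyEquivalences L M (Diagram.Hom.app (cobarη L F) b) := by
  refine cototAug_homotopyEquivalence L (X := cobarDiag F) (cobarDiagAug F) cobarDiagAug_map
    firstVertex b (cobarDiagσ F b) (cobarDiagσ₀ F b) ?_ ?_ ?_ ?_
  · intro m n f
    apply cobarAt_hom_ext
    intro α
    have h1 := congrArg Quiver.Hom.unop (barσ_naturality (cofreeAdjOp V M)
      (SimplexCategory.rev.map f) α (b := b) (X := op F)
      (fun γ => (cobarOut F (SimplexCategory.mk (m.len + 1)) γ).op))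
    have h2 := congrArg (fun t => Diagram.Hom.app t b)
      (cobarDiag_map_rev (F := F) (snocHom (SimplexCategory.rev.map f)) (snocSeq α b))
    have h3 := congrArg (fun t => Diagram.Hom.app t b) (cobarDiag_map (F := F) f α)
    simp only [Diagram.comp_app] at h2 h3
    unfold cobarDiagσ
    rw [Category.assoc, cobarAtIn_cobarOut, Category.assoc (cobarAtIn _), h3,
      ← Category.assoc (cobarAtIn _), cobarAtIn_cobarOut]
    refine (Category.assoc _ _ _).symm.trans ?_
    exact (congrArg (fun t => t ≫ cobarTermσ F α b) h2).trans h1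
  · intro n
    apply cobarAt_hom_ext
    intro α
    have h1 := congrArg Quiver.Hom.unop (barσ_incl (cofreeAdjOp V M) α (b := b) (X := op F)
      (fun γ => (cobarOut F n γ).op))
    have h2 := congrArg (fun t => Diagram.Hom.app t b)
      (cobarDiag_map_rev (F := F) (lastVertex.incl n) (snocSeq α b))
    simp only [Diagram.comp_app] at h2
    unfold cobarDiagσ
    rw [Category.assoc, cobarAtIn_cobarOut, ← Category.assoc, Category.id_comp]
    exact (congrArg (fun t => t ≫ cobarTermσ F α b) h2).trans h1
  · intro n
    apply cobarAt_hom_ext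
    intro α
    have h1 := congrArg Quiver.Hom.unop (barσ_pt (cofreeAdjOp V M) α (b := b) (X := op F)
      (fun γ => (cobarOut F (SimplexCategory.mk 0) γ).op) (lastVertex.pt n).toOrderHom rfl)
    have h2 := congrArg (fun t => Diagram.Hom.app t b)
      (cobarDiag_map_rev (F := F) (lastVertex.pt n) (snocSeq α b))
    have h3 := congrArg (fun t => Diagram.Hom.app t b)
      (cobarIn_cobarOut (F := F) (n := n)
        (fun α => (barAug (cofreeComonad V D M) α (op F)).unop) α)
    simp only [Diagram.comp_app] at h2 h3
    unfold cobarDiagσ cobarDiagAug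
    rw [Category.assoc, cobarAtIn_cobarOut, Category.assoc (cobarDiagσ₀ F b), h3]
    refine (Category.assoc _ _ _).symm.trans ?_
    exact (congrArg (fun t => t ≫ cobarTermσ F α b) h2).trans h1
  · have h3 := congrArg (fun t => Diagram.Hom.app t b)
      (cobarIn_cobarOut (F := F) (n := SimplexCategory.mk 0)
        (fun α => (barAug (cofreeComonad V D M) α (op F)).unop) (fun _ => b))
    simp only [Diagram.comp_app] at h3
    unfold cobarDiagσ₀ cobarDiagAug
    rw [← Category.assoc, h3]
    exact congrArg Quiver.Hom.unop (barσ₀_barAug (cofreeAdjOp V M) (X := op F))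

end Cobar

end BarResolution

end

section

local infixr:70 " ⋆ " => gcomp

section BarHom

variable {V : Type u₁} [Category.{v} V] [MonoidalCategory V] [SymmetricCategory V]
  [MonoidalClosed V] {D : Type v} [EnrichedCategory V D]
  {M : Type u₂} [Category.{v} M] [EnrichedOrdinaryCategory V M]
  [HasLimits V] [HasLimits M] [HasColimits M] [Tensored V M] [Cotensored V M]

lemma cosimplicialCobarHom_map_app {m n : SimplexCategory} (f : m ⟶ n) (X Y : Diagram V D M) :
    ((cosimplicialCobarHom V D M).map f).app (op X, Y) =
      (cobarHomIso m.len X Y).inv ≫ eHomWhiskerRight V ((barDiag X).map f.op) Y ≫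
        (cobarHomIso n.len X Y).hom := by
  refine congrArg (fun t => (cobarHomIso m.len X Y).inv ≫ t ≫ (cobarHomIso n.len X Y).hom) ?_
  dsimp [Functor.uncurry]
  simp
  exact (congrArg (fun t => _ ≫ t) (Category.comp_id _)).trans (Category.comp_id _)

lemma cosimplicialCobarHom_obj_map_left (n : SimplexCategory) {X X' : Diagram V D M} (f : X' ⟶ X)
    (Y : Diagram V D M) :
    ((cosimplicialCobarHom V D M).obj n).map (X := (op X, Y)) (Y := (op X', Y)) (f.op, 𝟙 Y) =
      (cobarHomIso n.len X Y).inv ≫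
        eHomWhiskerRight V (((simplicialBarDiagram V D M).obj (op n)).map f) Y ≫
        (cobarHomIso n.len X' Y).hom := by
  refine congrArg (fun t => (cobarHomIso n.len X Y).inv ≫ t ≫ (cobarHomIso n.len X' Y).hom) ?_
  dsimp [Functor.uncurry]
  simp
  exact Category.comp_id _

lemma cosimplicialCobarHom_obj_map_right (n : SimplexCategory) (X : Diagram V D M)
    {Y Y' : Diagram V D M} (g : Y ⟶ Y') :
    ((cosimplicialCobarHom V D M).obj n).map (X := (op X, Y)) (Y := (op X, Y')) (𝟙 (op X), g) =
      (cobarHomIso n.len X Y).inv ≫ eHomWhiskerLeft V _ g ≫ (cobarHomIso n.len X Y').hom := by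
  refine congrArg (fun t => (cobarHomIso n.len X Y).inv ≫ t ≫ (cobarHomIso n.len X Y').hom) ?_
  dsimp [Functor.uncurry]
  simp
  exact Category.id_comp _

lemma weightedCoendMap_id (S : SimplexCategory ⥤ V) (X : SimplexCategoryᵒᵖ ⥤ Diagram V D M) :
    weightedCoendMap S (𝟙 X) = 𝟙 _ := by
  apply weightedCoend_hom_ext
  intro n
  rw [weightedCoendι_map, NatTrans.id_app, eHomWhiskerRight_id, eHomWhiskerLeft_id]

lemma weightedCoendMap_comp (S : SimplexCategory ⥤ V) {X Y Z : SimplexCategoryᵒᵖ ⥤ Diagram V D M}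
    (f : X ⟶ Y) (g : Y ⟶ Z) :
    weightedCoendMap S (f ≫ g) = weightedCoendMap S f ≫ weightedCoendMap S g := by
  apply weightedCoend_hom_ext
  intro n
  rw [weightedCoendι_map, eHomWhiskerLeft_comp, ← Category.assoc, weightedCoendι_map,
    Category.assoc, ← eHom_whisker_exchange, ← Category.assoc, weightedCoendι_map, Category.assoc,
    ← eHomWhiskerRight_comp, NatTrans.comp_app]

variable (L : SSet.{v} ⥤ V)

/-- The bar construction as a functor. -/
@[reducible]
def barFunctor : Diagram V D M ⥤ Diagram V D M where
  obj F := bar L F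
  map f := weightedCoendMap (simplexWeight L) ((simplicialBarDiagram V D M).flip.map f)
  map_id _ := (congrArg (weightedCoendMap _) (CategoryTheory.Functor.map_id _ _)).trans (weightedCoendMap_id _ _)
  map_comp _ _ := (congrArg (weightedCoendMap _) (Functor.map_comp _ _ _)).trans
    (weightedCoendMap_comp _ _ _)

/-- The cobar construction as a functor. -/
@[reducible]
def cobarFunctor : Diagram V D M ⥤ Diagram V D M where
  obj F := cobar L F
  map f := cototMap (simplexWeight L) ((cosimplicialCobarDiagram V D M).flip.map f)
  map_id _ := (congrArg (cototMap _) (CategoryTheory.Functor.map_id _ _)).trans ((weightedEnd _ _).map_id _)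
  map_comp _ _ := (congrArg (cototMap _) (Functor.map_comp _ _ _)).trans
    ((weightedEnd _ _).map_comp _ _)

/-- The coprojections of the bar construction. -/
def barι (X : Diagram V D M) (n : SimplexCategory) :
    (simplexWeight L).obj n ⟶ ((barDiag X).obj (op n) ⟶[V] bar L X) :=
  weightedCoendι (simplexWeight L) (barDiag X) n

lemma barι_map {X Y : Diagram V D M} (f : X ⟶ Y) (n : SimplexCategory) :
    barι L X n ≫ eHomWhiskerLeft V _ ((barFunctor L).map f) =
      barι L Y n ≫ eHomWhiskerRight V (((simplicialBarDiagram V D M).obj (op n)).map f) _ :=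
  weightedCoendι_map _ n

/-- The isomorphism `M^D(B(D, D, X), Y) ≅ ∫_n [Δⁿ, M^D(Bₙ(D, D, X), Y)]`. -/
def barHomTotIso (X Y : Diagram V D M) :
    (bar L X ⟶[V] Y) ≅ tot (simplexWeight L) (homCosimplicial (barDiag X) Y) :=
  weightedCoendHomIso (simplexWeight L) (barDiag X) Y

/-- The isomorphism of cosimplicial objects `M^D(B(D, D, X), Y) ≅ C(X, D, Y)`. -/
def cobarHomCosimplicialIso (X Y : Diagram V D M) :
    homCosimplicial (barDiag X) Y ≅ (cosimplicialCobarHom V D M).flip.obj (op X, Y) :=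
  NatIso.ofComponents (fun n => cobarHomIso n.len X Y) (fun {m n} f => by
    refine Eq.trans ?_ (congrArg (fun t => (cobarHomIso m.len X Y).hom ≫ t)
      (cosimplicialCobarHom_map_app f X Y)).symm
    exact ((cobarHomIso m.len X Y).hom_inv_id_assoc _).symm)

/-- The isomorphism `M^D(B(D, D, X), Y) ≅ C(X, D, Y)`. -/
def barHomIso (X Y : Diagram V D M) : (bar L X ⟶[V] Y) ≅ (cobarHom D M L).obj (op X, Y) :=
  barHomTotIso L X Y ≪≫
    (weightedEnd (simplexWeight L) MonoidalClosed.internalHom).mapIso (cobarHomCosimplicialIso X Y)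

/-- The projections of `C(X, D, Y)`. -/
def cobarHomEv (X Y : Diagram V D M) (n : SimplexCategory) :
    (simplexWeight L).obj n ⊗ (cobarHom D M L).obj (op X, Y) ⟶ cobarHomObj n.len X Y :=
  totEv (simplexWeight L) ((cosimplicialCobarHom V D M).flip.obj (op X, Y)) n

variable {L}

lemma cobarHom_hom_ext {X Y : Diagram V D M} {A : V} {u u' : A ⟶ (cobarHom D M L).obj (op X, Y)}
    (h : ∀ n, _ ◁ u ≫ cobarHomEv L X Y n = _ ◁ u' ≫ cobarHomEv L X Y n) : u = u' :=
  tot_hom_ext h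

lemma cobarHom_map_ev {X X' Y Y' : Diagram V D M} (f : X' ⟶ X) (g : Y ⟶ Y') (n : SimplexCategory) :
    (simplexWeight L).obj n ◁ (cobarHom D M L).map (X := (op X, Y)) (Y := (op X', Y')) (f.op, g) ≫
        cobarHomEv L X' Y' n = cobarHomEv L X Y n ≫
          ((cosimplicialCobarHom V D M).obj n).map (X := (op X, Y)) (Y := (op X', Y')) (f.op, g) :=
  tot_map_totEv (S := simplexWeight L) ((cosimplicialCobarHom V D M).flip.map
    (X := (op X, Y)) (Y := (op X', Y')) (f.op, g)) n

lemma cobarHom_map_left_ev {X X' : Diagram V D M} (f : X' ⟶ X) (Y : Diagram V D M)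
    (n : SimplexCategory) :
    (simplexWeight L).obj n ◁ (cobarHom D M L).map (X := (op X, Y)) (Y := (op X', Y)) (f.op, 𝟙 Y) ≫
        cobarHomEv L X' Y n = cobarHomEv L X Y n ≫ (cobarHomIso n.len X Y).inv ≫
          eHomWhiskerRight V (((simplicialBarDiagram V D M).obj (op n)).map f) Y ≫
            (cobarHomIso n.len X' Y).hom :=
  (cobarHom_map_ev f (𝟙 Y) n).trans (congrArg (fun t => cobarHomEv L X Y n ≫ t)
    (cosimplicialCobarHom_obj_map_left n f Y))

lemma cobarHom_map_right_ev (X : Diagram V D M) {Y Y' : Diagram V D M} (g : Y ⟶ Y')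
    (n : SimplexCategory) :
    (simplexWeight L).obj n ◁ (cobarHom D M L).map (X := (op X, Y)) (Y := (op X, Y'))
          (𝟙 (op X), g) ≫ cobarHomEv L X Y' n =
      cobarHomEv L X Y n ≫ (cobarHomIso n.len X Y).inv ≫ eHomWhiskerLeft V _ g ≫
        (cobarHomIso n.len X Y').hom :=
  (cobarHom_map_ev (𝟙 X) g n).trans (congrArg (fun t => cobarHomEv L X Y n ≫ t)
    (cosimplicialCobarHom_obj_map_right n X g))

lemma barHomIso_ev {X Y : Diagram V D M} {A : V} (u : A ⟶ (bar L X ⟶[V] Y))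
    (n : SimplexCategory) :
    _ ◁ (u ≫ (barHomIso L X Y).hom) ≫ cobarHomEv L X Y n =
      (barι L X n ⋆ u) ≫ (cobarHomIso n.len X Y).hom := by
  have h1 : _ ◁ (u ≫ (barHomTotIso L X Y).hom) ≫ totEv (simplexWeight L) _ n = barι L X n ⋆ u :=
    weightedCoendHomIso_totEv (S := simplexWeight L) (X := barDiag X) u n
  have h2 : _ ≫ cobarHomEv L X Y n = _ ≫ (cobarHomIso n.len X Y).hom :=
    tot_map_totEv (S := simplexWeight L) (cobarHomCosimplicialIso X Y).hom n
  have h3 : u ≫ (barHomIso L X Y).hom = (u ≫ (barHomTotIso L X Y).hom) ≫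
      (weightedEnd (simplexWeight L) MonoidalClosed.internalHom).map
        (cobarHomCosimplicialIso X Y).hom := (Category.assoc _ _ _).symm
  refine (congrArg (fun t => (simplexWeight L).obj n ◁ t ≫ cobarHomEv L X Y n) h3).trans ?_
  refine (congrArg (fun t => t ≫ cobarHomEv L X Y n)
    (MonoidalCategory.whiskerLeft_comp _ _ _)).trans ?_
  refine (Category.assoc _ _ _).trans ((congrArg (fun t => _ ≫ t) h2).trans ?_)
  exact (Category.assoc _ _ _).symm.trans (congrArg (fun t => t ≫ (cobarHomIso n.len X Y).hom) h1)

lemma whiskerRight_barHomIso {X X' : Diagram V D M} (f : X' ⟶ X) (Y : Diagram V D M) :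
    eHomWhiskerRight V ((barFunctor L).map f) Y ≫ (barHomIso L X' Y).hom =
      (barHomIso L X Y).hom ≫
        (cobarHom D M L).map (X := (op X, Y)) (Y := (op X', Y)) (f.op, 𝟙 Y) := by
  apply cobarHom_hom_ext
  intro n
  have h := barHomIso_ev (L := L) (𝟙 (bar L X ⟶[V] Y)) n
  rw [Category.id_comp] at h
  rw [barHomIso_ev, MonoidalCategory.whiskerLeft_comp, Category.assoc,
    cobarHom_map_left_ev, ← Category.assoc (_ ◁ _), h, Category.assoc, Iso.hom_inv_id_assoc]
  have h1 := whiskerLeft_gcomp (barι L X' n)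
    (𝟙 (bar L X ⟶[V] Y)) ((barFunctor L).map f)
  rw [Category.id_comp] at h1
  rw [← h1, ← Category.assoc, gcomp_whiskerRight]
  refine congrArg (fun t => (t ⋆ 𝟙 _) ≫ (cobarHomIso n.len X' Y).hom) ?_
  exact barι_map L f n

lemma whiskerLeft_barHomIso (X : Diagram V D M) {Y Y' : Diagram V D M} (g : Y ⟶ Y') :
    eHomWhiskerLeft V (bar L X) g ≫ (barHomIso L X Y').hom =
      (barHomIso L X Y).hom ≫
        (cobarHom D M L).map (X := (op X, Y)) (Y := (op X, Y')) (𝟙 (op X), g) := by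
  apply cobarHom_hom_ext
  intro n
  have h := barHomIso_ev (L := L) (𝟙 (bar L X ⟶[V] Y)) n
  rw [Category.id_comp] at h
  rw [barHomIso_ev, MonoidalCategory.whiskerLeft_comp, Category.assoc,
    cobarHom_map_right_ev, ← Category.assoc (_ ◁ _), h, Category.assoc, Iso.hom_inv_id_assoc]
  rw [← Category.assoc]
  refine congrArg (fun t => t ≫ (cobarHomIso n.len X Y').hom) ?_
  exact ((gcomp_whiskerLeft (barι L X n) (𝟙 _) g).trans
    (congrArg (fun t => barι L X n ⋆ t) (Category.id_comp _))).symm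

end BarHom

end

section

section FunctorDuality

/-- A natural isomorphism `N(F X, Y) ≅ N(X, P Y)`. -/
structure FunctorDuality (V : Type u₁) [Category.{v} V] [MonoidalCategory V]
    {N : Type u₂} [Category.{v} N] [EnrichedOrdinaryCategory V N] (F : N ⥤ N) (P : Nᵒᵖ ⥤ Nᵒᵖ) where
  iso (X : N) (Y : Nᵒᵖ) : (F.obj X ⟶[V] Y.unop) ≅ (X ⟶[V] (P.obj Y).unop)
  whiskerRight {X X' : N} (f : X ⟶ X') (Y : Nᵒᵖ) :
    eHomWhiskerRight V (F.map f) Y.unop ≫ (iso X Y).hom =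
      (iso X' Y).hom ≫ eHomWhiskerRight V f _
  whiskerLeft (X : N) {Y Y' : Nᵒᵖ} (g : Y ⟶ Y') :
    eHomWhiskerLeft V _ g.unop ≫ (iso X Y).hom =
      (iso X Y').hom ≫ eHomWhiskerLeft V X (P.map g).unop

variable {V : Type u₁} [Category.{v} V] [MonoidalCategory V]
  {N : Type u₂} [Category.{v} N] [EnrichedOrdinaryCategory V N]

namespace FunctorDuality

variable {F F' F'' G G' : N ⥤ N} {P P' P'' Q Q' : Nᵒᵖ ⥤ Nᵒᵖ}

variable (V N) in
/-- The identity functors are dual to each other. -/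
def refl : FunctorDuality V (𝟭 N) (𝟭 Nᵒᵖ) where
  iso _ _ := Iso.refl _
  whiskerRight _ _ := (Category.comp_id _).trans (Category.id_comp _).symm
  whiskerLeft _ _ _ _ := (Category.comp_id _).trans (Category.id_comp _).symm

/-- Duality of composite functors. -/
def comp (Φ : FunctorDuality V F P) (Ψ : FunctorDuality V G Q) :
    FunctorDuality V (F ⋙ G) (Q ⋙ P) where
  iso X Y := Ψ.iso (F.obj X) Y ≪≫ Φ.iso X (Q.obj Y)
  whiskerRight f Y := by
    have h1 := Ψ.whiskerRight (F.map f) Y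
    have h2 := Φ.whiskerRight f (Q.obj Y)
    dsimp only [Functor.comp_map, Functor.comp_obj, Iso.trans_hom]
    rw [reassoc_of% h1, h2, Category.assoc]
  whiskerLeft X Y Y' g := by
    have h1 := Ψ.whiskerLeft (F.obj X) g
    have h2 := Φ.whiskerLeft X (Q.map g)
    dsimp only [Functor.comp_map, Functor.comp_obj, Iso.trans_hom]
    rw [reassoc_of% h1, h2, Category.assoc]

/-- Transport of a duality along an isomorphism. -/
def ofIso (Φ : FunctorDuality V F P) (e : P ≅ Q) : FunctorDuality V F Q where
  iso X Y := Φ.iso X Y ≪≫ ((eHomFunctor V N).obj (op X)).mapIso (e.app Y).symm.unop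
  whiskerRight {X X'} f Y := by
    have h1 := Φ.whiskerRight f Y
    change _ ≫ _ ≫ eHomWhiskerLeft V X (e.inv.app Y).unop =
      (_ ≫ eHomWhiskerLeft V X' (e.inv.app Y).unop) ≫ _
    rw [reassoc_of% h1, Category.assoc, eHom_whisker_exchange]
  whiskerLeft X Y Y' g := by
    have h1 := Φ.whiskerLeft X g
    have h2 := congrArg Quiver.Hom.unop (e.inv.naturality g)
    simp only [unop_comp] at h2
    change _ ≫ _ ≫ eHomWhiskerLeft V X (e.inv.app Y).unop =
      (_ ≫ eHomWhiskerLeft V X (e.inv.app Y').unop) ≫ _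
    rw [reassoc_of% h1, Category.assoc, ← eHomWhiskerLeft_comp, ← eHomWhiskerLeft_comp, h2]

/-- Compatibility of natural transformations with dualities. -/
def Compatible (Φ : FunctorDuality V F P) (Φ' : FunctorDuality V F' P') (u : F ⟶ F')
    (w : P ⟶ P') : Prop :=
  ∀ (X : N) (Y : Nᵒᵖ), eHomWhiskerRight V (u.app X) Y.unop ≫ (Φ.iso X Y).hom =
    (Φ'.iso X Y).hom ≫ eHomWhiskerLeft V X (w.app Y).unop

variable {Φ : FunctorDuality V F P} {Φ' : FunctorDuality V F' P'} {Φ'' : FunctorDuality V F'' P''}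
  {Ψ : FunctorDuality V G Q} {Ψ' : FunctorDuality V G' Q'}

variable (Φ) in
lemma Compatible.id : Compatible Φ Φ (𝟙 F) (𝟙 P) := fun _ _ =>
  (congrArg (fun t => t ≫ _) (eHomWhiskerRight_id V _ _)).trans
    ((Category.id_comp _).trans ((Category.comp_id _).symm.trans
      (congrArg (fun t => _ ≫ t) (eHomWhiskerLeft_id V _ _).symm)))

lemma Compatible.comp {u : F ⟶ F'} {u' : F' ⟶ F''} {w : P ⟶ P'} {w' : P' ⟶ P''}
    (h : Compatible Φ Φ' u w) (h' : Compatible Φ' Φ'' u' w') :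
    Compatible Φ Φ'' (u ≫ u') (w ≫ w') := fun X Y => by
  rw [NatTrans.comp_app, eHomWhiskerRight_comp, Category.assoc, h X Y, reassoc_of% (h' X Y),
    ← eHomWhiskerLeft_comp, NatTrans.comp_app, unop_comp]

variable (Φ) in
lemma Compatible.whiskerLeft {u : G ⟶ G'} {w : Q ⟶ Q'} (h : Compatible Ψ Ψ' u w) :
    Compatible (Φ.comp Ψ) (Φ.comp Ψ') (Functor.whiskerLeft F u) (Functor.whiskerRight w P) :=
  fun X Y => by
    have h1 := h (F.obj X) Y
    have h2 := Φ.whiskerLeft X (w.app Y)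
    change eHomWhiskerRight V (u.app (F.obj X)) _ ≫ (Ψ.iso (F.obj X) Y).hom ≫ _ =
      ((Ψ'.iso (F.obj X) Y).hom ≫ (Φ.iso X (Q'.obj Y)).hom) ≫ _
    rw [reassoc_of% h1, Category.assoc]
    exact congrArg (fun t => _ ≫ t) h2

variable (Ψ) in
lemma Compatible.whiskerRight {u : F ⟶ F'} {w : P ⟶ P'} (h : Compatible Φ Φ' u w) :
    Compatible (Φ.comp Ψ) (Φ'.comp Ψ) (Functor.whiskerRight u G) (Functor.whiskerLeft Q w) :=
  fun X Y => by
    have h1 := h X (Q.obj Y)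
    have h2 := Ψ.whiskerRight (u.app X) Y
    change eHomWhiskerRight V (G.map (u.app X)) _ ≫ (Ψ.iso (F.obj X) Y).hom ≫ _ =
      ((Ψ.iso (F'.obj X) Y).hom ≫ (Φ'.iso X (Q.obj Y)).hom) ≫ _
    rw [reassoc_of% h2, Category.assoc]
    exact congrArg (fun t => _ ≫ t) h1

variable (Φ) in
lemma Compatible.ofIso_inv (e : P ≅ Q) : Compatible (Φ.ofIso e) Φ (𝟙 F) e.inv := fun X Y =>
  (congrArg (fun t => t ≫ ((Φ.ofIso e).iso X Y).hom) (eHomWhiskerRight_id V _ _)).trans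
    (Category.id_comp _)

variable (Φ) in
lemma Compatible.ofIso_hom (e : P ≅ Q) : Compatible Φ (Φ.ofIso e) (𝟙 F) e.hom := fun X Y => by
  refine ((congrArg (fun t => t ≫ _) (eHomWhiskerRight_id V _ _)).trans
    (Category.id_comp _)).trans ?_
  change _ = ((Φ.iso X Y).hom ≫ eHomWhiskerLeft V X (e.inv.app Y).unop) ≫ _
  rw [Category.assoc, ← eHomWhiskerLeft_comp, ← unop_comp, e.hom_inv_id_app]
  exact (Category.comp_id _).symm.trans (congrArg (fun t => _ ≫ t) (eHomWhiskerLeft_id V _ _).symm)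

variable (Φ) in
lemma Compatible.comp_refl : Compatible (Φ.comp (refl V N)) Φ F.rightUnitor.hom P.leftUnitor.hom :=
  fun X Y => by
    refine ((congrArg (fun t => t ≫ _) (eHomWhiskerRight_id V _ _)).trans
      (Category.id_comp _)).trans ((Category.id_comp _).trans ?_)
    exact (Category.comp_id _).symm.trans
      (congrArg (fun t => (Φ.iso X Y).hom ≫ t) (eHomWhiskerLeft_id V _ _).symm)

variable (Φ Ψ Φ'') in
lemma Compatible.comp_assoc : Compatible (Φ.comp (Ψ.comp Φ'')) ((Φ.comp Ψ).comp Φ'')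
    (Functor.associator F G F'').inv (Functor.associator P'' Q P).hom := fun X Y => by
  refine ((congrArg (fun t => t ≫ _) (eHomWhiskerRight_id V _ _)).trans
    (Category.id_comp _)).trans ((Category.assoc _ _ _).trans ?_)
  exact (Category.comp_id _).symm.trans
    (congrArg (fun t => _ ≫ t) (eHomWhiskerLeft_id V _ _).symm)

end FunctorDuality

open FunctorDuality

variable {I : Type*}

variable (V) in
/-- Dualities `N(T X, Y) ≅ N(X, S Y)` for families of comonads `T` and of monads `S`,
compatible with the comonad and the monad structures. -/
structure ComonadDuality (T : I → Comonad N) (S : I → Comonad Nᵒᵖ) where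
  duality (i : I) : FunctorDuality V (T i).toFunctor (S i).toFunctor
  ε (i : I) : Compatible (duality i) (FunctorDuality.refl V N) (T i).ε (S i).ε
  δ (i : I) : Compatible (duality i) ((duality i).comp (duality i)) (T i).δ (S i).δ

/-- The first `n` terms of a sequence in the reverse order. -/
def revSeq (a : ℕ → I) : ℕ → ℕ → I
  | 0 => fun _ => a 0
  | n + 1 => consSeq (a n) (revSeq a n)

lemma revSeq_apply (a : ℕ → I) {n i j : ℕ} (h : i + j + 1 = n) : revSeq a n i = a j := by
  induction n generalizing i with
  | zero => omega
  | succ n ih =>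
    cases i with
    | zero =>
      obtain rfl : j = n := by omega
      rfl
    | succ i => exact ih (by omega)

variable {T : I → Comonad N} {S : I → Comonad Nᵒᵖ} (Δ : ComonadDuality V T S)

namespace ComonadDuality

/-- The dualities for words. -/
def word (a : ℕ → I) : ∀ n : ℕ,
    FunctorDuality V (EnrichedHomotopy.word T a n) (EnrichedHomotopy.word S (revSeq a n) n)
  | 0 => FunctorDuality.refl V N
  | n + 1 => ((word a n).comp (Δ.duality (a n))).ofIso (consIso S (a n) (revSeq a n) n).symm

lemma compatible_wordε (a : ℕ → I) (n : ℕ) : Compatible (Δ.word a (n + 1)) (Δ.word a n)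
    (wordε T a n) (wordInnerε S (a n) (revSeq a n) n) := by
  have h := ((Compatible.ofIso_inv _ (consIso S (a n) (revSeq a n) n).symm).comp
    (Compatible.whiskerLeft (Δ.word a n) (Δ.ε (a n)))).comp (Compatible.comp_refl (Δ.word a n))
  refine (congrArg₂ (Compatible _ _) ?_ ?_).mp h
  · ext X
    exact (Category.comp_id _).trans (Category.id_comp _)
  · ext X
    exact Category.comp_id _

variable {a b : ℕ → I} {f g : ℕ → ℕ} {m n : ℕ}

lemma compatible_coextEq {i j : I} (h : j = i) {p : ℕ} {A B : ℕ → I} {F H : N ⥤ N}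
    (u : F ⋙ (T i).toFunctor ⟶ H) (Φ : FunctorDuality V F (EnrichedHomotopy.word S A p))
    (Ψ : FunctorDuality V H (EnrichedHomotopy.word S B m))
    (hg : IsReindexing g (consSeq i A) (consSeq j B) (m + 1) (p + 1)) (hg0 : g 0 = 0)
    (hg' : IsReindexing (fun k => g (k + 1)) (consSeq i A) B m (p + 1))
    (hu : Compatible ((Φ.comp (Δ.duality i)).ofIso (consIso S i A p).symm) Ψ u
      (wordMap S (fun k => g (k + 1)) (consSeq i A) B m (p + 1) hg')) :
    Compatible ((Φ.comp (Δ.duality i)).ofIso (consIso S i A p).symm)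
      ((Ψ.comp (Δ.duality j)).ofIso (consIso S j B m).symm) (coextEq T h u)
      (wordMap S g (consSeq i A) (consSeq j B) (m + 1) (p + 1) hg) := by
  subst h
  have h1 := Compatible.whiskerLeft Φ (Δ.δ j)
  have h2 := Compatible.whiskerRight (Δ.duality j) ((Compatible.ofIso_hom (Φ.comp (Δ.duality j)) 
    (consIso S j A p).symm).comp hu)
  have h3 := (((Compatible.ofIso_inv (Φ.comp (Δ.duality j)) (consIso S j A p).symm).comp h1).comp
    ((Compatible.comp_assoc _ _ _).comp h2)).comp (Compatible.ofIso_hom (Ψ.comp (Δ.duality j)) (consIso S j B m).symm)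
  have h4 := wordMap_keep S hg hg0
  rw [← Iso.eq_comp_inv] at h4
  rw [h4]
  refine (congrArg₂ (Compatible _ _) ?_ ?_).mp h3
  · ext X
    change ((𝟙 ((T j).obj (F.obj X)) ≫ (T j).δ.app (F.obj X)) ≫ 𝟙 _ ≫ (T j).map (𝟙 _ ≫ u.app X)) ≫
      𝟙 ((T j).obj (H.obj X)) = kext (T j) (u.app X)
    rw [Category.id_comp, Category.id_comp, Category.id_comp, Category.comp_id]
    rfl
  · ext X
    dsimp [wordInnerδ]
    simp

lemma compatible_wordMap (hf : IsReindexing f a b m n)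
    (hg : IsReindexing g (revSeq a n) (revSeq b m) m n)
    (h : ∀ i j, i + j + 1 = m → g i + f j + 1 = n) :
    Compatible (Δ.word a n) (Δ.word b m) (wordMap T f a b m n hf)
        (wordMap S g (revSeq a n) (revSeq b m) m n hg) := by
  induction hk : n + m generalizing n m f g with
  | zero =>
    obtain rfl : n = 0 := by omega
    obtain rfl : m = 0 := by omega
    have e1 : wordMap T f a b 0 0 hf = 𝟙 _ := skip_self T a _
    have e2 : wordMap S g (revSeq a 0) (revSeq b 0) 0 0 hg = 𝟙 _ := skip_self S _ _
    rw [e1, e2]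
    exact Compatible.id (FunctorDuality.refl V N)
  | succ k ih =>
    cases n with
    | zero => exact absurd (hf.lt 0 (by omega)) (by omega)
    | succ n =>
      by_cases hd : IsReindexing f a b m n
      · have hg1 : ∀ i < m, 1 ≤ g i := fun i hi => by
          have := h i (m - 1 - i) (by omega)
          have := hd.lt (m - 1 - i) (by omega)
          omega
        have hg' : IsReindexing (fun i => g i - 1) (revSeq a n) (revSeq b m) m n := by
          refine ⟨fun i hi => ?_, fun i j hij hj => ?_, fun i hi => ?_⟩
          · have := hg.lt i hi
            have := hg1 i hi
            omega
          · have := hg.mono i j hij hj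
            omega
          · refine (hg.eq i hi).trans ?_
            have := hg1 i hi
            obtain ⟨p, hp⟩ : ∃ p, g i = p + 1 := ⟨g i - 1, by omega⟩
            rw [hp]
            rfl
        have e1 := skip_wordMap T hd (Nat.le_succ n)
        have e2 := wordMap_drop S hg' (a n)
        have e3 := wordMap_congr S hg (isReindexing_drop hg' (a n))
          (fun i hi => (Nat.sub_add_cancel (hg1 i hi)).symm)
        have e4 := ih hd hg' (fun i j hij => by
          have := h i j hij
          have := hg1 i (by omega)
          omega) (by omega)
        have e5 := (Δ.compatible_wordε a n).comp e4
        rw [skip_succ] at e1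
        refine (congrArg₂ (Compatible _ _) e1 ?_).mp e5
        exact e2.symm.trans e3.symm
      · obtain ⟨m, rfl⟩ : ∃ p, m = p + 1 := by
          refine ⟨m - 1, (Nat.sub_add_cancel (Nat.pos_of_ne_zero fun hm => hd ?_)).symm⟩
          subst hm
          exact ⟨fun i hi => absurd hi (by omega), fun i j _ hj => absurd hj (by omega),
            fun i hi => absurd hi (by omega)⟩
        have hfm : f m = n := by
          by_contra hne
          refine hd ⟨fun i hi => ?_, hf.mono, hf.eq⟩
          have := hf.mono i m (by omega) (by omega)
          have := hf.lt m (by omega)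
          omega
        subst hfm
        have hg0 : g 0 = 0 := by
          have := h 0 m (by omega)
          omega
        have hf' := hf.pred
        have hg' : IsReindexing (fun k => g (k + 1)) (revSeq a (f m + 1)) (revSeq b m) m
            (f m + 1) :=
          ⟨fun _ hj => hg.lt _ (Nat.succ_lt_succ hj),
            fun _ _ hjk hk => hg.mono _ _ (Nat.succ_le_succ hjk) (Nat.succ_lt_succ hk),
            fun j hj => hg.eq (j + 1) (Nat.succ_lt_succ hj)⟩
        have e1 := ih hf' hg' (fun i j hij => h (i + 1) j (by omega)) (by omega)
        rw [wordMap_last]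
        exact Δ.compatible_coextEq (hf.eq m (Nat.lt_succ_self m)) (F := EnrichedHomotopy.word T a (f m))
          (H := EnrichedHomotopy.word T b m) _ (Δ.word a (f m)) (Δ.word b m) hg hg0 hg' e1

end ComonadDuality

end FunctorDuality

end

section

local infixr:70 " ⋆ " => gcomp

section BarCobarDuality

variable {V : Type u₁} [Category.{v} V] [MonoidalCategory V] [SymmetricCategory V]
  [MonoidalClosed V] {D : Type v} [EnrichedCategory V D]
  {M : Type u₂} [Category.{v} M] [EnrichedOrdinaryCategory V M]
  [HasLimits V] [HasLimits M] [HasColimits M] [Tensored V M] [Cotensored V M]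

namespace Diagram

/-- The enriched Yoneda isomorphism `M^D(F, {D(-, b), X}) ≅ M(F b, X)`. -/
def cofreeYonedaIso (b : D) (X : M) (F : Diagram V D M) :
    (F ⟶[V] cofree V b X) ≅ (F.val b ⟶[V] X) where
  hom := cofreeYoneda b X F
  inv := cofreeYonedaInv (𝟙 _)
  hom_inv_id := cofreeYoneda_ext (by
    rw [Category.assoc, cofreeYonedaInv_yoneda, Category.comp_id, Category.id_comp])
  inv_hom_id := cofreeYonedaInv_yoneda _

lemma comp_freeYoneda_whisker {b : D} {X : M} {F G : Diagram V D M} (f : free V b X ⟶ G) :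
    eHomWhiskerRight V f F ≫ freeYoneda b X F =
      homπ G F b ≫ eHomWhiskerRight V (freeHomEquiv b X G f) (F.val b) := by
  rw [freeYoneda, reassoc_of% eHomWhiskerRight_π, ← eHomWhiskerRight_comp]
  rfl

lemma comp_cofreeYoneda_whisker {b : D} {X : M} {F G : Diagram V D M} (f : G ⟶ cofree V b X) :
    eHomWhiskerLeft V F f ≫ cofreeYoneda b X F =
      homπ F G b ≫ eHomWhiskerLeft V (F.val b) ((cofreeHomEquiv b G X).symm f) := by
  rw [cofreeYoneda, reassoc_of% eHomWhiskerLeft_π, ← eHomWhiskerLeft_comp]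
  rfl

end Diagram

open Diagram FunctorDuality

lemma freeHomEquiv_comonad_map (b : D) {X X' : Diagram V D M} (f : X ⟶ X') :
    freeHomEquiv b (X.val b) (free V b (X'.val b)) ((freeComonad V D M b).map f) =
      Hom.app f b ≫ freeη V b (X'.val b) :=
  (Equiv.apply_symm_apply _ _).trans (congrArg (fun t => Hom.app f b ≫ t) (Category.comp_id _))

lemma freeHomEquiv_comonad_ε (b : D) (X : Diagram V D M) :
    freeHomEquiv b (X.val b) X ((freeComonad V D M b).ε.app X) = 𝟙 _ :=
  Equiv.apply_symm_apply _ _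

lemma freeHomEquiv_comonad_δ (b : D) (X : Diagram V D M) :
    freeHomEquiv b (X.val b) (free V b ((free V b (X.val b)).val b))
      ((freeComonad V D M b).δ.app X) =
      freeη V b (X.val b) ≫ freeη V b ((free V b (X.val b)).val b) := by
  refine (Equiv.apply_symm_apply _ _).trans ?_
  exact congrArg₂ (fun s t => s ≫ t) (Category.comp_id _) (Category.comp_id _)

lemma cofreeHomEquiv_monad_map (b : D) {Y Y' : (Diagram V D M)ᵒᵖ} (g : Y ⟶ Y') :
    (cofreeHomEquiv b (cofree V b (Y'.unop.val b)) (Y.unop.val b)).symm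
        ((cofreeComonad V D M b).map g).unop =
      cofreeε V b (Y'.unop.val b) ≫ Hom.app g.unop b :=
  (Equiv.symm_apply_apply _ _).trans (congrArg (fun t => t ≫ Hom.app g.unop b)
    (Category.id_comp _))

lemma cofreeHomEquiv_monad_η (b : D) (Y : (Diagram V D M)ᵒᵖ) :
    (cofreeHomEquiv b Y.unop (Y.unop.val b)).symm ((cofreeComonad V D M b).ε.app Y).unop = 𝟙 _ :=
  Equiv.symm_apply_apply _ _

lemma cofreeHomEquiv_monad_μ (b : D) (Y : (Diagram V D M)ᵒᵖ) :
    (cofreeHomEquiv b (cofree V b ((cofree V b (Y.unop.val b)).val b)) (Y.unop.val b)).symm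
        ((cofreeComonad V D M b).δ.app Y).unop =
      cofreeε V b ((cofree V b (Y.unop.val b)).val b) ≫ cofreeε V b (Y.unop.val b) := by
  refine (Equiv.symm_apply_apply _ _).trans ?_
  exact congrArg₂ (fun s t => s ≫ t) (Category.id_comp _) (Category.id_comp _)

variable (V M) in
/-- The isomorphism `M^D(D(b, -) ⊙ X b, Y) ≅ M^D(X, {D(-, b), Y b})`. -/
def freeDualityIso (b : D) (X Y : Diagram V D M) :
    (free V b (X.val b) ⟶[V] Y) ≅ (X ⟶[V] cofree V b (Y.val b)) :=
  freeYonedaIso b (X.val b) Y ≪≫ (cofreeYonedaIso b (Y.val b) X).symm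

lemma freeDualityIso_yoneda (b : D) (X Y : Diagram V D M) :
    (freeDualityIso V M b X Y).hom ≫ cofreeYoneda b (Y.val b) X = freeYoneda b (X.val b) Y :=
  (Category.assoc _ _ _).trans ((congrArg (fun t => freeYoneda b (X.val b) Y ≫ t)
    (cofreeYonedaIso b (Y.val b) X).inv_hom_id).trans (Category.comp_id _))

variable (V M) in
/-- The duality of the functors `X ↦ D(b, -) ⊙ X b` and `Y ↦ {D(-, b), Y b}`. -/
def freeDuality (b : D) :
    FunctorDuality V (freeComonad V D M b).toFunctor (cofreeComonad V D M b).toFunctor where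
  iso X Y := freeDualityIso V M b X Y.unop
  whiskerRight {X X'} f Y := by
    have h1 := comp_freeYoneda_whisker (F := Y.unop) ((freeComonad V D M b).map f)
    apply cofreeYoneda_ext
    refine (Category.assoc _ _ _).trans ((congrArg (fun t => _ ≫ t)
      (freeDualityIso_yoneda b X Y.unop)).trans (h1.trans ?_))
    refine (congrArg (fun t => _ ≫ eHomWhiskerRight V t _) (freeHomEquiv_comonad_map b f)).trans ?_
    refine Eq.trans ?_ (Category.assoc _ _ _).symm
    refine Eq.trans ?_ (congrArg (fun t => (freeDualityIso V M b X' Y.unop).hom ≫ t)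
      (eHomWhiskerRight_cofreeYoneda f b (Y.unop.val b)).symm)
    rw [eHomWhiskerRight_comp, ← Category.assoc (freeDualityIso V M b X' Y.unop).hom,
      freeDualityIso_yoneda, freeYoneda, Category.assoc]
    rfl
  whiskerLeft X Y Y' g := by
    apply cofreeYoneda_ext
    refine (Category.assoc _ _ _).trans ((congrArg (fun t => _ ≫ t)
      (freeDualityIso_yoneda b X Y.unop)).trans ?_)
    refine (eHomWhiskerLeft_freeYoneda g.unop b (X.val b)).trans ?_
    refine Eq.trans ?_ (Category.assoc _ _ _).symm
    refine Eq.trans ?_ (congrArg (fun t => (freeDualityIso V M b X Y'.unop).hom ≫ t)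
      (comp_cofreeYoneda_whisker (F := X) ((cofreeComonad V D M b).map g).unop).symm)
    refine Eq.trans ?_ (congrArg (fun t => (freeDualityIso V M b X Y'.unop).hom ≫
      homπ X (cofree V b (Y'.unop.val b)) b ≫ eHomWhiskerLeft V (X.val b) t)
      (cofreeHomEquiv_monad_map b g).symm)
    rw [eHomWhiskerLeft_comp, ← freeDualityIso_yoneda, cofreeYoneda, Category.assoc, Category.assoc]

lemma compatible_freeComonad_ε (b : D) : Compatible (freeDuality V M b)
    (FunctorDuality.refl V (Diagram V D M)) (freeComonad V D M b).ε (cofreeComonad V D M b).ε := by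
  intro X Y
  apply cofreeYoneda_ext
  refine (Category.assoc _ _ _).trans ((congrArg (fun t => _ ≫ t)
    (freeDualityIso_yoneda b X Y.unop)).trans ?_)
  refine (comp_freeYoneda_whisker (F := Y.unop) ((freeComonad V D M b).ε.app X)).trans ?_
  refine (congrArg (fun t => _ ≫ eHomWhiskerRight V t _) (freeHomEquiv_comonad_ε b X)).trans ?_
  refine Eq.trans ?_ (congrArg (fun t => t ≫ _) (Category.id_comp _).symm)
  refine Eq.trans ?_ (comp_cofreeYoneda_whisker (F := X) ((cofreeComonad V D M b).ε.app Y).unop).symm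
  refine Eq.trans ?_ (congrArg (fun t => homπ X Y.unop b ≫ eHomWhiskerLeft V (X.val b) t)
      (cofreeHomEquiv_monad_η b Y).symm)
  exact congrArg (fun t => homπ X Y.unop b ≫ t) ((eHomWhiskerRight_id V _ _).trans
    (eHomWhiskerLeft_id V _ _).symm)

lemma compatible_freeComonad_δ (b : D) : Compatible (freeDuality V M b)
    ((freeDuality V M b).comp (freeDuality V M b)) (freeComonad V D M b).δ
      (cofreeComonad V D M b).δ := by
  intro X Y
  apply cofreeYoneda_ext
  have e1 : (eHomWhiskerRight V ((freeComonad V D M b).δ.app X) Y.unop ≫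
      (freeDualityIso V M b X Y.unop).hom) ≫ cofreeYoneda b (Y.unop.val b) X =
      freeYoneda b _ Y.unop ≫ eHomWhiskerRight V (freeη V b (X.val b)) _ := by
    refine (Category.assoc _ _ _).trans ((congrArg (fun t => _ ≫ t)
      (freeDualityIso_yoneda b X Y.unop)).trans ?_)
    refine (comp_freeYoneda_whisker (F := Y.unop) ((freeComonad V D M b).δ.app X)).trans ?_
    refine (congrArg (fun t => _ ≫ eHomWhiskerRight V t _) (freeHomEquiv_comonad_δ b X)).trans ?_
    rw [eHomWhiskerRight_comp, freeYoneda, Category.assoc]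
    rfl
  have e2 : (freeDualityIso V M b X (cofree V b (Y.unop.val b))).hom ≫
      eHomWhiskerLeft V X ((cofreeComonad V D M b).δ.app Y).unop ≫
        cofreeYoneda b (Y.unop.val b) X =
      cofreeYoneda b (Y.unop.val b) (free V b (X.val b)) ≫
        eHomWhiskerRight V (freeη V b (X.val b)) _ := by
    refine (congrArg (fun t => _ ≫ t) (comp_cofreeYoneda_whisker (F := X)
      ((cofreeComonad V D M b).δ.app Y).unop)).trans ?_
    refine (congrArg (fun t => _ ≫ homπ X _ b ≫ eHomWhiskerLeft V (X.val b) t)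
      (cofreeHomEquiv_monad_μ b Y)).trans ?_
    rw [eHomWhiskerLeft_comp]
    have e3 := freeDualityIso_yoneda b X (cofree V b (Y.unop.val b))
    rw [cofreeYoneda, freeYoneda] at e3
    rw [cofreeYoneda, Category.assoc, eHom_whisker_exchange]
    have e4 := congrArg (fun t => t ≫ eHomWhiskerLeft V (X.val b) (cofreeε V b (Y.unop.val b))) e3
    simp only [Category.assoc] at e4 ⊢
    exact e4
  have e4 : (((freeDualityIso V M b (free V b (X.val b)) Y.unop).hom ≫
      (freeDualityIso V M b X (cofree V b (Y.unop.val b))).hom) ≫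
      eHomWhiskerLeft V X ((cofreeComonad V D M b).δ.app Y).unop) ≫
        cofreeYoneda b (Y.unop.val b) X =
      freeYoneda b _ Y.unop ≫ eHomWhiskerRight V (freeη V b (X.val b)) _ := by
    refine (Category.assoc _ _ _).trans ((Category.assoc _ _ _).trans ?_)
    refine (congrArg (fun t => (freeDualityIso V M b _ Y.unop).hom ≫ t) e2).trans ?_
    refine (Category.assoc _ _ _).symm.trans ?_
    exact congrArg (fun t => t ≫ eHomWhiskerRight V (freeη V b (X.val b)) _)
      (freeDualityIso_yoneda b (free V b (X.val b)) Y.unop)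
  exact e1.trans e4.symm

variable (V D M) in
/-- The duality between the comonads `X ↦ D(b, -) ⊙ X b` and the monads `Y ↦ {D(-, b), Y b}`. -/
def freeComonadDuality : ComonadDuality V (freeComonad V D M) (cofreeComonad V D M) where
  duality b := freeDuality V M b
  ε b := compatible_freeComonad_ε b
  δ b := compatible_freeComonad_δ b

end BarCobarDuality

end

section

local infixr:70 " ⋆ " => gcomp

section BarWordDuality

open FunctorDuality

variable {V : Type u₁} [Category.{v} V] [MonoidalCategory V]
  {N : Type u₂} [Category.{v} N] [EnrichedOrdinaryCategory V N] {I : Type*}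
  {T : I → Comonad N} {S : I → Comonad Nᵒᵖ} (Δ : ComonadDuality V T S)

/-- The sequences `α` and `β` are the reverses of each other. -/
def IsReverse {n : ℕ} (α β : Fin (n + 1) → I) : Prop := ∀ i, β i = α i.rev

variable {m n : ℕ} {α β : Fin (n + 1) → I}

lemma IsReverse.revSeq_eq (h : IsReverse α β) {i : ℕ} (hi : i < n + 1) :
    revSeq (extend α) (n + 1) i = extend β i := by
  rw [revSeq_apply (extend α) (show i + (n - i) + 1 = n + 1 by omega)]
  refine Eq.trans ?_ (h _).symm
  change α _ = α _
  congr 1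
  ext
  simp only [Fin.val_rev]
  omega

lemma IsReverse.isReindexing (h : IsReverse α β) :
    IsReindexing id (revSeq (extend α) (n + 1)) (extend β) (n + 1) (n + 1) :=
  ⟨fun _ hi => hi, fun _ _ hij _ => hij, fun _ hi => (h.revSeq_eq hi).symm⟩

lemma IsReverse.isReindexing' (h : IsReverse α β) :
    IsReindexing id (extend β) (revSeq (extend α) (n + 1)) (n + 1) (n + 1) :=
  ⟨fun _ hi => hi, fun _ _ hij _ => hij, fun _ hi => h.revSeq_eq hi⟩

namespace ComonadDuality

/-- The dualities `N(T_{αₙ} ⋯ T_{α₀} X, Y) ≅ N(X, S_{α₀} ⋯ S_{αₙ} Y)`. -/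
def barWord (h : IsReverse α β) :
    FunctorDuality V (EnrichedHomotopy.barWord T α) (EnrichedHomotopy.barWord S β) :=
  (Δ.word (extend α) (n + 1)).ofIso (wordCongr S h.isReindexing h.isReindexing')

lemma compatible_barWordMap (h : IsReverse α β) (f g : Fin (m + 1) →o Fin (n + 1))
    (hfg : ∀ i, g i = (f i.rev).rev) (h' : IsReverse (α ∘ f) (β ∘ g)) :
    Compatible (Δ.barWord h) (Δ.barWord h') (barWordMap T f α) (barWordMap S g β) := by
  have hr : IsReindexing (extendHom g) (revSeq (extend α) (n + 1))
      (revSeq (extend (α ∘ f)) (m + 1)) (m + 1) (n + 1) := by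
    refine ⟨(isReindexing_extend g β).lt, (isReindexing_extend g β).mono, fun i hi => ?_⟩
    rw [h'.revSeq_eq hi, h.revSeq_eq ((isReindexing_extend g β).lt i hi)]
    exact (isReindexing_extend g β).eq i hi
  have h1 := Δ.compatible_wordMap (isReindexing_extend f α) hr (fun i j hij => by
    change (g ⟨min i m, _⟩ : ℕ) + (f ⟨min j m, _⟩ : ℕ) + 1 = n + 1
    rw [hfg, Fin.val_rev]
    have e : (Fin.rev ⟨min i m, by omega⟩ : Fin (m + 1)) = ⟨min j m, by omega⟩ := by
      ext
      simp only [Fin.val_rev]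
      omega
    rw [e]
    have := (f ⟨min j m, by omega⟩).2
    omega)
  have h2 := ((Compatible.ofIso_inv (Δ.word (extend α) (n + 1))
    (wordCongr S h.isReindexing h.isReindexing')).comp h1).comp
    (Compatible.ofIso_hom (Δ.word (extend (α ∘ f)) (m + 1))
      (wordCongr S h'.isReindexing h'.isReindexing'))
  refine (congrArg₂ (Compatible _ _) ?_ ?_).mp h2
  · rw [barWordMap_eq_wordMap]
    exact (Category.comp_id _).trans (Category.id_comp _)
  · rw [barWordMap_eq_wordMap]
    have e1 := wordMap_comp S h.isReindexing' hr
    have e2 := wordMap_comp S (h.isReindexing'.comp hr) h'.isReindexing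
    refine Eq.trans ?_ (e2.trans ?_)
    · exact congrArg (fun t => t ≫ wordMap S id _ _ (m + 1) (m + 1) h'.isReindexing) e1
    · exact wordMap_congr S _ _ (fun _ _ => rfl)

end ComonadDuality

end BarWordDuality

section SigmaPi

variable {V : Type u₁} [Category.{v} V] [MonoidalCategory V] [SymmetricCategory V]
  [MonoidalClosed V] {N : Type u₂} [Category.{v} N] [EnrichedOrdinaryCategory V N] {J : Type v}
  {A : V}

lemma exists_sigma_ehom [Cotensored V N] {Z : J → N} [HasCoproduct Z] {Y : N}
    (φ : ∀ j, A ⟶ (Z j ⟶[V] Y)) :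
    ∃ u : A ⟶ ((∐ Z) ⟶[V] Y), ∀ j, u ≫ eHomWhiskerRight V (Sigma.ι Z j) Y = φ j := by
  have h : ∀ {j j' : Discrete J} (f : j ⟶ j'), φ j'.as ≫
      eHomWhiskerRight V ((Discrete.functor Z).map f) Y = φ j.as := by
    rintro ⟨j⟩ ⟨j'⟩ ⟨⟨h⟩⟩
    dsimp at h
    subst h
    simp
  exact ⟨colimLift (colimit.isColimit (Discrete.functor Z)) (fun j => φ j.as) h,
    fun j => colimLift_fac (colimit.isColimit (Discrete.functor Z)) _ h ⟨j⟩⟩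

lemma exists_pi_ehom [Tensored V N] {Z : J → N} [HasProduct Z] {X : N}
    (φ : ∀ j, A ⟶ (X ⟶[V] Z j)) :
    ∃ u : A ⟶ (X ⟶[V] ∏ᶜ Z), ∀ j, u ≫ eHomWhiskerLeft V X (Pi.π Z j) = φ j := by
  have h : ∀ {j j' : Discrete J} (f : j ⟶ j'), φ j.as ≫
      eHomWhiskerLeft V X ((Discrete.functor Z).map f) = φ j'.as := by
    rintro ⟨j⟩ ⟨j'⟩ ⟨⟨h⟩⟩
    dsimp at h
    subst h
    simp
  exact ⟨limLift (limit.isLimit (Discrete.functor Z)) (fun j => φ j.as) h,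
    fun j => limLift_fac (limit.isLimit (Discrete.functor Z)) _ h ⟨j⟩⟩

end SigmaPi

section BarCobarDuality

variable {V : Type u₁} [Category.{v} V] [MonoidalCategory V] [SymmetricCategory V]
  [MonoidalClosed V] {D : Type v} [EnrichedCategory V D]
  {M : Type u₂} [Category.{v} M] [EnrichedOrdinaryCategory V M]
  [HasLimits V] [HasLimits M] [HasColimits M] [Tensored V M] [Cotensored V M]

/-- The duality `M^D(D(αₙ, -) ⊙ ⋯ ⊙ X α₀, Y) ≅ M^D(X, {D(-, α₀), ⋯ Y αₙ})` -/
def barTermDuality {n : ℕ} {α β : Fin (n + 1) → D} (h : IsReverse α β) :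
    FunctorDuality V (barWord (freeComonad V D M) α) (barWord (cofreeComonad V D M) β) :=
  (freeComonadDuality V D M).barWord h

/-- The isomorphism `M^D(D(αₙ, -) ⊙ ⋯ ⊙ X α₀, Y) ≅ M^D(X, {D(-, α₀), ⋯ Y αₙ})`. -/
def barTermIso {n : ℕ} {α β : Fin (n + 1) → D} (h : IsReverse α β) (X Y : Diagram V D M) :
    (barTerm X α ⟶[V] Y) ≅ (X ⟶[V] cobarTerm Y β) :=
  (barTermDuality h).iso X (op Y)

lemma isReverse_rev {n : ℕ} (α : Fin (n + 1) → D) : IsReverse α (α ∘ Fin.rev) := fun _ => rfl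

lemma isReverse_rev' {n : ℕ} (β : Fin (n + 1) → D) : IsReverse (β ∘ Fin.rev) β :=
  fun i => congrArg β i.rev_rev.symm

lemma isReverse_map {m n : SimplexCategory} (f : m ⟶ n) {α β : Fin (n.len + 1) → D}
    (h : IsReverse α β) : IsReverse (α ∘ f.toOrderHom)
      (β ∘ (SimplexCategory.rev.map f).toOrderHom) := fun i => by
  refine (h _).trans (congrArg α ?_)
  exact Fin.rev_rev _

lemma barTermIso_map {m n : SimplexCategory} (f : m ⟶ n) {α β : Fin (n.len + 1) → D}
    (h : IsReverse α β) (X Y : Diagram V D M) :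
    eHomWhiskerRight V ((barWordMap (freeComonad V D M) f.toOrderHom α).app X) Y ≫
        (barTermIso h X Y).hom =
      (barTermIso (isReverse_map f h) X Y).hom ≫ eHomWhiskerLeft V X
        ((barWordMap (cofreeComonad V D M) (SimplexCategory.rev.map f).toOrderHom β).app
          (op Y)).unop :=
  (freeComonadDuality V D M).compatible_barWordMap h f.toOrderHom
    (SimplexCategory.rev.map f).toOrderHom (fun _ => rfl) (isReverse_map f h) X (op Y)

section Level

variable {X Y : Diagram V D M} {n : SimplexCategory} {A : V}

lemma bar_ehom_ext {u u' : A ⟶ ((barDiag X).obj (op n) ⟶[V] Y)}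
    (h : ∀ α, u ≫ eHomWhiskerRight V (barIn X n α) Y = u' ≫ eHomWhiskerRight V (barIn X n α) Y) :
    u = u' :=
  colim_hom_ext (colimit.isColimit (Discrete.functor fun α : Fin (n.len + 1) → D => barTerm X α))
    (fun j => h j.as)

lemma cobar_ehom_ext {u u' : A ⟶ (X ⟶[V] (cobarDiag Y).obj n)}
    (h : ∀ α, u ≫ eHomWhiskerLeft V X (cobarOut Y n α) =
      u' ≫ eHomWhiskerLeft V X (cobarOut Y n α)) : u = u' :=
  lim_hom_ext (limit.isLimit (Discrete.functor fun α : Fin (n.len + 1) → D => cobarTerm Y α))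
    (fun j => h j.as)

lemma exists_bar_ehom (φ : ∀ α : Fin (n.len + 1) → D, A ⟶ (barTerm X α ⟶[V] Y)) :
    ∃ u : A ⟶ ((barDiag X).obj (op n) ⟶[V] Y),
      ∀ α, u ≫ eHomWhiskerRight V (barIn X n α) Y = φ α :=
  exists_sigma_ehom φ

lemma exists_cobar_ehom (φ : ∀ α : Fin (n.len + 1) → D, A ⟶ (X ⟶[V] cobarTerm Y α)) :
    ∃ u : A ⟶ (X ⟶[V] (cobarDiag Y).obj n),
      ∀ α, u ≫ eHomWhiskerLeft V X (cobarOut Y n α) = φ α :=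
  exists_pi_ehom φ

variable (X Y n) in
/-- The morphism `M^D(Bₙ(D, D, X), Y) ⟶ M^D(X, Cⁿ(D, D, Y))`. -/
def barLevelHom : ((barDiag X).obj (op n) ⟶[V] Y) ⟶ (X ⟶[V] (cobarDiag Y).obj n) :=
  (exists_cobar_ehom fun β => eHomWhiskerRight V (barIn X n (β ∘ Fin.rev)) Y ≫
    (barTermIso (isReverse_rev' β) X Y).hom).choose

lemma barLevelHom_out {α β : Fin (n.len + 1) → D} (h : IsReverse α β) :
    barLevelHom X Y n ≫ eHomWhiskerLeft V X (cobarOut Y n β) =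
      eHomWhiskerRight V (barIn X n α) Y ≫ (barTermIso h X Y).hom := by
  obtain rfl : α = β ∘ Fin.rev := funext fun i =>
    (congrArg α i.rev_rev.symm).trans (h i.rev).symm
  exact (exists_cobar_ehom fun β => eHomWhiskerRight V (barIn X n (β ∘ Fin.rev)) Y ≫
    (barTermIso (isReverse_rev' β) X Y).hom).choose_spec β

variable (X Y n) in
/-- The morphism `M^D(X, Cⁿ(D, D, Y)) ⟶ M^D(Bₙ(D, D, X), Y)`. -/
def barLevelInv : (X ⟶[V] (cobarDiag Y).obj n) ⟶ ((barDiag X).obj (op n) ⟶[V] Y) :=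
  (exists_bar_ehom fun α => eHomWhiskerLeft V X (cobarOut Y n (α ∘ Fin.rev)) ≫
    (barTermIso (isReverse_rev α) X Y).inv).choose

lemma barLevelInv_in (α : Fin (n.len + 1) → D) :
    barLevelInv X Y n ≫ eHomWhiskerRight V (barIn X n α) Y =
      eHomWhiskerLeft V X (cobarOut Y n (α ∘ Fin.rev)) ≫ (barTermIso (isReverse_rev α) X Y).inv :=
  (exists_bar_ehom fun α => eHomWhiskerLeft V X (cobarOut Y n (α ∘ Fin.rev)) ≫
    (barTermIso (isReverse_rev α) X Y).inv).choose_spec α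

variable (X Y n) in
/-- The isomorphism `M^D(Bₙ(D, D, X), Y) ≅ M^D(X, Cⁿ(D, D, Y))`. -/
def barLevelIso : ((barDiag X).obj (op n) ⟶[V] Y) ≅ (X ⟶[V] (cobarDiag Y).obj n) where
  hom := barLevelHom X Y n
  inv := barLevelInv X Y n
  hom_inv_id := bar_ehom_ext fun α => by
    rw [Category.assoc, barLevelInv_in, ← Category.assoc, barLevelHom_out (isReverse_rev α),
      Category.assoc, Iso.hom_inv_id, Category.comp_id, Category.id_comp]
  inv_hom_id := cobar_ehom_ext fun β => by
    obtain ⟨α, rfl⟩ : ∃ α : Fin (n.len + 1) → D, β = α ∘ Fin.rev :=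
      ⟨β ∘ Fin.rev, funext (isReverse_rev' β)⟩
    rw [Category.assoc, barLevelHom_out (isReverse_rev α), ← Category.assoc, barLevelInv_in,
      Category.assoc, Iso.inv_hom_id, Category.comp_id, Category.id_comp]

end Level

variable (X Y : Diagram V D M)

lemma barLevelHom_map {m n : SimplexCategory} (f : m ⟶ n) :
    eHomWhiskerRight V ((barDiag X).map f.op) Y ≫ barLevelHom X Y n =
      barLevelHom X Y m ≫ eHomWhiskerLeft V X ((cobarDiag Y).map f) := by
  apply cobar_ehom_ext
  intro β
  have h := isReverse_rev' β
  rw [Category.assoc, barLevelHom_out h, Category.assoc, ← eHomWhiskerLeft_comp, cobarDiag_map,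
    eHomWhiskerLeft_comp, ← Category.assoc, ← eHomWhiskerRight_comp, barIn_map,
    eHomWhiskerRight_comp, Category.assoc, barTermIso_map f h, ← Category.assoc,
    ← Category.assoc, barLevelHom_out (isReverse_map f h)]

lemma barLevelHom_whiskerRight {X X' : Diagram V D M} (f : X ⟶ X') (n : SimplexCategory) :
    eHomWhiskerRight V (((simplicialBarDiagram V D M).obj (op n)).map f) Y ≫ barLevelHom X Y n =
      barLevelHom X' Y n ≫ eHomWhiskerRight V f _ := by
  apply cobar_ehom_ext
  intro β
  have h := isReverse_rev' β
  have h1 : barIn X n (β ∘ Fin.rev) ≫ ((simplicialBarDiagram V D M).obj (op n)).map f =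
      (barWord (freeComonad V D M) (β ∘ Fin.rev)).map f ≫ barIn X' n (β ∘ Fin.rev) :=
    ι_colimMap _ _
  have h2 : eHomWhiskerRight V ((barWord (freeComonad V D M) (β ∘ Fin.rev)).map f) Y ≫
      (barTermIso h X Y).hom = (barTermIso h X' Y).hom ≫ eHomWhiskerRight V f _ :=
    (barTermDuality h).whiskerRight f (op Y)
  rw [Category.assoc, barLevelHom_out h, Category.assoc, ← eHom_whisker_exchange, ← Category.assoc,
    ← eHomWhiskerRight_comp, h1, eHomWhiskerRight_comp, Category.assoc, h2, ← Category.assoc,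
    ← Category.assoc, barLevelHom_out h]

lemma barLevelHom_whiskerLeft {Y Y' : Diagram V D M} (g : Y ⟶ Y') (n : SimplexCategory) :
    eHomWhiskerLeft V _ g ≫ barLevelHom X Y' n = barLevelHom X Y n ≫
      eHomWhiskerLeft V X (((cosimplicialCobarDiagram V D M).obj n).map g) := by
  apply cobar_ehom_ext
  intro β
  have h := isReverse_rev' β
  have h1 : ((cosimplicialCobarDiagram V D M).obj n).map g ≫ cobarOut Y' n β = cobarOut Y n β ≫
      ((barWord (cofreeComonad V D M) β).map g.op).unop :=
    limMap_π _ _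
  have h2 : eHomWhiskerLeft V _ g ≫ (barTermIso h X Y').hom = (barTermIso h X Y).hom ≫
      eHomWhiskerLeft V X ((barWord (cofreeComonad V D M) β).map g.op).unop :=
    (barTermDuality h).whiskerLeft X g.op
  rw [Category.assoc, barLevelHom_out h, Category.assoc, ← eHomWhiskerLeft_comp, h1,
    eHomWhiskerLeft_comp, eHom_whisker_exchange_assoc, h2, ← Category.assoc,
    ← Category.assoc, barLevelHom_out h]

end BarCobarDuality

end

section

local infixr:70 " ⋆ " => gcomp

section BarCobar

variable {V : Type u₁} [Category.{v} V] [MonoidalCategory V] [SymmetricCategory V]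
  [MonoidalClosed V] {D : Type v} [EnrichedCategory V D]
  {M : Type u₂} [Category.{v} M] [EnrichedOrdinaryCategory V M]
  [HasLimits V] [HasLimits M] [HasColimits M] [Tensored V M] [Cotensored V M]
  (L : SSet.{v} ⥤ V)

/-- The projections of the cobar construction. -/
def cobarπ (Y : Diagram V D M) (n : SimplexCategory) :
    (simplexWeight L).obj n ⟶ (cobar L Y ⟶[V] (cobarDiag Y).obj n) :=
  cototπ (simplexWeight L) (cobarDiag Y) n

lemma cobarπ_map {X Y : Diagram V D M} (f : X ⟶ Y) (n : SimplexCategory) :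
    cobarπ L Y n ≫ eHomWhiskerRight V ((cobarFunctor L).map f) _ =
      cobarπ L X n ≫ eHomWhiskerLeft V _ (((cosimplicialCobarDiagram V D M).obj n).map f) :=
  cototπ_map _ n

lemma cobarπ_ehom_ext {X Y : Diagram V D M} {A : V} {u u' : A ⟶ (X ⟶[V] cobar L Y)}
    (h : ∀ n, u ⋆ cobarπ L Y n = u' ⋆ cobarπ L Y n) : u = u' :=
  cotot_ehom_ext h

/-- The isomorphism `M^D(X, C(D, D, Y)) ≅ ∫_n [Δⁿ, M^D(X, Cⁿ(D, D, Y))]`. -/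
def cobarTotIso (X Y : Diagram V D M) :
    (X ⟶[V] cobar L Y) ≅ tot (simplexWeight L) (cohomCosimplicial (V := V) (cobarDiag Y) X) :=
  cototHomIso (simplexWeight L) (cobarDiag Y) X

/-- The isomorphism of cosimplicial objects `M^D(B(D, D, X), Y) ≅ M^D(X, C(D, D, Y))`. -/
def barLevelCosimplicialIso (X Y : Diagram V D M) :
    homCosimplicial (V := V) (barDiag X) Y ≅ cohomCosimplicial (cobarDiag Y) X :=
  NatIso.ofComponents (fun n => barLevelIso X Y n) (fun f => barLevelHom_map X Y f)

/-- The isomorphism `M^D(B(D, D, X), Y) ≅ M^D(X, C(D, D, Y))`. -/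
def barCobarIso (X Y : Diagram V D M) : (bar L X ⟶[V] Y) ≅ (X ⟶[V] cobar L Y) :=
  barHomTotIso L X Y ≪≫ (weightedEnd (simplexWeight L) MonoidalClosed.internalHom).mapIso
    (barLevelCosimplicialIso X Y) ≪≫ (cobarTotIso L X Y).symm

lemma barCobarIso_π {X Y : Diagram V D M} {A : V} (u : A ⟶ (bar L X ⟶[V] Y))
    (n : SimplexCategory) :
    (u ≫ (barCobarIso L X Y).hom) ⋆ cobarπ L Y n =
      (β_ _ _).hom ≫ (barι L X n ⋆ u) ≫ barLevelHom X Y n := by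
  have h1 : _ ◁ (u ≫ (barHomTotIso L X Y).hom) ≫ totEv (simplexWeight L) _ n = barι L X n ⋆ u :=
    weightedCoendHomIso_totEv (S := simplexWeight L) (X := barDiag X) u n
  have h2 : _ ◁ (u ≫ (barCobarIso L X Y).hom ≫ (cobarTotIso L X Y).hom) ≫
      totEv (simplexWeight L) _ n = (β_ _ _).hom ≫ ((u ≫ (barCobarIso L X Y).hom) ⋆ cobarπ L Y n) :=
    (congrArg (fun t => _ ◁ t ≫ totEv (simplexWeight L) _ n) (Category.assoc _ _ _).symm).trans
      (cototHomIso_totEv (S := simplexWeight L) (X := cobarDiag Y) _ n)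
  have h3 := tot_map_totEv (S := simplexWeight L) (barLevelCosimplicialIso X Y).hom n
  have h4 : u ≫ (barCobarIso L X Y).hom ≫ (cobarTotIso L X Y).hom =
      (u ≫ (barHomTotIso L X Y).hom) ≫
        (weightedEnd (simplexWeight L) MonoidalClosed.internalHom).map
          (barLevelCosimplicialIso X Y).hom := by
    simp only [barCobarIso, Iso.trans_hom, Iso.symm_hom, Category.assoc, Iso.inv_hom_id,
      Category.comp_id]
    rfl
  have h5 : (barι L X n ⋆ u) ≫ barLevelHom X Y n =
      (β_ _ _).hom ≫ ((u ≫ (barCobarIso L X Y).hom) ⋆ cobarπ L Y n) := by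
    rw [← h2, h4, ← h1]
    refine Eq.symm ((congrArg (fun t => t ≫ totEv (simplexWeight L)
      (cohomCosimplicial (cobarDiag Y) X) n) (MonoidalCategory.whiskerLeft_comp _ _ _)).trans ?_)
    exact (Category.assoc _ _ _).trans ((congrArg (fun t => _ ≫ t) h3).trans
      (Category.assoc _ _ _).symm)
  rw [h5, SymmetricCategory.symmetry_assoc]

lemma barCobarIso_whiskerRight {X X' : Diagram V D M} (f : X ⟶ X') (Y : Diagram V D M) :
    eHomWhiskerRight V ((barFunctor L).map f) Y ≫ (barCobarIso L X Y).hom =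
      (barCobarIso L X' Y).hom ≫ eHomWhiskerRight V f (cobar L Y) := by
  apply cobarπ_ehom_ext
  intro n
  have h1 := whiskerLeft_gcomp (barι L X n) (𝟙 (bar L X' ⟶[V] Y)) ((barFunctor L).map f)
  rw [Category.id_comp] at h1
  have h2 := barCobarIso_π L (𝟙 (bar L X' ⟶[V] Y)) n
  rw [Category.id_comp] at h2
  rw [barCobarIso_π, ← h1, ← gcomp_whiskerRight, h2, barι_map, Category.assoc, Category.assoc,
    ← barLevelHom_whiskerRight, ← Category.assoc (_ ⋆ _), gcomp_whiskerRight]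

lemma barCobarIso_whiskerLeft (X : Diagram V D M) {Y Y' : Diagram V D M} (g : Y ⟶ Y') :
    eHomWhiskerLeft V (bar L X) g ≫ (barCobarIso L X Y').hom =
      (barCobarIso L X Y).hom ≫ eHomWhiskerLeft V X ((cobarFunctor L).map g) := by
  apply cobarπ_ehom_ext
  intro n
  have h1 := gcomp_whiskerLeft (barι L X n) (𝟙 (bar L X ⟶[V] Y)) g
  rw [Category.id_comp] at h1
  have h2 := barCobarIso_π L (𝟙 (bar L X ⟶[V] Y)) n
  rw [Category.id_comp] at h2
  rw [barCobarIso_π, ← h1, whiskerLeft_gcomp, cobarπ_map, ← gcomp_whiskerLeft, h2, Category.assoc,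
    Category.assoc, Category.assoc, barLevelHom_whiskerLeft]

end BarCobar

end

section

local infixr:70 " ⋆ " => gcomp

section Homotopical

variable {A B C : Type*} [Category* A] [Category* B] [Category* C]

lemma IsHomotopical.of_isIso (W : MorphismProperty C) [IsHomotopical W] {X Y : C} (f : X ⟶ Y)
    [IsIso f] : W f :=
  (IsHomotopical.two_out_of_six (W := W) f (inv f) f
    (by rw [IsIso.hom_inv_id]; exact IsHomotopical.id_mem X)
    (by rw [IsIso.inv_hom_id]; exact IsHomotopical.id_mem Y)).1

instance (W : MorphismProperty C) [IsHomotopical W] : W.HasTwoOutOfThreeProperty where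
  comp_mem f g hf hg := by
    have := (IsHomotopical.two_out_of_six (W := W) f (𝟙 _) g (by rwa [Category.comp_id])
      (by rwa [Category.id_comp])).2.2.2
    rwa [Category.id_comp] at this
  of_postcomp f g hg hfg := (IsHomotopical.two_out_of_six (W := W) f g (𝟙 _) hfg
    (by rwa [Category.comp_id])).1
  of_precomp f g hf hfg := (IsHomotopical.two_out_of_six (W := W) (𝟙 _) f g
    (by rwa [Category.id_comp]) hfg).2.2.1

instance (W : MorphismProperty C) [IsHomotopical W] : W.RespectsIso where
  precomp i _ _f hf := W.comp_mem _ _ (IsHomotopical.of_isIso W i) hf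
  postcomp i _ _f hf := W.comp_mem _ _ hf (IsHomotopical.of_isIso W i)

lemma IsHomotopicalOn.isoClosure {F : A ⥤ C} {W : MorphismProperty A} [W.RespectsIso]
    {P : ObjectProperty A} {W' : MorphismProperty C} [W'.RespectsIso]
    (h : IsHomotopicalOn F W P W') : IsHomotopicalOn F W P.isoClosure W' := by
  rintro X Y f ⟨X', hX, ⟨e⟩⟩ ⟨Y', hY, ⟨e'⟩⟩ hf
  have h1 := h (e.inv ≫ f ≫ e'.hom) hX hY
    ((W.cancel_left_of_respectsIso _ _).mpr ((W.cancel_right_of_respectsIso _ _).mpr hf))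
  rw [F.map_comp, F.map_comp] at h1
  exact (W'.cancel_right_of_respectsIso _ _).mp ((W'.cancel_left_of_respectsIso _ _).mp h1)

lemma prodProperty_isoClosure {P : ObjectProperty A} {P' : ObjectProperty B} {X : A} {Y : B}
    (hX : P.isoClosure X) (hY : P'.isoClosure Y) : (prodProperty P P').isoClosure (X, Y) := by
  obtain ⟨X', hX, ⟨e⟩⟩ := hX
  obtain ⟨Y', hY, ⟨e'⟩⟩ := hY
  exact ⟨(X', Y'), ⟨hX, hY⟩, ⟨e.prod e'⟩⟩

lemma op_isoClosure {P : ObjectProperty A} {X : A} (hX : P.isoClosure X) :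
    P.op.isoClosure (op X) := by
  obtain ⟨X', hX, ⟨e⟩⟩ := hX
  exact ⟨op X', hX, ⟨e.symm.op⟩⟩

instance (W : MorphismProperty A) (W' : MorphismProperty B) [W.RespectsIso] [W'.RespectsIso] :
    (W.prod W').RespectsIso where
  precomp := by
    rintro ⟨X, Y⟩ ⟨X', Y'⟩ ⟨X'', Y''⟩ i (hi : IsIso i) f hf
    have := ((isIso_prod_iff _ _).1 hi).1
    have := ((isIso_prod_iff _ _).1 hi).2
    exact ⟨(W.cancel_left_of_respectsIso _ _).mpr hf.1, (W'.cancel_left_of_respectsIso _ _).mpr hf.2⟩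
  postcomp := by
    rintro ⟨X, Y⟩ ⟨X', Y'⟩ ⟨X'', Y''⟩ i (hi : IsIso i) f hf
    have := ((isIso_prod_iff _ _).1 hi).1
    have := ((isIso_prod_iff _ _).1 hi).2
    exact ⟨(W.cancel_right_of_respectsIso _ _).mpr hf.1,
      (W'.cancel_right_of_respectsIso _ _).mpr hf.2⟩

variable {F : A ⥤ B ⥤ C} {W : MorphismProperty A} {P : ObjectProperty A}
  {W' : MorphismProperty B} {P' : ObjectProperty B} {W'' : MorphismProperty C}

lemma IsHomotopicalOn₂.map_app [W.RespectsIso] [W'.RespectsIso] [W''.RespectsIso]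
    [W'.ContainsIdentities] (h : IsHomotopicalOn₂ F W P W' P' W'') {X X' : A} (f : X ⟶ X')
    (hX : P.isoClosure X) (hX' : P.isoClosure X') (hf : W f) {Y : B} (hY : P'.isoClosure Y) :
    W'' ((F.map f).app Y) := by
  have := h.isoClosure (X := (X, Y)) (Y := (X', Y)) (f, 𝟙 Y) (prodProperty_isoClosure hX hY)
    (prodProperty_isoClosure hX' hY) ⟨hf, W'.id_mem Y⟩
  simpa [Functor.uncurry] using this

lemma IsHomotopicalOn₂.obj_map [W.RespectsIso] [W'.RespectsIso] [W''.RespectsIso]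
    [W.ContainsIdentities] (h : IsHomotopicalOn₂ F W P W' P' W'') {Y Y' : B} (g : Y ⟶ Y')
    (hY : P'.isoClosure Y) (hY' : P'.isoClosure Y') (hg : W' g) {X : A} (hX : P.isoClosure X) :
    W'' ((F.obj X).map g) := by
  have := h.isoClosure (X := (X, Y)) (Y := (X, Y')) (𝟙 X, g) (prodProperty_isoClosure hX hY)
    (prodProperty_isoClosure hX hY') ⟨W.id_mem X, hg⟩
  simpa [Functor.uncurry] using this

lemma IsHomotopicalOn₂.of_variables [W''.IsStableUnderComposition]
    (h : ∀ {X X' : A} (f : X ⟶ X'), P X → P X' → W f → ∀ {Y : B}, P' Y → W'' ((F.map f).app Y))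
    (h' : ∀ {Y Y' : B} (g : Y ⟶ Y'), P' Y → P' Y' → W' g → ∀ {X : A}, P X →
      W'' ((F.obj X).map g)) :
    IsHomotopicalOn₂ F W P W' P' W'' := by
  rintro ⟨X, Y⟩ ⟨X', Y'⟩ ⟨f, g⟩ hX hY hfg
  exact W''.comp_mem _ _ (h f hX.1 hY.1 hfg.1 hX.2) (h' g hX.2 hY.2 hfg.2 hY.1)

end Homotopical

section Evaluation

variable {V : Type u₁} [Category.{v} V] [MonoidalCategory V] [SymmetricCategory V]
  [MonoidalClosed V] {D : Type v} [EnrichedCategory V D]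
  {M : Type u₂} [Category.{v} M] [EnrichedOrdinaryCategory V M] [HasLimits V]

namespace Diagram

variable {K : V} {X Y : Diagram V D M} (d : D)

lemma tcoev_π [Tensored V M] : tcoev V K X ≫ homπ X (tobj V K X) d = tcoev V K (X.val d) :=
  homLift_π _ (isNat_tensorUnit K X) d

lemma cev_π [Cotensored V M] : cev V K Y ≫ homπ (cobj V K Y) Y d = cev V K (Y.val d) :=
  homLift_π _ (isNat_cotensorCounit K Y) d

lemma tdesc_app [Tensored V M] (f : K ⟶ (X ⟶[V] Y)) :
    Hom.app (tdesc f) d = tdesc (V := V) (X := X.val d) (Y := Y.val d) (f ≫ homπ X Y d) := by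
  apply tobj_hom_ext
  refine Eq.trans ?_ (tdesc_fac _).symm
  refine (congrArg (· ≫ _) (tcoev_π (X := X) (K := K) d).symm).trans ?_
  refine (Category.assoc _ _ _).trans ?_
  refine (congrArg (tcoev V K X ≫ ·) (eHomWhiskerLeft_π X (tdesc f) d).symm).trans ?_
  exact (Category.assoc _ _ _).symm.trans (congrArg (· ≫ homπ X Y d) (tdesc_fac f))

lemma cdesc_app [Cotensored V M] (f : K ⟶ (X ⟶[V] Y)) :
    Hom.app (cdesc f) d = cdesc (V := V) (X := Y.val d) (Y := X.val d) (f ≫ homπ X Y d) := by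
  apply cobj_hom_ext
  refine Eq.trans ?_ (cdesc_fac _).symm
  refine (congrArg (· ≫ _) (cev_π (Y := Y) (K := K) d).symm).trans ?_
  refine (Category.assoc _ _ _).trans ?_
  refine (congrArg (cev V K Y ≫ ·) (eHomWhiskerRight_π (cdesc f) Y d).symm).trans ?_
  exact (Category.assoc _ _ _).symm.trans (congrArg (· ≫ homπ X Y d) (cdesc_fac f))

end Diagram

end Evaluation

end

section

local infixr:70 " ⋆ " => gcomp

section Naturality

variable {V : Type u₁} [Category.{v} V] [MonoidalCategory V] [SymmetricCategory V]
  [MonoidalClosed V] {D : Type v} [EnrichedCategory V D]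
  {M : Type u₂} [Category.{v} M] [EnrichedOrdinaryCategory V M]
  [HasLimits V] [HasLimits M] [HasColimits M] [Tensored V M] [Cotensored V M]
  (L : SSet.{v} ⥤ V) [L.Monoidal] {X Y : Diagram V D M} (f : X ⟶ Y)

lemma barDiagAug_naturality (n : SimplexCategory) :
    ((simplicialBarDiagram V D M).obj (op n)).map f ≫ barDiagAug Y n = barDiagAug X n ≫ f := by
  apply bar_hom_ext
  intro α
  have h : barIn X n α ≫ ((simplicialBarDiagram V D M).obj (op n)).map f =
      (barWord (freeComonad V D M) α).map f ≫ barIn Y n α :=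
    Limits.Sigma.ι_map (f := fun α : Fin (n.len + 1) → D => barTerm X α)
      (g := fun α => barTerm Y α) (fun α => (barWord (freeComonad V D M) α).map f) α
  refine (Category.assoc _ _ _).symm.trans ((congrArg (· ≫ _) h).trans ((Category.assoc _ _ _).trans ?_))
  unfold barDiagAug
  refine (congrArg (fun t => _ ≫ t) (barIn_barOut _ α)).trans ?_
  refine (barAug_naturality (freeComonad V D M) α f).trans ?_
  exact (congrArg (· ≫ f) (barIn_barOut (fun α => barAug (freeComonad V D M) α X) α).symm).trans
    (Category.assoc _ _ _)

lemma barε_naturality : (barFunctor L).map f ≫ barε L Y = barε L X ≫ f := by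
  have hX : ∀ n, barι L X n ≫ eHomWhiskerLeft V _ (barε L X) =
      weightUnit L n ≫ eHomEquiv V (barDiagAug X n) := fun n =>
    weightedCoendι_desc _ (coendAug_compatible L _ map_barDiagAug) n
  have hY : ∀ n, barι L Y n ≫ eHomWhiskerLeft V _ (barε L Y) =
      weightUnit L n ≫ eHomEquiv V (barDiagAug Y n) := fun n =>
    weightedCoendι_desc _ (coendAug_compatible L _ map_barDiagAug) n
  have key : ∀ n, barι L X n ≫ eHomWhiskerLeft V _ ((barFunctor L).map f ≫ barε L Y) =
      barι L X n ≫ eHomWhiskerLeft V _ (barε L X ≫ f) := by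
    intro n
    have e : eHomWhiskerRight V (((simplicialBarDiagram V D M).obj (op n)).map f) (bar L Y) ≫
        eHomWhiskerLeft V ((barDiag X).obj (op n)) (barε L Y) =
      eHomWhiskerLeft V ((barDiag Y).obj (op n)) (barε L Y) ≫
        eHomWhiskerRight V (((simplicialBarDiagram V D M).obj (op n)).map f) Y :=
      (eHom_whisker_exchange _ _ _).symm
    rw [eHomWhiskerLeft_comp, eHomWhiskerLeft_comp, ← Category.assoc, barι_map, Category.assoc,
      e, reassoc_of% hY, reassoc_of% hX,
      ← eHomEquiv_comp_right, ← eHomEquiv_comp_left, barDiagAug_naturality]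
  exact weightedCoend_hom_ext key

lemma cobarDiagAug_naturality (n : SimplexCategory) :
    cobarDiagAug X n ≫ ((cosimplicialCobarDiagram V D M).obj n).map f = f ≫ cobarDiagAug Y n := by
  apply cobar_hom_ext
  intro α
  have h : ((cosimplicialCobarDiagram V D M).obj n).map f ≫ cobarOut Y n α =
      cobarOut X n α ≫ ((barWord (cofreeComonad V D M) α).map f.op).unop :=
    Limits.Pi.map_π (f := fun α : Fin (n.len + 1) → D => cobarTerm X α)
      (g := fun α => cobarTerm Y α) (fun α => ((barWord (cofreeComonad V D M) α).map f.op).unop) α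
  refine (Category.assoc _ _ _).trans ((congrArg (fun t => _ ≫ t) h).trans ?_)
  unfold cobarDiagAug
  refine (Category.assoc _ _ _).symm.trans ((congrArg (· ≫ _) (cobarIn_cobarOut _ α)).trans ?_)
  refine (congrArg Quiver.Hom.unop
    (barAug_naturality (cofreeComonad V D M) α f.op)).trans ?_
  exact (congrArg (f ≫ ·) (cobarIn_cobarOut
    (fun α => (barAug (cofreeComonad V D M) α (op Y)).unop) α).symm).trans (Category.assoc _ _ _).symm

lemma cobarη_naturality : cobarη L X ≫ (cobarFunctor L).map f = f ≫ cobarη L Y := by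
  have hX : ∀ n, cobarπ L X n ≫ eHomWhiskerRight V (cobarη L X) _ =
      weightUnit L n ≫ eHomEquiv V (cobarDiagAug X n) := fun n =>
    cototDesc_π _ (cototAug_compatible L _ cobarDiagAug_map) n
  have hY : ∀ n, cobarπ L Y n ≫ eHomWhiskerRight V (cobarη L Y) _ =
      weightUnit L n ≫ eHomEquiv V (cobarDiagAug Y n) := fun n =>
    cototDesc_π _ (cototAug_compatible L _ cobarDiagAug_map) n
  have key : ∀ n, cobarπ L Y n ≫ eHomWhiskerRight V (cobarη L X ≫ (cobarFunctor L).map f) _ =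
      cobarπ L Y n ≫ eHomWhiskerRight V (f ≫ cobarη L Y) _ := by
    intro n
    have e : eHomWhiskerLeft V (cobar L X) (((cosimplicialCobarDiagram V D M).obj n).map f) ≫
        eHomWhiskerRight V (cobarη L X) ((cobarDiag Y).obj n) =
      eHomWhiskerRight V (cobarη L X) ((cobarDiag X).obj n) ≫
        eHomWhiskerLeft V X (((cosimplicialCobarDiagram V D M).obj n).map f) :=
      eHom_whisker_exchange _ _ _
    rw [eHomWhiskerRight_comp, eHomWhiskerRight_comp, ← Category.assoc, cobarπ_map, Category.assoc,
      e, reassoc_of% hY, reassoc_of% hX,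
      ← eHomEquiv_comp_right, ← eHomEquiv_comp_left, cobarDiagAug_naturality]
  exact cotot_hom_ext key

end Naturality

section EHom

variable {V : Type u₁} [Category.{v} V] [MonoidalCategory V] [SymmetricCategory V]
  [MonoidalClosed V] {N : Type u₂} [Category.{v} N] [EnrichedOrdinaryCategory V N]

instance isIso_eHomWhiskerLeft (X : N) {Y Y' : N} (g : Y ⟶ Y') [IsIso g] :
    IsIso (eHomWhiskerLeft V X g) :=
  inferInstanceAs (IsIso (((eHomFunctor V N).obj (op X)).map g))

instance isIso_eHomWhiskerRight {X X' : N} (f : X ⟶ X') [IsIso f] (Y : N) :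
    IsIso (eHomWhiskerRight V f Y) :=
  inferInstanceAs (IsIso (((eHomFunctor V N).map f.op).app Y))

end EHom

section HomDeformation

variable {V : Type u₁} [Category.{v} V] [MonoidalCategory V] [SymmetricCategory V]
  [MonoidalClosed V] {D : Type v} [EnrichedCategory V D]
  {M : Type u₂} [Category.{v} M] [EnrichedOrdinaryCategory V M]
  [HasLimits V] [HasLimits M] [HasColimits M] [Tensored V M] [Cotensored V M]
  {L : SSet.{v} ⥤ V} [L.Monoidal] [L.IsLeftAdjoint]
  {WV : MorphismProperty V} [IsHomotopical WV] {VQ VR : ObjectProperty V}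
  {W : MorphismProperty M} [IsHomotopical W] {MQ MR : ObjectProperty M}
  (hW : simplicialHomotopyEquivalences L M ≤ W)
  (hD : IsGoodForHom L D WV VR W MQ MR)

include hW in
lemma barε_weq (X : Diagram V D M) : objectwiseWeq V D W (barε L X) :=
  fun d => hW _ (barε_homotopyEquivalence L X d)

include hW in
lemma cobarη_weq (X : Diagram V D M) : objectwiseWeq V D W (cobarη L X) :=
  fun d => hW _ (cobarη_homotopyEquivalence L X d)

include hD

lemma cobarHom_map_weq {X X' Y Y' : Diagram V D M} (f : X ⟶ X') (g : Y ⟶ Y')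
    (hX : (objectwise V D MQ).isoClosure X) (hX' : (objectwise V D MQ).isoClosure X')
    (hY : (objectwise V D MR).isoClosure Y) (hY' : (objectwise V D MR).isoClosure Y')
    (hf : objectwiseWeq V D W f) (hg : objectwiseWeq V D W g) :
    WV ((cobarHom D M L).map (X := (op X', Y)) (Y := (op X, Y')) (f.op, g)) := by
  refine IsHomotopicalOn.isoClosure hD.homotopical (X := (op X', Y)) (Y := (op X, Y')) (f.op, g)
    (prodProperty_isoClosure (op_isoClosure hX') hY) (prodProperty_isoClosure (op_isoClosure hX) hY')
    ⟨hf, hg⟩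

lemma eHomWhiskerLeft_bar_weq {X Y Y' : Diagram V D M} (g : Y ⟶ Y')
    (hX : (objectwise V D MQ).isoClosure X) (hY : (objectwise V D MR).isoClosure Y)
    (hY' : (objectwise V D MR).isoClosure Y') (hg : objectwiseWeq V D W g) :
    WV (eHomWhiskerLeft V (bar L X) g) := by
  rw [← WV.cancel_right_of_respectsIso _ (barHomIso L X Y').hom, whiskerLeft_barHomIso,
    WV.cancel_left_of_respectsIso]
  exact cobarHom_map_weq hD (𝟙 X) g hX hX hY hY' (IsHomotopical.id_mem X) hg

lemma eHomWhiskerRight_bar_weq {X X' Y : Diagram V D M} (f : X ⟶ X')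
    (hX : (objectwise V D MQ).isoClosure X) (hX' : (objectwise V D MQ).isoClosure X')
    (hY : (objectwise V D MR).isoClosure Y) (hf : objectwiseWeq V D W f) :
    WV (eHomWhiskerRight V ((barFunctor L).map f) Y) := by
  rw [← WV.cancel_right_of_respectsIso _ (barHomIso L X Y).hom, whiskerRight_barHomIso,
    WV.cancel_left_of_respectsIso]
  exact cobarHom_map_weq hD f (𝟙 Y) hX hX' hY hY hf (IsHomotopical.id_mem Y)

lemma eHomWhiskerRight_cobar_weq {X X' Y : Diagram V D M} (f : X ⟶ X')
    (hX : (objectwise V D MQ).isoClosure X) (hX' : (objectwise V D MQ).isoClosure X')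
    (hY : (objectwise V D MR).isoClosure Y) (hf : objectwiseWeq V D W f) :
    WV (eHomWhiskerRight V f (cobar L Y)) := by
  rw [← WV.cancel_left_of_respectsIso (barCobarIso L X' Y).hom, ← barCobarIso_whiskerRight,
    WV.cancel_right_of_respectsIso]
  exact eHomWhiskerRight_bar_weq hD f hX hX' hY hf

lemma isoClosure_objectwise_of_barObjects {X : Diagram V D M} (hX : barObjects L D MQ X) :
    (objectwise V D MQ).isoClosure X := by
  obtain ⟨G, hG, ⟨e⟩⟩ := hX
  obtain ⟨G', hG', ⟨e'⟩⟩ := hD.bar_mem G hG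
  exact ⟨G', hG', ⟨e ≪≫ e'⟩⟩

lemma isoClosure_objectwise_of_cobarObjects {X : Diagram V D M} (hX : cobarObjects L D MR X) :
    (objectwise V D MR).isoClosure X := by
  obtain ⟨G, hG, ⟨e⟩⟩ := hX
  obtain ⟨G', hG', ⟨e'⟩⟩ := hD.cobar_mem G hG
  exact ⟨G', hG', ⟨e ≪≫ e'⟩⟩

lemma eHomWhiskerLeft_weq_of_barObjects {X Y Y' : Diagram V D M} (g : Y ⟶ Y')
    (hX : barObjects L D MQ X) (hY : (objectwise V D MR).isoClosure Y)
    (hY' : (objectwise V D MR).isoClosure Y') (hg : objectwiseWeq V D W g) :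
    WV (eHomWhiskerLeft V X g) := by
  obtain ⟨G, hG, ⟨e⟩⟩ := hX
  rw [← WV.cancel_left_of_respectsIso (eHomWhiskerRight V e.hom Y), ← eHom_whisker_exchange,
    WV.cancel_right_of_respectsIso]
  exact eHomWhiskerLeft_bar_weq hD g ((objectwise V D MQ).le_isoClosure _ hG) hY hY' hg

lemma eHomWhiskerRight_weq_of_cobarObjects {X X' Y : Diagram V D M} (f : X ⟶ X')
    (hX : (objectwise V D MQ).isoClosure X) (hX' : (objectwise V D MQ).isoClosure X')
    (hY : cobarObjects L D MR Y) (hf : objectwiseWeq V D W f) :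
    WV (eHomWhiskerRight V f Y) := by
  obtain ⟨G, hG, ⟨e⟩⟩ := hY
  rw [← WV.cancel_right_of_respectsIso _ (eHomWhiskerLeft V X e.hom), ← eHom_whisker_exchange,
    WV.cancel_left_of_respectsIso]
  exact eHomWhiskerRight_cobar_weq hD f hX hX' ((objectwise V D MR).le_isoClosure _ hG) hf

include hW

lemma eHomWhiskerRight_weq_of_barObjects {X X' Y : Diagram V D M} (f : X ⟶ X')
    (hX : barObjects L D MQ X) (hX' : barObjects L D MQ X')
    (hY : objectwise V D MR Y) (hf : objectwiseWeq V D W f) :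
    WV (eHomWhiskerRight V f Y) := by
  have h (Z : Diagram V D M) (hZ : barObjects L D MQ Z) : WV (eHomWhiskerLeft V Z (cobarη L Y)) :=
    eHomWhiskerLeft_weq_of_barObjects hD _ hZ ((objectwise V D MR).le_isoClosure _ hY)
      (hD.cobar_mem Y hY) (cobarη_weq hW Y)
  have hc := WV.comp_mem _ _ (h X' hX') (eHomWhiskerRight_cobar_weq hD f
    (isoClosure_objectwise_of_barObjects hD hX) (isoClosure_objectwise_of_barObjects hD hX')
    ((objectwise V D MR).le_isoClosure _ hY) hf)
  rw [eHom_whisker_exchange] at hc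
  exact WV.of_postcomp _ _ (h X hX) hc

lemma eHomWhiskerLeft_weq_of_cobarObjects {X Y Y' : Diagram V D M} (g : Y ⟶ Y')
    (hX : objectwise V D MQ X) (hY : cobarObjects L D MR Y)
    (hY' : cobarObjects L D MR Y') (hg : objectwiseWeq V D W g) :
    WV (eHomWhiskerLeft V X g) := by
  have h (Z : Diagram V D M) (hZ : cobarObjects L D MR Z) :
      WV (eHomWhiskerRight V (barε L X) Z) :=
    eHomWhiskerRight_weq_of_cobarObjects hD _ (hD.bar_mem X hX)
      ((objectwise V D MQ).le_isoClosure _ hX) hZ (barε_weq hW X)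
  have hc := WV.comp_mem _ _ (h Y hY) (eHomWhiskerLeft_bar_weq hD g
    ((objectwise V D MQ).le_isoClosure _ hX) (isoClosure_objectwise_of_cobarObjects hD hY)
    (isoClosure_objectwise_of_cobarObjects hD hY') hg)
  rw [← eHom_whisker_exchange] at hc
  exact WV.of_postcomp _ _ (h Y' hY') hc

end HomDeformation

end

section

section Corepresenting

variable {C : Type*} [Category* C]

/-- Objects with naturally isomorphic covariant hom functors are isomorphic. -/
def isoOfHomEquiv {X Y : C} (e : ∀ Z, (X ⟶ Z) ≃ (Y ⟶ Z))
    (he : ∀ {Z Z' : C} (f : X ⟶ Z) (g : Z ⟶ Z'), e Z' (f ≫ g) = e Z f ≫ g) : Y ≅ X :=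
  Coyoneda.ext Y X (fun f => (e _).symm f) (fun f => e _ f) (fun f => (e _).apply_symm_apply f)
    (fun f => (e _).symm_apply_apply f) he

/-- Objects with naturally isomorphic contravariant hom functors are isomorphic. -/
def isoOfHomEquiv' {X Y : C} (e : ∀ Z, (Z ⟶ X) ≃ (Z ⟶ Y))
    (he : ∀ {Z Z' : C} (f : Z' ⟶ Z) (g : Z ⟶ X), e Z' (f ≫ g) = f ≫ e Z g) : X ≅ Y :=
  Yoneda.ext X Y (fun f => e _ f) (fun f => (e _).symm f) (fun f => (e _).symm_apply_apply f)
    (fun f => (e _).apply_symm_apply f) he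

end Corepresenting

section TensorEquiv

variable {V : Type u₁} [Category.{v} V] [MonoidalCategory V] [SymmetricCategory V]
  [MonoidalClosed V] {N : Type u₂} [Category.{v} N] [EnrichedOrdinaryCategory V N]

lemma tensorHomEquiv_comp [Tensored V N] {K : V} {X Y Z : N} (f : tobj V K X ⟶ Y) (g : Y ⟶ Z) :
    tensorHomEquiv K X Z (f ≫ g) = tensorHomEquiv K X Y f ≫ eHomWhiskerLeft V X g := by
  change tcoev V K X ≫ _ = (tcoev V K X ≫ _) ≫ _
  rw [eHomWhiskerLeft_comp, Category.assoc]

lemma cotensorHomEquiv_comp [Cotensored V N] {K : V} {X Y Z : N} (f : Z ⟶ Y) (g : Y ⟶ cobj V K X) :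
    cotensorHomEquiv K X Z (f ≫ g) = cotensorHomEquiv K X Y g ≫ eHomWhiskerRight V f X := by
  change cev V K X ≫ _ = (cev V K X ≫ _) ≫ _
  rw [eHomWhiskerRight_comp, Category.assoc]

lemma tensorHomEquiv_symm_comp [Tensored V N] {K : V} {X Y Z : N} (f : K ⟶ (X ⟶[V] Y))
    (g : Y ⟶ Z) : (tensorHomEquiv K X Z).symm (f ≫ eHomWhiskerLeft V X g) =
      (tensorHomEquiv K X Y).symm f ≫ g := by
  rw [Equiv.symm_apply_eq, tensorHomEquiv_comp, Equiv.apply_symm_apply]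

lemma cotensorHomEquiv_symm_comp [Cotensored V N] {K : V} {X Y Z : N} (f : Z ⟶ Y)
    (g : K ⟶ (Y ⟶[V] X)) : (cotensorHomEquiv K X Z).symm (g ≫ eHomWhiskerRight V f X) =
      f ≫ (cotensorHomEquiv K X Y).symm g := by
  rw [Equiv.symm_apply_eq, cotensorHomEquiv_comp, Equiv.apply_symm_apply]

lemma tdesc_eId_naturality [HasLimits V] [Tensored V N] {K : V} (k : K ⟶ 𝟙_ V) {X Y : N} (f : X ⟶ Y) :
    tmapRight K f ≫ tdesc (k ≫ eId V Y) = tdesc (k ≫ eId V X) ≫ f := by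
  apply tobj_hom_ext
  rw [tcoev_tmapRight, tdesc_fac, eHomWhiskerLeft_comp, reassoc_of% tdesc_fac, Category.assoc,
    Category.assoc, eId_whisker]

lemma cdesc_eId_naturality [HasLimits V] [Cotensored V N] {K : V} (k : K ⟶ 𝟙_ V) {X Y : N} (f : X ⟶ Y) :
    cdesc (k ≫ eId V X) ≫ cmapRight K f = f ≫ cdesc (k ≫ eId V Y) := by
  apply cobj_hom_ext
  rw [cev_cmapRight, cdesc_fac, eHomWhiskerRight_comp, reassoc_of% cdesc_fac, Category.assoc,
    Category.assoc, eId_whisker]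

instance [Tensored V N] (K : V) {X Y : N} (f : X ⟶ Y) [IsIso f] :
    IsIso (tmapRight (V := V) K f) :=
  inferInstanceAs (IsIso (((tensorFunctor V N).obj K).map f))

instance [Cotensored V N] (K : V) {X Y : N} (f : X ⟶ Y) [IsIso f] :
    IsIso (cmapRight (V := V) K f) :=
  inferInstanceAs (IsIso (((cotensorFunctor V N).obj (op K)).map f))

end TensorEquiv

section DiagramDeformation

variable {V : Type u₁} [Category.{v} V] [MonoidalCategory V] [SymmetricCategory V]
  [MonoidalClosed V] {D : Type v} [EnrichedCategory V D]
  {M : Type u₂} [Category.{v} M] [EnrichedOrdinaryCategory V M]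
  [HasLimits V] [HasLimits M] [HasColimits M] [Tensored V M] [Cotensored V M]

section

variable (L : SSet.{v} ⥤ V)

/-- Morphisms `B(D, D, X) ⟶ Y` are morphisms `X ⟶ C(D, D, Y)`. -/
def barHomEquiv (X Y : Diagram V D M) : (bar L X ⟶ Y) ≃ (X ⟶ cobar L Y) :=
  (eHomEquiv V).trans ((Iso.homToEquiv (barCobarIso L X Y)).trans (eHomEquiv V).symm)

lemma eHomEquiv_barHomEquiv {X Y : Diagram V D M} (f : bar L X ⟶ Y) :
    eHomEquiv V (barHomEquiv L X Y f) = eHomEquiv V f ≫ (barCobarIso L X Y).hom :=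
  (eHomEquiv V).apply_symm_apply _

lemma barHomEquiv_comp {X Y Z : Diagram V D M} (f : bar L X ⟶ Y) (g : Y ⟶ Z) :
    barHomEquiv L X Z (f ≫ g) = barHomEquiv L X Y f ≫ (cobarFunctor L).map g := by
  apply (eHomEquiv V).injective
  rw [eHomEquiv_barHomEquiv, eHomEquiv_comp_left, eHomEquiv_comp_left, eHomEquiv_barHomEquiv,
    Category.assoc, Category.assoc, barCobarIso_whiskerLeft]

lemma barHomEquiv_map_comp {X Y Z : Diagram V D M} (f : X ⟶ Y) (g : bar L Y ⟶ Z) :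
    barHomEquiv L X Z ((barFunctor L).map f ≫ g) = f ≫ barHomEquiv L Y Z g := by
  apply (eHomEquiv V).injective
  rw [eHomEquiv_barHomEquiv, eHomEquiv_comp_right, eHomEquiv_comp_right, eHomEquiv_barHomEquiv,
    Category.assoc, Category.assoc, barCobarIso_whiskerRight]

/-- `K ⊙ B(D, D, X) ≅ B(D, D, K ⊙ X)`. -/
def tensorBarIso (K : V) (X : Diagram V D M) : tobj V K (bar L X) ≅ bar L (tobj V K X) :=
  isoOfHomEquiv
    (fun Z => (barHomEquiv L _ Z).trans ((tensorHomEquiv K X (cobar L Z)).trans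
      ((Iso.homToEquiv (barCobarIso L X Z)).symm.trans (tensorHomEquiv K (bar L X) Z).symm)))
    (fun {Z Z'} f g => by
      dsimp only [Equiv.trans_apply, Iso.homToEquiv_symm_apply]
      rw [barHomEquiv_comp, tensorHomEquiv_comp, ← tensorHomEquiv_symm_comp, Category.assoc,
        Category.assoc]
      congr 2
      rw [Iso.comp_inv_eq, Category.assoc, Iso.eq_inv_comp, barCobarIso_whiskerLeft])

/-- `{K, C(D, D, X)} ≅ C(D, D, {K, X})`. -/
def cotensorCobarIso (K : V) (X : Diagram V D M) : cobj V K (cobar L X) ≅ cobar L (cobj V K X) :=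
  isoOfHomEquiv'
    (fun Z => (cotensorHomEquiv K (cobar L X) Z).trans
      ((Iso.homToEquiv (barCobarIso L Z X)).symm.trans
        ((cotensorHomEquiv K X (bar L Z)).symm.trans (barHomEquiv L Z _))))
    (fun {Z Z'} f g => by
      dsimp only [Equiv.trans_apply, Iso.homToEquiv_symm_apply]
      rw [cotensorHomEquiv_comp, ← barHomEquiv_map_comp, ← cotensorHomEquiv_symm_comp,
        Category.assoc, Category.assoc]
      congr 3
      rw [Iso.comp_inv_eq, Category.assoc, Iso.eq_inv_comp, barCobarIso_whiskerRight])

end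

variable {WV : MorphismProperty V} [IsHomotopical WV] {VQ : ObjectProperty V}
  {W : MorphismProperty M} [IsHomotopical W] {MQ MR : ObjectProperty M}

lemma isoClosure_val {P : ObjectProperty M} {X : Diagram V D M}
    (hX : (objectwise V D P).isoClosure X) (d : D) : P.isoClosure (X.val d) := by
  obtain ⟨Y, hY, ⟨e⟩⟩ := hX
  exact ⟨Y.val d, hY d, ⟨(Diagram.ev V M d).mapIso e⟩⟩

lemma Diagram.tensorFunctor_map_app {K K' : V} (k : K ⟶ K') (X : Diagram V D M) (d : D) :
    Hom.app (((tensorFunctor V (Diagram V D M)).map k).app X) d =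
      ((tensorFunctor V M).map k).app (X.val d) := by
  refine (tdesc_app d _).trans (congrArg tdesc ?_)
  exact (Category.assoc _ _ _).trans (congrArg (k ≫ ·) (tcoev_π d))

lemma Diagram.tensorFunctor_obj_map (K : V) {X Y : Diagram V D M} (f : X ⟶ Y) (d : D) :
    Hom.app (((tensorFunctor V (Diagram V D M)).obj K).map f) d =
      ((tensorFunctor V M).obj K).map (Hom.app f d) := by
  refine (tdesc_app d _).trans (congrArg tdesc ?_)
  refine (Category.assoc _ _ _).trans ?_
  refine (congrArg (tcoev V K Y ≫ ·) (eHomWhiskerRight_π f _ d)).trans ?_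
  exact (Category.assoc _ _ _).symm.trans (congrArg (· ≫ _) (tcoev_π d))

lemma Diagram.cotensorFunctor_map_app {K K' : Vᵒᵖ} (k : K ⟶ K') (X : Diagram V D M) (d : D) :
    Hom.app (((cotensorFunctor V (Diagram V D M)).map k).app X) d =
      ((cotensorFunctor V M).map k).app (X.val d) := by
  refine (cdesc_app d _).trans (congrArg cdesc ?_)
  exact (Category.assoc _ _ _).trans (congrArg (k.unop ≫ ·) (cev_π d))

lemma Diagram.cotensorFunctor_obj_map (K : Vᵒᵖ) {X Y : Diagram V D M} (f : X ⟶ Y) (d : D) :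
    Hom.app (((cotensorFunctor V (Diagram V D M)).obj K).map f) d =
      ((cotensorFunctor V M).obj K).map (Hom.app f d) := by
  refine (cdesc_app d _).trans (congrArg cdesc ?_)
  refine (Category.assoc _ _ _).trans ?_
  refine (congrArg (cev V K.unop X ≫ ·) (eHomWhiskerLeft_π _ f d)).trans ?_
  exact (Category.assoc _ _ _).symm.trans (congrArg (· ≫ _) (cev_π d))

lemma tensor_isHomotopicalOn₂ (hM : IsVHomotopical WV VQ W MQ MR)
    {P : ObjectProperty (Diagram V D M)} (hP : P ≤ (objectwise V D MQ).isoClosure) :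
    IsHomotopicalOn₂ (tensorFunctor V (Diagram V D M)) WV VQ (objectwiseWeq V D W) P
      (objectwiseWeq V D W) :=
  .of_variables
    (fun k hK hK' hk Y hY d => by
      rw [Diagram.tensorFunctor_map_app]
      exact hM.deform.tens.map_app k (VQ.le_isoClosure _ hK) (VQ.le_isoClosure _ hK') hk
        (isoClosure_val (hP _ hY) d))
    (fun f hX hX' hf K hK d => by
      rw [Diagram.tensorFunctor_obj_map]
      exact hM.deform.tens.obj_map (Diagram.Hom.app f d) (isoClosure_val (hP _ hX) d)
        (isoClosure_val (hP _ hX') d) (hf d) (VQ.le_isoClosure _ hK))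

lemma cotensor_isHomotopicalOn₂ (hM : IsVHomotopical WV VQ W MQ MR)
    {P : ObjectProperty (Diagram V D M)} (hP : P ≤ (objectwise V D MR).isoClosure) :
    IsHomotopicalOn₂ (cotensorFunctor V (Diagram V D M)) WV.op VQ.op (objectwiseWeq V D W) P
      (objectwiseWeq V D W) :=
  .of_variables
    (fun k hK hK' hk Y hY d => by
      rw [Diagram.cotensorFunctor_map_app]
      exact hM.deform.homl.map_app k (VQ.op.le_isoClosure _ hK) (VQ.op.le_isoClosure _ hK') hk
        (isoClosure_val (hP _ hY) d))
    (fun f hX hX' hf K hK d => by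
      rw [Diagram.cotensorFunctor_obj_map]
      exact hM.deform.homl.obj_map (Diagram.Hom.app f d) (isoClosure_val (hP _ hX) d)
        (isoClosure_val (hP _ hX') d) (hf d) (VQ.op.le_isoClosure _ hK))

lemma IsVHomotopical.tensor_unit_of_isoClosure (hM : IsVHomotopical WV VQ W MQ MR)
    (q : LeftDeformation WV VQ) {X : M} (hX : MQ.isoClosure X) :
    W (tdesc (q.q.app (𝟙_ V) ≫ eId V X) : tobj V _ X ⟶ X) := by
  obtain ⟨Y, hY, ⟨i⟩⟩ := hX
  rw [← W.cancel_right_of_respectsIso _ i.hom, ← tdesc_eId_naturality,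
    W.cancel_left_of_respectsIso]
  exact hM.tensor_unit q Y hY

lemma IsVHomotopical.cotensor_unit_of_isoClosure (hM : IsVHomotopical WV VQ W MQ MR)
    (q : LeftDeformation WV VQ) {X : M} (hX : MR.isoClosure X) :
    W (cdesc (q.q.app (𝟙_ V) ≫ eId V X) : X ⟶ cobj V _ X) := by
  obtain ⟨Y, hY, ⟨i⟩⟩ := hX
  rw [← W.cancel_left_of_respectsIso i.inv, ← cdesc_eId_naturality,
    W.cancel_right_of_respectsIso]
  exact hM.cotensor_unit q Y hY

lemma tensor_unit_weq (hM : IsVHomotopical WV VQ W MQ MR) (q : LeftDeformation WV VQ)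
    {X : Diagram V D M} (hX : (objectwise V D MQ).isoClosure X) :
    objectwiseWeq V D W (tdesc (q.q.app (𝟙_ V) ≫ eId V X) : tobj V _ X ⟶ X) := by
  intro d
  have e : Diagram.Hom.app (tdesc (q.q.app (𝟙_ V) ≫ eId V X) : tobj V _ X ⟶ X) d =
      tdesc (q.q.app (𝟙_ V) ≫ eId V (X.val d)) := by
    refine (Diagram.tdesc_app d _).trans (congrArg tdesc ?_)
    exact (Category.assoc _ _ _).trans (congrArg (q.q.app (𝟙_ V) ≫ ·) (Diagram.eId_π X d))
  rw [e]
  exact hM.tensor_unit_of_isoClosure q (isoClosure_val hX d)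

lemma cotensor_unit_weq (hM : IsVHomotopical WV VQ W MQ MR) (q : LeftDeformation WV VQ)
    {X : Diagram V D M} (hX : (objectwise V D MR).isoClosure X) :
    objectwiseWeq V D W (cdesc (q.q.app (𝟙_ V) ≫ eId V X) : X ⟶ cobj V _ X) := by
  intro d
  have e : Diagram.Hom.app (cdesc (q.q.app (𝟙_ V) ≫ eId V X) : X ⟶ cobj V _ X) d =
      cdesc (q.q.app (𝟙_ V) ≫ eId V (X.val d)) := by
    refine (Diagram.cdesc_app d _).trans (congrArg cdesc ?_)
    exact (Category.assoc _ _ _).trans (congrArg (q.q.app (𝟙_ V) ≫ ·) (Diagram.eId_π X d))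
  rw [e]
  exact hM.cotensor_unit_of_isoClosure q (isoClosure_val hX d)

variable {L : SSet.{v} ⥤ V} [L.Monoidal] [L.IsLeftAdjoint] {VR : ObjectProperty V}

lemma barObjects_isLeftDeformationRetract (hW : simplicialHomotopyEquivalences L M ≤ W)
    (hQ : IsLeftDeformationRetract (objectwiseWeq V D W) (objectwise V D MQ)) :
    IsLeftDeformationRetract (objectwiseWeq V D W) (barObjects L D MQ) := by
  obtain ⟨q⟩ := hQ
  exact ⟨{  Q := q.Q ⋙ barFunctor L
            q :=
              { app := fun X => barε L (q.Q.obj X) ≫ q.q.app X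
                naturality := fun X Y f => by
                  have h1 := barε_naturality L (q.Q.map f)
                  have h2 := q.q.naturality f
                  refine (Category.assoc _ _ _).symm.trans ((congrArg (· ≫ _) h1).trans ?_)
                  refine (Category.assoc _ _ _).trans ((congrArg (_ ≫ ·) h2).trans ?_)
                  exact (Category.assoc _ _ _).symm }
            weq := fun X => (objectwiseWeq V D W).comp_mem _ _ (barε_weq hW _) (q.weq X)
            mem := fun X => ⟨_, q.mem X, ⟨Iso.refl _⟩⟩ }⟩

lemma cobarObjects_isRightDeformationRetract (hW : simplicialHomotopyEquivalences L M ≤ W)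
    (hR : IsRightDeformationRetract (objectwiseWeq V D W) (objectwise V D MR)) :
    IsRightDeformationRetract (objectwiseWeq V D W) (cobarObjects L D MR) := by
  obtain ⟨r⟩ := hR
  exact ⟨{  R := r.R ⋙ cobarFunctor L
            r :=
              { app := fun X => r.r.app X ≫ cobarη L (r.R.obj X)
                naturality := fun X Y f => by
                  have h1 := cobarη_naturality L (r.R.map f)
                  have h2 := r.r.naturality f
                  refine (Category.assoc _ _ _).symm.trans ((congrArg (· ≫ _) h2).trans ?_)
                  refine (Category.assoc _ _ _).trans ((congrArg (_ ≫ ·) h1.symm).trans ?_)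
                  exact (Category.assoc _ _ _).symm }
            weq := fun X => (objectwiseWeq V D W).comp_mem _ _ (r.weq X) (cobarη_weq hW _)
            mem := fun X => ⟨_, r.mem X, ⟨Iso.refl _⟩⟩ }⟩

variable (hM : IsVHomotopical WV VQ W MQ MR) (hW : simplicialHomotopyEquivalences L M ≤ W)
  (hD : IsGoodForHom L D WV VR W MQ MR)
  (hQ : IsLeftDeformationRetract (objectwiseWeq V D W) (objectwise V D MQ))
  (hR : IsRightDeformationRetract (objectwiseWeq V D W) (objectwise V D MR))

include hM hW hD hQ hR

theorem isVHomotopical_bar :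
    IsVHomotopical WV VQ (objectwiseWeq V D W) (barObjects L D MQ) (objectwise V D MR) where
  homotopical := inferInstance
  deform :=
    { left₁ := hM.deform.left₁
      left₂ := barObjects_isLeftDeformationRetract hW hQ
      right := hR
      tens := tensor_isHomotopicalOn₂ hM fun _ h => isoClosure_objectwise_of_barObjects hD h
      homl := cotensor_isHomotopicalOn₂ hM ((objectwise V D MR).le_isoClosure)
      homr := .of_variables
        (fun f hX hX' hf _ hY => eHomWhiskerRight_weq_of_barObjects hW hD f.unop hX' hX hY hf)
        (fun g hY hY' hg _ hX => eHomWhiskerLeft_weq_of_barObjects hD g hX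
          ((objectwise V D MR).le_isoClosure _ hY) ((objectwise V D MR).le_isoClosure _ hY') hg) }
  tensor_mem K X hK hX := by
    obtain ⟨G, hG, ⟨e⟩⟩ := hX
    exact ⟨tobj V K G, fun d => hM.tensor_mem K _ hK (hG d),
      ⟨((tensorFunctor V _).obj K).mapIso e ≪≫ tensorBarIso L K G⟩⟩
  cotensor_mem K X hK hX d := hM.cotensor_mem K _ hK (hX d)
  tensor_unit q _ hX := tensor_unit_weq hM q (isoClosure_objectwise_of_barObjects hD hX)
  cotensor_unit q _ hX := cotensor_unit_weq hM q ((objectwise V D MR).le_isoClosure _ hX)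

theorem isVHomotopical_cobar :
    IsVHomotopical WV VQ (objectwiseWeq V D W) (objectwise V D MQ) (cobarObjects L D MR) where
  homotopical := inferInstance
  deform :=
    { left₁ := hM.deform.left₁
      left₂ := hQ
      right := cobarObjects_isRightDeformationRetract hW hR
      tens := tensor_isHomotopicalOn₂ hM ((objectwise V D MQ).le_isoClosure)
      homl := cotensor_isHomotopicalOn₂ hM fun _ h => isoClosure_objectwise_of_cobarObjects hD h
      homr := .of_variables
        (fun f hX hX' hf _ hY => eHomWhiskerRight_weq_of_cobarObjects hD f.unop
          ((objectwise V D MQ).le_isoClosure _ hX') ((objectwise V D MQ).le_isoClosure _ hX) hY hf)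
        (fun g hY hY' hg _ hX => eHomWhiskerLeft_weq_of_cobarObjects hW hD g hX hY hY' hg) }
  tensor_mem K X hK hX d := hM.tensor_mem K _ hK (hX d)
  cotensor_mem K X hK hX := by
    obtain ⟨G, hG, ⟨e⟩⟩ := hX
    exact ⟨cobj V K G, fun d => hM.cotensor_mem K _ hK (hG d),
      ⟨((cotensorFunctor V _).obj (op K)).mapIso e ≪≫ cotensorCobarIso L K G⟩⟩
  tensor_unit q _ hX := tensor_unit_weq hM q ((objectwise V D MQ).le_isoClosure _ hX)
  cotensor_unit q _ hX := cotensor_unit_weq hM q (isoClosure_objectwise_of_cobarObjects hD hX)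

end DiagramDeformation

end

section

section Derived

variable {A B C D E : Type*} [Category* A] [Category* B] [Category* C] [Category* D] [Category* E]

section Whiskering

variable (L : C ⥤ D) (W : MorphismProperty C) [L.IsLocalization W] {F G : D ⥤ E}

include W in
lemma exists_natTrans_of_localization (α : L ⋙ F ⟶ L ⋙ G) :
    ∃ β : F ⟶ G, ∀ X, β.app (L.obj X) = α.app X := by
  have := Localization.full_whiskeringLeft L W E
  exact ⟨((Functor.whiskeringLeft C D E).obj L).preimage α, fun X =>
    congrArg (fun t => t.app X) (((Functor.whiskeringLeft C D E).obj L).map_preimage α)⟩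

end Whiskering

section Left

variable {W : MorphismProperty C} {P : ObjectProperty C} (q : LeftDeformation W P)

/-- The components of a left deformation. -/
def LeftDeformation.π (X : C) : q.Q.obj X ⟶ X := q.q.app X

lemma LeftDeformation.π_naturality {X Y : C} (f : X ⟶ Y) : q.Q.map f ≫ q.π Y = q.π X ≫ f :=
  q.q.naturality f

/-- The natural transformation `F ⟶ G` extending one on a left deformation retract whose
deformations are inverted by `F`. -/
def LeftDeformation.extend {F G : C ⥤ E} (hF : ∀ X, IsIso (F.map (q.π X)))
    (m : ∀ X, P X → (F.obj X ⟶ G.obj X))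
    (hm : ∀ {X Y} (hX : P X) (hY : P Y) (f : X ⟶ Y), F.map f ≫ m Y hY = m X hX ≫ G.map f) :
    F ⟶ G where
  app X := inv (F.map (q.π X)) ≫ m _ (q.mem X) ≫ G.map (q.π X)
  naturality X Y f := by
    rw [← cancel_epi (F.map (q.π X)), ← F.map_comp_assoc, ← q.π_naturality, F.map_comp,
      Category.assoc, Category.assoc, IsIso.hom_inv_id_assoc, IsIso.hom_inv_id_assoc,
      Category.assoc, ← G.map_comp, ← q.π_naturality, G.map_comp, reassoc_of% (hm (q.mem X)
      (q.mem Y))]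

lemma LeftDeformation.map_π_extend {F G : C ⥤ E} (hF : ∀ X, IsIso (F.map (q.π X)))
    (m : ∀ X, P X → (F.obj X ⟶ G.obj X))
    (hm : ∀ {X Y} (hX : P X) (hY : P Y) (f : X ⟶ Y), F.map f ≫ m Y hY = m X hX ≫ G.map f)
    (X : C) : F.map (q.π X) ≫ (q.extend hF m hm).app X = m _ (q.mem X) ≫ G.map (q.π X) := by
  dsimp [extend]
  rw [IsIso.hom_inv_id_assoc]

lemma isLeftDerivedFunctor_of_isIso {L : C ⥤ D} [L.IsLocalization W] {G : C ⥤ E} {G' : D ⥤ E}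
    (α : L ⋙ G' ⟶ G) (hP : IsLeftDeformationRetract W P) (hα : ∀ X, P X → IsIso (α.app X)) :
    G'.IsLeftDerivedFunctor α W := by
  obtain ⟨q⟩ := hP
  have hL : ∀ X, IsIso (L.map (q.π X)) := fun X => Localization.inverts L W _ (q.weq X)
  have key : ∀ (K : D ⥤ E) (β : L ⋙ K ⟶ G), ∃ τ : K ⟶ G', ∀ X, τ.app (L.obj X) ≫ α.app X =
      β.app X := by
    intro K β
    obtain ⟨τ, hτ⟩ := exists_natTrans_of_localization L W
      (q.extend (F := L ⋙ K) (G := L ⋙ G') (fun X => inferInstanceAs (IsIso (K.map (L.map _))))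
        (fun X hX => have := hα X hX; β.app X ≫ inv (α.app X))
        (fun {X Y} hX hY f => by
          have := hα X hX
          have := hα Y hY
          have h := α.naturality f
          dsimp only
          rw [Category.assoc, ← cancel_mono (α.app Y), Category.assoc, Category.assoc,
            Category.assoc, Category.assoc, IsIso.inv_hom_id, Category.comp_id, h,
            IsIso.inv_hom_id_assoc, β.naturality]))
    refine ⟨τ, fun X => ?_⟩
    have := hα _ (q.mem X)
    have h := α.naturality (q.π X)
    have : IsIso ((L ⋙ K).map (q.π X)) := inferInstanceAs (IsIso (K.map (L.map _)))
    rw [hτ, ← cancel_epi ((L ⋙ K).map (q.π X)), ← Category.assoc, q.map_π_extend]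
    dsimp only
    rw [Category.assoc, Category.assoc, h, IsIso.inv_hom_id_assoc, β.naturality]
  refine ⟨⟨⟨IsTerminal.ofUniqueHom (fun Z => CostructuredArrow.homMk (key Z.left Z.hom).choose
    (by ext X; exact (key Z.left Z.hom).choose_spec X)) fun Z m => ?_⟩⟩⟩
  apply CostructuredArrow.hom_ext
  refine Localization.natTrans_ext L W fun X => ?_
  let τ : Z.left ⟶ G' := m.left
  let τ' : Z.left ⟶ G' := (key Z.left Z.hom).choose
  have hX : τ.app (L.obj (q.Q.obj X)) ≫ α.app (q.Q.obj X) =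
      τ'.app (L.obj (q.Q.obj X)) ≫ α.app (q.Q.obj X) :=
    (congrArg (fun t => t.app (q.Q.obj X)) (CostructuredArrow.w m)).trans
      ((key Z.left Z.hom).choose_spec (q.Q.obj X)).symm
  have := hα _ (q.mem X)
  rw [cancel_mono] at hX
  change τ.app (L.obj X) = τ'.app (L.obj X)
  rw [← cancel_epi (Z.left.map (L.map (q.π X))), NatTrans.naturality, NatTrans.naturality, hX]

end Left

section Right

variable {W : MorphismProperty C} {P : ObjectProperty C}

/-- The components of a right deformation. -/
def RightDeformation.ι (r : RightDeformation W P) (X : C) : X ⟶ r.R.obj X := r.r.app X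

lemma RightDeformation.ι_naturality (r : RightDeformation W P) {X Y : C} (f : X ⟶ Y) :
    f ≫ r.ι Y = r.ι X ≫ r.R.map f :=
  r.r.naturality f

lemma isRightDerivedFunctor_of_isIso {L : C ⥤ D} [L.IsLocalization W] {G : C ⥤ E} {G' : D ⥤ E}
    (α : G ⟶ L ⋙ G') (hP : IsRightDeformationRetract W P) (hα : ∀ X, P X → IsIso (α.app X)) :
    G'.IsRightDerivedFunctor α W := by
  obtain ⟨r⟩ := hP
  have hL : ∀ X, IsIso (L.map (r.ι X)) := fun X => Localization.inverts L W _ (r.weq X)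
  have h1 : ∀ {X Y : C} (f : X ⟶ Y), G.map f ≫ α.app Y = α.app X ≫ G'.map (L.map f) :=
    fun f => α.naturality f
  have key : ∀ (K : D ⥤ E) (β : G ⟶ L ⋙ K), ∃ τ : G' ⟶ K, ∀ X, α.app X ≫ τ.app (L.obj X) =
      β.app X := by
    intro K β
    have h2 : ∀ {X Y : C} (f : X ⟶ Y), G.map f ≫ β.app Y = β.app X ≫ K.map (L.map f) :=
      fun f => β.naturality f
    obtain ⟨τ, hτ⟩ := exists_natTrans_of_localization L W (F := G') (G := K)
      { app := fun X => have := hα _ (r.mem X)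
          G'.map (L.map (r.ι X)) ≫ inv (α.app (r.R.obj X)) ≫ β.app _ ≫
            inv (K.map (L.map (r.ι X)))
        naturality := fun X Y f => by
          have := hα _ (r.mem X)
          have := hα _ (r.mem Y)
          dsimp
          rw [← cancel_mono (K.map (L.map (r.ι Y)))]
          simp only [Category.assoc, IsIso.inv_hom_id, Category.comp_id]
          rw [← G'.map_comp_assoc, ← L.map_comp, r.ι_naturality, ← K.map_comp, ← L.map_comp,
            r.ι_naturality, L.map_comp, K.map_comp, G'.map_comp, IsIso.inv_hom_id_assoc, ← h2,
            Category.assoc]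
          congr 1
          rw [IsIso.eq_inv_comp, ← reassoc_of% (h1 (r.R.map f)), IsIso.hom_inv_id_assoc] }
    refine ⟨τ, fun X => ?_⟩
    have := hα _ (r.mem X)
    rw [hτ]
    dsimp only
    rw [← reassoc_of% (h1 (r.ι X)), IsIso.hom_inv_id_assoc, reassoc_of% (h2 (r.ι X)),
      IsIso.hom_inv_id]
    exact Category.comp_id _
  refine ⟨⟨⟨IsInitial.ofUniqueHom (fun Z => StructuredArrow.homMk (key Z.right Z.hom).choose
    (by ext X; exact (key Z.right Z.hom).choose_spec X)) fun Z m => ?_⟩⟩⟩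
  apply StructuredArrow.hom_ext
  refine Localization.natTrans_ext L W fun X => ?_
  let τ : G' ⟶ Z.right := m.right
  let τ' : G' ⟶ Z.right := (key Z.right Z.hom).choose
  have hX : α.app (r.R.obj X) ≫ τ.app (L.obj (r.R.obj X)) =
      α.app (r.R.obj X) ≫ τ'.app (L.obj (r.R.obj X)) :=
    (congrArg (fun t => t.app (r.R.obj X)) (StructuredArrow.w m)).trans
      ((key Z.right Z.hom).choose_spec (r.R.obj X)).symm
  have := hα _ (r.mem X)
  rw [cancel_epi] at hX
  change τ.app (L.obj X) = τ'.app (L.obj X)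
  rw [← cancel_mono (Z.right.map (L.map (r.ι X))), ← NatTrans.naturality,
    ← NatTrans.naturality, hX]

end Right

section Adjunction

/-- The components of the counit of an adjunction. -/
def adjCounit {G : A ⥤ B} {F : B ⥤ A} (adj : G ⊣ F) (Y : B) : G.obj (F.obj Y) ⟶ Y :=
  adj.counit.app Y

variable {A' B' : Type*} [Category* A'] [Category* B'] {WA : MorphismProperty A}
  {WB : MorphismProperty B} [IsHomotopical WA] [IsHomotopical WB] {P : ObjectProperty A}
  {R : ObjectProperty B} {LA : A ⥤ A'} {LB : B ⥤ B'} [LA.IsLocalization WA] [LB.IsLocalization WB]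
  {G : A ⥤ B} {F : B ⥤ A} (adj : G ⊣ F) {G' : A' ⥤ B'} (α : LA ⋙ G' ⟶ G ⋙ LB)
  (hP : IsLeftDeformationRetract WA P) (hα : ∀ X, P X → IsIso (α.app X))
  (hR : IsRightDeformationRetract WB R) (hF : IsHomotopicalOn F WB R WA)

lemma RightDeformation.map_weq (r : RightDeformation WB R) {X Y : B} (f : X ⟶ Y) (hf : WB f) :
    WB (r.R.map f) := by
  have h : WB (f ≫ r.ι Y) := WB.comp_mem _ _ hf (r.weq Y)
  rw [r.ι_naturality] at h
  exact WB.of_precomp _ _ (r.weq X) h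

lemma LeftDeformation.map_weq (q : LeftDeformation WA P) {X Y : A} (f : X ⟶ Y) (hf : WA f) :
    WA (q.Q.map f) := by
  have h : WA (q.π X ≫ f) := WA.comp_mem _ _ (q.weq X) hf
  rw [← q.π_naturality] at h
  exact WA.of_postcomp _ _ (q.weq Y) h

include hP hα hR hF in
/-- The derived adjunction. -/
theorem exists_derived_adjunction :
    ∃ (F' : B' ⥤ A') (adj' : G' ⊣ F'), ∀ Y, R Y →
      IsIso (adj'.homEquiv _ _ (α.app (F.obj Y) ≫ LB.map (adjCounit adj Y))) := by
  obtain ⟨r⟩ := hR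
  have hinv : WB.IsInvertedBy (r.R ⋙ F ⋙ LA) := fun X Y f hf =>
    Localization.inverts LA WA _ (hF _ (r.mem X) (r.mem Y) (r.map_weq f hf))
  let F' : B' ⥤ A' := Localization.lift _ hinv LB
  let e : LB ⋙ F' ≅ r.R ⋙ F ⋙ LA := Localization.fac _ hinv LB
  let β : F ⋙ LA ⟶ LB ⋙ F' := Functor.whiskerRight r.r (F ⋙ LA) ≫ e.inv
  have hβ : ∀ Y, R Y → IsIso (β.app Y) := fun Y hY => by
    have : IsIso (LA.map (F.map (r.r.app Y))) :=
      Localization.inverts LA WA _ (hF _ hY (r.mem Y) (r.weq Y))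
    have h : β.app Y = LA.map (F.map (r.r.app Y)) ≫ e.inv.app Y := rfl
    rw [h]
    infer_instance
  have : G'.IsLeftDerivedFunctor α WA := isLeftDerivedFunctor_of_isIso α hP hα
  have : F'.IsRightDerivedFunctor β WB := isRightDerivedFunctor_of_isIso β ⟨r⟩ hβ
  have : (G' ⋙ F').IsLeftDerivedFunctor
      ((Functor.associator _ _ _).inv ≫ Functor.whiskerRight α F') WA :=
    isLeftDerivedFunctor_of_isIso _ hP fun X hX => by
      have := hα X hX
      simp only [NatTrans.comp_app, Functor.associator_inv_app, Functor.whiskerRight_app]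
      infer_instance
  have : (F' ⋙ G').IsRightDerivedFunctor
      (Functor.whiskerRight β G' ≫ (Functor.associator _ _ _).hom) WB :=
    isRightDerivedFunctor_of_isIso _ ⟨r⟩ fun X hX => by
      have := hβ X hX
      simp only [NatTrans.comp_app, Functor.associator_hom_app, Functor.whiskerRight_app]
      infer_instance
  refine ⟨F', adj.derived WA WB α β, fun Y hY => ?_⟩
  have h : (adj.derived WA WB α β).homEquiv _ _ (α.app (F.obj Y) ≫ LB.map (adjCounit adj Y)) =
      β.app Y := by
    rw [← Equiv.eq_symm_apply, Adjunction.homEquiv_counit]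
    exact (adj.derivedε_fac_app WB α β Y).symm
  rw [h]
  exact hβ Y hY

include adj hP hα hR hF in
theorem isLeftAdjoint_of_deformation : G'.IsLeftAdjoint := by
  obtain ⟨_, adj', _⟩ := exists_derived_adjunction adj α hP hα hR hF
  exact adj'.isLeftAdjoint

include hP hα hR hF in
theorem isIso_homEquiv_of_deformation {F' : B' ⥤ A'} (adj' : G' ⊣ F') {Y : B} (hY : R Y) :
    IsIso (adj'.homEquiv _ _ (α.app (F.obj Y) ≫ LB.map (adjCounit adj Y))) := by
  obtain ⟨F'', adj'', h⟩ := exists_derived_adjunction adj α hP hα hR hF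
  have := h Y hY
  obtain ⟨e, he⟩ : ∃ e : F''.obj (LB.obj Y) ≅ F'.obj (LB.obj Y),
      ∀ {X : A'} (f : G'.obj X ⟶ LB.obj Y),
        adj'.homEquiv _ _ f = adj''.homEquiv _ _ f ≫ e.hom := by
    refine ⟨(adj''.rightAdjointUniq adj').app _, fun f => ?_⟩
    rw [Adjunction.homEquiv_unit, Adjunction.homEquiv_unit,
      ← Adjunction.unit_rightAdjointUniq_hom_app adj'' adj', Category.assoc, Category.assoc]
    exact congrArg (_ ≫ ·) ((adj''.rightAdjointUniq adj').hom.naturality f).symm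
  rw [he]
  infer_instance

end Adjunction

end Derived

end

section

section DerivedBifunctors

variable {C D E : Type*} [Category* C] [Category* D] [Category* E]

lemma IsLeftDeformationRetract.prod {W : MorphismProperty C} {P : ObjectProperty C}
    {W' : MorphismProperty D} {P' : ObjectProperty D} (h : IsLeftDeformationRetract W P)
    (h' : IsLeftDeformationRetract W' P') :
    IsLeftDeformationRetract (W.prod W') (prodProperty P P') := by
  obtain ⟨q⟩ := h
  obtain ⟨q'⟩ := h'
  exact ⟨{
    Q := q.Q.prod q'.Q
    q := { app := fun X => Prod.mkHom (q.π X.1) (q'.π X.2)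
           naturality := fun X Y f => Prod.ext (q.π_naturality f.1) (q'.π_naturality f.2) }
    weq := fun X => ⟨q.weq X.1, q'.weq X.2⟩
    mem := fun X => ⟨q.mem X.1, q'.mem X.2⟩ }⟩

lemma IsRightDeformationRetract.prod {W : MorphismProperty C} {P : ObjectProperty C}
    {W' : MorphismProperty D} {P' : ObjectProperty D} (h : IsRightDeformationRetract W P)
    (h' : IsRightDeformationRetract W' P') :
    IsRightDeformationRetract (W.prod W') (prodProperty P P') := by
  obtain ⟨r⟩ := h
  obtain ⟨r'⟩ := h'
  exact ⟨{
    R := r.R.prod r'.R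
    r := { app := fun X => Prod.mkHom (r.ι X.1) (r'.ι X.2)
           naturality := fun X Y f => Prod.ext (r.ι_naturality f.1) (r'.ι_naturality f.2) }
    weq := fun X => ⟨r.weq X.1, r'.weq X.2⟩
    mem := fun X => ⟨r.mem X.1, r'.mem X.2⟩ }⟩

lemma IsLeftDeformationRetract.op {W : MorphismProperty C} {P : ObjectProperty C}
    (h : IsLeftDeformationRetract W P) : IsRightDeformationRetract W.op P.op := by
  obtain ⟨q⟩ := h
  exact ⟨{
    R := q.Q.op
    r := { app := fun X => (q.π X.unop).op
           naturality := fun X Y f => Quiver.Hom.unop_inj (q.π_naturality f.unop).symm }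
    weq := fun X => q.weq X.unop
    mem := fun X => q.mem X.unop }⟩

lemma exists_leftDerived {W : MorphismProperty C} [IsHomotopical W] {P : ObjectProperty C}
    (hP : IsLeftDeformationRetract W P) (L : C ⥤ D) [L.IsLocalization W] (F : C ⥤ E)
    (hF : ∀ {X Y : C} (f : X ⟶ Y), P X → P Y → W f → IsIso (F.map f)) :
    ∃ (G : D ⥤ E) (α : L ⋙ G ⟶ F), ∀ X, P X → IsIso (α.app X) := by
  obtain ⟨q⟩ := hP
  have h : W.IsInvertedBy (q.Q ⋙ F) := fun X Y f hf =>
    hF _ (q.mem X) (q.mem Y) (q.map_weq f hf)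
  refine ⟨Localization.lift _ h L, (Localization.fac _ h L).hom ≫ Functor.whiskerRight q.q F,
    fun X hX => ?_⟩
  have : IsIso (F.map (q.q.app X)) := hF _ (q.mem X) hX (q.weq X)
  rw [NatTrans.comp_app, Functor.whiskerRight_app]
  infer_instance

lemma exists_iso_of_leftDerived {W : MorphismProperty C} {P : ObjectProperty C}
    (hP : IsLeftDeformationRetract W P) {L : C ⥤ D} [L.IsLocalization W] {F₁ F₂ : D ⥤ E}
    {G₁ G₂ : C ⥤ E} (α₁ : L ⋙ F₁ ⟶ G₁) (α₂ : L ⋙ F₂ ⟶ G₂) (e : G₁ ≅ G₂)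
    (h₁ : ∀ X, P X → IsIso (α₁.app X)) (h₂ : ∀ X, P X → IsIso (α₂.app X)) :
    ∃ θ : F₁ ≅ F₂, ∀ X, θ.hom.app (L.obj X) ≫ α₂.app X = α₁.app X ≫ e.hom.app X := by
  have := isLeftDerivedFunctor_of_isIso α₁ hP h₁
  have := isLeftDerivedFunctor_of_isIso α₂ hP h₂
  exact ⟨Functor.leftDerivedNatIso F₁ F₂ α₁ α₂ W e, fun X =>
    Functor.leftDerivedNatTrans_app F₁ F₂ α₁ α₂ W e.hom X⟩

lemma exists_mem_iso_of_localization {W : MorphismProperty C} {P : ObjectProperty C}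
    (hP : IsLeftDeformationRetract W P) (L : C ⥤ D) [L.IsLocalization W] (Y : D) :
    ∃ X, P X ∧ Nonempty (L.obj X ≅ Y) := by
  obtain ⟨q⟩ := hP
  have := Localization.essSurj L W
  have : IsIso (L.map (q.π (L.objPreimage Y))) := Localization.inverts L W _ (q.weq _)
  exact ⟨_, q.mem (L.objPreimage Y),
    ⟨asIso (L.map (q.π (L.objPreimage Y))) ≪≫ L.objObjPreimageIso Y⟩⟩

end DerivedBifunctors

open MonoidalRightAction

section DerivedActions

variable {V H N 𝒩 : Type*} [Category* V] [Category* H] [Category* N] [Category* 𝒩]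
  [MonoidalCategory V] [MonoidalRightAction V N]

/-- The homotopical conditions under which a right action of a monoidal category has a left
derived action. -/
structure IsHomotopicalAction (WV : MorphismProperty V) (VQ : ObjectProperty V)
    (W : MorphismProperty N) (NQ : ObjectProperty N) : Prop where
  left₁ : IsLeftDeformationRetract WV VQ
  left₂ : IsLeftDeformationRetract W NQ
  mem {X : N} {K : V} : NQ X → VQ K → NQ (X ⊙ᵣ K)
  weq {X Y : N} {K L : V} (f : X ⟶ Y) (k : K ⟶ L) : NQ X → NQ Y → VQ K → VQ L → W f → WV k →
    W (f ⊙ᵣₘ k)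
  unit (q : LeftDeformation WV VQ) (X : N) : NQ X → W (X ⊴ᵣ q.π (𝟙_ V) ≫ (ρᵣ X).hom)

/-- A left derived functor of a right action. -/
structure DerivedAct (γ : V ⥤ H) (δ : N ⥤ 𝒩) (VQ : ObjectProperty V) (NQ : ObjectProperty N) where
  Φ : 𝒩 × H ⥤ 𝒩
  t (X : N) (K : V) : Φ.obj (δ.obj X, γ.obj K) ⟶ δ.obj (X ⊙ᵣ K)
  t_naturality {X Y : N} {K L : V} (f : X ⟶ Y) (k : K ⟶ L) :
    Φ.map (Prod.mkHom (δ.map f) (γ.map k)) ≫ t Y L = t X K ≫ δ.map (f ⊙ᵣₘ k)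
  isIso_t {X : N} {K : V} : NQ X → VQ K → IsIso (t X K)

variable {WV : MorphismProperty V} [IsHomotopical WV] {VQ : ObjectProperty V}
  {W : MorphismProperty N} [IsHomotopical W] {NQ : ObjectProperty N}

lemma IsHomotopicalAction.exists_derivedAct (h : IsHomotopicalAction WV VQ W NQ)
    (γ : V ⥤ H) (δ : N ⥤ 𝒩) [γ.IsLocalization WV] [δ.IsLocalization W] :
    Nonempty (DerivedAct γ δ VQ NQ) := by
  have : IsHomotopical (W.prod WV) := {
    id_mem := fun X => ⟨W.id_mem _, WV.id_mem _⟩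
    two_out_of_six := fun f g h hfg hgh =>
      ⟨⟨(IsHomotopical.two_out_of_six f.1 g.1 h.1 hfg.1 hgh.1).1,
        (IsHomotopical.two_out_of_six f.2 g.2 h.2 hfg.2 hgh.2).1⟩,
       ⟨(IsHomotopical.two_out_of_six f.1 g.1 h.1 hfg.1 hgh.1).2.1,
        (IsHomotopical.two_out_of_six f.2 g.2 h.2 hfg.2 hgh.2).2.1⟩,
       ⟨(IsHomotopical.two_out_of_six f.1 g.1 h.1 hfg.1 hgh.1).2.2.1,
        (IsHomotopical.two_out_of_six f.2 g.2 h.2 hfg.2 hgh.2).2.2.1⟩,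
       ⟨(IsHomotopical.two_out_of_six f.1 g.1 h.1 hfg.1 hgh.1).2.2.2,
        (IsHomotopical.two_out_of_six f.2 g.2 h.2 hfg.2 hgh.2).2.2.2⟩⟩ }
  let T : N × V ⥤ N :=
    { obj := fun X => X.1 ⊙ᵣ X.2
      map := fun f => f.1 ⊙ᵣₘ f.2
      map_id := fun X => by simp [actionHom_def]
      map_comp := fun f g => by simp }
  obtain ⟨Φ, α, hα⟩ := exists_leftDerived (h.left₂.prod h.left₁) (δ.prod γ) (T ⋙ δ)
    (fun f hX hY hf => Localization.inverts δ W _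
      (h.weq f.1 f.2 hX.1 hY.1 hX.2 hY.2 hf.1 hf.2))
  exact ⟨{
    Φ := Φ
    t := fun X K => α.app (X, K)
    t_naturality := fun {X Y K L} f k => α.naturality (Prod.mkHom f k : (X, K) ⟶ (Y, L))
    isIso_t := fun hX hK => hα _ ⟨hX, hK⟩ }⟩

namespace DerivedAct

variable {γ : V ⥤ H} {δ : N ⥤ 𝒩} (T : DerivedAct γ δ VQ NQ)

/-- The value of a derived action on objects. -/
def o (A : 𝒩) (K : H) : 𝒩 := T.Φ.obj (A, K)

/-- The value of a derived action on morphisms. -/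
def h {A B : 𝒩} {K L : H} (f : A ⟶ B) (k : K ⟶ L) : T.o A K ⟶ T.o B L := T.Φ.map (Prod.mkHom f k)

/-- The comparison of a derived action with the action. -/
def τ (X : N) (K : V) : T.o (δ.obj X) (γ.obj K) ⟶ δ.obj (X ⊙ᵣ K) := T.t X K

lemma h_id (A : 𝒩) (K : H) : T.h (𝟙 A) (𝟙 K) = 𝟙 _ := T.Φ.map_id (A, K)

lemma h_comp {A B C : 𝒩} {K L M : H} (f : A ⟶ B) (g : B ⟶ C) (k : K ⟶ L) (l : L ⟶ M) :
    T.h f k ≫ T.h g l = T.h (f ≫ g) (k ≫ l) := (T.Φ.map_comp (Prod.mkHom f k) (Prod.mkHom g l)).symm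

instance {A B : 𝒩} {K L : H} (f : A ⟶ B) (k : K ⟶ L) [IsIso f] [IsIso k] : IsIso (T.h f k) :=
  ⟨T.h (inv f) (inv k), by simp [h_comp, h_id], by simp [h_comp, h_id]⟩

lemma τ_naturality {X Y : N} {K L : V} (f : X ⟶ Y) (k : K ⟶ L) :
    T.h (δ.map f) (γ.map k) ≫ T.τ Y L = T.τ X K ≫ δ.map (f ⊙ᵣₘ k) := T.t_naturality f k

lemma τ_naturality_left {X Y : N} {K : V} (f : X ⟶ Y) :
    T.h (δ.map f) (𝟙 _) ≫ T.τ Y K = T.τ X K ≫ δ.map (f ⊵ᵣ K) := by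
  have := T.τ_naturality f (𝟙 K)
  rwa [γ.map_id, actionHom_def, actionHomRight_id, Category.comp_id] at this

lemma τ_naturality_right {X : N} {K L : V} (k : K ⟶ L) :
    T.h (𝟙 _) (γ.map k) ≫ T.τ X L = T.τ X K ≫ δ.map (X ⊴ᵣ k) := by
  have := T.τ_naturality (𝟙 X) k
  rwa [δ.map_id, actionHom_def, id_actionHomLeft, Category.id_comp] at this

lemma isIso_τ {X : N} {K : V} (hX : NQ X) (hK : VQ K) : IsIso (T.τ X K) := T.isIso_t hX hK

section Tensor

variable (S : DerivedAct γ γ VQ VQ)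

/-- The comparison of a derived tensor product with the tensor product. -/
def μ (K L : V) : S.o (γ.obj K) (γ.obj L) ⟶ γ.obj (K ⊗ L) := S.τ K L

lemma μ_naturality {K K' L L' : V} (k : K ⟶ K') (l : L ⟶ L') :
    S.h (γ.map k) (γ.map l) ≫ S.μ K' L' = S.μ K L ≫ γ.map (k ⊗ₘ l) := S.τ_naturality k l

lemma μ_naturality_left {K K' L : V} (k : K ⟶ K') :
    S.h (γ.map k) (𝟙 _) ≫ S.μ K' L = S.μ K L ≫ γ.map (k ▷ L) := S.τ_naturality_left k

lemma μ_naturality_right {K L L' : V} (l : L ⟶ L') :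
    S.h (𝟙 _) (γ.map l) ≫ S.μ K L' = S.μ K L ≫ γ.map (K ◁ l) := S.τ_naturality_right l

lemma isIso_μ {K L : V} (hK : VQ K) (hL : VQ L) : IsIso (S.μ K L) := S.isIso_t hK hL

end Tensor

end DerivedAct

variable {γ : V ⥤ H} {δ : N ⥤ 𝒩}

/-- The associativity of a derived action. -/
structure DerivedAssoc (S : DerivedAct γ γ VQ VQ) (T : DerivedAct γ δ VQ NQ) where
  a (A : 𝒩) (K L : H) : T.o A (S.o K L) ≅ T.o (T.o A K) L
  naturality {A A' : 𝒩} {K K' L L' : H} (f : A ⟶ A') (k : K ⟶ K') (l : L ⟶ L') :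
    T.h f (S.h k l) ≫ (a A' K' L').hom = (a A K L).hom ≫ T.h (T.h f k) l
  fac (X : N) (K L : V) :
    (a (δ.obj X) (γ.obj K) (γ.obj L)).hom ≫ T.h (T.τ X K) (𝟙 _) ≫ T.τ (X ⊙ᵣ K) L =
      T.h (𝟙 _) (S.μ K L) ≫ T.τ X (K ⊗ L) ≫ δ.map (αᵣ X K L).hom

lemma DerivedAssoc.tensor_fac {S : DerivedAct γ γ VQ VQ} (s : DerivedAssoc S S) (J K L : V) :
    (s.a (γ.obj J) (γ.obj K) (γ.obj L)).hom ≫ S.h (S.μ J K) (𝟙 _) ≫ S.μ (J ⊗ K) L =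
      S.h (𝟙 _) (S.μ K L) ≫ S.μ J (K ⊗ L) ≫ γ.map (α_ J K L).inv :=
  s.fac J K L

lemma IsHomotopicalAction.exists_assoc (hV : IsHomotopicalAction WV VQ WV VQ)
    (h : IsHomotopicalAction WV VQ W NQ) [γ.IsLocalization WV] [δ.IsLocalization W]
    (S : DerivedAct γ γ VQ VQ) (T : DerivedAct γ δ VQ NQ) : Nonempty (DerivedAssoc S T) := by
  let F₁ : 𝒩 × (H × H) ⥤ 𝒩 := 
    { obj := fun X => T.o X.1 (S.o X.2.1 X.2.2)
      map := fun f => T.h f.1 (S.h f.2.1 f.2.2)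
      map_id := fun X => by simp [DerivedAct.h_id]
      map_comp := fun f g => by simp [DerivedAct.h_comp] }
  let F₂ : 𝒩 × (H × H) ⥤ 𝒩 := 
    { obj := fun X => T.o (T.o X.1 X.2.1) X.2.2
      map := fun f => T.h (T.h f.1 f.2.1) f.2.2
      map_id := fun X => by simp [DerivedAct.h_id]
      map_comp := fun f g => by simp [DerivedAct.h_comp] }
  let G₁ : N × (V × V) ⥤ 𝒩 := 
    { obj := fun X => δ.obj (X.1 ⊙ᵣ (X.2.1 ⊗ X.2.2))
      map := fun f => δ.map (f.1 ⊙ᵣₘ (f.2.1 ⊗ₘ f.2.2))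
      map_id := fun X => by simp [actionHom_def]
      map_comp := fun f g => by simp [← Functor.map_comp, ← actionHom_comp] }
  let G₂ : N × (V × V) ⥤ 𝒩 := 
    { obj := fun X => δ.obj ((X.1 ⊙ᵣ X.2.1) ⊙ᵣ X.2.2)
      map := fun f => δ.map ((f.1 ⊙ᵣₘ f.2.1) ⊙ᵣₘ f.2.2)
      map_id := fun X => by simp [actionHom_def]
      map_comp := fun f g => by simp [← Functor.map_comp, ← actionHom_comp] }
  let α₁ : δ.prod (γ.prod γ) ⋙ F₁ ⟶ G₁ := 
    { app := fun X => T.h (𝟙 (δ.obj X.1)) (S.μ X.2.1 X.2.2) ≫ T.τ X.1 (X.2.1 ⊗ X.2.2)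
      naturality := fun X Y f => by
        change T.h (δ.map f.1) (S.h (γ.map f.2.1) (γ.map f.2.2)) ≫ _ ≫ _ =
          (_ ≫ _) ≫ δ.map (f.1 ⊙ᵣₘ (f.2.1 ⊗ₘ f.2.2))
        rw [reassoc_of% T.h_comp, S.μ_naturality, Category.assoc, ← T.τ_naturality, reassoc_of% T.h_comp,
          Category.comp_id]
        erw [Category.id_comp] }
  let α₂ : δ.prod (γ.prod γ) ⋙ F₂ ⟶ G₂ := 
    { app := fun X => T.h (T.τ X.1 X.2.1) (𝟙 (γ.obj X.2.2)) ≫ T.τ (X.1 ⊙ᵣ X.2.1) X.2.2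
      naturality := fun X Y f => by
        change T.h (T.h (δ.map f.1) (γ.map f.2.1)) (γ.map f.2.2) ≫ _ ≫ _ =
          (_ ≫ _) ≫ δ.map ((f.1 ⊙ᵣₘ f.2.1) ⊙ᵣₘ f.2.2)
        rw [Category.assoc, ← T.τ_naturality, reassoc_of% T.h_comp, reassoc_of% T.h_comp, T.τ_naturality]
        erw [Category.comp_id, Category.id_comp] }
  obtain ⟨θ, hθ⟩ := exists_iso_of_leftDerived (h.left₂.prod (h.left₁.prod h.left₁)) α₁ α₂
    (NatIso.ofComponents (fun X => δ.mapIso (αᵣ X.1 X.2.1 X.2.2)) (fun {X Y} f => by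
      change δ.map _ ≫ δ.map _ = δ.map _ ≫ δ.map _
      rw [← δ.map_comp, ← δ.map_comp, actionAssocIso_hom_naturality]))
    (fun X hX => by
      have := S.isIso_μ hX.2.1 hX.2.2
      have := T.isIso_τ hX.1 (hV.mem hX.2.1 hX.2.2)
      exact inferInstanceAs (IsIso (T.h (𝟙 (δ.obj X.1)) (S.μ X.2.1 X.2.2) ≫ T.τ X.1 (X.2.1 ⊗ X.2.2))))
    (fun X hX => by
      have := T.isIso_τ hX.1 hX.2.1
      have := T.isIso_τ (h.mem hX.1 hX.2.1) hX.2.2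
      exact inferInstanceAs (IsIso (T.h (T.τ X.1 X.2.1) (𝟙 (γ.obj X.2.2)) ≫ T.τ (X.1 ⊙ᵣ X.2.1) X.2.2)))
  exact ⟨{
    a := fun A K L => θ.app (A, (K, L))
    naturality := fun {A A' K K' L L'} f k l =>
      θ.hom.naturality (Prod.mkHom f (Prod.mkHom k l) : (A, (K, L)) ⟶ (A', (K', L')))
    fac := fun X K L => (hθ (X, (K, L))).trans (Category.assoc _ _ _) }⟩

/-- The unitality of a derived action. -/
structure DerivedUnit (T : DerivedAct γ δ VQ NQ) where
  u (A : 𝒩) : T.o A (γ.obj (𝟙_ V)) ≅ A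
  naturality {A A' : 𝒩} (f : A ⟶ A') : T.h f (𝟙 _) ≫ (u A').hom = (u A).hom ≫ f
  fac (X : N) : (u (δ.obj X)).hom = T.τ X (𝟙_ V) ≫ δ.map (ρᵣ X).hom

lemma IsHomotopicalAction.exists_unit
    (h : IsHomotopicalAction WV VQ W NQ) [γ.IsLocalization WV] [δ.IsLocalization W]
    (T : DerivedAct γ δ VQ NQ) : Nonempty (DerivedUnit T) := by
  obtain ⟨q⟩ := h.left₁
  have : IsIso (γ.map (q.π (𝟙_ V))) := Localization.inverts γ WV _ (q.weq _)
  let F₁ : 𝒩 ⥤ 𝒩 := 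
    { obj := fun X => T.o X (γ.obj (𝟙_ V))
      map := fun f => T.h f (𝟙 _)
      map_id := fun X => by simp [DerivedAct.h_id]
      map_comp := fun f g => by simp [DerivedAct.h_comp] }
  let α₁ : δ ⋙ F₁ ⟶ δ := 
    { app := fun X => T.τ X (𝟙_ V) ≫ δ.map (ρᵣ X).hom
      naturality := fun X Y f => by
        change T.h (δ.map f) (𝟙 _) ≫ _ ≫ _ = _
        rw [reassoc_of% T.τ_naturality_left, ← δ.map_comp, ← actionUnitIso_hom_naturality, δ.map_comp,
          Category.assoc] }
  obtain ⟨θ, hθ⟩ := exists_iso_of_leftDerived (L := δ) (F₁ := F₁) (F₂ := 𝟭 𝒩) h.left₂ α₁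
    (Functor.rightUnitor δ).hom (Iso.refl _)
    (fun X hX => by
      have := T.isIso_τ hX (q.mem (𝟙_ V))
      have h1 : IsIso (δ.map (X ⊴ᵣ q.π (𝟙_ V) ≫ (ρᵣ X).hom)) :=
        Localization.inverts δ W _ (h.unit q X hX)
      have h2 : T.h (𝟙 (δ.obj X)) (γ.map (q.π (𝟙_ V))) ≫ α₁.app X =
          T.τ X _ ≫ δ.map (X ⊴ᵣ q.π (𝟙_ V) ≫ (ρᵣ X).hom) := by
        change _ ≫ _ ≫ _ = _
        rw [reassoc_of% T.τ_naturality_right, δ.map_comp]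
      have h3 : IsIso (T.h (𝟙 (δ.obj X)) (γ.map (q.π (𝟙_ V))) ≫ α₁.app X) := by
        rw [h2]
        infer_instance
      exact IsIso.of_isIso_comp_left (T.h (𝟙 (δ.obj X)) (γ.map (q.π (𝟙_ V)))) (α₁.app X))
    (fun X hX => by
      change IsIso (𝟙 _)
      infer_instance)
  refine ⟨{
    u := fun A => θ.app A
    naturality := fun f => θ.hom.naturality f
    fac := fun X => ?_ }⟩
  have := hθ X
  exact (Category.comp_id _).symm.trans (this.trans (Category.comp_id _))

section Coherence

variable [γ.IsLocalization WV] [δ.IsLocalization W] {S : DerivedAct γ γ VQ VQ}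
  {T : DerivedAct γ δ VQ NQ}
  (hV : IsHomotopicalAction WV VQ WV VQ) (h : IsHomotopicalAction WV VQ W NQ)
  (s : DerivedAssoc S S) (t : DerivedAssoc S T)

include hV h in
lemma DerivedAssoc.pentagon (A : 𝒩) (K L M : H) :
    (t.a A K (S.o L M)).hom ≫ (t.a (T.o A K) L M).hom =
      T.h (𝟙 A) (s.a K L M).hom ≫ (t.a A (S.o K L) M).hom ≫ T.h (t.a A K L).hom (𝟙 M) := by
  obtain ⟨x, hx, ⟨e⟩⟩ := exists_mem_iso_of_localization h.left₂ δ A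
  obtain ⟨k, hk, ⟨e₁⟩⟩ := exists_mem_iso_of_localization h.left₁ γ K
  obtain ⟨l, hl, ⟨e₂⟩⟩ := exists_mem_iso_of_localization h.left₁ γ L
  obtain ⟨m, hm, ⟨e₃⟩⟩ := exists_mem_iso_of_localization h.left₁ γ M
  have key : (t.a (δ.obj x) (γ.obj k) (S.o (γ.obj l) (γ.obj m))).hom ≫
      (t.a (T.o (δ.obj x) (γ.obj k)) (γ.obj l) (γ.obj m)).hom =
      T.h (𝟙 _) (s.a (γ.obj k) (γ.obj l) (γ.obj m)).hom ≫
        (t.a (δ.obj x) (S.o (γ.obj k) (γ.obj l)) (γ.obj m)).hom ≫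
          T.h (t.a (δ.obj x) (γ.obj k) (γ.obj l)).hom (𝟙 _) := by
    have := T.isIso_τ hx hk
    have := T.isIso_τ (h.mem hx hk) hl
    have := T.isIso_τ (h.mem (h.mem hx hk) hl) hm
    rw [← cancel_mono (T.h (T.h (T.τ x k) (𝟙 (γ.obj l))) (𝟙 (γ.obj m)) ≫
      T.h (T.τ (x ⊙ᵣ k) l) (𝟙 (γ.obj m)) ≫ T.τ ((x ⊙ᵣ k) ⊙ᵣ l) m)]
    simp only [Category.assoc]
    rw [← reassoc_of% t.naturality, S.h_id, t.fac, reassoc_of% T.h_comp, reassoc_of% T.h_comp, Category.comp_id,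
      Category.id_comp]
    have e1 : T.h (T.τ x k) (S.μ l m) = T.h (𝟙 _) (S.μ l m) ≫ T.h (T.τ x k) (𝟙 _) := by
      rw [T.h_comp, Category.id_comp, Category.comp_id]
    have e2 : T.h (𝟙 (T.o (δ.obj x) (γ.obj k))) (S.μ l m) =
        T.h (T.h (𝟙 (δ.obj x)) (𝟙 (γ.obj k))) (S.μ l m) := by rw [T.h_id]
    have e3 : T.h ((t.a (δ.obj x) (γ.obj k) (γ.obj l)).hom ≫ T.h (T.τ x k) (𝟙 (γ.obj l)))
        (𝟙 (γ.obj m)) ≫ T.h (T.τ (x ⊙ᵣ k) l) (𝟙 (γ.obj m)) =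
        T.h (T.h (𝟙 (δ.obj x)) (S.μ k l)) (𝟙 _) ≫ T.h (T.τ x (k ⊗ l)) (𝟙 _) ≫
          T.h (δ.map (αᵣ x k l).hom) (𝟙 _) := by
      rw [T.h_comp, T.h_comp, T.h_comp, Category.assoc, t.fac]
      simp only [Category.comp_id]
    have e4 : T.h (𝟙 _) (s.a (γ.obj k) (γ.obj l) (γ.obj m)).hom ≫
        T.h (𝟙 (δ.obj x)) (S.h (S.μ k l) (𝟙 _)) ≫ T.h (𝟙 _) (S.μ (k ⊗ l) m) =
        T.h (𝟙 (δ.obj x)) (S.h (𝟙 _) (S.μ l m)) ≫ T.h (𝟙 _) (S.μ k (l ⊗ m)) ≫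
          T.h (𝟙 _) (γ.map (α_ k l m).inv) := by
      rw [T.h_comp, T.h_comp, T.h_comp, T.h_comp, s.tensor_fac]
    have e5 : x ⊴ᵣ (α_ k l m).inv ≫ (αᵣ x (k ⊗ l) m).hom ≫ (αᵣ x k l).hom ⊵ᵣ m =
        (αᵣ x k (l ⊗ m)).hom ≫ (αᵣ (x ⊙ᵣ k) l m).hom := by
      rw [← actionHom_associator, ← actionHomRight_comp_assoc, Iso.inv_hom_id, actionHomRight_id,
        Category.id_comp]
    rw [e1, e2, Category.assoc, ← reassoc_of% t.naturality, reassoc_of% t.fac, Category.comp_id, reassoc_of% e3,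
      ← reassoc_of% t.naturality, T.τ_naturality_left, reassoc_of% t.fac, reassoc_of% e4,
      reassoc_of% T.τ_naturality_right, ← δ.map_comp, ← δ.map_comp, ← δ.map_comp, e5]
  rw [← cancel_epi (T.h e.hom (S.h e₁.hom (S.h e₂.hom e₃.hom)))]
  rw [reassoc_of% t.naturality, t.naturality, reassoc_of% key, reassoc_of% T.h_comp, Category.comp_id, s.naturality]
  have e6 : T.h ((t.a (δ.obj x) (γ.obj k) (γ.obj l)).hom ≫ T.h (T.h e.hom e₁.hom) e₂.hom)
      (𝟙 (γ.obj m) ≫ e₃.hom) = T.h (T.h e.hom (S.h e₁.hom e₂.hom)) e₃.hom ≫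
        T.h (t.a A K L).hom (𝟙 M) := by
    rw [T.h_comp, t.naturality, Category.id_comp, Category.comp_id]
  rw [T.h_comp, e6, ← reassoc_of% t.naturality, reassoc_of% T.h_comp, Category.id_comp]

end Coherence

end DerivedActions

end

section

open MonoidalRightAction

section DerivedCoherence

variable {V H N 𝒩 : Type*} [Category* V] [Category* H] [Category* N] [Category* 𝒩]
  [MonoidalCategory V] [SymmetricCategory V] [MonoidalRightAction V N]
  {WV : MorphismProperty V} [IsHomotopical WV] {VQ : ObjectProperty V}
  {W : MorphismProperty N} [IsHomotopical W] {NQ : ObjectProperty N}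
  {γ : V ⥤ H} {δ : N ⥤ 𝒩} [γ.IsLocalization WV] [δ.IsLocalization W]

/-- The symmetry of a derived tensor product. -/
structure DerivedBraiding (S : DerivedAct γ γ VQ VQ) where
  b (K L : H) : S.o K L ≅ S.o L K
  naturality {K K' L L' : H} (k : K ⟶ K') (l : L ⟶ L') :
    S.h k l ≫ (b K' L').hom = (b K L).hom ≫ S.h l k
  fac (K L : V) : (b (γ.obj K) (γ.obj L)).hom ≫ S.μ L K = S.μ K L ≫ γ.map (β_ K L).hom

lemma IsHomotopicalAction.exists_braiding (h : IsHomotopicalAction WV VQ WV VQ)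
    (S : DerivedAct γ γ VQ VQ) : Nonempty (DerivedBraiding S) := by
  let F₂ : H × H ⥤ H :=
    { obj := fun X => S.o X.2 X.1
      map := fun f => S.h f.2 f.1
      map_id := fun X => by simp [DerivedAct.h_id]
      map_comp := fun f g => by simp [DerivedAct.h_comp] }
  let G₁ : V × V ⥤ H :=
    { obj := fun X => γ.obj (X.1 ⊗ X.2)
      map := fun f => γ.map (f.1 ⊗ₘ f.2)
      map_id := fun X => by simp
      map_comp := fun f g => by simp [← Functor.map_comp] }
  let G₂ : V × V ⥤ H :=
    { obj := fun X => γ.obj (X.2 ⊗ X.1)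
      map := fun f => γ.map (f.2 ⊗ₘ f.1)
      map_id := fun X => by simp
      map_comp := fun f g => by simp [← Functor.map_comp] }
  let α₁ : γ.prod γ ⋙ S.Φ ⟶ G₁ :=
    { app := fun X => S.μ X.1 X.2
      naturality := fun X Y f => S.μ_naturality f.1 f.2 }
  let α₂ : γ.prod γ ⋙ F₂ ⟶ G₂ :=
    { app := fun X => S.μ X.2 X.1
      naturality := fun X Y f => S.μ_naturality f.2 f.1 }
  obtain ⟨θ, hθ⟩ := exists_iso_of_leftDerived (h.left₁.prod h.left₁) α₁ α₂
    (NatIso.ofComponents (fun X => γ.mapIso (β_ X.1 X.2)) (fun {X Y} f => by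
      change γ.map _ ≫ γ.map _ = γ.map _ ≫ γ.map _
      rw [← γ.map_comp, ← γ.map_comp, BraidedCategory.braiding_naturality]))
    (fun X hX => S.isIso_μ hX.1 hX.2) (fun X hX => S.isIso_μ hX.2 hX.1)
  exact ⟨{
    b := fun K L => θ.app (K, L)
    naturality := fun {K K' L L'} k l =>
      θ.hom.naturality (Prod.mkHom k l : (K, L) ⟶ (K', L'))
    fac := fun K L => hθ (K, L) }⟩

section

variable {S : DerivedAct γ γ VQ VQ} {T : DerivedAct γ δ VQ NQ}
  (h : IsHomotopicalAction WV VQ W NQ) (t : DerivedAssoc S T) (s : DerivedAssoc S S)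
  (u : DerivedUnit T) (w : DerivedUnit S) (b : DerivedBraiding S)

include h in
lemma DerivedAssoc.rightUnit (A : 𝒩) (K : H) :
    (t.a A K (γ.obj (𝟙_ V))).hom ≫ (u.u (T.o A K)).hom = T.h (𝟙 A) (w.u K).hom := by
  obtain ⟨x, hx, ⟨e⟩⟩ := exists_mem_iso_of_localization h.left₂ δ A
  obtain ⟨k, hk, ⟨e₁⟩⟩ := exists_mem_iso_of_localization h.left₁ γ K
  have key : (t.a (δ.obj x) (γ.obj k) (γ.obj (𝟙_ V))).hom ≫ (u.u (T.o (δ.obj x) (γ.obj k))).hom =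
      T.h (𝟙 _) (w.u (γ.obj k)).hom := by
    have := T.isIso_τ hx hk
    have e2 : (w.u (γ.obj k)).hom = S.μ k (𝟙_ V) ≫ γ.map (ρ_ k).hom := w.fac k
    rw [← cancel_mono (T.τ x k), Category.assoc, ← u.naturality, u.fac, reassoc_of% t.fac, e2,
      ← δ.map_comp, ← actionHom_rightUnitor, ← T.τ_naturality_right, reassoc_of% T.h_comp,
      Category.id_comp]
  rw [← cancel_epi (T.h e.hom (S.h e₁.hom (𝟙 _))), reassoc_of% t.naturality, u.naturality,
    reassoc_of% key, T.h_comp, T.h_comp, w.naturality, Category.id_comp, Category.comp_id]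

/-- The left unitor of a derived tensor product. -/
def DerivedBraiding.l (K : H) : S.o (γ.obj (𝟙_ V)) K ≅ K := b.b _ _ ≪≫ w.u K

lemma DerivedBraiding.l_naturality {K K' : H} (k : K ⟶ K') :
    S.h (𝟙 _) k ≫ (b.l w K').hom = (b.l w K).hom ≫ k := by
  rw [l, l, Iso.trans_hom, Iso.trans_hom, reassoc_of% b.naturality, w.naturality, Category.assoc]

lemma DerivedBraiding.l_fac (K : V) :
    (b.l w (γ.obj K)).hom = S.μ (𝟙_ V) K ≫ γ.map (λ_ K).hom := by
  have e : (w.u (γ.obj K)).hom = S.μ K (𝟙_ V) ≫ γ.map (ρ_ K).hom := w.fac K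
  rw [l, Iso.trans_hom, e, reassoc_of% b.fac, ← γ.map_comp, braiding_rightUnitor]

include h in
lemma DerivedAssoc.triangle (A : 𝒩) (K : H) :
    (t.a A (γ.obj (𝟙_ V)) K).hom ≫ T.h (u.u A).hom (𝟙 K) = T.h (𝟙 A) (b.l w K).hom := by
  obtain ⟨x, hx, ⟨e⟩⟩ := exists_mem_iso_of_localization h.left₂ δ A
  obtain ⟨k, hk, ⟨e₁⟩⟩ := exists_mem_iso_of_localization h.left₁ γ K
  have key : (t.a (δ.obj x) (γ.obj (𝟙_ V)) (γ.obj k)).hom ≫ T.h (u.u (δ.obj x)).hom (𝟙 _) =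
      T.h (𝟙 _) (b.l w (γ.obj k)).hom := by
    have := T.isIso_τ hx hk
    have e2 : T.h (u.u (δ.obj x)).hom (𝟙 (γ.obj k)) = T.h (T.τ x (𝟙_ V)) (𝟙 _) ≫
        T.h (δ.map (ρᵣ x).hom) (𝟙 _) := by rw [T.h_comp, u.fac, Category.comp_id]
    rw [← cancel_mono (T.τ x k), Category.assoc, e2, Category.assoc, T.τ_naturality_left,
      reassoc_of% t.fac, b.l_fac, ← δ.map_comp, ← actionHom_leftUnitor, ← T.τ_naturality_right,
      reassoc_of% T.h_comp, Category.id_comp]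
  rw [← cancel_epi (T.h e.hom (S.h (𝟙 _) e₁.hom)), reassoc_of% t.naturality, T.h_comp, u.naturality,
    Category.comp_id, ← Category.id_comp e₁.hom, ← T.h_comp, reassoc_of% key, T.h_comp, T.h_comp,
    b.l_naturality, Category.id_comp, Category.id_comp, Category.comp_id]

lemma DerivedAssoc.tensor_fac_inv (J K L : V) :
    (s.a (γ.obj J) (γ.obj K) (γ.obj L)).inv ≫ S.h (𝟙 _) (S.μ K L) ≫ S.μ J (K ⊗ L) =
      S.h (S.μ J K) (𝟙 _) ≫ S.μ (J ⊗ K) L ≫ γ.map (α_ J K L).hom := by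
  rw [Iso.inv_comp_eq, reassoc_of% s.tensor_fac, ← γ.map_comp, Iso.inv_hom_id, γ.map_id,
    Category.comp_id]

lemma DerivedAssoc.inv_naturality {J J' K K' L L' : H} (j : J ⟶ J') (k : K ⟶ K') (l : L ⟶ L') :
    S.h (S.h j k) l ≫ (s.a J' K' L').inv = (s.a J K L).inv ≫ S.h j (S.h k l) := by
  rw [Iso.eq_inv_comp, ← reassoc_of% s.naturality, Iso.hom_inv_id, Category.comp_id]

variable (hV : IsHomotopicalAction WV VQ WV VQ)

include hV in
lemma DerivedBraiding.symmetry (K L : H) : (b.b K L).hom ≫ (b.b L K).hom = 𝟙 _ := by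
  obtain ⟨k, hk, ⟨e⟩⟩ := exists_mem_iso_of_localization hV.left₂ γ K
  obtain ⟨l, hl, ⟨e'⟩⟩ := exists_mem_iso_of_localization hV.left₁ γ L
  have key : (b.b (γ.obj k) (γ.obj l)).hom ≫ (b.b (γ.obj l) (γ.obj k)).hom = 𝟙 _ := by
    have := S.isIso_μ hk hl
    rw [← cancel_mono (S.μ k l), Category.assoc, b.fac, reassoc_of% b.fac, ← γ.map_comp,
      SymmetricCategory.symmetry, γ.map_id, Category.comp_id, Category.id_comp]
  rw [← cancel_epi (S.h e.hom e'.hom), reassoc_of% b.naturality, b.naturality, reassoc_of% key,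
    Category.comp_id]

include hV in
lemma DerivedBraiding.hexagon (J K L : H) :
    (s.a J K L).inv ≫ (b.b J (S.o K L)).hom ≫ (s.a K L J).inv =
      S.h (b.b J K).hom (𝟙 L) ≫ (s.a K J L).inv ≫ S.h (𝟙 K) (b.b J L).hom := by
  obtain ⟨x, hx, ⟨e⟩⟩ := exists_mem_iso_of_localization hV.left₂ γ J
  obtain ⟨y, hy, ⟨e'⟩⟩ := exists_mem_iso_of_localization hV.left₁ γ K
  obtain ⟨z, hz, ⟨e''⟩⟩ := exists_mem_iso_of_localization hV.left₁ γ L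
  have key : (s.a (γ.obj x) (γ.obj y) (γ.obj z)).inv ≫
      (b.b (γ.obj x) (S.o (γ.obj y) (γ.obj z))).hom ≫ (s.a (γ.obj y) (γ.obj z) (γ.obj x)).inv =
      S.h (b.b (γ.obj x) (γ.obj y)).hom (𝟙 _) ≫ (s.a (γ.obj y) (γ.obj x) (γ.obj z)).inv ≫
        S.h (𝟙 _) (b.b (γ.obj x) (γ.obj z)).hom := by
    have := S.isIso_μ hz hx
    have := S.isIso_μ hy (hV.mem hz hx)
    have e1 : S.h (𝟙 (γ.obj y)) (b.b (γ.obj x) (γ.obj z)).hom ≫ S.h (𝟙 _) (S.μ z x) =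
        S.h (𝟙 _) (S.μ x z) ≫ S.h (𝟙 _) (γ.map (β_ x z).hom) := by
      rw [S.h_comp, S.h_comp, b.fac]
    have e2 : S.h (b.b (γ.obj x) (γ.obj y)).hom (𝟙 (γ.obj z)) ≫ S.h (S.μ y x) (𝟙 _) =
        S.h (S.μ x y) (𝟙 _) ≫ S.h (γ.map (β_ x y).hom) (𝟙 _) := by
      rw [S.h_comp, S.h_comp, b.fac]
    rw [← cancel_mono (S.h (𝟙 (γ.obj y)) (S.μ z x) ≫ S.μ y (z ⊗ x))]
    simp only [Category.assoc]
    rw [s.tensor_fac_inv, ← reassoc_of% b.naturality, reassoc_of% b.fac, reassoc_of% e1, S.μ_naturality_right,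
      reassoc_of% s.tensor_fac_inv x y z, reassoc_of% s.tensor_fac_inv y x z, reassoc_of% e2,
      reassoc_of% S.μ_naturality_left]
    simp only [← γ.map_comp]
    rw [BraidedCategory.hexagon_forward]
  have e3 : S.h (𝟙 (γ.obj y) ≫ e'.hom) ((b.b (γ.obj x) (γ.obj z)).hom ≫ S.h e''.hom e.hom) =
      S.h e'.hom (S.h e.hom e''.hom) ≫ S.h (𝟙 K) (b.b J L).hom := by
    rw [S.h_comp, b.naturality, Category.id_comp, Category.comp_id]
  have e4 : S.h (S.h e.hom e'.hom) e''.hom ≫ S.h (b.b J K).hom (𝟙 L) =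
      S.h (b.b (γ.obj x) (γ.obj y)).hom (𝟙 _) ≫ S.h (S.h e'.hom e.hom) e''.hom := by
    rw [S.h_comp, S.h_comp, b.naturality, Category.id_comp, Category.comp_id]
  rw [← cancel_epi (S.h (S.h e.hom e'.hom) e''.hom), reassoc_of% s.inv_naturality,
    reassoc_of% b.naturality, s.inv_naturality, reassoc_of% key, S.h_comp, e3, reassoc_of% e4,
    reassoc_of% s.inv_naturality]

end

lemma hexagon_reverse_of_forward {C : Type*} [Category* C] [MonoidalCategory C]
    (b : ∀ X Y : C, X ⊗ Y ≅ Y ⊗ X) (hb : ∀ X Y, (b X Y).hom ≫ (b Y X).hom = 𝟙 _)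
    (h : ∀ X Y Z : C, (α_ X Y Z).hom ≫ (b X (Y ⊗ Z)).hom ≫ (α_ Y Z X).hom =
      ((b X Y).hom ▷ Z) ≫ (α_ Y X Z).hom ≫ (Y ◁ (b X Z).hom)) (X Y Z : C) :
    (α_ X Y Z).inv ≫ (b (X ⊗ Y) Z).hom ≫ (α_ Z X Y).inv =
      (X ◁ (b Y Z).hom) ≫ (α_ X Z Y).inv ≫ ((b X Z).hom ▷ Y) := by
  have hb' : ∀ X Y, (b X Y).hom = (b Y X).inv := fun X Y => by
    rw [← cancel_mono (b Y X).hom, hb, Iso.inv_hom_id]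
  have e : (α_ Z X Y) ≪≫ b Z (X ⊗ Y) ≪≫ α_ X Y Z =
      whiskerRightIso (b Z X) Y ≪≫ α_ X Z Y ≪≫ whiskerLeftIso X (b Z Y) := by
    ext
    exact h Z X Y
  have := congrArg Iso.inv e
  simpa [hb'] using this

theorem IsHomotopicalAction.exists_monoidal (hV : IsHomotopicalAction WV VQ WV VQ) (γ : V ⥤ H)
    [γ.IsLocalization WV] :
    ∃ (_ : MonoidalCategory H) (_ : SymmetricCategory H) (_ : γ.LaxBraided),
      IsIso (Functor.LaxMonoidal.ε γ) ∧
        ∀ K L, VQ K → VQ L → IsIso (Functor.LaxMonoidal.μ γ K L) := by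
  obtain ⟨S⟩ := hV.exists_derivedAct γ γ
  obtain ⟨s⟩ := hV.exists_assoc hV S S
  obtain ⟨w⟩ := hV.exists_unit S
  obtain ⟨b⟩ := hV.exists_braiding S
  let str : MonoidalCategoryStruct H :=
    { tensorObj := S.o
      whiskerLeft := fun K _ _ l => S.h (𝟙 K) l
      whiskerRight := fun k L => S.h k (𝟙 L)
      tensorHom := fun k l => S.h k l
      tensorUnit := γ.obj (𝟙_ V)
      associator := fun J K L => (s.a J K L).symm
      leftUnitor := fun K => b.l w K
      rightUnitor := fun K => w.u K }
  let mon : MonoidalCategory H := MonoidalCategory.ofTensorHom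
    (id_tensorHom_id := fun K L => S.h_id K L)
    (id_tensorHom := fun _ _ _ _ => rfl)
    (tensorHom_id := fun _ _ => rfl)
    (tensorHom_comp_tensorHom := fun _ _ _ _ => S.h_comp _ _ _ _)
    (associator_naturality := fun j k l => s.inv_naturality j k l)
    (leftUnitor_naturality := fun k => b.l_naturality w k)
    (rightUnitor_naturality := fun k => w.naturality k)
    (pentagon := fun J K L M => by
      have e : s.a J K (S.o L M) ≪≫ s.a (S.o J K) L M =
          asIso (S.h (𝟙 J) (s.a K L M).hom) ≪≫ s.a J (S.o K L) M ≪≫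
            asIso (S.h (s.a J K L).hom (𝟙 M)) := Iso.ext (s.pentagon hV hV s J K L M)
      have e' := congrArg Iso.inv e
      have e1 : (asIso (S.h (𝟙 J) (s.a K L M).hom)).inv = S.h (𝟙 J) (s.a K L M).inv := by
        rw [asIso_inv, IsIso.inv_eq_of_hom_inv_id]
        rw [S.h_comp, Iso.hom_inv_id, Category.comp_id, S.h_id]
      have e2 : (asIso (S.h (s.a J K L).hom (𝟙 M))).inv = S.h (s.a J K L).inv (𝟙 M) := by
        rw [asIso_inv, IsIso.inv_eq_of_hom_inv_id]
        rw [S.h_comp, Iso.hom_inv_id, Category.comp_id, S.h_id]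
      rw [Iso.trans_inv, Iso.trans_inv, Iso.trans_inv, e1, e2, Category.assoc] at e'
      exact e'.symm)
    (triangle := fun J K =>
      (Iso.inv_comp_eq _).2 (s.triangle hV w w b J K).symm)
  let sym : SymmetricCategory H :=
    { braiding := b.b
      braiding_naturality_right := fun K _ _ l => b.naturality (𝟙 K) l
      braiding_naturality_left := fun k L => b.naturality k (𝟙 L)
      hexagon_forward := b.hexagon s hV
      hexagon_reverse := hexagon_reverse_of_forward b.b (b.symmetry hV) (b.hexagon s hV)
      symmetry := b.symmetry hV }
  let lax : γ.LaxMonoidal :=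
    { ε := 𝟙 _
      μ := S.μ
      μ_natural_left := fun k L => S.μ_naturality_left k
      μ_natural_right := fun K k => S.μ_naturality_right k
      associativity := fun J K L => (s.tensor_fac_inv J K L).symm
      left_unitality := fun K => by
        rw [MonoidalCategory.id_whiskerRight, Category.id_comp]
        exact b.l_fac w K
      right_unitality := fun K => by
        rw [MonoidalCategory.whiskerLeft_id, Category.id_comp]
        exact w.fac K }
  exact ⟨mon, sym, { toLaxMonoidal := lax, braided := fun K L => by exact (b.fac K L).symm },
    by exact inferInstanceAs (IsIso (𝟙 (γ.obj (𝟙_ V)))), fun K L hK hL => S.isIso_μ hK hL⟩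

end DerivedCoherence

section LaxActions

variable {V H N 𝒩 : Type*} [Category* V] [Category* H] [Category* N] [Category* 𝒩]
  [MonoidalCategory V] [MonoidalRightAction V N] [MonoidalCategory H] [MonoidalRightAction H 𝒩]

open Functor.LaxMonoidal

/-- A lax morphism of actions. -/
structure LaxAction (γ : V ⥤ H) [γ.LaxMonoidal] (δ : N ⥤ 𝒩) where
  t (X : N) (K : V) : δ.obj X ⊙ᵣ γ.obj K ⟶ δ.obj (X ⊙ᵣ K)
  naturality_left {X Y : N} (f : X ⟶ Y) (K : V) :
    δ.map f ⊵ᵣ γ.obj K ≫ t Y K = t X K ≫ δ.map (f ⊵ᵣ K)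
  naturality_right (X : N) {K L : V} (k : K ⟶ L) :
    δ.obj X ⊴ᵣ γ.map k ≫ t X L = t X K ≫ δ.map (X ⊴ᵣ k)
  assoc (X : N) (K L : V) :
    (αᵣ (δ.obj X) (γ.obj K) (γ.obj L)).hom ≫ t X K ⊵ᵣ γ.obj L ≫ t (X ⊙ᵣ K) L =
      δ.obj X ⊴ᵣ μ γ K L ≫ t X (K ⊗ L) ≫ δ.map (αᵣ X K L).hom
  unit (X : N) : δ.obj X ⊴ᵣ ε γ ≫ t X (𝟙_ V) ≫ δ.map (ρᵣ X).hom = (ρᵣ (δ.obj X)).hom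

end LaxActions

section DerivedActionExistence

open Functor.LaxMonoidal

variable {V H N 𝒩 : Type*} [Category* V] [Category* H] [Category* N] [Category* 𝒩]
  [MonoidalCategory V] [SymmetricCategory V] [MonoidalRightAction V N]
  {WV : MorphismProperty V} [IsHomotopical WV] {VQ : ObjectProperty V}
  {W : MorphismProperty N} [IsHomotopical W] {NQ : ObjectProperty N}

theorem IsHomotopicalAction.exists_action (hV : IsHomotopicalAction WV VQ WV VQ)
    (h : IsHomotopicalAction WV VQ W NQ) (γ : V ⥤ H) (δ : N ⥤ 𝒩) [γ.IsLocalization WV]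
    [δ.IsLocalization W] [MonoidalCategory H] [SymmetricCategory H] [γ.LaxBraided] [IsIso (ε γ)]
    (hμ : ∀ K L, VQ K → VQ L → IsIso (μ γ K L)) :
    ∃ (_ : MonoidalRightAction H 𝒩) (t : LaxAction γ δ),
      ∀ X K, NQ X → VQ K → IsIso (t.t X K) := by
  let S : DerivedAct γ γ VQ VQ :=
    { Φ :=
        { obj := fun X => X.1 ⊗ X.2
          map := fun f => f.1 ⊗ₘ f.2
          map_id := fun X => by simp
          map_comp := fun f g => by simp }
      t := μ γ
      t_naturality := fun k l => μ_natural γ k l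
      isIso_t := fun hK hL => hμ _ _ hK hL }
  let s : DerivedAssoc S S :=
    { a := fun J K L => (α_ J K L).symm
      naturality := fun j k l => (associator_inv_naturality j k l)
      fac := fun J K L => by
        have e := associativity γ J K L
        rw [← cancel_mono (γ.map (α_ J K L).inv), Category.assoc, Category.assoc, ← γ.map_comp,
          Iso.hom_inv_id, γ.map_id, Category.comp_id, Category.assoc, Category.assoc,
          ← Iso.inv_comp_eq] at e
        have e1 : S.h (𝟙 (γ.obj J)) (S.μ K L) = γ.obj J ◁ μ γ K L := id_tensorHom _ _
        have e2 : S.h (S.τ J K) (𝟙 (γ.obj L)) = μ γ J K ▷ γ.obj L := tensorHom_id _ _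
        rw [e1, e2]
        exact e }
  let w : DerivedUnit S :=
    { u := fun K => whiskerLeftIso K (asIso (ε γ)).symm ≪≫ ρ_ K
      naturality := fun {K L} k => by
        change (k ⊗ₘ 𝟙 _) ≫ L ◁ inv (ε γ) ≫ (ρ_ _).hom = (K ◁ inv (ε γ) ≫ (ρ_ _).hom) ≫ k
        rw [tensorHom_id, ← whisker_exchange_assoc, Category.assoc, rightUnitor_naturality]
      fac := fun K => by
        change γ.obj K ◁ inv (ε γ) ≫ (ρ_ _).hom = μ γ K (𝟙_ V) ≫ γ.map (ρ_ K).hom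
        rw [right_unitality γ, ← MonoidalCategory.whiskerLeft_comp_assoc, IsIso.inv_hom_id,
          MonoidalCategory.whiskerLeft_id, Category.id_comp] }
  obtain ⟨T⟩ := h.exists_derivedAct γ δ
  obtain ⟨t⟩ := hV.exists_assoc h S T
  obtain ⟨u⟩ := h.exists_unit T
  let b : DerivedBraiding S :=
    { b := fun K L => β_ K L
      naturality := fun k l => BraidedCategory.braiding_naturality k l
      fac := fun K L => (Functor.LaxBraided.braided K L).symm }
  let str : MonoidalRightActionStruct H 𝒩 :=
    { actionObj := T.o
      actionHomRight := fun A _ _ k => T.h (𝟙 A) k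
      actionHomLeft := fun f K => T.h f (𝟙 K)
      actionHom := fun f k => T.h f k
      actionAssocIso := fun A K L => t.a A K L
      actionUnitIso := fun A => asIso (T.h (𝟙 A) (ε γ)) ≪≫ u.u A }
  let act : MonoidalRightAction H 𝒩 :=
    { toMonoidalRightActionStruct := str
      actionHom_def := fun f k => by
        change T.h f k = T.h f (𝟙 _) ≫ T.h (𝟙 _) k
        rw [T.h_comp, Category.id_comp, Category.comp_id]
      actionHomRight_id := fun _ _ => T.h_id _ _
      id_actionHomLeft := fun _ _ => T.h_id _ _
      actionHom_comp := fun _ _ _ _ => (T.h_comp _ _ _ _).symm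
      actionAssocIso_hom_naturality := fun f k l => t.naturality f k l
      actionUnitIso_hom_naturality := fun {A B} f => by
        change (T.h (𝟙 A) (ε γ) ≫ (u.u A).hom) ≫ f = T.h f (𝟙 _) ≫ T.h (𝟙 B) (ε γ) ≫ (u.u B).hom
        rw [Category.assoc, ← u.naturality, reassoc_of% T.h_comp, reassoc_of% T.h_comp, Category.id_comp,
          Category.id_comp, Category.comp_id, Category.comp_id]
      actionHomRight_whiskerRight := fun {K L} k M A => by
        change T.h (𝟙 A) (k ▷ M) = (t.a A K M).hom ≫ T.h (T.h (𝟙 A) k) (𝟙 M) ≫ (t.a A L M).inv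
        rw [← reassoc_of% t.naturality, Iso.hom_inv_id, Category.comp_id]
        exact congrArg (T.h (𝟙 A)) (tensorHom_id k M).symm
      whiskerRight_actionHomLeft := fun K L M k A => by
        change T.h (𝟙 A) (K ◁ k) = (t.a A K L).hom ≫ T.h (𝟙 (T.o A K)) k ≫ (t.a A K M).inv
        rw [← T.h_id, ← reassoc_of% t.naturality, Iso.hom_inv_id, Category.comp_id]
        exact congrArg (T.h (𝟙 A)) (id_tensorHom K k).symm
      actionHom_associator := fun K L M A => by
        change T.h (𝟙 A) (α_ K L M).hom ≫ (t.a A K (L ⊗ M)).hom ≫ (t.a (T.o A K) L M).hom =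
          (t.a A (K ⊗ L) M).hom ≫ T.h (t.a A K L).hom (𝟙 M)
        have := DerivedAssoc.pentagon hV h s t A K L M
        refine (congrArg (_ ≫ ·) this).trans ?_
        have e1 : T.h (𝟙 A) (α_ K L M).hom ≫ T.h (𝟙 A) (s.a K L M).hom = 𝟙 _ :=
          (T.h_comp _ _ _ _).trans ((congrArg₂ T.h (Category.comp_id _)
            (Iso.hom_inv_id (α_ K L M))).trans (T.h_id _ _))
        exact (Category.assoc _ _ _).symm.trans ((congrArg (· ≫ _) e1).trans (Category.id_comp _))
      actionHom_leftUnitor := fun K A => by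
        change T.h (𝟙 A) (λ_ K).hom =
          (t.a A (𝟙_ H) K).hom ≫ T.h (T.h (𝟙 A) (ε γ) ≫ (u.u A).hom) (𝟙 K)
        have e1 : T.h (T.h (𝟙 A) (ε γ) ≫ (u.u A).hom) (𝟙 K) =
            T.h (T.h (𝟙 A) (ε γ)) (𝟙 K) ≫ T.h (u.u A).hom (𝟙 K) := by
          rw [T.h_comp, Category.comp_id]
        have e2 : (S.h (ε γ) (𝟙 K)) ≫ (b.l w K).hom = (λ_ K).hom := by
          change (ε γ ⊗ₘ 𝟙 K) ≫ (β_ _ _).hom ≫ K ◁ inv (ε γ) ≫ (ρ_ K).hom = _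
          rw [BraidedCategory.braiding_naturality_assoc, id_tensorHom,
            ← MonoidalCategory.whiskerLeft_comp_assoc, IsIso.hom_inv_id,
            MonoidalCategory.whiskerLeft_id, Category.id_comp, braiding_rightUnitor]
        rw [e1, ← reassoc_of% t.naturality]
        refine Eq.trans ?_ (congrArg (_ ≫ ·) (DerivedAssoc.triangle h t u w b A K).symm)
        exact (congrArg₂ T.h (Category.comp_id _) e2).symm.trans (T.h_comp _ _ _ _).symm
      actionHom_rightUnitor := fun K A => by
        change T.h (𝟙 A) (ρ_ K).hom =
          (t.a A K (𝟙_ H)).hom ≫ T.h (𝟙 (T.o A K)) (ε γ) ≫ (u.u (T.o A K)).hom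
        have e2 : (S.h (𝟙 K) (ε γ)) ≫ (w.u K).hom = (ρ_ K).hom := by
          change (𝟙 K ⊗ₘ ε γ) ≫ K ◁ inv (ε γ) ≫ (ρ_ K).hom = _
          rw [id_tensorHom, ← MonoidalCategory.whiskerLeft_comp_assoc, IsIso.hom_inv_id,
            MonoidalCategory.whiskerLeft_id, Category.id_comp]
        rw [← T.h_id, ← reassoc_of% t.naturality]
        refine Eq.trans ?_ (congrArg (_ ≫ ·) (DerivedAssoc.rightUnit h t u w A K).symm)
        exact (congrArg₂ T.h (Category.comp_id _) e2).symm.trans (T.h_comp _ _ _ _).symm }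
  exact ⟨act,
    { t := T.τ
      naturality_left := fun f K => T.τ_naturality_left f
      naturality_right := fun X {_ _} k => T.τ_naturality_right k
      assoc := fun X K L => t.fac X K L
      unit := fun X => by
        change T.h (𝟙 _) (ε γ) ≫ T.τ X (𝟙_ V) ≫ δ.map (ρᵣ X).hom =
          T.h (𝟙 _) (ε γ) ≫ (u.u (δ.obj X)).hom
        rw [u.fac] }, fun X K hX hK => T.isIso_τ hX hK⟩

end DerivedActionExistence

end

section

local infixr:70 " ⋆ " => gcomp

section TensorAction

open MonoidalRightAction

variable {V : Type u₁} [Category.{v} V] [MonoidalCategory V] [SymmetricCategory V]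
  [MonoidalClosed V] [HasLimits V] {N : Type u₂} [Category.{v} N] [EnrichedOrdinaryCategory V N]
  [Tensored V N]

lemma tcoev_tmapRight_tmapLeft {K K' : V} (k : K ⟶ K') {X X' Z : N} (f : X ⟶ X')
    (g : tobj V K' X' ⟶ Z) :
    tcoev V K X ≫ eHomWhiskerLeft V X ((tmapRight K f ≫ tmapLeft k X') ≫ g) =
      k ≫ tcoev V K' X' ≫ eHomWhiskerLeft V X' g ≫ eHomWhiskerRight V f Z := by
  rw [Category.assoc, tcoev_tmapRight, tcoev_tmapLeft, Category.assoc, Category.assoc]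

lemma tcoev_tmapRight_tmapLeft' {K K' : V} (k : K ⟶ K') {X X' : N} (f : X ⟶ X') :
    tcoev V K X ≫ eHomWhiskerLeft V X (tmapRight K f ≫ tmapLeft k X') =
      k ≫ tcoev V K' X' ≫ eHomWhiskerRight V f _ := by
  rw [← Category.comp_id (tmapRight K f ≫ tmapLeft k X'), tcoev_tmapRight_tmapLeft,
    eHomWhiskerLeft_id, Category.id_comp]

lemma tcoev_tmapRight' (K : V) {X X' : N} (f : X ⟶ X') :
    tcoev V K X ≫ eHomWhiskerLeft V X (tmapRight K f) = tcoev V K X' ≫ eHomWhiskerRight V f _ :=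
  tdesc_fac _

lemma tcoev_tmapLeft' {K K' : V} (k : K ⟶ K') (X : N) :
    tcoev V K X ≫ eHomWhiskerLeft V X (tmapLeft k X) = k ≫ tcoev V K' X :=
  tdesc_fac _

/-- The isomorphism `(K ⊗ L) ⊙ X ≅ L ⊙ (K ⊙ X)`. -/
def tensorAssoc (X : N) (K L : V) : tobj V (K ⊗ L) X ≅ tobj V L (tobj V K X) where
  hom := tdesc (tcoev V K X ⋆ tcoev V L (tobj V K X))
  inv := tdesc (tlift (tcoev V (K ⊗ L) X))
  hom_inv_id := tobj_hom_ext (by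
    rw [eHomWhiskerLeft_comp, reassoc_of% tdesc_fac, gcomp_whiskerLeft, tdesc_fac,
      tcoev_gcomp_tlift, eHomWhiskerLeft_id, Category.comp_id])
  inv_hom_id := tobj_hom_ext (tensor_hom_ext (by
    change tcoev V K X ⋆ _ = tcoev V K X ⋆ _
    rw [eHomWhiskerLeft_comp, reassoc_of% tdesc_fac, ← gcomp_whiskerLeft, tcoev_gcomp_tlift,
      tdesc_fac, eHomWhiskerLeft_id, Category.comp_id]))

lemma tcoev_tensorAssoc_hom (X : N) (K L : V) :
    tcoev V (K ⊗ L) X ≫ eHomWhiskerLeft V X (tensorAssoc X K L).hom =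
      tcoev V K X ⋆ tcoev V L (tobj V K X) := tdesc_fac _

/-- The isomorphism `E ⊙ X ≅ X`. -/
def tensorUnitIso (X : N) : tobj V (𝟙_ V) X ≅ X where
  hom := tdesc (eId V X)
  inv := (eHomEquiv V).symm (tcoev V (𝟙_ V) X)
  hom_inv_id := tobj_hom_ext (by
    have e : eId V X ≫ eHomWhiskerLeft V X ((eHomEquiv V).symm (tcoev V (𝟙_ V) X)) =
        tcoev V (𝟙_ V) X := by
      rw [← eHomEquiv_id, ← eHomEquiv_comp_left, Category.id_comp, Equiv.apply_symm_apply]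
    rw [eHomWhiskerLeft_comp, reassoc_of% tdesc_fac, e, eHomWhiskerLeft_id, Category.comp_id])
  inv_hom_id := (eHomEquiv V).injective (by
    rw [eHomEquiv_comp_left, Equiv.apply_symm_apply, tdesc_fac, eHomEquiv_id])

lemma tcoev_tensorUnitIso_hom (X : N) :
    tcoev V (𝟙_ V) X ≫ eHomWhiskerLeft V X (tensorUnitIso X).hom = eId V X := tdesc_fac _

/-- The tensors of a tensored `V`-category are a right action of `V`. -/
instance tensorAction : MonoidalRightAction V N where
  actionObj X K := tobj V K X
  actionHomRight X _ _ k := tmapLeft k X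
  actionHomLeft f K := tmapRight K f
  actionHom {K L X Y} f k := tmapRight K f ≫ tmapLeft k Y
  actionAssocIso := tensorAssoc
  actionUnitIso := tensorUnitIso
  actionHom_def _ _ := rfl
  actionHomRight_id K X := tobj_hom_ext (by
    rw [tcoev_tmapLeft', Category.id_comp, eHomWhiskerLeft_id, Category.comp_id])
  id_actionHomLeft K X := tobj_hom_ext (by
    rw [tcoev_tmapRight', eHomWhiskerRight_id, eHomWhiskerLeft_id])
  actionHom_comp f f' k k' := tobj_hom_ext (by
    rw [tcoev_tmapRight_tmapLeft', tcoev_tmapRight_tmapLeft, reassoc_of% tcoev_tmapRight_tmapLeft',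
      eHomWhiskerRight_comp, Category.assoc])
  actionAssocIso_hom_naturality {X Y K K' L L'} f k l := tobj_hom_ext (by
    rw [tcoev_tmapRight_tmapLeft, reassoc_of% tcoev_tensorAssoc_hom, eHomWhiskerLeft_comp,
      reassoc_of% tcoev_tensorAssoc_hom, gcomp_whiskerLeft, tcoev_tmapRight_tmapLeft',
      ← Category.assoc l, ← whiskerLeft_gcomp, tcoev_tmapRight_tmapLeft', gcomp_comp,
      gcomp_whiskerRight])
  actionUnitIso_hom_naturality {X Y} f := tobj_hom_ext (by
    rw [tcoev_tmapRight, tcoev_tensorUnitIso_hom, eHomWhiskerLeft_comp,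
      reassoc_of% tcoev_tensorUnitIso_hom, eId_whisker])
  actionHomRight_whiskerRight {K K'} k L X := by
    change tmapLeft (k ▷ L) X = (tensorAssoc X K L).hom ≫ tmapRight L (tmapLeft k X) ≫
      (tensorAssoc X K' L).inv
    rw [← Category.assoc, Iso.eq_comp_inv]
    apply tobj_hom_ext
    rw [tcoev_tmapLeft, tcoev_tensorAssoc_hom, eHomWhiskerLeft_comp,
      reassoc_of% tcoev_tensorAssoc_hom, gcomp_whiskerLeft, tcoev_tmapRight', ← whiskerLeft_gcomp,
      tcoev_tmapLeft', gcomp_comp_left]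
  whiskerRight_actionHomLeft K {L L'} k X := by
    change tmapLeft (K ◁ k) X = (tensorAssoc X K L).hom ≫ tmapLeft k (tobj V K X) ≫
      (tensorAssoc X K L').inv
    rw [← Category.assoc, Iso.eq_comp_inv]
    apply tobj_hom_ext
    rw [tcoev_tmapLeft, tcoev_tensorAssoc_hom, eHomWhiskerLeft_comp,
      reassoc_of% tcoev_tensorAssoc_hom, gcomp_whiskerLeft, tcoev_tmapLeft', gcomp_comp_right]
  actionHom_associator K L M X := tobj_hom_ext (by
    rw [tcoev_tmapLeft, eHomWhiskerLeft_comp, reassoc_of% tcoev_tensorAssoc_hom, gcomp_whiskerLeft,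
      tcoev_tensorAssoc_hom, eHomWhiskerLeft_comp, reassoc_of% tcoev_tensorAssoc_hom,
      gcomp_whiskerLeft, tcoev_tmapRight', ← whiskerLeft_gcomp, tcoev_tensorAssoc_hom, gcomp_assoc])
  actionHom_leftUnitor K X := tobj_hom_ext (by
    rw [tcoev_tmapLeft', eHomWhiskerLeft_comp, reassoc_of% tcoev_tensorAssoc_hom,
      gcomp_whiskerLeft, tcoev_tmapRight', ← whiskerLeft_gcomp, tcoev_tensorUnitIso_hom, id_gcomp])
  actionHom_rightUnitor K X := tobj_hom_ext (by
    rw [tcoev_tmapLeft', eHomWhiskerLeft_comp, reassoc_of% tcoev_tensorAssoc_hom,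
      gcomp_whiskerLeft, tcoev_tensorUnitIso_hom, gcomp_id])

end TensorAction

section HomotopicalActions

variable {V : Type u₁} [Category.{v} V] [MonoidalCategory V] [SymmetricCategory V]
  [MonoidalClosed V] {WV : MorphismProperty V} {VQ VR : ObjectProperty V}

lemma IsClosedMonoidalDeformationRetract.isHomotopicalAction
    (hV : IsClosedMonoidalDeformationRetract WV VQ VR) : IsHomotopicalAction WV VQ WV VQ where
  left₁ := hV.deform.left₁
  left₂ := hV.deform.left₁
  mem hX hK := hV.tensor_mem _ _ hX hK
  weq {X Y K L} f k hX hY hK hL hf hk := by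
    have := hV.deform.tens (X := (X, K)) (Y := (Y, L)) (Prod.mkHom f k) ⟨hX, hK⟩ ⟨hY, hL⟩ ⟨hf, hk⟩
    change WV (f ⊗ₘ k)
    rw [MonoidalCategory.tensorHom_def]
    exact this
  unit q X hX := hV.tensor_unit q X hX

lemma IsVHomotopical.isHomotopicalAction [HasLimits V] {N : Type u₂} [Category.{v} N]
    [EnrichedOrdinaryCategory V N] [Tensored V N] [Cotensored V N]
    {W : MorphismProperty N} {NQ NR : ObjectProperty N}
    (hN : IsVHomotopical WV VQ W NQ NR) : IsHomotopicalAction WV VQ W NQ where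
  left₁ := hN.deform.left₁
  left₂ := hN.deform.left₂
  mem hX hK := hN.tensor_mem _ _ hK hX
  weq {X Y K L} f k hX hY hK hL hf hk := by
    have := hN.deform.tens (X := (K, X)) (Y := (L, Y)) (Prod.mkHom k f) ⟨hK, hX⟩ ⟨hL, hY⟩ ⟨hk, hf⟩
    have e : tmapRight K f ≫ tmapLeft k Y = tmapLeft k X ≫ tmapRight L f :=
      ((tensorFunctor V N).map k).naturality f
    change W (tmapRight K f ≫ tmapLeft k Y)
    rw [e]
    exact this
  unit q X hX := by
    have e : tmapLeft (q.π (𝟙_ V)) X ≫ (tensorUnitIso X).hom =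
        tdesc (q.π (𝟙_ V) ≫ eId V X) := tobj_hom_ext (by
      rw [tcoev_tmapLeft, tcoev_tensorUnitIso_hom, tdesc_fac])
    change W (tmapLeft (q.π (𝟙_ V)) X ≫ (tensorUnitIso X).hom)
    rw [e]
    exact hN.tensor_unit q X hX

end HomotopicalActions

end

section

local infixr:70 " ⋆ " => gcomp

open MonoidalRightAction

section ClosedActions

variable (H 𝒩 : Type*) [Category* H] [Category* 𝒩] [MonoidalCategory H] [MonoidalRightAction H 𝒩]

variable {𝒩} in
/-- The functor `A ⊙ᵣ -`. -/
def actOn (A : 𝒩) : H ⥤ 𝒩 where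
  obj K := A ⊙ᵣ K
  map k := A ⊴ᵣ k

variable {H} in
/-- The functor `- ⊙ᵣ K`. -/
def actBy (K : H) : 𝒩 ⥤ 𝒩 where
  obj A := A ⊙ᵣ K
  map f := f ⊵ᵣ K

/-- A right action such that all functors `A ⊙ᵣ -` have right adjoints. -/
class HasActionHom where
  R (A : 𝒩) : 𝒩 ⥤ H
  adj (A : 𝒩) : actOn H A ⊣ R A

/-- A right action such that all functors `- ⊙ᵣ K` have right adjoints. -/
class HasActionCotensor where
  R (K : H) : 𝒩 ⥤ 𝒩
  adj (K : H) : actBy 𝒩 K ⊣ R K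

variable {H 𝒩} [HasActionHom H 𝒩]

variable (H) in
/-- The hom-object of a closed action. -/
def rhom (A B : 𝒩) : H := (HasActionHom.R A).obj B

/-- The adjunction defining the hom-objects of a closed action. -/
def rhomEquiv {A B : 𝒩} {K : H} : (A ⊙ᵣ K ⟶ B) ≃ (K ⟶ rhom H A B) :=
  (HasActionHom.adj A).homEquiv K B

variable (H) in
/-- The evaluation of a closed action. -/
def rhomEv (A B : 𝒩) : A ⊙ᵣ rhom H A B ⟶ B := rhomEquiv.symm (𝟙 _)

lemma rhomEquiv_symm_comp {A B : 𝒩} {K L : H} (k : L ⟶ K) (x : K ⟶ rhom H A B) :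
    rhomEquiv.symm (k ≫ x) = A ⊴ᵣ k ≫ rhomEquiv.symm x :=
  (HasActionHom.adj A).homEquiv_naturality_left_symm k x

lemma rhomEquiv_symm_eq {A B : 𝒩} {K : H} (x : K ⟶ rhom H A B) :
    rhomEquiv.symm x = A ⊴ᵣ x ≫ rhomEv H A B := by
  rw [rhomEv, ← rhomEquiv_symm_comp, Category.comp_id]

variable (H) in
/-- The composition of a closed action. -/
def rhomComp (A B C : 𝒩) : rhom H A B ⊗ rhom H B C ⟶ rhom H A C :=
  rhomEquiv ((αᵣ _ _ _).hom ≫ rhomEv H A B ⊵ᵣ _ ≫ rhomEv H B C)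

lemma rhomEquiv_symm_gcomp {A B C : 𝒩} {K L : H} (x : K ⟶ rhom H A B) (y : L ⟶ rhom H B C) :
    rhomEquiv.symm ((x ⊗ₘ y) ≫ rhomComp H A B C) =
      (αᵣ A K L).hom ≫ rhomEquiv.symm x ⊵ᵣ L ≫ rhomEquiv.symm y := by
  have e := actionAssocIso_hom_naturality (𝟙 A) x y
  rw [id_actionHom, id_actionHom, actionHom_def] at e
  rw [rhomEquiv_symm_comp, rhomComp, Equiv.symm_apply_apply, reassoc_of% e, rhomEquiv_symm_eq x,
    rhomEquiv_symm_eq y, comp_actionHomLeft, Category.assoc, action_exchange_assoc]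

instance closedActionEnriched : EnrichedOrdinaryCategory H 𝒩 where
  Hom := rhom H
  id A := rhomEquiv (ρᵣ A).hom
  comp := rhomComp H
  id_comp A B := rhomEquiv.symm.injective (by
    rw [← tensorHom_id, rhomEquiv_symm_comp, rhomEquiv_symm_gcomp, Equiv.symm_apply_apply,
      ← actionHom_leftUnitor_assoc, ← actionHomRight_comp_assoc, Iso.inv_hom_id,
      actionHomRight_id, Category.id_comp])
  comp_id A B := rhomEquiv.symm.injective (by
    rw [← id_tensorHom, rhomEquiv_symm_comp, rhomEquiv_symm_gcomp, Equiv.symm_apply_apply,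
      ← actionUnitIso_hom_naturality,
      ← actionHom_rightUnitor_assoc, ← actionHomRight_comp_assoc, Iso.inv_hom_id,
      actionHomRight_id, Category.id_comp])
  assoc A B C D := rhomEquiv.symm.injective (by
    have e1 := rhomEquiv_symm_gcomp (𝟙 (rhom H A B)) (𝟙 (rhom H B C))
    have e2 := rhomEquiv_symm_gcomp (𝟙 (rhom H B C)) (𝟙 (rhom H C D))
    rw [id_tensorHom_id, Category.id_comp] at e1 e2
    rw [← id_tensorHom, ← tensorHom_id, rhomEquiv_symm_comp, rhomEquiv_symm_gcomp,
      rhomEquiv_symm_gcomp, e1, e2]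
    simp only [comp_actionHomLeft, Category.assoc]
    rw [← actionHom_associator_assoc, ← actionHomRight_comp_assoc, Iso.inv_hom_id,
      actionHomRight_id, Category.id_comp, actionHomLeft_tensor]
    simp only [Category.assoc, Iso.inv_hom_id_assoc])
  homEquiv {A B} := 
    { toFun := fun f => rhomEquiv ((ρᵣ A).hom ≫ f)
      invFun := fun x => (ρᵣ A).inv ≫ rhomEquiv.symm x
      left_inv := fun f => by simp
      right_inv := fun x => by simp }
  homEquiv_id A := by
    change rhomEquiv _ = rhomEquiv _
    rw [Category.comp_id]
  homEquiv_comp {A B C} f g := rhomEquiv.symm.injective (by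
    change rhomEquiv.symm (rhomEquiv ((ρᵣ A).hom ≫ f ≫ g)) = rhomEquiv.symm ((λ_ (𝟙_ H)).inv ≫
      (rhomEquiv ((ρᵣ A).hom ≫ f) ⊗ₘ rhomEquiv ((ρᵣ B).hom ≫ g)) ≫ rhomComp H A B C)
    rw [rhomEquiv_symm_comp, rhomEquiv_symm_gcomp, Equiv.symm_apply_apply, Equiv.symm_apply_apply,
      Equiv.symm_apply_apply, comp_actionHomLeft, Category.assoc, ← actionHom_leftUnitor_assoc,
      ← actionHomRight_comp_assoc, Iso.inv_hom_id, actionHomRight_id, Category.id_comp,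
      ← actionUnitIso_hom_naturality_assoc])

/-- The adjunction defining the hom-objects of a closed action, in terms of the enrichment. -/
def actEquiv {A B : 𝒩} {K : H} : (A ⊙ᵣ K ⟶ B) ≃ (K ⟶ (A ⟶[H] B)) := rhomEquiv

lemma actEquiv_symm_comp {A B : 𝒩} {K L : H} (k : L ⟶ K) (x : K ⟶ (A ⟶[H] B)) :
    actEquiv.symm (k ≫ x) = A ⊴ᵣ k ≫ actEquiv.symm x :=
  rhomEquiv_symm_comp k x

lemma actEquiv_symm_gcomp {A B C : 𝒩} {K L : H} (x : K ⟶ (A ⟶[H] B)) (y : L ⟶ (B ⟶[H] C)) :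
    actEquiv.symm (x ⋆ y) = (αᵣ A K L).hom ≫ actEquiv.symm x ⊵ᵣ L ≫ actEquiv.symm y :=
  rhomEquiv_symm_gcomp x y

lemma actEquiv_symm_eHomEquiv {A B : 𝒩} (f : A ⟶ B) :
    actEquiv.symm (eHomEquiv H f) = (ρᵣ A).hom ≫ f :=
  rhomEquiv.symm_apply_apply _

lemma actEquiv_symm_whiskerLeft {A B C : 𝒩} {K : H} (x : K ⟶ (A ⟶[H] B)) (g : B ⟶ C) :
    actEquiv.symm (x ≫ eHomWhiskerLeft H A g) = actEquiv.symm x ≫ g := by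
  have e := gcomp_eHomEquiv x g
  rw [← Iso.inv_comp_eq] at e
  rw [← e, actEquiv_symm_comp, actEquiv_symm_gcomp, actEquiv_symm_eHomEquiv,
    ← actionUnitIso_hom_naturality_assoc, ← actionHom_rightUnitor_assoc,
    ← actionHomRight_comp_assoc, Iso.inv_hom_id, actionHomRight_id, Category.id_comp]

lemma actEquiv_symm_whiskerRight {A B C : 𝒩} {K : H} (f : A ⟶ B) (x : K ⟶ (B ⟶[H] C)) :
    actEquiv.symm (x ≫ eHomWhiskerRight H f C) = f ⊵ᵣ K ≫ actEquiv.symm x := by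
  have e := eHomEquiv_gcomp f x
  rw [← Iso.inv_comp_eq] at e
  rw [← e, actEquiv_symm_comp, actEquiv_symm_gcomp, actEquiv_symm_eHomEquiv, comp_actionHomLeft,
    Category.assoc, ← actionHom_leftUnitor_assoc,
    ← actionHomRight_comp_assoc, Iso.inv_hom_id, actionHomRight_id, Category.id_comp]

variable [SymmetricCategory H] [MonoidalClosed H]

instance closedActionTensored : Tensored H 𝒩 where
  tensor K A :=
    { obj := A ⊙ᵣ K
      coev := actEquiv (𝟙 _)
      isIso_curry := fun B => by
        have key : ∀ {L : H} (u : L ⟶ ((A ⊙ᵣ K : 𝒩) ⟶[H] B)),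
            actEquiv.symm (K ◁ u ≫ actEquiv (𝟙 (A ⊙ᵣ K)) ▷ _ ≫ eComp H A (A ⊙ᵣ K) B) =
              (αᵣ A K L).hom ≫ actEquiv.symm u := fun {L} u => by
          have e : K ◁ u ≫ actEquiv (𝟙 (A ⊙ᵣ K)) ▷ _ ≫ eComp H A (A ⊙ᵣ K) B =
              actEquiv (𝟙 (A ⊙ᵣ K)) ⋆ u := by
            rw [gcomp, tensorHom_def', Category.assoc]
          rw [e, actEquiv_symm_gcomp, Equiv.symm_apply_apply, id_actionHomLeft, Category.id_comp]
        refine isIso_curry_of_universal _ (fun L u u' hu => ?_) (fun L f => ?_)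
        · have := congrArg actEquiv.symm hu
          rw [key, key, cancel_epi] at this
          exact actEquiv.symm.injective this
        · refine ⟨actEquiv ((αᵣ A K L).inv ≫ actEquiv.symm f), actEquiv.symm.injective ?_⟩
          rw [key, Equiv.symm_apply_apply, Iso.hom_inv_id_assoc] }

lemma tdesc_eq {A B : 𝒩} {K : H} (x : K ⟶ (A ⟶[H] B)) :
    tdesc x = (actEquiv (𝒩 := 𝒩)).symm x := by
  refine tobj_hom_ext ((tdesc_fac x).trans (actEquiv.symm.injective ?_))
  refine Eq.trans ?_ (actEquiv_symm_whiskerLeft (𝒩 := 𝒩)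
    (actEquiv (𝟙 (A ⊙ᵣ K))) (actEquiv.symm x)).symm
  rw [Equiv.symm_apply_apply, Category.id_comp]

variable [HasActionCotensor H 𝒩]

/-- The adjunction defining the cotensors of a closed action. -/
def coactEquiv {A B : 𝒩} {K : H} : (A ⊙ᵣ K ⟶ B) ≃ (A ⟶ (HasActionCotensor.R K).obj B) :=
  (HasActionCotensor.adj K).homEquiv A B

lemma coactEquiv_symm_comp {A A' B : 𝒩} {K : H} (f : A' ⟶ A)
    (g : A ⟶ (HasActionCotensor.R K).obj B) :
    coactEquiv.symm (f ≫ g) = f ⊵ᵣ K ≫ coactEquiv.symm g :=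
  (HasActionCotensor.adj K).homEquiv_naturality_left_symm f g

instance closedActionCotensored : Cotensored H 𝒩 where
  cotensor K A :=
    { obj := (HasActionCotensor.R K).obj A
      ev := actEquiv (coactEquiv.symm (𝟙 _))
      isIso_curry := fun B => by
        have key : ∀ {L : H} (u : L ⟶ (B ⟶[H] (HasActionCotensor.R K).obj A)),
            actEquiv.symm (K ◁ u ≫ (β_ K _).hom ≫ _ ◁ actEquiv (coactEquiv.symm (𝟙 _)) ≫
              eComp H B _ A) = B ⊴ᵣ (β_ K L).hom ≫ (αᵣ B L K).hom ≫
                coactEquiv.symm (actEquiv.symm u) := fun {L} u => by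
          have e : K ◁ u ≫ (β_ K _).hom ≫ _ ◁ actEquiv (coactEquiv.symm (𝟙 _)) ≫
              eComp H B _ A = (β_ K L).hom ≫ (u ⋆ actEquiv (coactEquiv.symm (𝟙 _))) := by
            rw [gcomp, MonoidalCategory.tensorHom_def, Category.assoc,
              BraidedCategory.braiding_naturality_right_assoc]
          rw [e, actEquiv_symm_comp, actEquiv_symm_gcomp, Equiv.symm_apply_apply,
            ← coactEquiv_symm_comp, Category.comp_id]
        refine isIso_curry_of_universal _ (fun L u u' hu => ?_) (fun L f => ?_)
        · have := congrArg actEquiv.symm hu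
          rw [key, key, cancel_epi, cancel_epi] at this
          exact actEquiv.symm.injective (coactEquiv.symm.injective this)
        · refine ⟨actEquiv (coactEquiv ((αᵣ B L K).inv ≫ B ⊴ᵣ (β_ K L).inv ≫ actEquiv.symm f)),
            actEquiv.symm.injective ?_⟩
          rw [key, Equiv.symm_apply_apply, Equiv.symm_apply_apply, Iso.hom_inv_id_assoc,
            actionHomRight_hom_inv_assoc] }

lemma cdesc_eq {A B : 𝒩} {K : H} (x : K ⟶ (A ⟶[H] B)) :
    cdesc x = coactEquiv (actEquiv.symm x) := by
  refine cobj_hom_ext ((cdesc_fac x).trans (actEquiv.symm.injective ?_))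
  refine Eq.trans ?_ (actEquiv_symm_whiskerRight (coactEquiv (actEquiv.symm x))
    (actEquiv (coactEquiv.symm (𝟙 _)))).symm
  rw [Equiv.symm_apply_apply, ← coactEquiv_symm_comp, Category.comp_id, Equiv.symm_apply_apply]

end ClosedActions

end

section

local infixr:70 " ⋆ " => gcomp

open MonoidalRightAction Functor.LaxMonoidal

section TensorDesc

variable {V : Type u₁} [Category.{v} V] [MonoidalCategory V] [SymmetricCategory V]
  [MonoidalClosed V] [HasLimits V] {N : Type u₂} [Category.{v} N] [EnrichedOrdinaryCategory V N]
  [Tensored V N]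

lemma tdesc_comp {K L : V} {X Y : N} (k : L ⟶ K) (x : K ⟶ (X ⟶[V] Y)) :
    tdesc (k ≫ x) = tmapLeft k X ≫ tdesc x := tobj_hom_ext (by
  rw [tdesc_fac, tcoev_tmapLeft, tdesc_fac])

lemma tdesc_eHomEquiv {X Y : N} (f : X ⟶ Y) :
    tdesc (eHomEquiv V f) = (tensorUnitIso X).hom ≫ f := tobj_hom_ext (by
  rw [tdesc_fac, eHomWhiskerLeft_comp, reassoc_of% tcoev_tensorUnitIso_hom, ← eHomEquiv_id,
    ← eHomEquiv_comp_left, Category.id_comp])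

lemma tdesc_gcomp {K L : V} {X Y Z : N} (x : K ⟶ (X ⟶[V] Y)) (y : L ⟶ (Y ⟶[V] Z)) :
    tdesc (x ⋆ y) = (tensorAssoc X K L).hom ≫ tmapRight L (tdesc x) ≫ tdesc y := tobj_hom_ext (by
  rw [tdesc_fac, eHomWhiskerLeft_comp, reassoc_of% tcoev_tensorAssoc_hom, gcomp_whiskerLeft,
    tcoev_tmapRight, tdesc_fac, ← whiskerLeft_gcomp, tdesc_fac])

lemma tdesc_whiskerLeft {K : V} {X Y Z : N} (x : K ⟶ (X ⟶[V] Y)) (g : Y ⟶ Z) :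
    tdesc (x ≫ eHomWhiskerLeft V X g) = tdesc x ≫ g := tobj_hom_ext (by
  rw [tdesc_fac, eHomWhiskerLeft_comp, reassoc_of% tdesc_fac])

lemma tdesc_whiskerRight {K : V} {X Y Z : N} (f : X ⟶ Y) (x : K ⟶ (Y ⟶[V] Z)) :
    tdesc (x ≫ eHomWhiskerRight V f Z) = tmapRight K f ≫ tdesc x := tobj_hom_ext (by
  rw [tdesc_fac, tcoev_tmapRight, tdesc_fac])

lemma tdesc_tcoev (K : V) (X : N) : tdesc (tcoev V K X) = 𝟙 _ := tobj_hom_ext (by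
  rw [tdesc_fac, eHomWhiskerLeft_id, Category.comp_id])

end TensorDesc

section LaxHom

variable {V : Type u₁} [Category.{v} V] [MonoidalCategory V] [SymmetricCategory V]
  [MonoidalClosed V] [HasLimits V] {N : Type u₂} [Category.{v} N] [EnrichedOrdinaryCategory V N]
  [Tensored V N] {H 𝒩 : Type*} [Category* H] [Category* 𝒩] [MonoidalCategory H]
  [MonoidalRightAction H 𝒩] {γ : V ⥤ H} [γ.LaxMonoidal] {δ : N ⥤ 𝒩}
  (t : LaxAction γ δ)

namespace LaxAction

/-- The comparison of tensors given by a lax morphism of actions. -/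
def τ (X : N) (K : V) : δ.obj X ⊙ᵣ γ.obj K ⟶ δ.obj (tobj V K X) := t.t X K

lemma τ_left {X Y : N} (f : X ⟶ Y) (K : V) :
    δ.map f ⊵ᵣ γ.obj K ≫ t.τ Y K = t.τ X K ≫ δ.map (tmapRight K f) := t.naturality_left f K

lemma τ_right (X : N) {K L : V} (k : K ⟶ L) :
    δ.obj X ⊴ᵣ γ.map k ≫ t.τ X L = t.τ X K ≫ δ.map (tmapLeft k X) := t.naturality_right X k

lemma τ_assoc (X : N) (K L : V) :
    (αᵣ (δ.obj X) (γ.obj K) (γ.obj L)).hom ≫ t.τ X K ⊵ᵣ γ.obj L ≫ t.τ (tobj V K X) L =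
      δ.obj X ⊴ᵣ μ γ K L ≫ t.τ X (K ⊗ L) ≫ δ.map (tensorAssoc X K L).hom := t.assoc X K L

lemma τ_unit (X : N) : δ.obj X ⊴ᵣ ε γ ≫ t.τ X (𝟙_ V) ≫ δ.map (tensorUnitIso X).hom =
    (ρᵣ (δ.obj X)).hom := t.unit X

variable [HasActionHom H 𝒩]

/-- The comparison of hom-objects induced by a lax morphism of actions. -/
def r (X Y : N) : γ.obj (X ⟶[V] Y) ⟶ (δ.obj X ⟶[H] δ.obj Y) :=
  actEquiv (t.τ X (X ⟶[V] Y) ≫ δ.map (tdesc (𝟙 _)))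

lemma actEquiv_symm_r {X Y : N} {K : V} (x : K ⟶ (X ⟶[V] Y)) :
    actEquiv.symm (γ.map x ≫ t.r X Y) = t.τ X K ≫ δ.map (tdesc x) := by
  rw [actEquiv_symm_comp, r, Equiv.symm_apply_apply, ← Category.assoc, τ_right, Category.assoc,
    ← δ.map_comp, ← tdesc_comp, Category.comp_id]

lemma actEquiv_symm_r' (X Y : N) :
    actEquiv.symm (t.r X Y) = t.τ X _ ≫ δ.map (tdesc (𝟙 _)) := by
  rw [r, Equiv.symm_apply_apply]

lemma map_hom {X Y : N} (f : X ⟶ Y) :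
    ε γ ≫ γ.map (eHomEquiv V f) ≫ t.r X Y = eHomEquiv H (δ.map f) :=
  actEquiv.symm.injective (by
    rw [actEquiv_symm_comp, actEquiv_symm_r, actEquiv_symm_eHomEquiv, tdesc_eHomEquiv, δ.map_comp,
      ← t.τ_unit, Category.assoc, Category.assoc])

lemma map_comp (X Y Z : N) :
    μ γ (X ⟶[V] Y) (Y ⟶[V] Z) ≫ γ.map (eComp V X Y Z) ≫ t.r X Z =
      (t.r X Y ⊗ₘ t.r Y Z) ≫ eComp H (δ.obj X) (δ.obj Y) (δ.obj Z) :=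
  actEquiv.symm.injective (by
    have e : eComp V X Y Z = 𝟙 (X ⟶[V] Y) ⋆ 𝟙 (Y ⟶[V] Z) := by
      rw [gcomp, id_tensorHom_id, Category.id_comp]
    refine Eq.trans ?_ (actEquiv_symm_gcomp (t.r X Y) (t.r Y Z)).symm
    rw [actEquiv_symm_comp, actEquiv_symm_r, e, tdesc_gcomp, actEquiv_symm_r', actEquiv_symm_r',
      comp_actionHomLeft, Category.assoc, ← Category.assoc (δ.map _ ⊵ᵣ _), τ_left, Category.assoc,
      δ.map_comp, δ.map_comp]
    have := t.τ_assoc X (X ⟶[V] Y) (Y ⟶[V] Z)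
    rw [reassoc_of% this])

lemma r_whiskerLeft (X : N) {Y Z : N} (g : Y ⟶ Z) :
    γ.map (eHomWhiskerLeft V X g) ≫ t.r X Z = t.r X Y ≫ eHomWhiskerLeft H (δ.obj X) (δ.map g) :=
  actEquiv.symm.injective (by
    rw [actEquiv_symm_r, actEquiv_symm_whiskerLeft, actEquiv_symm_r', Category.assoc, ← δ.map_comp,
      ← tdesc_whiskerLeft, Category.id_comp])

lemma r_whiskerRight {X Y : N} (f : X ⟶ Y) (Z : N) :
    γ.map (eHomWhiskerRight V f Z) ≫ t.r X Z = t.r Y Z ≫ eHomWhiskerRight H (δ.map f) (δ.obj Z) :=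
  actEquiv.symm.injective (by
    rw [actEquiv_symm_r, actEquiv_symm_whiskerRight, actEquiv_symm_r', ← Category.assoc, τ_left,
      Category.assoc, ← δ.map_comp, ← tdesc_whiskerRight, Category.id_comp])

end LaxAction

end LaxHom

section Comparison

variable {V : Type u₁} [Category.{v} V] [MonoidalCategory V] [SymmetricCategory V]
  [MonoidalClosed V] {N : Type u₂} [Category.{v} N] [EnrichedOrdinaryCategory V N]
  [Tensored V N] [Cotensored V N] {H 𝒩 : Type*} [Category* H] [Category* 𝒩] [MonoidalCategory H]
  [SymmetricCategory H] [MonoidalClosed H] [EnrichedOrdinaryCategory H 𝒩] [Tensored H 𝒩]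
  [Cotensored H 𝒩] {γ : V ⥤ H} {δ : N ⥤ 𝒩}
  (r : ∀ X Y : N, γ.obj (X ⟶[V] Y) ⟶ (δ.obj X ⟶[H] δ.obj Y))
  (hl : ∀ (X : N) {Y Z : N} (g : Y ⟶ Z), γ.map (eHomWhiskerLeft V X g) ≫ r X Z =
    r X Y ≫ eHomWhiskerLeft H (δ.obj X) (δ.map g))
  (hr : ∀ {X Y : N} (f : X ⟶ Y) (Z : N), γ.map (eHomWhiskerRight V f Z) ≫ r X Z =
    r Y Z ≫ eHomWhiskerRight H (δ.map f) (δ.obj Z))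

include hl hr

lemma exists_homComparison :
    ∃ a : Functor.uncurry.obj (eHomFunctor V N) ⋙ γ ⟶
      δ.op.prod δ ⋙ Functor.uncurry.obj (eHomFunctor H 𝒩), ∀ X Y : N, a.app (op X, Y) = r X Y :=
  ⟨{  app := fun X => r X.1.unop X.2
      naturality := fun X Y f => by
        change γ.map (eHomWhiskerRight V f.1.unop _ ≫ eHomWhiskerLeft V _ f.2) ≫ r _ _ =
          r _ _ ≫ eHomWhiskerRight H (δ.map f.1.unop) _ ≫ eHomWhiskerLeft H _ (δ.map f.2)
        rw [γ.map_comp, Category.assoc, hl, ← Category.assoc, hr, Category.assoc] },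
    fun _ _ => rfl⟩

lemma exists_tensorComparison :
    ∃ t : γ.prod δ ⋙ Functor.uncurry.obj (tensorFunctor H 𝒩) ⟶
      Functor.uncurry.obj (tensorFunctor V N) ⋙ δ,
    ∀ (K : V) (X : N), t.app (K, X) = tdesc (γ.map (tcoev V K X) ≫ r X (tobj V K X)) :=
  ⟨{  app := fun X => tdesc (γ.map (tcoev V X.1 X.2) ≫ r X.2 (tobj V X.1 X.2))
      naturality := fun X Y f => tobj_hom_ext (by
        change tcoev H (γ.obj X.1) (δ.obj X.2) ≫ eHomWhiskerLeft H (δ.obj X.2)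
          ((tdesc (γ.map f.1 ≫ tcoev H (γ.obj Y.1) (δ.obj X.2)) ≫
            tdesc (tcoev H (γ.obj Y.1) (δ.obj Y.2) ≫ eHomWhiskerRight H (δ.map f.2) _)) ≫
            tdesc (γ.map (tcoev V Y.1 Y.2) ≫ r Y.2 (tobj V Y.1 Y.2))) =
          tcoev H (γ.obj X.1) (δ.obj X.2) ≫ eHomWhiskerLeft H (δ.obj X.2)
            (tdesc (γ.map (tcoev V X.1 X.2) ≫ r X.2 (tobj V X.1 X.2)) ≫
            δ.map (tdesc (f.1 ≫ tcoev V Y.1 X.2) ≫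
              tdesc (tcoev V Y.1 Y.2 ≫ eHomWhiskerRight V f.2 _)))
        rw [Category.assoc, eHomWhiskerLeft_comp, eHomWhiskerLeft_comp, reassoc_of% tdesc_fac,
          Category.assoc, reassoc_of% tdesc_fac, Category.assoc, ← eHom_whisker_exchange,
          reassoc_of% tdesc_fac, eHomWhiskerLeft_comp, reassoc_of% tdesc_fac, Category.assoc,
          Category.assoc, ← hl, ← hr, eHomWhiskerLeft_comp]
        simp only [← Category.assoc, ← γ.map_comp]
        congr 2
        rw [tdesc_fac, Category.assoc, Category.assoc, tdesc_fac]) },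
    fun _ _ => rfl⟩

lemma exists_cotensorComparison :
    ∃ c : Functor.uncurry.obj (cotensorFunctor V N) ⋙ δ ⟶
      γ.op.prod δ ⋙ Functor.uncurry.obj (cotensorFunctor H 𝒩),
    ∀ (K : V) (X : N), c.app (op K, X) = cdesc (γ.map (cev V K X) ≫ r (cobj V K X) X) :=
  ⟨{  app := fun X => cdesc (γ.map (cev V X.1.unop X.2) ≫ r (cobj V X.1.unop X.2) X.2)
      naturality := fun X Y f => cobj_hom_ext (by
        change cev H (γ.obj Y.1.unop) (δ.obj Y.2) ≫ eHomWhiskerRight H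
          (δ.map (cdesc (f.1.unop ≫ cev V X.1.unop X.2) ≫
            cdesc (cev V Y.1.unop X.2 ≫ eHomWhiskerLeft V _ f.2)) ≫
            cdesc (γ.map (cev V Y.1.unop Y.2) ≫ r (cobj V Y.1.unop Y.2) Y.2)) (δ.obj Y.2) =
          cev H (γ.obj Y.1.unop) (δ.obj Y.2) ≫ eHomWhiskerRight H
            (cdesc (γ.map (cev V X.1.unop X.2) ≫ r (cobj V X.1.unop X.2) X.2) ≫
            cdesc (γ.map f.1.unop ≫ cev H (γ.obj X.1.unop) (δ.obj X.2)) ≫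
            cdesc (cev H (γ.obj Y.1.unop) (δ.obj X.2) ≫ eHomWhiskerLeft H _ (δ.map f.2)))
              (δ.obj Y.2)
        have e : cev V Y.1.unop Y.2 ≫ eHomWhiskerRight V
            (cdesc (f.1.unop ≫ cev V X.1.unop X.2) ≫
            cdesc (cev V Y.1.unop X.2 ≫ eHomWhiskerLeft V _ f.2)) Y.2 =
              f.1.unop ≫ cev V X.1.unop X.2 ≫ eHomWhiskerLeft V _ f.2 := by
          rw [eHomWhiskerRight_comp, reassoc_of% cdesc_fac, Category.assoc, eHom_whisker_exchange,
            reassoc_of% cdesc_fac, Category.assoc]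
        rw [eHomWhiskerRight_comp, reassoc_of% cdesc_fac, Category.assoc, ← hr,
          ← Category.assoc (γ.map _), ← γ.map_comp, e,
          ← Category.assoc (cdesc (γ.map (cev V X.1.unop X.2) ≫ r _ X.2)), eHomWhiskerRight_comp,
          reassoc_of% cdesc_fac, Category.assoc, eHom_whisker_exchange, eHomWhiskerRight_comp,
          Category.assoc, reassoc_of% cdesc_fac, Category.assoc, reassoc_of% cdesc_fac,
          Category.assoc, ← hl, γ.map_comp, γ.map_comp, Category.assoc, Category.assoc]) },
    fun _ _ => rfl⟩

end Comparison

end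

section

local infixr:70 " ⋆ " => gcomp

open MonoidalRightAction Functor.LaxMonoidal

section DerivedMonoidal

variable {V : Type u₁} [Category.{v} V] [MonoidalCategory V] [SymmetricCategory V]
  [MonoidalClosed V] {WV : MorphismProperty V} [IsHomotopical WV] {VQ VR : ObjectProperty V}

section

variable {H : Type*} [Category* H] [MonoidalCategory H] [MonoidalClosed H] (γ : V ⥤ H)
  [γ.LaxMonoidal]

lemma exists_ihomComparison :
    ∃ c : Functor.uncurry.obj MonoidalClosed.internalHom ⋙ γ ⟶
      γ.op.prod γ ⋙ Functor.uncurry.obj MonoidalClosed.internalHom,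
    ∀ X Y : V, c.app (op X, Y) =
      MonoidalClosed.curry (μ γ X ((ihom X).obj Y) ≫ γ.map ((ihom.ev X).app Y)) :=
  ⟨{  app := fun X => MonoidalClosed.curry
        (μ γ X.1.unop ((ihom X.1.unop).obj X.2) ≫ γ.map ((ihom.ev X.1.unop).app X.2))
      naturality := fun X Y f => MonoidalClosed.uncurry_injective (by
        change MonoidalClosed.uncurry (γ.map ((MonoidalClosed.pre f.1.unop).app X.2 ≫
          (ihom Y.1.unop).map f.2) ≫ MonoidalClosed.curry
            (μ γ Y.1.unop ((ihom Y.1.unop).obj Y.2) ≫ γ.map ((ihom.ev Y.1.unop).app Y.2))) =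
          MonoidalClosed.uncurry (MonoidalClosed.curry
            (μ γ X.1.unop ((ihom X.1.unop).obj X.2) ≫ γ.map ((ihom.ev X.1.unop).app X.2)) ≫
            (MonoidalClosed.pre (γ.map f.1.unop)).app (γ.obj X.2) ≫
              (ihom (γ.obj Y.1.unop)).map (γ.map f.2))
        have e : Y.1.unop ◁ ((MonoidalClosed.pre f.1.unop).app X.2 ≫ (ihom Y.1.unop).map f.2) ≫
            (ihom.ev Y.1.unop).app Y.2 = f.1.unop ▷ _ ≫ (ihom.ev X.1.unop).app X.2 ≫ f.2 := by
          rw [← MonoidalClosed.uncurry_eq, MonoidalClosed.uncurry_natural_right,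
            MonoidalClosed.uncurry_pre, Category.assoc]
        rw [MonoidalClosed.uncurry_natural_left, MonoidalClosed.uncurry_curry,
          ← Category.assoc (γ.obj Y.1.unop ◁ _), μ_natural_right, Category.assoc, ← γ.map_comp, e,
          ← Category.assoc (MonoidalClosed.curry _), MonoidalClosed.uncurry_natural_right,
          MonoidalClosed.uncurry_pre_app, MonoidalClosed.uncurry_curry, Category.assoc,
          Category.assoc, μ_natural_left_assoc]
        simp only [γ.map_comp]) },
    fun _ _ => rfl⟩

end

theorem IsClosedMonoidalDeformationRetract.exists_derivedMonoidal
    (hV : IsClosedMonoidalDeformationRetract WV VQ VR) :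
    ∃ (_ : MonoidalCategory (Ho WV)) (_ : SymmetricCategory (Ho WV)) (_ : MonoidalClosed (Ho WV))
      (_ : WV.Q.LaxBraided), IsDerivedMonoidal WV ∧
        ∀ K L, VQ K → VQ L → IsIso (μ WV.Q K L) := by
  obtain ⟨mon, sym, lax, hε, hμ⟩ := hV.isHomotopicalAction.exists_monoidal WV.Q
  have hihom : ∀ {X : V}, VQ X → IsHomotopicalOn (ihom X) WV VR WV := fun {X} hX Y Y' f hY hY' hf =>
    hV.deform.homl.obj_map f (VR.le_isoClosure _ hY) (VR.le_isoClosure _ hY') hf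
      (X := op X) (VQ.op.le_isoClosure _ hX)
  let α (X : V) : WV.Q ⋙ tensorLeft (WV.Q.obj X) ⟶ tensorLeft X ⋙ WV.Q :=
    { app := fun K => μ WV.Q X K
      naturality := fun K L k => μ_natural_right WV.Q X k }
  have hadj : ∀ K : Ho WV, (tensorLeft K).IsLeftAdjoint := fun K => by
    obtain ⟨X, hX, ⟨e⟩⟩ := exists_mem_iso_of_localization hV.deform.left₁ WV.Q K
    have := isLeftAdjoint_of_deformation (ihom.adjunction X) (α X) hV.deform.left₁
      (fun Y hY => hμ X Y hX hY) hV.deform.right (hihom hX)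
    exact Functor.isLeftAdjoint_of_iso ((curriedTensor (Ho WV)).mapIso e)
  let clo : MonoidalClosed (Ho WV) :=
    { closed := fun K => ⟨(tensorLeft K).rightAdjoint, Adjunction.ofIsLeftAdjoint _⟩ }
  refine ⟨mon, sym, clo, lax, ⟨hε, ?_, ?_⟩, hμ⟩
  · let m : WV.Q.prod WV.Q ⋙ Functor.uncurry.obj (curriedTensor (Ho WV)) ⟶
        Functor.uncurry.obj (curriedTensor V) ⋙ WV.Q :=
      { app := fun X => μ WV.Q X.1 X.2
        naturality := fun X Y f => by
          change (WV.Q.map f.1 ▷ _ ≫ _ ◁ WV.Q.map f.2) ≫ _ = _ ≫ WV.Q.map (f.1 ▷ _ ≫ _ ◁ f.2)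
          rw [← MonoidalCategory.tensorHom_def, ← MonoidalCategory.tensorHom_def, μ_natural] }
    exact ⟨m, fun _ _ => rfl, isLeftDerivedFunctor_of_isIso m
      (hV.deform.left₁.prod hV.deform.left₁) fun X hX => hμ X.1 X.2 hX.1 hX.2⟩
  · obtain ⟨c, hc⟩ := exists_ihomComparison WV.Q
    refine ⟨c, hc, isRightDerivedFunctor_of_isIso c (hV.deform.left₁.op.prod hV.deform.right)
      fun X hX => ?_⟩
    have := isIso_homEquiv_of_deformation (ihom.adjunction X.1.unop) (α X.1.unop) hV.deform.left₁
      (fun Y hY => hμ _ Y hX.1 hY) hV.deform.right (hihom hX.1)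
      (ihom.adjunction (WV.Q.obj X.1.unop)) hX.2
    have e : c.app X = _ := hc X.1.unop X.2
    rw [e]
    exact this

end DerivedMonoidal

section DerivedEnrichment

variable {V : Type u₁} [Category.{v} V] [MonoidalCategory V] [SymmetricCategory V]
  [MonoidalClosed V] [HasLimits V] {WV : MorphismProperty V} [IsHomotopical WV]
  {VQ VR : ObjectProperty V}

/-- The adjunction between tensors and hom-objects. -/
def tensorHomAdj {N : Type u₂} [Category.{v} N] [EnrichedOrdinaryCategory V N] [Tensored V N]
    (X : N) : actOn V X ⊣ (eHomFunctor V N).obj (op X) :=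
  Adjunction.mkOfHomEquiv
    { homEquiv := fun K Y => tensorHomEquiv K X Y
      homEquiv_naturality_left_symm := fun k x => tdesc_comp k x
      homEquiv_naturality_right := fun f g => tensorHomEquiv_comp f g }

lemma cdesc_tensorHomEquiv_comp {N : Type u₂} [Category.{v} N] [EnrichedOrdinaryCategory V N]
    [Tensored V N] [Cotensored V N] {K : V} {X Y Y' : N} (f : tobj V K X ⟶ Y) (g : Y ⟶ Y') :
    cdesc (tensorHomEquiv K X Y' (f ≫ g)) = cdesc (tensorHomEquiv K X Y f) ≫ cmapRight K g :=
  cobj_hom_ext (by rw [tensorHomEquiv_comp, cdesc_fac, cev_cmapRight, cdesc_fac])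

/-- The adjunction between tensors and cotensors. -/
def tensorCotensorAdj {N : Type u₂} [Category.{v} N] [EnrichedOrdinaryCategory V N] [Tensored V N]
    [Cotensored V N] (K : V) : actBy N K ⊣ (cotensorFunctor V N).obj (op K) :=
  Adjunction.mkOfHomEquiv
    { homEquiv := fun X Y => (tensorHomEquiv K X Y).trans (cotensorHomEquiv K Y X).symm
      homEquiv_naturality_left_symm := fun f x =>
        (congrArg tdesc (cotensorHomEquiv_comp f x)).trans (tdesc_whiskerRight f _)
      homEquiv_naturality_right := fun f g => cdesc_tensorHomEquiv_comp f g }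

theorem locallySmall_of_enriched {H C : Type*} [Category* H] [MonoidalCategory H] [Category* C]
    [EnrichedOrdinaryCategory H C] [LocallySmall.{v} H] : LocallySmall.{v} C where
  hom_small _ _ := small_map (eHomEquiv H)

variable [MonoidalCategory (Ho WV)] [SymmetricCategory (Ho WV)]
    [MonoidalClosed (Ho WV)] [WV.Q.LaxBraided]
  {N : Type u₂} [Category.{v} N] [EnrichedOrdinaryCategory V N] [Tensored V N] [Cotensored V N]
  {W : MorphismProperty N} [IsHomotopical W] {NQ NR : ObjectProperty N}

theorem IsVHomotopical.exists_derivedEnrichment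
    (hV : IsClosedMonoidalDeformationRetract WV VQ VR) (hN : IsVHomotopical WV VQ W NQ NR)
    (hm : IsDerivedMonoidal WV) (hμ : ∀ K L, VQ K → VQ L → IsIso (μ WV.Q K L)) :
    ∃ (_ : EnrichedOrdinaryCategory (Ho WV) (Ho W)) (_ : Tensored (Ho WV) (Ho W))
      (_ : Cotensored (Ho WV) (Ho W))
      (r : ∀ X Y : N, WV.Q.obj (X ⟶[V] Y) ⟶ (W.Q.obj X ⟶[Ho WV] W.Q.obj Y)),
      IsDerivedEnrichment WV W r := by
  have := hm.isIso_ε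
  obtain ⟨act, t, ht⟩ := hV.isHomotopicalAction.exists_action hN.isHomotopicalAction WV.Q W.Q hμ
  have hhom : ∀ {X : N}, NQ X → IsHomotopicalOn ((eHomFunctor V N).obj (op X)) W NR WV :=
    fun {X} hX Y Y' f hY hY' hf =>
      hN.deform.homr.obj_map f (NR.le_isoClosure _ hY) (NR.le_isoClosure _ hY') hf
        (X := op X) (NQ.op.le_isoClosure _ hX)
  have hcot : ∀ {K : V}, VQ K → IsHomotopicalOn ((cotensorFunctor V N).obj (op K)) W NR W :=
    fun {K} hK Y Y' f hY hY' hf =>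
      hN.deform.homl.obj_map f (NR.le_isoClosure _ hY) (NR.le_isoClosure _ hY') hf
        (X := op K) (VQ.op.le_isoClosure _ hK)
  let α (X : N) : WV.Q ⋙ actOn (Ho WV) (W.Q.obj X) ⟶ actOn V X ⋙ W.Q :=
    { app := fun K => t.τ X K
      naturality := fun K L k => t.τ_right X k }
  let β (K : V) : W.Q ⋙ actBy (Ho W) (WV.Q.obj K) ⟶ actBy N K ⋙ W.Q :=
    { app := fun X => t.τ X K
      naturality := fun X Y f => t.τ_left f K }
  have hadj : ∀ A : Ho W, (actOn (Ho WV) A).IsLeftAdjoint := fun A => by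
    obtain ⟨X, hX, ⟨e⟩⟩ := exists_mem_iso_of_localization hN.deform.left₂ W.Q A
    have := isLeftAdjoint_of_deformation (tensorHomAdj X) (α X) hV.deform.left₁
      (fun K hK => ht X K hX hK) hN.deform.right (hhom hX)
    exact Functor.isLeftAdjoint_of_iso (NatIso.ofComponents
      (F := actOn (Ho WV) (W.Q.obj X)) (G := actOn (Ho WV) A)
      (fun K => (actBy (Ho W) K).mapIso e) (fun k => action_exchange e.hom k))
  have hadj' : ∀ K : Ho WV, (actBy (Ho W) K).IsLeftAdjoint := fun K => by
    obtain ⟨L, hL, ⟨e⟩⟩ := exists_mem_iso_of_localization hV.deform.left₁ WV.Q K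
    have := isLeftAdjoint_of_deformation (tensorCotensorAdj L) (β L) hN.deform.left₂
      (fun X hX => ht X L hX hL) hN.deform.right (hcot hL)
    exact Functor.isLeftAdjoint_of_iso (NatIso.ofComponents
      (F := actBy (Ho W) (WV.Q.obj L)) (G := actBy (Ho W) K)
      (fun A => (actOn (Ho WV) A).mapIso e) (fun f => (action_exchange f e.hom).symm))
  let hh : HasActionHom (Ho WV) (Ho W) :=
    { R := fun A => (actOn (Ho WV) A).rightAdjoint
      adj := fun A => Adjunction.ofIsLeftAdjoint _ }
  let hc : HasActionCotensor (Ho WV) (Ho W) :=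
    { R := fun K => (actBy (Ho W) K).rightAdjoint
      adj := fun K => Adjunction.ofIsLeftAdjoint _ }
  refine ⟨inferInstance, inferInstance, inferInstance, t.r, ⟨t.map_hom, t.map_comp, ?_, ?_, ?_⟩⟩
  · obtain ⟨a, ha⟩ := exists_homComparison t.r (fun X _ _ g => t.r_whiskerLeft X g)
      (fun f Z => t.r_whiskerRight f Z)
    refine ⟨a, ha, isRightDerivedFunctor_of_isIso a (hN.deform.left₂.op.prod hN.deform.right)
      fun X hX => ?_⟩
    have := isIso_homEquiv_of_deformation (tensorHomAdj X.1.unop) (α X.1.unop) hV.deform.left₁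
      (fun K hK => ht _ K hX.1 hK) hN.deform.right (hhom hX.1)
      (HasActionHom.adj (W.Q.obj X.1.unop)) hX.2
    have e : a.app X = _ := ha X.1.unop X.2
    rw [e]
    exact this
  · obtain ⟨a, ha⟩ := exists_tensorComparison t.r (fun X _ _ g => t.r_whiskerLeft X g)
      (fun f Z => t.r_whiskerRight f Z)
    refine ⟨a, ha, isLeftDerivedFunctor_of_isIso a (hV.deform.left₁.prod hN.deform.left₂)
      fun X hX => ?_⟩
    have e : a.app X = _ := ha X.1 X.2
    rw [e, tdesc_eq, t.actEquiv_symm_r, tdesc_tcoev, W.Q.map_id, Category.comp_id]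
    exact ht _ _ hX.2 hX.1
  · obtain ⟨a, ha⟩ := exists_cotensorComparison t.r (fun X _ _ g => t.r_whiskerLeft X g)
      (fun f Z => t.r_whiskerRight f Z)
    refine ⟨a, ha, isRightDerivedFunctor_of_isIso a (hV.deform.left₁.op.prod hN.deform.right)
      fun X hX => ?_⟩
    have := isIso_homEquiv_of_deformation (tensorCotensorAdj X.1.unop) (β X.1.unop)
      hN.deform.left₂ (fun Y hY => ht Y _ hY hX.1) hN.deform.right (hcot hX.1)
      (HasActionCotensor.adj (WV.Q.obj X.1.unop)) hX.2
    have e : a.app X = _ := ha X.1.unop X.2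
    have e' : adjCounit (tensorCotensorAdj X.1.unop) X.2 = tdesc (cev V X.1.unop X.2) :=
      congrArg tdesc (by
        change cev V X.1.unop X.2 ≫ eHomWhiskerRight V (𝟙 _) _ = _
        rw [eHomWhiskerRight_id, Category.comp_id])
    rw [e'] at this
    rw [e, cdesc_eq, t.actEquiv_symm_r]
    exact this

end DerivedEnrichment

end

end

end EnrichedHomotopy

theorem mainTheorem6 {V : Type u₁} [Category.{v} V] [MonoidalCategory V] [SymmetricCategory V]
    [MonoidalClosed V] [HasLimits V] [HasColimits V]
    (L : SSet.{v} ⥤ V) [L.Monoidal] [L.IsLeftAdjoint]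
    (WV : MorphismProperty V) [IsHomotopical WV] (VQ VR : ObjectProperty V)
    (hV : IsClosedMonoidalDeformationRetract WV VQ VR)
    {M : Type u₂} [Category.{v} M] [EnrichedOrdinaryCategory V M] [Tensored V M] [Cotensored V M]
    [HasLimits M] [HasColimits M]
    (W : MorphismProperty M) [IsHomotopical W] (MQ MR : ObjectProperty M)
    (hM : IsVHomotopical WV VQ W MQ MR)
    (hW : simplicialHomotopyEquivalences L M ≤ W)
    (D : Type v) [EnrichedCategory V D]
    (hD : IsGoodForHom L D WV VR W MQ MR)
    (hQ : IsLeftDeformationRetract (objectwiseWeq V D W) (objectwise V D MQ))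
    (hR : IsRightDeformationRetract (objectwiseWeq V D W) (objectwise V D MR)) :
    IsVHomotopical WV VQ (objectwiseWeq V D W) (barObjects L D MQ) (objectwise V D MR) ∧
    IsVHomotopical WV VQ (objectwiseWeq V D W) (objectwise V D MQ) (cobarObjects L D MR) ∧
    (∃ (_ : MonoidalCategory (Ho WV)) (_ : SymmetricCategory (Ho WV)) (_ : MonoidalClosed (Ho WV))
      (_ : WV.Q.LaxBraided), IsDerivedMonoidal WV ∧
      ∃ (_ : EnrichedOrdinaryCategory (Ho WV) (Ho (objectwiseWeq V D W)))
        (_ : Tensored (Ho WV) (Ho (objectwiseWeq V D W)))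
        (_ : Cotensored (Ho WV) (Ho (objectwiseWeq V D W)))
        (r : ∀ F G : Diagram V D M, WV.Q.obj (F ⟶[V] G) ⟶
          ((objectwiseWeq V D W).Q.obj F ⟶[Ho WV] (objectwiseWeq V D W).Q.obj G)),
        IsDerivedEnrichment WV (objectwiseWeq V D W) r) ∧
    (LocallySmall.{v} (Ho WV) → LocallySmall.{v} (Ho (objectwiseWeq V D W))) := by
  have hB := isVHomotopical_bar hM hW hD hQ hR
  refine ⟨hB, isVHomotopical_cobar hM hW hD hQ hR, ?_, ?_⟩
  · obtain ⟨mon, sym, clo, lax, hm, hμ⟩ := hV.exists_derivedMonoidal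
    exact ⟨mon, sym, clo, lax, hm, hB.exists_derivedEnrichment hV hm hμ⟩
  · intro _
    obtain ⟨mon, sym, clo, lax, hm, hμ⟩ := hV.exists_derivedMonoidal
    obtain ⟨_, _⟩ := hB.exists_derivedEnrichment hV hm hμ
    exact locallySmall_of_enriched (H := Ho WV)
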